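/- **Conventions.** A *general polyhedron* in $\mathbb R^m$ is a set given by finitely many conditions $\ell(x)=p$, $\ell(x)\ge p$, $\ell(x)>p$ with integral linear forms $\ell$ and $p\in\mathbb R$; a *face* of it is obtained by turning weak inequalities into equalities. An *integer affine* map is $x\mapsto Ax+b$ with $A$ integral and $b$ real. An *open fan* is obtained from a finite fan of closed rational cones in $\mathbb R^N$ by removing some of its cones from all of them and intersecting with an open neighbourhood of $0$. A *polyhedral complex* $X$ is a topological space $|X|$ with a set of subsets (*cells*) $\sigma$ and embeddings $\varphi_\sigma:\sigma\to\mathbb R^{\dim\sigma}$ onto full-dimensional general polyhedra, such that nonempty intersections of two cells are cells and faces of both, the maps $\varphi_\sigma\circ\varphi_{\sigma'}^{-1}$ are integer affine, and $|X|$ is the disjoint union of the relative interiors of the cells; moreover, for each cell $\sigma$ the star $S_\sigma=\bigcup_{\sigma'\supseteq\sigma}(\sigma')^{ri}$ is open and is identified by a homeomorphism $\Phi_\sigma$ with the support $|F_\sigma|$ of an open fan $F_\sigma$, carrying each $\sigma'\cap S_\sigma$ ($\sigma'\supseteq\sigma$) to a cell of $F_\sigma$, compatibly (integer affinely, in both directions)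 with the $\varphi_{\sigma'}$ and, on overlaps, with the other $\Phi_\tau$. A *refinement* of $X$ is a complex on the same space whose cells are contained in cells of $X$, with compatible (in both directions integer affine) charts $\varphi$. An *orbit space* $X/G$ is a polyhedral complex with a group $G$ acting on $|X|$ by automorphisms (homeomorphisms permuting the cells, integer affine in the charts $\Phi$). For a cell $\sigma$ let $G_\sigma$ be its pointwise stabilizer. $X/G$ with a $G$-invariant weight function $\omega_X:X^{(n)}\to\mathbb Q$ on the $n$-dimensional cells is a *tropical orbit space* of dimension $n$ if every cell has dimension at most $n$ and lies in an $n$-dimensional cell, there are finitely many $G$-classes of cells, $|G_\sigma|<\infty$ for $\sigma\in X^{(n)}$, and for each $(n-1)$-dimensional cell $\tau$ the set $\{\sigma>\tau\}$ is finite and there are $\lambda_{\sigma/\tau}\ge0$ with $\sum_{\tilde\sigma\in G_\tau\sigma}\lambda_{\tilde\sigma/\tau}=1$ for all $\sigma>\tau$ and $\sum_{\sigma>\tau}\lambda_{\sigma/\tau}\,[\omega_X](\sigma)\,u_{\sigma/\tau}\in V_\tau$. Here $[\omega_X](\sigma)=\omega_X(\sigma)/|G_\sigma|$, and $V_\tau$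 and the primitive normal vectors $u_{\sigma/\tau}$ are taken in the fan $F_\tau$. A *suborbit space* $Z/G$ of $X/G$ is an orbit space with a continuous $G$-equivariant injection $|Z|\to|X|$ carrying each cell into a cell and respecting the integral affine structures: stars are mapped to stars, and the charts $\Phi$ of $Z$ and of $X$ are integer affine functions of each other on the stars of $Z$. $X/G$ of dimension $n$ is *irreducible* if every nonempty $n$-dimensional tropical suborbit space $Z/G$ (with some nowhere zero weights) for which $|Z|\to|X|$ is a closed embedding satisfies $|Z|=|X|$. A *morphism* $f:X/G\to Y/H$ is a continuous map $f:|X|\to|Y|$ together with a homomorphism $\phi:G\to H$ such that $f(gx)=\phi(g)f(x)$; each cell $\sigma$ of $X$ is mapped into a cell of $Y$ and, if $\tilde\sigma$ is the minimal such cell, $f(S_\sigma)\subseteq S_{\tilde\sigma}$ and $f$ is integer affine there in the charts $\Phi$; and there is a refinement $X'$ of $X$ such that for all cells $\sigma,\tilde\sigma$ of $X'$ and $h\in H$, if $f(\sigma)\cap hf(\tilde\sigma)$ is nonempty and $\dim (f(\sigma)\cap hf(\tilde\sigma))=\dim f(\sigma)=\dim hf(\tilde\sigma)$, then $f(\sigma)=hf(\tilde\sigma)$.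 **Theorem.** Let $X/G$ and $Y/H$ be tropical orbit spaces of the same dimension $n$, where $Y/H$ is irreducible, its weights are nonzero and $\{h\in H: h(\sigma')=\sigma'\}$ is finite for every $\sigma'\in Y^{(n)}$. Let $f:X/G\to Y/H$ be a morphism with $f(X/G)=Y/H$ as topological spaces, i.e. the induced map $|X|/G\to|Y|/H$ is surjective and $|Y|/H$ carries the quotient topology. Then there is a suborbit space $Y_0/H$ of $Y/H$ with finitely many classes of cells, all of dimension smaller than $n$, and with $|Y_0|$ closed in $|Y|$, such that (a) each point $Q\in|Y|\setminus|Y_0|$ lies in the relative interior of an $n$-dimensional cell $\sigma'_Q$ of $Y$; (b) each point $P\in f^{-1}(|Y|\setminus|Y_0|)$ lies in the relative interior of an $n$-dimensional cell $\sigma_P$ of $X$, and the index $|\Lambda'_{\sigma'_{f(P)}}/f(\Lambda_{\sigma_P})|$ is finite, where $\Lambda_{\sigma_P}$ and $\Lambda'_{\sigma'_{f(P)}}$ are the lattices of these cells and $f(\Lambda_{\sigma_P})$ is the image under the linear part of $f$; (c) for $Q\in|Y|\setminus|Y_0|$ there are only finitely many classes $[P]\in|X|/G$ with $f([P])=[Q]$,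 and the sum $$\sum_{[P]:\,f([P])=[Q]}\operatorname{mult}_{[P]}f,\qquad \operatorname{mult}_{[P]}f=\frac{[\omega_X](\sigma_P)}{[\omega_Y](\sigma'_{f(P)})}\cdot\bigl|\Lambda'_{\sigma'_{f(P)}}/f(\Lambda_{\sigma_P})\bigr|,$$ computed with any choice of representatives $P$, does not depend on $Q$. -/

import Mathlib

open Set Topology
open scoped Pointwise

universe u v

noncomputable section

namespace TropOrbit

/-- The integral linear form with coefficient vector `a`. -/
def intForm {n : ℕ} (a : Fin n → ℤ) (x : Fin n → ℝ) : ℝ := ∑ i, (a i : ℝ) * x i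

/-- A general polyhedron in `ℝⁿ`: finitely many weak and strict inequalities given by integral
linear forms and real constants (an equality is a pair of weak inequalities). -/
def IsGenPolyhedron {n : ℕ} (P : Set (Fin n → ℝ)) : Prop :=
  ∃ W S : Finset ((Fin n → ℤ) × ℝ),
    P = {x | (∀ w ∈ W, w.2 ≤ intForm w.1 x) ∧ ∀ s ∈ S, s.2 < intForm s.1 x}

/-- A closed (rational polyhedral) cone in `ℝⁿ`. -/
def IsClosedCone {n : ℕ} (P : Set (Fin n → ℝ)) : Prop :=
  ∃ W : Finset (Fin n → ℤ), P = {x | ∀ a ∈ W, 0 ≤ intForm a x}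

/-- `T` is a face of `P`: the part of `P` on which a weak inequality that is valid on `P` becomes
an equality. (Turning several weak inequalities of a description of `P` into equalities is the same
as turning their sum into an equality; the zero form gives `P` itself.) -/
def IsFace {n : ℕ} (T P : Set (Fin n → ℝ)) : Prop :=
  ∃ (a : Fin n → ℤ) (p : ℝ), (∀ x ∈ P, p ≤ intForm a x) ∧ T = {x | x ∈ P ∧ intForm a x = p}

/-- A (finite rational polyhedral) fan in `ℝⁿ`. -/
structure IsFan {n : ℕ} (C : Set (Set (Fin n → ℝ))) : Prop where
  finite : C.Finite
  closedCone : ∀ s ∈ C, IsClosedCone s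
  face_mem : ∀ s ∈ C, ∀ t : Set (Fin n → ℝ), t.Nonempty → IsFace t s → t ∈ C
  inter_face : ∀ s ∈ C, ∀ t ∈ C, IsFace (s ∩ t) s ∧ IsFace (s ∩ t) t

/-- An open fan: remove some of the cones of a fan from all its cones (this gives a general fan),
and intersect the result with an open neighbourhood of the origin. -/
def IsOpenFan {n : ℕ} (F : Set (Set (Fin n → ℝ))) : Prop :=
  ∃ C R : Set (Set (Fin n → ℝ)), ∃ U : Set (Fin n → ℝ),
    IsFan C ∧ R ⊆ C ∧ IsOpen U ∧ (0 : Fin n → ℝ) ∈ U ∧ F = (fun t => (t \ ⋃₀ R) ∩ U) '' C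

/-- On the set `s`, the map `F'` is an integer affine linear function of the map `F`:
`F' = A F + b` with an integral matrix `A` and a real vector `b`. -/
def IntAffineOn {α : Type*} {m n : ℕ} (s : Set α) (F : α → Fin m → ℝ) (F' : α → Fin n → ℝ) : Prop :=
  ∃ (A : Matrix (Fin n) (Fin m) ℤ) (b : Fin n → ℝ),
    ∀ x ∈ s, F' x = (A.map (fun k : ℤ => (k : ℝ))).mulVec (F x) + b

/-- The relative interior of `s` with respect to the chart `φ`. -/
def relIntOf {α : Type*} {n : ℕ} (φ : α → Fin n → ℝ) (s : Set α) : Set α :=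
  {x | x ∈ s ∧ φ x ∈ interior (φ '' s)}

/-- The data of a system of charted polyhedra on `α`. Only the values of `dim`, `chart`, `starDim`,
`starChart`, `fan` on members of `cells` (and of `chart` on points of the cell) matter. -/
structure ComplexData (α : Type u) where
  cells : Set (Set α)
  dim : Set α → ℕ
  chart : (s : Set α) → α → Fin (dim s) → ℝ
  starDim : Set α → ℕ
  starChart : (s : Set α) → α → Fin (starDim s) → ℝ
  fan : (s : Set α) → Set (Set (Fin (starDim s) → ℝ))

namespace ComplexData

variable {α : Type u} (X : ComplexData α)

/-- The relative interior of a cell. -/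
def relInt (s : Set α) : Set α := relIntOf (X.chart s) s

/-- The open star of a cell: the union of the relative interiors of the cells containing it. -/
def star (s : Set α) : Set α := {x | ∃ t ∈ X.cells, s ⊆ t ∧ x ∈ X.relInt t}

/-- The cells that properly contain `t`. -/
def above (t : Set α) : Set (Set α) := {s | s ∈ X.cells ∧ t ⊂ s}

/-- `t` is the inclusion-minimal cell containing the set `S`. -/
def IsMinimalCell (t S : Set α) : Prop :=
  t ∈ X.cells ∧ S ⊆ t ∧ ∀ t' ∈ X.cells, S ⊆ t' → t ⊆ t'

/-- The nonempty set `S` lies in a cell and has dimension `d` there. -/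
def HasDim (S : Set α) (d : ℕ) : Prop :=
  S.Nonempty ∧ ∃ t ∈ X.cells, S ⊆ t ∧
    Module.finrank ℝ (affineSpan ℝ (X.chart t '' S)).direction = d

end ComplexData

/-- A general polyhedral complex with underlying topological space `|X| = α`. -/
structure PolyComplex (α : Type u) [TopologicalSpace α] extends ComplexData α where
  inter_mem : ∀ s ∈ cells, ∀ t ∈ cells, (s ∩ t).Nonempty →
    s ∩ t ∈ cells ∧ IsFace (chart s '' (s ∩ t)) (chart s '' s) ∧
      IsFace (chart t '' (s ∩ t)) (chart t '' t)
  chart_embedding : ∀ s ∈ cells, IsEmbedding (s.domRestrict (chart s))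
  chart_polyhedron : ∀ s ∈ cells, IsGenPolyhedron (chart s '' s)
  chart_full : ∀ s ∈ cells, affineSpan ℝ (chart s '' s) = ⊤
  chart_affine : ∀ s ∈ cells, ∀ t ∈ cells, IntAffineOn (s ∩ t) (chart t) (chart s)
  exists_unique_cell : ∀ x : α, ∃! s : Set α, s ∈ cells ∧ x ∈ toComplexData.relInt s
  star_open : ∀ s ∈ cells, IsOpen (toComplexData.star s)
  fan_open : ∀ s ∈ cells, IsOpenFan (fan s)
  star_embedding : ∀ s ∈ cells, IsEmbedding ((toComplexData.star s).domRestrict (starChart s))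
  star_image : ∀ s ∈ cells, starChart s '' toComplexData.star s = ⋃₀ fan s
  star_cell : ∀ s ∈ cells, ∀ t ∈ cells, s ⊆ t →
    starChart s '' (t ∩ toComplexData.star s) ∈ fan s ∧
    IntAffineOn (t ∩ toComplexData.star s) (chart t) (starChart s) ∧
    IntAffineOn (t ∩ toComplexData.star s) (starChart s) (chart t)
  star_affine : ∀ s ∈ cells, ∀ t ∈ cells,
    IntAffineOn (toComplexData.star s ∩ toComplexData.star t) (starChart s) (starChart t)

/-- `X'` is a refinement of `X` (both complexes have the underlying space `α`). -/
def PolyComplex.IsRefinement {α : Type u} [TopologicalSpace α] (X' X : PolyComplex α) : Prop :=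
  ∀ s ∈ X'.cells, (∃ t ∈ X.cells, s ⊆ t) ∧
    ∀ t ∈ X.cells, s ⊆ t →
      IntAffineOn s (X.chart t) (X'.chart s) ∧ IntAffineOn s (X'.chart s) (X.chart t)

/-- The cell whose relative interior contains the point `x`. -/
def PolyComplex.cellOf {α : Type u} [TopologicalSpace α] (X : PolyComplex α) (x : α) : Set α :=
  (X.exists_unique_cell x).choose

section Orbit

variable {α : Type u} [TopologicalSpace α]

/-- `X/G` is an orbit space: each element of `G` acts on `|X|` by an automorphism of the
polyhedral complex `X`. -/
structure IsOrbitSpace (X : PolyComplex α) (G : Type*) [Group G] [MulAction G α] : Prop where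
  continuous_smul : ∀ g : G, Continuous fun x : α => g • x
  smul_mem : ∀ g : G, ∀ s ∈ X.cells, g • s ∈ X.cells
  smul_affine : ∀ g : G, ∀ s ∈ X.cells,
    IntAffineOn (X.star s) (X.starChart s) (fun x => X.starChart (g • s) (g • x))

/-- There are only finitely many `G`-classes of cells. -/
def FinitelyManyClasses (X : PolyComplex α) (G : Type*) [Group G] [MulAction G α] : Prop :=
  ∃ T : Set (Set α), T.Finite ∧ ∀ s ∈ X.cells, ∃ g : G, ∃ t ∈ T, s = g • t

/-- The weight `[ω]([s]) = ω(s) / |G_s|` of the class of `s`, where `G_s` is the pointwise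
stabilizer of `s`. -/
def classWeight (G : Type*) [Group G] [MulAction G α] (ω : Set α → ℚ) (s : Set α) : ℚ :=
  ω s / (Nat.card (fixingSubgroup G s) : ℚ)

/-- `u` represents the primitive normal vector of `cs` relative to `ct`, where `ct ⊆ cs` are
cells of an open fan in `ℝᴺ` whose dimensions differ by one: `u` is a lattice vector
in the span of `cs` that generates the lattice of `cs` modulo the lattice of `ct`, and
`cs` lies in the half space of its span into which `u` points. -/
def IsPrimitiveNormal {N : ℕ} (ct cs : Set (Fin N → ℝ)) (w : Fin N → ℤ) : Prop :=
  (fun i => (w i : ℝ)) ∈ Submodule.span ℝ cs ∧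
  (∀ v : Fin N → ℤ, (fun i => (v i : ℝ)) ∈ Submodule.span ℝ cs →
    ∃ k : ℤ, (fun i => ((v i - k * w i : ℤ) : ℝ)) ∈ Submodule.span ℝ ct) ∧
  (∀ x ∈ cs \ ct, ∃ r : ℝ, 0 < r ∧ x - r • (fun i => (w i : ℝ)) ∈ Submodule.span ℝ ct)

/-- The cell of the open fan of `t` that corresponds to the cell `s ⊇ t`. -/
def starCone (X : PolyComplex α) (t s : Set α) : Set (Fin (X.starDim t) → ℝ) :=
  X.starChart t '' (s ∩ X.star t)

/-- The balancing condition of an orbit space at the codimension one cell `t`. The set `X_{s/t}`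
consists of the translates of `s` under the pointwise stabilizer of `t`. -/
def IsBalancedAt (X : PolyComplex α) (G : Type*) [Group G] [MulAction G α] (ω : Set α → ℚ)
    (t : Set α) : Prop :=
  (X.above t).Finite ∧
  ∃ (l : Set α → ℝ) (w : Set α → Fin (X.starDim t) → ℤ),
    (∀ s ∈ X.above t, 0 ≤ l s) ∧
    (∀ s ∈ X.above t, IsPrimitiveNormal (starCone X t t) (starCone X t s) (w s)) ∧
    (∀ s ∈ X.above t,
      ∑ᶠ s' ∈ {s' | s' ∈ X.above t ∧ ∃ g ∈ fixingSubgroup G t, s' = g • s}, l s' = 1) ∧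
    ∑ᶠ s ∈ X.above t, (l s * (classWeight G ω s : ℝ)) • (fun i => (w s i : ℝ))
      ∈ Submodule.span ℝ (starCone X t t)

/-- `(X, ω)/G` is a tropical orbit space of (pure) dimension `n`. Only the values of `ω` on
`n`-dimensional cells matter. -/
structure IsTropicalOrbitSpace (X : PolyComplex α) (G : Type*) [Group G] [MulAction G α]
    (n : ℕ) (ω : Set α → ℚ) : Prop where
  orbitSpace : IsOrbitSpace X G
  pure_dim : ∀ s ∈ X.cells, X.dim s ≤ n ∧ ∃ t ∈ X.cells, s ⊆ t ∧ X.dim t = n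
  weight_smul : ∀ g : G, ∀ s ∈ X.cells, X.dim s = n → ω (g • s) = ω s
  finite_classes : FinitelyManyClasses X G
  finite_stabilizer : ∀ s ∈ X.cells, X.dim s = n → (fixingSubgroup G s : Set G).Finite
  balanced : ∀ t ∈ X.cells, X.dim t + 1 = n → IsBalancedAt X G ω t

/-- `Z/G` is a suborbit space of `X/G`, where the inclusion `|Z| ⊆ |X|` is the map `i`: every
polyhedron of `Z` lies in a polyhedron of `X`, the integral affine structures (in the charts of
the open stars) are compatible, and `G` acts in the same way. -/
structure IsSubOrbitSpace {β : Type*} [TopologicalSpace β] (Z : PolyComplex β) (X : PolyComplex α)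
    (G : Type*) [Group G] [MulAction G β] [MulAction G α] (i : β → α) : Prop where
  injective : Function.Injective i
  continuous : Continuous i
  map_smul : ∀ (g : G) (x : β), i (g • x) = g • i x
  exists_cell : ∀ s ∈ Z.cells, ∃ t ∈ X.cells, i '' s ⊆ t
  star_affine : ∀ s ∈ Z.cells, ∀ t, X.IsMinimalCell t (i '' s) →
    MapsTo i (Z.star s) (X.star t) ∧
    IntAffineOn (Z.star s) (Z.starChart s) (fun x => X.starChart t (i x)) ∧
    IntAffineOn (Z.star s) (fun x => X.starChart t (i x)) (Z.starChart s)

/-- An `n`-dimensional tropical orbit space `X/G` is irreducible: every nonempty closed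
`n`-dimensional tropical suborbit space with nonzero weights (which may differ from those of `X`)
is all of `X`. -/
def IsIrreducible (X : PolyComplex α) (G : Type v) [Group G] [MulAction G α] (n : ℕ) : Prop :=
  ∀ (β : Type u) [TopologicalSpace β] [MulAction G β] (Z : PolyComplex β) (ω : Set β → ℚ)
    (i : β → α), Nonempty β → IsTropicalOrbitSpace Z G n ω →
    (∀ s ∈ Z.cells, Z.dim s = n → ω s ≠ 0) →
    IsSubOrbitSpace Z X G i → IsClosedEmbedding i → Function.Surjective i

end Orbit

/-- A morphism of orbit spaces `X/G → Y/H`. -/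
structure OrbitMorphism {α β : Type*} [TopologicalSpace α] [TopologicalSpace β]
    (X : PolyComplex α) (Y : PolyComplex β) (G H : Type*) [Group G] [Group H]
    [MulAction G α] [MulAction H β] where
  toFun : α → β
  groupHom : G →* H
  continuous : Continuous toFun
  exists_cell : ∀ s ∈ X.cells, ∃ t ∈ Y.cells, toFun '' s ⊆ t
  star_affine : ∀ s ∈ X.cells, ∀ t, Y.IsMinimalCell t (toFun '' s) →
    MapsTo toFun (X.star s) (Y.star t) ∧
    IntAffineOn (X.star s) (X.starChart s) (fun x => Y.starChart t (toFun x))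
  common_images : ∃ X' : PolyComplex α, X'.IsRefinement X ∧
    ∀ s ∈ X'.cells, ∀ s' ∈ X'.cells, ∀ (h : H) (d : ℕ),
      Y.HasDim (toFun '' s ∩ h • (toFun '' s')) d → Y.HasDim (toFun '' s) d →
      Y.HasDim (h • (toFun '' s')) d → toFun '' s = h • (toFun '' s')
  map_smul : ∀ (g : G) (x : α), toFun (g • x) = groupHom g • toFun x

namespace OrbitMorphism

variable {α β : Type*} [TopologicalSpace α] [TopologicalSpace β]
  {X : PolyComplex α} {Y : PolyComplex β} {G H : Type*} [Group G] [Group H]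
  [MulAction G α] [MulAction H β]

/-- The induced map `|X|/G → |Y|/H` on the topological quotients. -/
def orbitMap (f : OrbitMorphism X Y G H) :
    Quotient (MulAction.orbitRel G α) → Quotient (MulAction.orbitRel H β) :=
  Quotient.map f.toFun (by
    intro a b hab
    have hab' : a ∈ MulAction.orbit G b := hab
    obtain ⟨g, hg⟩ := hab'
    have hg' : g • b = a := hg
    show f.toFun a ∈ MulAction.orbit H (f.toFun b)
    exact ⟨f.groupHom g, by show f.groupHom g • f.toFun b = f.toFun a; rw [← hg', f.map_smul]⟩)

open Classical in
/-- The lattice index `|Λ'_t / f(Λ_s)|`: since the charts identify `s` and `t` with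
full-dimensional polyhedra, it is the index of the image of the integral matrix that describes
`f` in these charts (`0` if this index is infinite). -/
def latticeIndex (f : OrbitMorphism X Y G H) (s : Set α) (t : Set β) : ℕ :=
  if h : ∃ (A : Matrix (Fin (Y.dim t)) (Fin (X.dim s)) ℤ) (b : Fin (Y.dim t) → ℝ),
      ∀ x ∈ s, Y.chart t (f.toFun x)
        = (A.map (fun k : ℤ => (k : ℝ))).mulVec (X.chart s x) + b then
    (LinearMap.range h.choose.mulVecLin).toAddSubgroup.index
  else 0

/-- The multiplicity of `f` at the point `P` of `|X|`. It only depends on the class of `P`. -/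
def mult (f : OrbitMorphism X Y G H) (ωX : Set α → ℚ) (ωY : Set β → ℚ) (P : α) : ℚ :=
  classWeight G ωX (X.cellOf P) / classWeight H ωY (Y.cellOf (f.toFun P)) *
    (f.latticeIndex (X.cellOf P) (Y.cellOf (f.toFun P)) : ℚ)

/-- The classes `[P]` with `f([P]) = [Q]`. -/
def fibre (f : OrbitMorphism X Y G H) (Q : β) : Set (Quotient (MulAction.orbitRel G α)) :=
  {c | f.orbitMap c = Quotient.mk _ Q}

end OrbitMorphism

end TropOrbit

end

open Set Topology
open scoped Pointwise

noncomputable section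

namespace TropOrbit

/-! ### Integral matrices acting on real vectors -/

/-! Preimages are counted with multiplicity by `count`: the sum, over pairs (h, s) with Q in h f(s),
of the weight of s times the lattice index of f on s, where a G-class of cells is counted through
one representative divided by the order of its stabilizer (`orbitWeight`). Only good cells
contribute, that is, n-dimensional cells mapped injectively with finite index into an n-dimensional
cell (`IsGood`).

Inside an n-dimensional cell t of Y the images of the degenerate cells lie in finitely many
hyperplanes, the walls. Images of good cells are closed (`isClosed_image`; this needs the quotient
topology and the common refinement), so off the walls the count is locally constant. Along a line
that avoids the images of codimension two it can change only where the line crosses the image of a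
facet r of X. The form x ↦ det(x, image of r) measures the lattice index on every cell adjacent to
r, so balancing at r says that the changes cancel (`finsum_crossing_eq_zero`). Joining two generic
points through a third one shows that the count has one generic value `genCount` on t.

At a facet u of Y, lattice index times normal vector is compatible with f modulo the span of u
(`idx_mul_eq`). Hence balancing on X pushes forward: the numbers `genCount` are balanced on Y
(`finsum_genCount_mem`). Choose d with `genCount` = d · ωY on one cell. The difference `genCount` -
d · ωY is again balanced; if it were nonzero somewhere, its support would be a closed tropical
suborbit space missing that cell, against irreducibility. So `genCount` = d · ωY everywhere.

Since the groups may be infinite, two reductions are needed throughout. The coefficients λ of the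
balancing condition are averaged away over the pointwise stabilizer of the facet
(`IsBalancedAt.exists_sum_mem`). Sums over classes are compared by double counting with two
different choices of representatives (`finsum_mul_eq_of_invariant`).

Finally Y₀ consists of the lower-dimensional cells and of the H-translates of the walls, cut into
relatively open strata by the signs of the wall functions. Off Y₀ the stabilizer of a point is the
pointwise stabilizer of its cell, so `count` becomes |H_t| times the sum of [ωX] · index over the
fibre. Division by ωY(t) turns this into the sum of the multiplicities, which is d. -/

/-- The real matrix underlying an integral matrix. -/
def rmat {m n : ℕ} (A : Matrix (Fin m) (Fin n) ℤ) : Matrix (Fin m) (Fin n) ℝ :=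
  A.map (fun k : ℤ => (k : ℝ))

/-- The real vector underlying an integral vector. -/
def rvec {n : ℕ} (w : Fin n → ℤ) : Fin n → ℝ := fun i => (w i : ℝ)

lemma rmat_mul {l m n : ℕ} (A : Matrix (Fin l) (Fin m) ℤ) (B : Matrix (Fin m) (Fin n) ℤ) :
    rmat (A * B) = rmat A * rmat B :=
  Matrix.map_mul (f := Int.castRingHom ℝ)

lemma rmat_one {n : ℕ} : rmat (1 : Matrix (Fin n) (Fin n) ℤ) = 1 :=
  Matrix.map_one _ (by simp) (by simp)

lemma rmat_injective {m n : ℕ} :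
    Function.Injective (rmat : Matrix (Fin m) (Fin n) ℤ → Matrix (Fin m) (Fin n) ℝ) := by
  intro A B h
  ext i j
  have := congrFun (congrFun h i) j
  simpa [rmat] using this

lemma rmat_mulVec_rvec {m n : ℕ} (A : Matrix (Fin m) (Fin n) ℤ) (w : Fin n → ℤ) :
    (rmat A).mulVec (rvec w) = rvec (A.mulVec w) := by
  ext i
  simp [rmat, rvec, Matrix.mulVec, dotProduct]

lemma rvec_injective {n : ℕ} : Function.Injective (rvec : (Fin n → ℤ) → Fin n → ℝ) := by
  intro v w h
  ext i
  have := congrFun h i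
  simpa [rvec] using this

lemma continuous_intForm {n : ℕ} (a : Fin n → ℤ) : Continuous (intForm a) := by
  unfold intForm
  fun_prop

lemma intForm_add {n : ℕ} (a : Fin n → ℤ) (x y : Fin n → ℝ) :
    intForm a (x + y) = intForm a x + intForm a y := by
  simp [intForm, mul_add, Finset.sum_add_distrib]

lemma intForm_smul {n : ℕ} (a : Fin n → ℤ) (r : ℝ) (x : Fin n → ℝ) :
    intForm a (r • x) = r * intForm a x := by
  simp [intForm, Finset.mul_sum, mul_left_comm]

/-- `intForm a` as a linear map. -/
def intFormLin {n : ℕ} (a : Fin n → ℤ) : (Fin n → ℝ) →ₗ[ℝ] ℝ where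
  toFun := intForm a
  map_add' := intForm_add a
  map_smul' r x := by simp [intForm_smul]

lemma intForm_sub {n : ℕ} (a : Fin n → ℤ) (x y : Fin n → ℝ) :
    intForm a (x - y) = intForm a x - intForm a y := (intFormLin a).map_sub x y

lemma intForm_zero_left {n : ℕ} (x : Fin n → ℝ) : intForm (0 : Fin n → ℤ) x = 0 := by
  simp [intForm]

lemma intForm_rvec_self {n : ℕ} {a : Fin n → ℤ} (ha : a ≠ 0) : 0 < intForm a (rvec a) := by
  obtain ⟨i, hi⟩ := Function.ne_iff.mp ha
  unfold intForm
  apply Finset.sum_pos'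
  · intro j _
    exact mul_self_nonneg _
  · exact ⟨i, Finset.mem_univ _, mul_self_pos.mpr (by simpa using hi)⟩

lemma intForm_mulVec {m n : ℕ} (a : Fin m → ℤ) (A : Matrix (Fin m) (Fin n) ℤ) (x : Fin n → ℝ) :
    intForm a ((rmat A).mulVec x) = intForm (Matrix.vecMul a A) x := by
  have h : ∀ {k : ℕ} (c : Fin k → ℤ) (y : Fin k → ℝ), intForm c y = rvec c ⬝ᵥ y :=
    fun c y => rfl
  have h2 : rvec (Matrix.vecMul a A) = Matrix.vecMul (rvec a) (rmat A) := by
    ext j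
    simp [rmat, rvec, Matrix.vecMul, dotProduct]
  rw [h, h, h2, Matrix.dotProduct_mulVec]

lemma continuous_mulVec {m n : ℕ} (A : Matrix (Fin m) (Fin n) ℝ) :
    Continuous (fun x : Fin n → ℝ => A.mulVec x) :=
  A.mulVecLin.continuous_of_finiteDimensional

/-- An affine map that vanishes on an affinely spanning set is zero. -/
lemma mulVec_add_eq_zero {m n : ℕ} {S : Set (Fin n → ℝ)} (hS : affineSpan ℝ S = ⊤)
    (A : Matrix (Fin m) (Fin n) ℝ) (b : Fin m → ℝ) (h : ∀ x ∈ S, A.mulVec x + b = 0) :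
    A = 0 ∧ b = 0 := by
  let f : (Fin n → ℝ) →ᵃ[ℝ] (Fin m → ℝ) :=
    A.mulVecLin.toAffineMap + AffineMap.const ℝ _ b
  have hf : ∀ x, f x = A.mulVec x + b := fun x => rfl
  have h0 : ∀ x, f x = 0 := by
    -- The zero set of `f` is written as the preimage of the affine subspace {0}; it is an affine
    -- subspace that contains `S`.
    have h1 : S ⊆ ((⊥ : AffineSubspace ℝ (Fin m → ℝ)) ⊔ affineSpan ℝ {0}).comap f := by
      intro x hx
      have : f x = 0 := by rw [hf]; exact h x hx
      simp [this]
    have h2 := affineSpan_le.mpr h1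
    rw [hS] at h2
    intro x
    have := h2 (AffineSubspace.mem_top ℝ _ x)
    simpa [AffineSubspace.mem_comap] using this
  have hb : b = 0 := by
    have := h0 0
    rw [hf] at this
    simpa using this
  refine ⟨?_, hb⟩
  ext i j
  have := h0 (Pi.single j 1)
  rw [hf, hb] at this
  simpa using congrFun this i

/-- Charts have full-dimensional image, so this is what makes the matrices of chart changes and of
morphisms unique. -/
lemma mulVec_add_ext {m n : ℕ} {S : Set (Fin n → ℝ)} (hS : affineSpan ℝ S = ⊤)
    {A A' : Matrix (Fin m) (Fin n) ℝ} {b b' : Fin m → ℝ}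
    (h : ∀ x ∈ S, A.mulVec x + b = A'.mulVec x + b') : A = A' ∧ b = b' := by
  have := mulVec_add_eq_zero hS (A - A') (b - b') (fun x hx => by
    rw [Matrix.sub_mulVec]
    have := h x hx
    rw [show A.mulVec x - A'.mulVec x + (b - b') = (A.mulVec x + b) - (A'.mulVec x + b') by abel,
      this, sub_self])
  exact ⟨sub_eq_zero.mp this.1, sub_eq_zero.mp this.2⟩

/-! ### Integer affine dependence -/

section IntAffine

variable {α β : Type*} {l m n : ℕ} {s t : Set α} {F : α → Fin l → ℝ} {F' : α → Fin m → ℝ}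
  {F'' : α → Fin n → ℝ}

lemma intAffineOn_iff : IntAffineOn s F F' ↔ ∃ (A : Matrix (Fin m) (Fin l) ℤ) (b : Fin m → ℝ),
    ∀ x ∈ s, F' x = (rmat A).mulVec (F x) + b := Iff.rfl

lemma IntAffineOn.refl (s : Set α) (F : α → Fin l → ℝ) : IntAffineOn s F F :=
  intAffineOn_iff.mpr ⟨1, 0, fun x _ => by rw [rmat_one]; simp⟩

lemma IntAffineOn.trans (h : IntAffineOn s F F') (h' : IntAffineOn s F' F'') :
    IntAffineOn s F F'' := by
  obtain ⟨A, b, hA⟩ := intAffineOn_iff.mp h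
  obtain ⟨B, c, hB⟩ := intAffineOn_iff.mp h'
  refine intAffineOn_iff.mpr ⟨B * A, (rmat B).mulVec b + c, fun x hx => ?_⟩
  rw [hB x hx, hA x hx, rmat_mul, Matrix.mulVec_add, ← Matrix.mulVec_mulVec, add_assoc]

lemma IntAffineOn.mono (h : IntAffineOn t F F') (hst : s ⊆ t) : IntAffineOn s F F' := by
  obtain ⟨A, b, hA⟩ := h
  exact ⟨A, b, fun x hx => hA x (hst hx)⟩

lemma IntAffineOn.comp {T : Set β} {g : β → α} (h : IntAffineOn s F F') (hg : MapsTo g T s) :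
    IntAffineOn T (fun x => F (g x)) (fun x => F' (g x)) := by
  obtain ⟨A, b, hA⟩ := h
  exact ⟨A, b, fun x hx => hA _ (hg hx)⟩

lemma intAffineOn_empty : IntAffineOn (∅ : Set α) F F' := ⟨0, 0, fun _ hx => hx.elim⟩

/-- Mutually inverse integer affine maps have mutually inverse linear parts. -/
lemma mul_eq_one_of_inverse (hS : affineSpan ℝ (F '' s) = ⊤) {A : Matrix (Fin m) (Fin l) ℤ}
    {b : Fin m → ℝ} {B : Matrix (Fin l) (Fin m) ℤ} {c : Fin l → ℝ}
    (hA : ∀ x ∈ s, F' x = (rmat A).mulVec (F x) + b)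
    (hB : ∀ x ∈ s, F x = (rmat B).mulVec (F' x) + c) : B * A = 1 := by
  have := mulVec_add_ext hS (A := rmat (B * A)) (A' := 1) (b := (rmat B).mulVec b + c) (b' := 0) (by
    rintro _ ⟨x, hx, rfl⟩
    rw [rmat_mul, ← Matrix.mulVec_mulVec, ← add_assoc, ← Matrix.mulVec_add, ← hA x hx, ← hB x hx]
    simp)
  apply rmat_injective
  rw [this.1, rmat_one]

/-- Integer affine dependence extends from a dense subset. -/
lemma mulVec_eqOn_of_dense [TopologicalSpace α] (hst : s ⊆ t)
    (hd : t ⊆ closure s) (hF : ContinuousOn F t) (hF' : ContinuousOn F' t)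
    {A : Matrix (Fin m) (Fin l) ℤ} {b : Fin m → ℝ}
    (hA : ∀ x ∈ s, F' x = (rmat A).mulVec (F x) + b) :
    ∀ x ∈ t, F' x = (rmat A).mulVec (F x) + b := by
  have hc : ContinuousOn (fun x => (rmat A).mulVec (F x) + b) t :=
    ((continuous_mulVec (rmat A)).comp_continuousOn hF).add continuousOn_const
  exact Set.EqOn.of_subset_closure (fun x hx => hA x hx) hF' hc hst hd

end IntAffine

/-! ### General polyhedra -/

lemma IsGenPolyhedron.convex {n : ℕ} {P : Set (Fin n → ℝ)} (h : IsGenPolyhedron P) :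
    Convex ℝ P := by
  obtain ⟨W, S, rfl⟩ := h
  have h1 : ∀ w : (Fin n → ℤ) × ℝ, Convex ℝ {x | w.2 ≤ intForm w.1 x} := fun w =>
    convex_halfSpace_ge (intFormLin w.1).isLinear _
  have h2 : ∀ w : (Fin n → ℤ) × ℝ, Convex ℝ {x | w.2 < intForm w.1 x} := fun w =>
    convex_halfSpace_gt (intFormLin w.1).isLinear _
  have : {x | (∀ w ∈ W, w.2 ≤ intForm w.1 x) ∧ ∀ s ∈ S, s.2 < intForm s.1 x}
      = (⋂ w ∈ W, {x | w.2 ≤ intForm w.1 x}) ∩ ⋂ w ∈ S, {x | w.2 < intForm w.1 x} := by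
    ext x; simp
  rw [this]
  exact (convex_iInter₂ fun w _ => h1 w).inter (convex_iInter₂ fun w _ => h2 w)

/-! ### Basic facts about polyhedral complexes -/

namespace PolyComplex

variable {α : Type u} [TopologicalSpace α] {X : PolyComplex α} {s t : Set α} {x : α}

lemma cellOf_mem (X : PolyComplex α) (x : α) : X.cellOf x ∈ X.cells :=
  (X.exists_unique_cell x).choose_spec.1.1

lemma mem_relInt_cellOf (X : PolyComplex α) (x : α) : x ∈ X.relInt (X.cellOf x) :=
  (X.exists_unique_cell x).choose_spec.1.2

lemma relInt_subset (X : PolyComplex α) (s : Set α) : X.relInt s ⊆ s := fun _ hx => hx.1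

lemma mem_cellOf (X : PolyComplex α) (x : α) : x ∈ X.cellOf x := (X.mem_relInt_cellOf x).1

lemma cellOf_eq (hs : s ∈ X.cells) (hx : x ∈ X.relInt s) : X.cellOf x = s :=
  (X.exists_unique_cell x).unique ⟨X.cellOf_mem x, X.mem_relInt_cellOf x⟩ ⟨hs, hx⟩

lemma mem_relInt_iff (hs : s ∈ X.cells) : x ∈ X.relInt s ↔ X.cellOf x = s :=
  ⟨cellOf_eq hs, fun h => h ▸ X.mem_relInt_cellOf x⟩

lemma convex_image (hs : s ∈ X.cells) : Convex ℝ (X.chart s '' s) :=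
  (X.chart_polyhedron s hs).convex

lemma interior_nonempty (hs : s ∈ X.cells) : (interior (X.chart s '' s)).Nonempty :=
  (convex_image hs).interior_nonempty_iff_affineSpan_eq_top.mpr (X.chart_full s hs)

lemma image_relInt (X : PolyComplex α) (s : Set α) :
    X.chart s '' X.relInt s = interior (X.chart s '' s) := by
  ext y
  constructor
  · rintro ⟨x, hx, rfl⟩
    exact hx.2
  · intro hy
    obtain ⟨x, hx, rfl⟩ := interior_subset hy
    exact ⟨x, ⟨hx, hy⟩, rfl⟩

lemma relInt_nonempty (hs : s ∈ X.cells) : (X.relInt s).Nonempty := by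
  have := interior_nonempty hs
  rw [← image_relInt] at this
  exact this.of_image

lemma cell_nonempty (hs : s ∈ X.cells) : s.Nonempty :=
  (relInt_nonempty hs).mono (X.relInt_subset s)

lemma chart_injOn (hs : s ∈ X.cells) : InjOn (X.chart s) s :=
  Set.injOn_iff_injective.mpr (X.chart_embedding s hs).injective

lemma chart_continuousOn (hs : s ∈ X.cells) : ContinuousOn (X.chart s) s :=
  continuousOn_iff_continuous_domRestrict.mpr (X.chart_embedding s hs).continuous

lemma starChart_injOn (hs : s ∈ X.cells) : InjOn (X.starChart s) (X.star s) :=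
  Set.injOn_iff_injective.mpr (X.star_embedding s hs).injective

end PolyComplex

/-- Closures can be tested in a chart although the chart is an embedding of a single cell only. -/
lemma mem_closure_of_embedding {α β : Type*} [TopologicalSpace α] [TopologicalSpace β]
    {s S : Set α} {φ : α → β} (h : IsEmbedding (s.domRestrict φ)) (hS : S ⊆ s) {x : α} (hx : x ∈ s)
    (hc : φ x ∈ closure (φ '' S)) : x ∈ closure S := by
  have h1 : (⟨x, hx⟩ : s) ∈ closure (Subtype.val ⁻¹' S : Set s) := by
    rw [h.isInducing.closure_eq_preimage_closure_image]
    have : s.domRestrict φ '' (Subtype.val ⁻¹' S) = φ '' S := by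
      ext y
      constructor
      · rintro ⟨⟨z, hz⟩, hz', rfl⟩
        exact ⟨z, hz', rfl⟩
      · rintro ⟨z, hz, rfl⟩
        exact ⟨⟨z, hS hz⟩, hz, rfl⟩
    rw [mem_preimage, this]
    exact hc
  have h2 := image_closure_subset_closure_image (continuous_subtype_val (p := (· ∈ s)))
    (mem_image_of_mem _ h1)
  refine closure_mono ?_ h2
  rintro _ ⟨z, hz, rfl⟩
  exact hz

namespace PolyComplex

variable {α : Type u} [TopologicalSpace α] {X : PolyComplex α} {s t : Set α} {x : α}

/-- A convex set with interior points lies in the closure of its interior, and the chart carries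
this back to the cell. -/
lemma subset_closure_relInt (hs : s ∈ X.cells) : s ⊆ closure (X.relInt s) := by
  intro x hx
  apply mem_closure_of_embedding (X.chart_embedding s hs) (X.relInt_subset s) hx
  rw [image_relInt, (convex_image hs).closure_interior_eq_closure_of_nonempty_interior
    (interior_nonempty hs)]
  exact subset_closure (mem_image_of_mem _ hx)

lemma relInt_subset_star (hs : s ∈ X.cells) : X.relInt s ⊆ X.star s :=
  fun _ hx => ⟨s, hs, Subset.rfl, hx⟩

lemma mem_star_iff : x ∈ X.star s ↔ s ⊆ X.cellOf x := by
  constructor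
  · rintro ⟨t, ht, hst, hx⟩
    rwa [cellOf_eq ht hx]
  · intro h
    exact ⟨_, X.cellOf_mem x, h, X.mem_relInt_cellOf x⟩

/-- The open star of the cell of `x` is a neighbourhood of `x`, hence meets the dense relative
interior of `t`; a common point has cell `t`, which therefore contains the cell of `x`. -/
lemma cellOf_subset (ht : t ∈ X.cells) (hx : x ∈ t) : X.cellOf x ⊆ t := by
  have h1 : x ∈ X.star (X.cellOf x) := mem_star_iff.mpr Subset.rfl
  obtain ⟨y, hy, hy'⟩ := mem_closure_iff.mp (subset_closure_relInt ht hx) _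
    (X.star_open _ (X.cellOf_mem x)) h1
  rw [mem_star_iff, cellOf_eq ht hy'] at hy
  exact hy

lemma mem_iff_cellOf_subset (ht : t ∈ X.cells) : x ∈ t ↔ X.cellOf x ⊆ t :=
  ⟨cellOf_subset ht, fun h => h (X.mem_cellOf x)⟩

lemma subset_of_mem_relInt (hs : s ∈ X.cells) (ht : t ∈ X.cells) (hx : x ∈ X.relInt s)
    (hxt : x ∈ t) : s ⊆ t := cellOf_eq hs hx ▸ cellOf_subset ht hxt

lemma inter_star_self (hs : s ∈ X.cells) : s ∩ X.star s = X.relInt s := by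
  ext x
  rw [mem_relInt_iff hs, mem_inter_iff, mem_star_iff, mem_iff_cellOf_subset hs]
  exact ⟨fun h => h.1.antisymm h.2, fun h => h ▸ ⟨Subset.rfl, Subset.rfl⟩⟩

lemma relInt_subset_star_of_subset (hs : s ∈ X.cells) (hst : t ⊆ s) :
    X.relInt s ⊆ X.star t := fun _ hx => ⟨s, hs, hst, hx⟩

/-- Even an infinite union of cells is closed: the star of the cell of a point outside is an open
set that misses it, because a point `y` of the star in a cell `t` gives `cellOf x ⊆ cellOf y ⊆ t`.
-/
lemma isClosed_of_lower {𝓒 : Set (Set α)} (h𝓒 : 𝓒 ⊆ X.cells) : IsClosed (⋃₀ 𝓒) := by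
  rw [← isOpen_compl_iff, isOpen_iff_forall_mem_open]
  intro x hx
  refine ⟨X.star (X.cellOf x), ?_, X.star_open _ (X.cellOf_mem x), mem_star_iff.mpr Subset.rfl⟩
  rintro y hy ⟨t, ht, hyt⟩
  apply hx
  exact ⟨t, ht, (mem_star_iff.mp hy).trans (cellOf_subset (h𝓒 ht) hyt) (X.mem_cellOf x)⟩

lemma isClosed_cell (ht : t ∈ X.cells) : IsClosed t := by
  have := isClosed_of_lower (X := X) (𝓒 := {t}) (by simpa using ht)
  simpa using this

/-- The fan of the star is finite, and a cell above `s` is recovered from its cone by looking at one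
point of its relative interior. -/
lemma finite_above (hs : s ∈ X.cells) : {t | t ∈ X.cells ∧ s ⊆ t}.Finite := by
  have hfan : (X.fan s).Finite := by
    obtain ⟨C, R, U, hC, -, -, -, h⟩ := X.fan_open s hs
    rw [h]
    exact hC.finite.image _
  refine Set.Finite.of_finite_image (f := fun t => X.starChart s '' (t ∩ X.star s))
    (hfan.subset ?_) ?_
  · rintro _ ⟨t, ⟨ht, hst⟩, rfl⟩
    exact (X.star_cell s hs t ht hst).1
  · have key : ∀ t ∈ X.cells, s ⊆ t → ∀ t' ∈ X.cells,
        X.starChart s '' (t ∩ X.star s) = X.starChart s '' (t' ∩ X.star s) → t ⊆ t' := by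
      intro t ht hst t' ht' h
      obtain ⟨x, hx⟩ := relInt_nonempty ht
      have h1 : X.starChart s x ∈ X.starChart s '' (t' ∩ X.star s) :=
        h ▸ mem_image_of_mem _ ⟨hx.1, relInt_subset_star_of_subset ht hst hx⟩
      obtain ⟨y, hy, hyx⟩ := h1
      have : y = x := starChart_injOn hs hy.2 (relInt_subset_star_of_subset ht hst hx) hyx
      exact subset_of_mem_relInt ht ht' hx (this ▸ hy.1)
    rintro t ⟨ht, hst⟩ t' ⟨ht', hst'⟩ h
    exact (key t ht hst t' ht' h).antisymm (key t' ht' hst' t ht h.symm)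

end PolyComplex

/-! ### Dimensions of cells -/

lemma le_of_mul_eq_one {m n : ℕ} {A : Matrix (Fin n) (Fin m) ℤ} {B : Matrix (Fin m) (Fin n) ℤ}
    (h : B * A = 1) : m ≤ n := by
  have hinj : Function.Injective A.mulVecLin := by
    intro x y hxy
    have : B.mulVec (A.mulVec x) = B.mulVec (A.mulVec y) := congrArg _ hxy
    simpa [h] using this
  simpa using LinearMap.finrank_le_finrank_of_injective hinj

/-- A square matrix with a left inverse is invertible and kills no nonzero row vector. This is the
source of all strict drops of dimension. -/
lemma lt_of_vecMul_eq_zero {m n : ℕ} {A : Matrix (Fin n) (Fin m) ℤ}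
    {B : Matrix (Fin m) (Fin n) ℤ} (h : B * A = 1) {a : Fin n → ℤ} (ha : a ≠ 0)
    (haA : Matrix.vecMul a A = 0) : m < n := by
  refine lt_of_le_of_ne (le_of_mul_eq_one h) ?_
  rintro rfl
  apply ha
  have h2 : A * B = 1 := mul_eq_one_comm.mp h
  calc a = Matrix.vecMul a (A * B) := by rw [h2, Matrix.vecMul_one]
    _ = 0 := by rw [← Matrix.vecMul_vecMul, haA, Matrix.zero_vecMul]

lemma eq_zero_of_intForm_eq {n : ℕ} {S : Set (Fin n → ℝ)} (hS : affineSpan ℝ S = ⊤)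
    {c : Fin n → ℤ} {p : ℝ} (h : ∀ x ∈ S, intForm c x = p) : c = 0 ∧ p = 0 := by
  have := mulVec_add_eq_zero hS (Matrix.of fun (_ : Fin 1) => rvec c) (fun _ => -p) (by
    intro x hx
    ext i
    have h1 : (Matrix.of fun (_ : Fin 1) => rvec c).mulVec x i = intForm c x := rfl
    simp [h1, h x hx])
  refine ⟨?_, by simpa using congrFun this.2 0⟩
  apply rvec_injective
  have h1 := congrFun this.1 0
  ext i
  simpa [rvec] using congrFun h1 i

/-- A nonempty open set covered by finitely many closed sets meets the interior of one of them. -/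
lemma exists_open_subset_of_finite_cover {α : Type*} [TopologicalSpace α] {𝓐 : Set (Set α)}
    (hfin : 𝓐.Finite) (hc : ∀ s ∈ 𝓐, IsClosed s) {O : Set α} (hO : IsOpen O) (hne : O.Nonempty)
    (hcov : O ⊆ ⋃₀ 𝓐) : ∃ s ∈ 𝓐, ∃ O' ⊆ O, IsOpen O' ∧ O'.Nonempty ∧ O' ⊆ s := by
  induction 𝓐, hfin using Set.Finite.induction_on generalizing O with
  | empty =>
    obtain ⟨x, hx⟩ := hne
    simpa using hcov hx
  | @insert a S _ _ ih =>
    by_cases h : O ⊆ a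
    · exact ⟨a, mem_insert _ _, O, Subset.rfl, hO, hne, h⟩
    · obtain ⟨x, hx, hxa⟩ := not_subset.mp h
      obtain ⟨s, hs, O', hO', h1, h2, h3⟩ := ih (O := O \ a)
        (fun s hs => hc s (mem_insert_of_mem _ hs)) (hO.sdiff (hc a (mem_insert _ _))) ⟨x, hx, hxa⟩
        (by
          rintro y ⟨hy, hya⟩
          obtain ⟨s, hs, hys⟩ := hcov hy
          rcases mem_insert_iff.mp hs with rfl | hs
          · exact absurd hys hya
          · exact ⟨s, hs, hys⟩)
      exact ⟨s, mem_insert_of_mem _ hs, O', hO'.trans sdiff_subset, h1, h2, h3⟩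

namespace PolyComplex

variable {α : Type u} [TopologicalSpace α] {X : PolyComplex α} {s t : Set α} {x : α}

lemma chart_affine_of_subset (hs : s ∈ X.cells) (ht : t ∈ X.cells) (hst : s ⊆ t) :
    IntAffineOn s (X.chart s) (X.chart t) ∧ IntAffineOn s (X.chart t) (X.chart s) := by
  constructor
  · exact (X.chart_affine t ht s hs).mono (subset_inter hst Subset.rfl)
  · exact (X.chart_affine s hs t ht).mono (subset_inter Subset.rfl hst)

/-- The linear form that cuts out the face is nonzero, since otherwise the face would be everything.
It is constant on the face, so it is killed by the linear part of the inclusion. -/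
lemma dim_lt_of_ssubset (hs : s ∈ X.cells) (ht : t ∈ X.cells) (hst : s ⊂ t) :
    X.dim s < X.dim t := by
  have hi : s ∩ t = s := inter_eq_left.mpr hst.1
  obtain ⟨-, -, a, p, ha, hT⟩ := X.inter_mem s hs t ht (by rw [hi]; exact cell_nonempty hs)
  rw [hi] at hT
  have ha0 : a ≠ 0 := by
    rintro rfl
    apply hst.not_subset
    obtain ⟨y, hy⟩ := cell_nonempty hs
    have h1 : X.chart t y ∈ X.chart t '' s := mem_image_of_mem _ hy
    rw [hT] at h1
    have hp : (0 : ℝ) = p := by simpa [intForm_zero_left] using h1.2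
    intro z hz
    have h2 : X.chart t z ∈ X.chart t '' s := by
      rw [hT]
      exact ⟨mem_image_of_mem _ hz, by rw [intForm_zero_left, hp]⟩
    obtain ⟨w, hw, hwz⟩ := h2
    exact chart_injOn ht (hst.1 hw) hz hwz ▸ hw
  obtain ⟨h1, h2⟩ := chart_affine_of_subset hs ht hst.1
  obtain ⟨A, b, hA⟩ := intAffineOn_iff.mp h1
  obtain ⟨B, c, hB⟩ := intAffineOn_iff.mp h2
  refine lt_of_vecMul_eq_zero (mul_eq_one_of_inverse (X.chart_full s hs) hA hB) ha0 ?_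
  refine (eq_zero_of_intForm_eq (X.chart_full s hs) (p := p - intForm a b) ?_).1
  rintro _ ⟨y, hy, rfl⟩
  have h3 : X.chart t y ∈ X.chart t '' s := mem_image_of_mem _ hy
  rw [hT] at h3
  have h4 := h3.2
  rw [hA y hy, intForm_add, intForm_mulVec] at h4
  linarith

lemma dim_le_of_subset (hs : s ∈ X.cells) (ht : t ∈ X.cells) (hst : s ⊆ t) :
    X.dim s ≤ X.dim t := by
  rcases hst.eq_or_ssubset with rfl | h
  · exact le_rfl
  · exact (dim_lt_of_ssubset hs ht h).le

lemma eq_of_subset_of_dim_le (hs : s ∈ X.cells) (ht : t ∈ X.cells) (hst : s ⊆ t)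
    (hd : X.dim t ≤ X.dim s) : s = t := by
  rcases hst.eq_or_ssubset with h | h
  · exact h
  · exact absurd (dim_lt_of_ssubset hs ht h) (not_lt.mpr hd)

/-- The star of `u` is covered by finitely many closed cells, those above `u`, so one of them
contains an open part of any nonempty open subset of the star. -/
lemma exists_cell_open_subset {u O : Set α} (hu : u ∈ X.cells) (hO : IsOpen O) (hne : O.Nonempty)
    (hOu : O ⊆ X.star u) :
    ∃ s ∈ X.cells, u ⊆ s ∧ ∃ O' ⊆ O, IsOpen O' ∧ O'.Nonempty ∧ O' ⊆ s := by
  obtain ⟨s, hs, h⟩ := exists_open_subset_of_finite_cover (finite_above hu)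
    (fun s hs => isClosed_cell hs.1) hO hne (fun x hx =>
      ⟨X.cellOf x, ⟨X.cellOf_mem x, mem_star_iff.mp (hOu hx)⟩, X.mem_cellOf x⟩)
  exact ⟨s, hs.1, hs.2, h⟩

/-- A containing cell of least dimension works: its intersection with another containing cell is a
cell of no smaller dimension, hence equal to it. -/
lemma exists_minimalCell {S : Set α} (hS : S.Nonempty) (h : ∃ t ∈ X.cells, S ⊆ t) :
    ∃ t, X.IsMinimalCell t S := by
  classical
  have hex : ∃ d, ∃ t ∈ X.cells, S ⊆ t ∧ X.dim t = d := by
    obtain ⟨t, ht, hSt⟩ := h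
    exact ⟨_, t, ht, hSt, rfl⟩
  obtain ⟨t, ht, hSt, hd⟩ := Nat.find_spec hex
  refine ⟨t, ht, hSt, fun t' ht' hSt' => ?_⟩
  have hm := (X.inter_mem t ht t' ht' (hS.mono (subset_inter hSt hSt'))).1
  have h1 := Nat.find_min' hex ⟨t ∩ t', hm, subset_inter hSt hSt', rfl⟩
  exact inter_eq_left.mp (eq_of_subset_of_dim_le hm ht inter_subset_left (hd ▸ h1))

lemma star_eq_relInt (hs : s ∈ X.cells) (hmax : ∀ t ∈ X.cells, s ⊆ t → s = t) :
    X.star s = X.relInt s := by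
  ext x
  rw [mem_star_iff, mem_relInt_iff hs]
  exact ⟨fun h => (hmax _ (X.cellOf_mem x) h).symm, fun h => h.ge⟩

lemma relInt_starChart_affine (hs : s ∈ X.cells) (ht : t ∈ X.cells) (hst : s ⊆ t) :
    IntAffineOn (X.relInt t) (X.chart t) (X.starChart s) ∧
      IntAffineOn (X.relInt t) (X.starChart s) (X.chart t) := by
  have h : X.relInt t ⊆ t ∩ X.star s :=
    subset_inter (X.relInt_subset t) (relInt_subset_star_of_subset ht hst)
  exact ⟨(X.star_cell s hs t ht hst).2.1.mono h, (X.star_cell s hs t ht hst).2.2.mono h⟩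

lemma affineSpan_relInt (hs : s ∈ X.cells) : affineSpan ℝ (X.chart s '' X.relInt s) = ⊤ := by
  rw [image_relInt]
  exact (isOpen_interior).affineSpan_eq_top (interior_nonempty hs)

lemma dim_eq_of_inverse {β : Type*} {m n : ℕ} {S : Set β} {F : β → Fin m → ℝ} {F' : β → Fin n → ℝ}
    (hS : affineSpan ℝ (F '' S) = ⊤) (hS' : affineSpan ℝ (F' '' S) = ⊤)
    (h : IntAffineOn S F F') (h' : IntAffineOn S F' F) : m = n := by
  obtain ⟨A, b, hA⟩ := intAffineOn_iff.mp h
  obtain ⟨B, c, hB⟩ := intAffineOn_iff.mp h'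
  exact (le_of_mul_eq_one (mul_eq_one_of_inverse hS hA hB)).antisymm
    (le_of_mul_eq_one (mul_eq_one_of_inverse hS' hB hA))

end PolyComplex

/-! ### Cellular integer affine maps -/

section CellMap

variable {α β γ : Type*} [TopologicalSpace α] [TopologicalSpace β] [TopologicalSpace γ]

/-- A continuous map that carries cells into cells and is integer affine between open stars. -/
structure IsCellMap (X : PolyComplex α) (Y : PolyComplex β) (F : α → β) : Prop where
  continuous : Continuous F
  exists_cell : ∀ s ∈ X.cells, ∃ t ∈ Y.cells, MapsTo F s t ∧ MapsTo F (X.star s) (Y.star t) ∧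
    IntAffineOn (X.star s) (X.starChart s) (fun x => Y.starChart t (F x))

open Classical in
/-- The cell of `Y` whose relative interior receives the relative interior of `s` under `F`. -/
def tgt (X : PolyComplex α) (Y : PolyComplex β) (F : α → β) (s : Set α) : Set β :=
  if h : (X.relInt s).Nonempty then Y.cellOf (F h.some) else ∅

variable {X : PolyComplex α} {Y : PolyComplex β} {Z : PolyComplex γ} {F : α → β} {F' : β → γ}
  {s s' : Set α} {x : α}

/-- A relative interior point of `s` goes to `t ∩ star t`, which is the relative interior of `t`; so
the choice of the point in `tgt` does not matter. -/
lemma tgt_eq {t : Set β} (hs : s ∈ X.cells) (ht : t ∈ Y.cells) (h : MapsTo F s t)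
    (h' : MapsTo F (X.star s) (Y.star t)) : tgt X Y F s = t := by
  have hne := PolyComplex.relInt_nonempty hs
  rw [tgt, dif_pos hne]
  apply PolyComplex.cellOf_eq ht
  rw [← PolyComplex.inter_star_self ht]
  exact ⟨h hne.some_mem.1, h' (PolyComplex.relInt_subset_star hs hne.some_mem)⟩

namespace IsCellMap

lemma tgt_spec (hF : IsCellMap X Y F) (hs : s ∈ X.cells) : tgt X Y F s ∈ Y.cells ∧
    MapsTo F s (tgt X Y F s) ∧ MapsTo F (X.star s) (Y.star (tgt X Y F s)) ∧
    IntAffineOn (X.star s) (X.starChart s) (fun x => Y.starChart (tgt X Y F s) (F x)) := by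
  obtain ⟨t, ht, h1, h2, h3⟩ := hF.exists_cell s hs
  rw [tgt_eq hs ht h1 h2]
  exact ⟨ht, h1, h2, h3⟩

lemma tgt_mem (hF : IsCellMap X Y F) (hs : s ∈ X.cells) : tgt X Y F s ∈ Y.cells :=
  (hF.tgt_spec hs).1

lemma mapsTo (hF : IsCellMap X Y F) (hs : s ∈ X.cells) : MapsTo F s (tgt X Y F s) :=
  (hF.tgt_spec hs).2.1

lemma mapsTo_star (hF : IsCellMap X Y F) (hs : s ∈ X.cells) :
    MapsTo F (X.star s) (Y.star (tgt X Y F s)) := (hF.tgt_spec hs).2.2.1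

lemma star_affine (hF : IsCellMap X Y F) (hs : s ∈ X.cells) :
    IntAffineOn (X.star s) (X.starChart s) (fun x => Y.starChart (tgt X Y F s) (F x)) :=
  (hF.tgt_spec hs).2.2.2

lemma mapsTo_relInt (hF : IsCellMap X Y F) (hs : s ∈ X.cells) :
    MapsTo F (X.relInt s) (Y.relInt (tgt X Y F s)) := by
  intro x hx
  rw [← PolyComplex.inter_star_self (hF.tgt_mem hs)]
  exact ⟨hF.mapsTo hs hx.1, hF.mapsTo_star hs (PolyComplex.relInt_subset_star hs hx)⟩

lemma cellOf_map (hF : IsCellMap X Y F) (x : α) : Y.cellOf (F x) = tgt X Y F (X.cellOf x) :=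
  PolyComplex.cellOf_eq (hF.tgt_mem (X.cellOf_mem x))
    (hF.mapsTo_relInt (X.cellOf_mem x) (X.mem_relInt_cellOf x))

/-- The definition speaks of star charts only. On the relative interior they are interchangeable
with the charts of the cells, and density extends the formula to the whole cell. -/
lemma chart_affine (hF : IsCellMap X Y F) (hs : s ∈ X.cells) :
    IntAffineOn s (X.chart s) (fun x => Y.chart (tgt X Y F s) (F x)) := by
  have ht := hF.tgt_mem hs
  have h1 : IntAffineOn (X.relInt s) (X.chart s) (X.starChart s) :=
    (PolyComplex.relInt_starChart_affine hs hs Subset.rfl).1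
  have h2 := (hF.star_affine hs).mono (PolyComplex.relInt_subset_star hs)
  have h3 := ((PolyComplex.relInt_starChart_affine ht ht Subset.rfl).2).comp (hF.mapsTo_relInt hs)
  obtain ⟨A, b, hA⟩ := intAffineOn_iff.mp ((h1.trans h2).trans h3)
  exact intAffineOn_iff.mpr ⟨A, b, mulVec_eqOn_of_dense (X.relInt_subset s)
    (PolyComplex.subset_closure_relInt hs) (PolyComplex.chart_continuousOn hs)
    ((PolyComplex.chart_continuousOn ht).comp hF.continuous.continuousOn (hF.mapsTo hs)) hA⟩

lemma tgt_mono (hF : IsCellMap X Y F) (hs : s ∈ X.cells) (hs' : s' ∈ X.cells) (h : s ⊆ s') :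
    tgt X Y F s ⊆ tgt X Y F s' := by
  obtain ⟨x, hx⟩ := PolyComplex.relInt_nonempty hs
  exact PolyComplex.subset_of_mem_relInt (hF.tgt_mem hs) (hF.tgt_mem hs') (hF.mapsTo_relInt hs hx)
    (hF.mapsTo hs' (h hx.1))

lemma comp (hF' : IsCellMap Y Z F') (hF : IsCellMap X Y F) :
    IsCellMap X Z (fun x => F' (F x)) where
  continuous := hF'.continuous.comp hF.continuous
  exists_cell s hs := by
    have ht := hF.tgt_mem hs
    exact ⟨_, hF'.tgt_mem ht, (hF'.mapsTo ht).comp (hF.mapsTo hs),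
      (hF'.mapsTo_star ht).comp (hF.mapsTo_star hs),
      (hF.star_affine hs).trans ((hF'.star_affine ht).comp (hF.mapsTo_star hs))⟩

lemma tgt_comp (hF' : IsCellMap Y Z F') (hF : IsCellMap X Y F) (hs : s ∈ X.cells) :
    tgt X Z (fun x => F' (F x)) s = tgt Y Z F' (tgt X Y F s) :=
  have ht := hF.tgt_mem hs
  tgt_eq hs (hF'.tgt_mem ht) ((hF'.mapsTo ht).comp (hF.mapsTo hs))
    ((hF'.mapsTo_star ht).comp (hF.mapsTo_star hs))

end IsCellMap

end CellMap

/-! ### Automorphisms -/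

lemma mapsTo_smul_set {G α : Type*} [Group G] [MulAction G α] (g : G) (s : Set α) :
    MapsTo (fun x => g • x) s (g • s) := fun _ hx => smul_mem_smul_set hx

namespace IsOrbitSpace

variable {α : Type u} [TopologicalSpace α] {X : PolyComplex α} {G : Type*} [Group G]
  [MulAction G α] {s t : Set α}

lemma smul_mem_iff (hX : IsOrbitSpace X G) (g : G) : g • s ∈ X.cells ↔ s ∈ X.cells := by
  refine ⟨fun h => ?_, hX.smul_mem g s⟩
  have := hX.smul_mem g⁻¹ _ h
  rwa [inv_smul_smul] at this

lemma cellOf_smul (hX : IsOrbitSpace X G) (g : G) (x : α) :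
    X.cellOf (g • x) = g • X.cellOf x := by
  have h1 : ∀ (g : G) (x : α), X.cellOf (g • x) ⊆ g • X.cellOf x := fun g x =>
    PolyComplex.cellOf_subset (hX.smul_mem g _ (X.cellOf_mem x))
      (smul_mem_smul_set (X.mem_cellOf x))
  refine (h1 g x).antisymm ?_
  have := h1 g⁻¹ (g • x)
  rw [inv_smul_smul] at this
  have h2 := smul_set_mono (a := g) this
  rwa [smul_inv_smul] at h2

lemma smul_mem_relInt (hX : IsOrbitSpace X G) (hs : s ∈ X.cells) (g : G) {x : α}
    (hx : x ∈ X.relInt s) : g • x ∈ X.relInt (g • s) := by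
  rw [PolyComplex.mem_relInt_iff (hX.smul_mem g s hs), hX.cellOf_smul, PolyComplex.cellOf_eq hs hx]

lemma smul_mem_star (hX : IsOrbitSpace X G) (g : G) {x : α}
    (hx : x ∈ X.star s) : g • x ∈ X.star (g • s) := by
  rw [PolyComplex.mem_star_iff] at hx ⊢
  rw [hX.cellOf_smul]
  exact smul_set_mono hx

lemma isCellMap (hX : IsOrbitSpace X G) (g : G) : IsCellMap X X (fun x => g • x) where
  continuous := hX.continuous_smul g
  exists_cell s hs := ⟨g • s, hX.smul_mem g s hs, mapsTo_smul_set g s,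
    fun _ hx => hX.smul_mem_star g hx, hX.smul_affine g s hs⟩

lemma tgt_smul (hX : IsOrbitSpace X G) (g : G) (hs : s ∈ X.cells) :
    tgt X X (fun x => g • x) s = g • s :=
  tgt_eq hs (hX.smul_mem g s hs) (mapsTo_smul_set g s) (fun _ hx => hX.smul_mem_star g hx)

lemma chart_affine (hX : IsOrbitSpace X G) (g : G) (hs : s ∈ X.cells) :
    IntAffineOn s (X.chart s) (fun x => X.chart (g • s) (g • x)) := by
  have := (hX.isCellMap g).chart_affine hs
  rwa [hX.tgt_smul g hs] at this

lemma chart_affine_symm (hX : IsOrbitSpace X G) (g : G) (hs : s ∈ X.cells) :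
    IntAffineOn s (fun x => X.chart (g • s) (g • x)) (X.chart s) := by
  have h := hX.chart_affine g⁻¹ (hX.smul_mem g s hs)
  have h2 := h.comp (mapsTo_smul_set g s)
  simp only [inv_smul_smul] at h2
  -- The type of the chart depends on the cell, so the equality `g⁻¹ • g • s = s` cannot be
  -- rewritten; it is eliminated for a variable cell instead.
  have h3 : ∀ s', s' = s → IntAffineOn s (fun x => X.chart (g • s) (g • x)) (X.chart s') →
      IntAffineOn s (fun x => X.chart (g • s) (g • x)) (X.chart s) := by
    rintro _ rfl h
    exact h
  exact h3 _ (inv_smul_smul g s) h2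

lemma dim_smul (hX : IsOrbitSpace X G) (g : G) (hs : s ∈ X.cells) :
    X.dim (g • s) = X.dim s := by
  refine PolyComplex.dim_eq_of_inverse (S := s) (F := fun x => X.chart (g • s) (g • x))
    (F' := X.chart s) ?_ (X.chart_full s hs) (hX.chart_affine_symm g hs) (hX.chart_affine g hs)
  rw [← X.chart_full _ (hX.smul_mem g s hs)]
  congr 1
  ext y
  constructor
  · rintro ⟨x, hx, rfl⟩
    exact ⟨g • x, smul_mem_smul_set hx, rfl⟩
  · rintro ⟨_, ⟨x, hx, rfl⟩, rfl⟩
    exact ⟨x, hx, rfl⟩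

end IsOrbitSpace

namespace OrbitMorphism

variable {α β : Type*} [TopologicalSpace α] [TopologicalSpace β]
  {X : PolyComplex α} {Y : PolyComplex β} {G H : Type*} [Group G] [Group H]
  [MulAction G α] [MulAction H β]

lemma isCellMap (f : OrbitMorphism X Y G H) : IsCellMap X Y f.toFun where
  continuous := f.continuous
  exists_cell s hs := by
    obtain ⟨t, ht⟩ := PolyComplex.exists_minimalCell
      ((PolyComplex.cell_nonempty hs).image f.toFun) (f.exists_cell s hs)
    obtain ⟨h1, h2⟩ := f.star_affine s hs t ht
    exact ⟨t, ht.1, mapsTo_iff_image_subset.mpr ht.2.1, h1, h2⟩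

lemma isCellMap_smul (f : OrbitMorphism X Y G H) (hY : IsOrbitSpace Y H) (h : H) :
    IsCellMap X Y (fun x => h • f.toFun x) := (hY.isCellMap h).comp f.isCellMap

lemma tgt_smul (f : OrbitMorphism X Y G H) (hY : IsOrbitSpace Y H) (h : H) {s : Set α}
    (hs : s ∈ X.cells) : tgt X Y (fun x => h • f.toFun x) s = h • tgt X Y f.toFun s := by
  rw [(hY.isCellMap h).tgt_comp f.isCellMap hs, hY.tgt_smul h (f.isCellMap.tgt_mem hs)]

lemma tgt_smul_source (f : OrbitMorphism X Y G H) (hX : IsOrbitSpace X G) (hY : IsOrbitSpace Y H)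
    (g : G) {s : Set α} (hs : s ∈ X.cells) :
    tgt X Y f.toFun (g • s) = f.groupHom g • tgt X Y f.toFun s := by
  have h1 := f.isCellMap.tgt_comp (hX.isCellMap g) hs
  rw [hX.tgt_smul g hs] at h1
  rw [← h1, ← f.tgt_smul hY _ hs]
  congr 1
  ext x
  exact f.map_smul g x

end OrbitMorphism

/-! ### The lattice index of an integral matrix -/

/-- The index of the image of an integral matrix (`0` if it is infinite). -/
def latIdx {m n : ℕ} (A : Matrix (Fin m) (Fin n) ℤ) : ℕ :=
  (LinearMap.range A.mulVecLin).toAddSubgroup.index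

/-- The image lies in the kernel of a nonzero integral form, which already has infinite index. -/
lemma latIdx_eq_zero_of_vecMul {m n : ℕ} {A : Matrix (Fin m) (Fin n) ℤ} {a : Fin m → ℤ}
    (ha : a ≠ 0) (h : Matrix.vecMul a A = 0) : latIdx A = 0 := by
  obtain ⟨i, hi⟩ := Function.ne_iff.mp ha
  let φ : (Fin m → ℤ) →+ ℤ :=
    { toFun := fun x => a ⬝ᵥ x
      map_zero' := by simp
      map_add' := fun x y => by simp [dotProduct_add] }
  have hle : (LinearMap.range A.mulVecLin).toAddSubgroup ≤ φ.ker := by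
    rintro _ ⟨x, rfl⟩
    change a ⬝ᵥ A.mulVec x = 0
    rw [Matrix.dotProduct_mulVec, h, zero_dotProduct]
  have hdvd := AddSubgroup.index_dvd_of_le hle
  have hker : φ.ker.index = 0 := by
    rw [AddSubgroup.index_ker, Nat.card_eq_zero]
    right
    refine Set.infinite_coe_iff.mpr (Set.infinite_of_injective_forall_mem
      (f := fun k : ℤ => a i * k) (fun k l hkl => mul_left_cancel₀ hi hkl) (fun k => ?_))
    exact ⟨Pi.single i k, by simp [φ]⟩
  rw [hker] at hdvd
  exact Nat.eq_zero_of_zero_dvd hdvd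

lemma exists_vecMul_eq_zero_of_det {n : ℕ} {A : Matrix (Fin n) (Fin n) ℤ} (h : A.det = 0) :
    ∃ a : Fin n → ℤ, a ≠ 0 ∧ Matrix.vecMul a A = 0 :=
  Matrix.exists_vecMul_eq_zero_iff.mpr h

/-- The convention that an infinite index is `0` makes the formula true for singular matrices as
well. -/
lemma latIdx_eq_det {n : ℕ} (A : Matrix (Fin n) (Fin n) ℤ) : latIdx A = A.det.natAbs := by
  by_cases h : A.det = 0
  · obtain ⟨a, ha, haA⟩ := exists_vecMul_eq_zero_of_det h
    rw [latIdx_eq_zero_of_vecMul ha haA, h, Int.natAbs_zero]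
  · have hinj : Function.Injective A.mulVecLin := by
      rw [← LinearMap.ker_eq_bot, LinearMap.ker_eq_bot']
      intro x hx
      by_contra hx0
      exact h (Matrix.exists_mulVec_eq_zero_iff.mp ⟨x, hx0, hx⟩)
    let e : (Fin n → ℤ) ≃ₗ[ℤ] LinearMap.range A.mulVecLin :=
      LinearEquiv.ofInjective A.mulVecLin hinj
    have := Submodule.natAbs_det_equiv (LinearMap.range A.mulVecLin) e
    rw [latIdx]
    have h2 : (LinearMap.range A.mulVecLin).subtype ∘ₗ
        AddMonoidHom.toIntLinearMap ((e : (Fin n → ℤ) ≃ₗ[ℤ] LinearMap.range A.mulVecLin) :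
          (Fin n → ℤ) →+ LinearMap.range A.mulVecLin) = Matrix.toLin' A := by
      ext x
      rfl
    rw [h2, LinearMap.det_toLin'] at this
    rw [this]
    rfl

lemma latIdx_mul_left {l m n : ℕ} {U : Matrix (Fin l) (Fin m) ℤ} {U' : Matrix (Fin m) (Fin l) ℤ}
    (h : U' * U = 1) (h' : U * U' = 1) (A : Matrix (Fin m) (Fin n) ℤ) :
    latIdx (U * A) = latIdx A := by
  have hb : Function.Bijective U.mulVecLin.toAddMonoidHom := by
    constructor
    · intro x y hxy
      have : U'.mulVec (U.mulVec x) = U'.mulVec (U.mulVec y) := congrArg _ hxy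
      simpa [h] using this
    · intro y
      exact ⟨U'.mulVec y, show U.mulVec (U'.mulVec y) = y by simp [h']⟩
  have he := AddSubgroup.index_map_equiv (LinearMap.range A.mulVecLin).toAddSubgroup
    (AddEquiv.ofBijective U.mulVecLin.toAddMonoidHom hb)
  rw [latIdx, latIdx, ← he]
  congr 1
  ext y
  constructor
  · rintro ⟨x, rfl⟩
    exact ⟨A.mulVec x, ⟨x, rfl⟩, by
      change U.mulVec (A.mulVec x) = (U * A).mulVec x
      rw [Matrix.mulVec_mulVec]⟩
  · rintro ⟨_, ⟨x, rfl⟩, rfl⟩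
    exact ⟨x, by
      change (U * A).mulVec x = U.mulVec (A.mulVec x)
      rw [Matrix.mulVec_mulVec]⟩

/-- A right inverse is enough: `V` is then surjective on integral vectors, so the images coincide.
-/
lemma latIdx_mul_right {l m n : ℕ} {V : Matrix (Fin n) (Fin l) ℤ} {V' : Matrix (Fin l) (Fin n) ℤ}
    (h : V * V' = 1) (A : Matrix (Fin m) (Fin n) ℤ) :
    latIdx (A * V) = latIdx A := by
  rw [latIdx, latIdx]
  congr 1
  ext y
  constructor
  · rintro ⟨x, rfl⟩
    exact ⟨V.mulVec x, by
      change A.mulVec (V.mulVec x) = (A * V).mulVec x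
      rw [Matrix.mulVec_mulVec]⟩
  · rintro ⟨x, rfl⟩
    exact ⟨V'.mulVec x, by
      change (A * V).mulVec (V'.mulVec x) = A.mulVec x
      rw [Matrix.mulVec_mulVec, Matrix.mul_assoc, h, Matrix.mul_one]⟩

/-- A degenerate integral map has its image in a rational hyperplane; this is where the walls come
from. -/
lemma exists_vecMul_eq_zero {m n : ℕ} (A : Matrix (Fin m) (Fin n) ℤ)
    (h : n < m ∨ n = m ∧ latIdx A = 0) : ∃ a : Fin m → ℤ, a ≠ 0 ∧ Matrix.vecMul a A = 0 := by
  rcases h with h | ⟨rfl, h⟩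
  · have : ¬ Function.Injective A.vecMulLinear := by
      intro hinj
      have := LinearMap.finrank_le_finrank_of_injective hinj
      simp at this
      omega
    rw [← LinearMap.ker_eq_bot] at this
    obtain ⟨a, ha, ha0⟩ := Submodule.exists_mem_ne_zero_of_ne_bot this
    exact ⟨a, ha0, ha⟩
  · rw [latIdx_eq_det, Int.natAbs_eq_zero] at h
    exact exists_vecMul_eq_zero_of_det h

lemma exists_inverse_of_latIdx_ne_zero {m n : ℕ} {A : Matrix (Fin m) (Fin n) ℤ} (hmn : n = m)
    (h : latIdx A ≠ 0) : ∃ B : Matrix (Fin n) (Fin m) ℝ, B * rmat A = 1 ∧ rmat A * B = 1 := by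
  subst hmn
  rw [latIdx_eq_det, Int.natAbs_ne_zero] at h
  have hdet : (rmat A).det = (A.det : ℝ) := ((Int.castRingHom ℝ).map_det A).symm
  have hu : IsUnit (rmat A).det := by
    rw [hdet]
    exact (Int.cast_ne_zero.mpr h).isUnit
  exact ⟨(rmat A)⁻¹, Matrix.nonsing_inv_mul _ hu, Matrix.mul_nonsing_inv _ hu⟩

/-! ### Points in general position -/

/-- Proper affine subspaces have Lebesgue measure zero, nonempty open sets have positive measure. -/
lemma exists_mem_notMem_affineSubspaces {n : ℕ} {ι : Type*} {I : Set ι} (hI : I.Finite)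
    (L : ι → AffineSubspace ℝ (Fin n → ℝ)) (hL : ∀ i ∈ I, L i ≠ ⊤) {O : Set (Fin n → ℝ)}
    (hO : IsOpen O) (hne : O.Nonempty) : ∃ x ∈ O, ∀ i ∈ I, x ∉ L i := by
  by_contra hcon
  push Not at hcon
  have h0 : MeasureTheory.volume (⋃ i ∈ I, (L i : Set (Fin n → ℝ))) = 0 :=
    (MeasureTheory.measure_biUnion_null_iff hI.countable).mpr
      (fun i hi => MeasureTheory.Measure.addHaar_affineSubspace _ _ (hL i hi))
  have h1 : O ⊆ ⋃ i ∈ I, (L i : Set (Fin n → ℝ)) := by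
    intro x hx
    obtain ⟨i, hi, hxi⟩ := hcon x hx
    exact mem_biUnion hi hxi
  have h2 := hO.measure_pos MeasureTheory.volume hne
  exact (h2.trans_le (MeasureTheory.measure_mono h1)).ne' h0

/-- The affine hyperplane `a x = p`. -/
def wallSpace {n : ℕ} (w : (Fin n → ℤ) × ℝ) : AffineSubspace ℝ (Fin n → ℝ) where
  carrier := {x | intForm w.1 x = w.2}
  smul_vsub_vadd_mem' c x y z hx hy hz := by
    simp only [mem_ofPred_eq, vsub_eq_sub, vadd_eq_add] at *
    rw [intForm_add, intForm_smul, intForm_sub, hx, hy, hz]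
    ring

lemma wallSpace_ne_top {n : ℕ} {w : (Fin n → ℤ) × ℝ} (h : w.1 ≠ 0) : wallSpace w ≠ ⊤ := by
  intro htop
  have h1 : ∀ x, intForm w.1 x = w.2 := fun x => by
    have : x ∈ wallSpace w := by rw [htop]; exact AffineSubspace.mem_top ℝ _ x
    exact this
  have h2 := h1 (rvec w.1)
  have h3 := h1 0
  have h4 := intForm_rvec_self h
  have h5 : intForm w.1 0 = 0 := (intFormLin w.1).map_zero
  linarith

/-! ### Determinants and facets -/

/-- The square matrix whose rows are `x` and the columns of `M`. -/
def consCols {R : Type*} {r : ℕ} (x : Fin (r + 1) → R) (M : Matrix (Fin (r + 1)) (Fin r) R) :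
    Matrix (Fin (r + 1)) (Fin (r + 1)) R :=
  Matrix.of fun i j => Fin.cases (motive := fun _ => R) (x j) (fun k => M j k) i

lemma consCols_zero {R : Type*} {r : ℕ} (x : Fin (r + 1) → R)
    (M : Matrix (Fin (r + 1)) (Fin r) R) (j : Fin (r + 1)) : consCols x M 0 j = x j := rfl

lemma consCols_succ {R : Type*} {r : ℕ} (x : Fin (r + 1) → R)
    (M : Matrix (Fin (r + 1)) (Fin r) R) (i : Fin r) (j : Fin (r + 1)) :
    consCols x M i.succ j = M j i := rfl

lemma det_consCols {r : ℕ} (x : Fin (r + 1) → ℝ) (M : Matrix (Fin (r + 1)) (Fin r) ℝ) :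
    (consCols x M).det = ∑ j : Fin (r + 1),
      (-1) ^ (j : ℕ) * x j * (M.transpose.submatrix id j.succAbove).det :=
  Matrix.det_succ_row_zero _

/-- The linear form `x ↦ det (x, M)`. -/
def sideForm {r : ℕ} (M : Matrix (Fin (r + 1)) (Fin r) ℝ) : (Fin (r + 1) → ℝ) →ₗ[ℝ] ℝ where
  toFun x := (consCols x M).det
  map_add' x y := by
    simp only [det_consCols, Pi.add_apply, mul_add, add_mul, Finset.sum_add_distrib]
  map_smul' c x := by
    simp only [det_consCols, Pi.smul_apply, smul_eq_mul, RingHom.id_apply, Finset.mul_sum]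
    exact Finset.sum_congr rfl fun j _ => by ring

lemma sideForm_apply {r : ℕ} (M : Matrix (Fin (r + 1)) (Fin r) ℝ) (x : Fin (r + 1) → ℝ) :
    sideForm M x = (consCols x M).det := rfl

lemma sideForm_mulVec {r : ℕ} (M : Matrix (Fin (r + 1)) (Fin r) ℝ) (y : Fin r → ℝ) :
    sideForm M (M.mulVec y) = 0 := by
  have h : M.mulVec y = ∑ j, y j • M.transpose j := by
    ext i
    simp [Matrix.mulVec, dotProduct, Matrix.transpose, mul_comm]
  rw [h, map_sum]
  refine Finset.sum_eq_zero fun j _ => ?_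
  rw [map_smul, sideForm_apply, Matrix.det_zero_of_row_eq (Fin.succ_ne_zero j).symm, smul_zero]
  ext k
  rfl

lemma sideForm_mul_left {r : ℕ} (A : Matrix (Fin (r + 1)) (Fin (r + 1)) ℝ)
    (M : Matrix (Fin (r + 1)) (Fin r) ℝ) (x : Fin (r + 1) → ℝ) :
    sideForm (A * M) (A.mulVec x) = A.det * sideForm M x := by
  rw [sideForm_apply, sideForm_apply, ← Matrix.det_transpose A, mul_comm, ← Matrix.det_mul]
  congr 1
  ext i j
  refine Fin.cases ?_ (fun i => ?_) i
  · simp only [consCols_zero, Matrix.mul_apply, Matrix.mulVec, dotProduct,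
      Matrix.transpose_apply, mul_comm]
  · simp only [consCols_succ, Matrix.mul_apply, Matrix.transpose_apply, mul_comm]

lemma sideForm_mul_right {r : ℕ} (M : Matrix (Fin (r + 1)) (Fin r) ℝ)
    (T : Matrix (Fin r) (Fin r) ℝ) (x : Fin (r + 1) → ℝ) :
    sideForm (M * T) x = T.det * sideForm M x := by
  rw [sideForm_apply, sideForm_apply, det_consCols, det_consCols, Finset.mul_sum]
  refine Finset.sum_congr rfl fun j _ => ?_
  have : (M * T).transpose.submatrix id j.succAbove
      = T.transpose * M.transpose.submatrix id j.succAbove := by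
    ext a b
    simp only [Matrix.submatrix_apply, Matrix.mul_apply, Matrix.transpose_apply, id, mul_comm]
  rw [this, Matrix.det_mul, Matrix.det_transpose]
  ring

/-- Expressing the unit vectors through `u` and the columns of `J` gives an integral left inverse of
the matrix with rows `u` and these columns, so its determinant is a unit of ℤ. -/
lemma abs_sideForm_eq_one {r : ℕ} {u : Fin (r + 1) → ℤ} {J : Matrix (Fin (r + 1)) (Fin r) ℤ}
    (h : ∀ z : Fin (r + 1) → ℤ, ∃ (k : ℤ) (y : Fin r → ℤ), z = k • u + J.mulVec y) :
    |sideForm (rmat J) (rvec u)| = 1 := by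
  let R : Matrix (Fin (r + 1)) (Fin (r + 1)) ℤ := consCols u J
  have hR : sideForm (rmat J) (rvec u) = (R.det : ℝ) := by
    rw [sideForm_apply]
    change _ = (Int.castRingHom ℝ) R.det
    rw [RingHom.map_det]
    congr 1
    ext i j
    refine Fin.cases ?_ (fun i => ?_) i
    · rfl
    · rfl
  choose k y hky using fun j => h (Pi.single j 1)
  let S : Matrix (Fin (r + 1)) (Fin (r + 1)) ℤ := Matrix.of fun j => Fin.cons (α := fun _ => ℤ) (k j) (y j)
  have hSR : S * R = 1 := by
    ext a b
    have := congrFun (hky a) b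
    rw [Matrix.mul_apply, Fin.sum_univ_succ]
    simp only [S, R, Matrix.of_apply, Fin.cons_zero, Fin.cons_succ, consCols_zero, consCols_succ]
    rw [Matrix.one_apply]
    simp only [Pi.single_apply, Pi.add_apply, Pi.smul_apply, smul_eq_mul, Matrix.mulVec,
      dotProduct] at this
    rw [show (if a = b then (1 : ℤ) else 0) = if b = a then 1 else 0 by simp [eq_comm], this]
    simp only [mul_comm]
  have hu : IsUnit R.det := IsUnit.of_mul_eq_one S.det (by
    rw [mul_comm, ← Matrix.det_mul, hSR, Matrix.det_one])
  rw [hR, ← Int.cast_abs, Int.isUnit_iff_abs_eq.mp hu, Int.cast_one]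

/-- `u` generates the integral vectors modulo the image of `J`. -/
def Generates {q r : ℕ} (u : Fin q → ℤ) (J : Matrix (Fin q) (Fin r) ℤ) : Prop :=
  ∀ z : Fin q → ℤ, ∃ (k : ℤ) (y : Fin r → ℤ), z = k • u + J.mulVec y

lemma latIdx_cast {n : ℕ} (A : Matrix (Fin n) (Fin n) ℤ) : (latIdx A : ℝ) = |(rmat A).det| := by
  have hdet : (rmat A).det = (A.det : ℝ) := ((Int.castRingHom ℝ).map_det A).symm
  rw [latIdx_eq_det, hdet, Nat.cast_natAbs, Int.cast_abs]

/-- A linear form that measures, up to sign, the lattice index on every cell adjacent to a given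
facet. -/
lemma exists_side_form {p r : ℕ} (hp : p = r + 1) (M : Matrix (Fin p) (Fin r) ℤ) :
    ∃ ℓ : (Fin p → ℝ) →ₗ[ℝ] ℝ, (∀ y, ℓ ((rmat M).mulVec y) = 0) ∧
      ∀ (q : ℕ) (_ : q = r + 1) (A : Matrix (Fin p) (Fin q) ℤ) (u : Fin q → ℤ)
        (J : Matrix (Fin q) (Fin r) ℤ), Generates u J → A * J = M →
        (latIdx A : ℝ) = |ℓ (rvec (A.mulVec u))| := by
  subst hp
  refine ⟨sideForm (rmat M), sideForm_mulVec _, ?_⟩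
  rintro q rfl A u J hu rfl
  -- det(A u, A J) = det A · det(u, J), and the second factor is ±1. The form depends on `M = A J`
  -- only, so one form serves all cells around the facet.
  rw [← rmat_mulVec_rvec, rmat_mul, sideForm_mul_left, abs_mul, abs_sideForm_eq_one hu, mul_one,
    latIdx_cast]

/-- Compute det(A u, A J) in two ways: it is ± det A, and after substituting `hT` and `hk` it is ± k
· det T, as the columns of `K J'` do not contribute. Thus the index on a cell is the index `T` on
its facet times the transversal stretching factor `k`. -/
lemma latIdx_facet {N r r' p q : ℕ} (hr : r' = r) (hp : p = r + 1) (hq : q = r + 1)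
    {A : Matrix (Fin p) (Fin q) ℤ} {u : Fin q → ℤ} {J : Matrix (Fin q) (Fin r) ℤ}
    (hu : Generates u J) {K : Matrix (Fin p) (Fin N) ℤ} {J' : Matrix (Fin N) (Fin r') ℤ}
    {T : Matrix (Fin r') (Fin r) ℤ} (hT : A * J = K * J' * T) {u' : Fin N → ℤ}
    (hu' : Generates (K.mulVec u') (K * J')) {k : ℝ} {y : Fin r' → ℝ}
    (hk : rvec (A.mulVec u) = (rmat K).mulVec (k • rvec u' + (rmat J').mulVec y)) :
    (latIdx A : ℝ) = latIdx T * |k| := by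
  subst hr hp hq
  have h1 : |sideForm (rmat (A * J)) (rvec (A.mulVec u))| = latIdx A := by
    rw [← rmat_mulVec_rvec, rmat_mul, sideForm_mul_left, abs_mul, abs_sideForm_eq_one hu, mul_one,
      latIdx_cast]
  rw [← h1, hT, rmat_mul, sideForm_mul_right, hk, Matrix.mulVec_add, Matrix.mulVec_smul,
    Matrix.mulVec_mulVec, ← rmat_mul, map_add, map_smul, sideForm_mulVec, add_zero,
    rmat_mulVec_rvec, smul_eq_mul, abs_mul, abs_mul, abs_sideForm_eq_one hu', mul_one, latIdx_cast]

/-! ### Charts as local homeomorphisms -/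

namespace PolyComplex

variable {α : Type u} [TopologicalSpace α] {X : PolyComplex α} {s t : Set α} {x : α}

lemma exists_open_chart_image (hs : s ∈ X.cells) {O : Set α} (hO : IsOpen O) :
    ∃ V : Set (Fin (X.dim s) → ℝ), IsOpen V ∧ ∀ x ∈ s, x ∈ O ↔ X.chart s x ∈ V := by
  have h1 : IsOpen (Subtype.val ⁻¹' O : Set s) := hO.preimage continuous_subtype_val
  obtain ⟨V, hV, hVO⟩ := (X.chart_embedding s hs).isInducing.isOpen_iff.mp h1
  refine ⟨V, hV, fun x hx => ?_⟩
  have : (⟨x, hx⟩ : s) ∈ s.domRestrict (X.chart s) ⁻¹' V ↔ (⟨x, hx⟩ : s) ∈ Subtype.val ⁻¹' O := by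
    rw [hVO]
  exact this.symm

lemma isOpen_chart_image (hs : s ∈ X.cells) {O : Set α} (hO : IsOpen O) (hOs : O ⊆ X.relInt s) :
    IsOpen (X.chart s '' O) := by
  obtain ⟨V, hV, hVO⟩ := exists_open_chart_image hs hO
  have : X.chart s '' O = V ∩ interior (X.chart s '' s) := by
    ext y
    constructor
    · rintro ⟨x, hx, rfl⟩
      exact ⟨(hVO x (hOs hx).1).mp hx, (hOs hx).2⟩
    · rintro ⟨hy, hy'⟩
      obtain ⟨x, hx, rfl⟩ := interior_subset hy'
      exact ⟨x, (hVO x hx).mpr hy, rfl⟩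
  rw [this]
  exact hV.inter isOpen_interior

/-- The inverse of the chart of a cell. -/
def chartInv (X : PolyComplex α) (s : Set α) (x₀ : α) (p : Fin (X.dim s) → ℝ) : α :=
  haveI : Nonempty α := ⟨x₀⟩
  Function.invFunOn (X.chart s) s p

lemma chartInv_mem {x₀ : α} {p : Fin (X.dim s) → ℝ} (hp : p ∈ X.chart s '' s) :
    X.chartInv s x₀ p ∈ s :=
  haveI : Nonempty α := ⟨x₀⟩
  Function.invFunOn_mem hp

lemma chart_chartInv {x₀ : α} {p : Fin (X.dim s) → ℝ} (hp : p ∈ X.chart s '' s) :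
    X.chart s (X.chartInv s x₀ p) = p :=
  haveI : Nonempty α := ⟨x₀⟩
  Function.invFunOn_eq hp

lemma chartInv_chart (hs : s ∈ X.cells) {x₀ : α} (hx : x ∈ s) :
    X.chartInv s x₀ (X.chart s x) = x :=
  chart_injOn hs (chartInv_mem (mem_image_of_mem _ hx)) hx (chart_chartInv (mem_image_of_mem _ hx))

lemma chartInv_mem_relInt {x₀ : α} {p : Fin (X.dim s) → ℝ} (hp : p ∈ interior (X.chart s '' s)) :
    X.chartInv s x₀ p ∈ X.relInt s :=
  ⟨chartInv_mem (interior_subset hp), by rwa [chart_chartInv (interior_subset hp)]⟩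

/-- Supplies the dimension hypotheses of the common image condition: sets with interior points in a
top-dimensional cell have full dimension. -/
lemma hasDim_of_open_subset (ht : t ∈ X.cells) (hopen : IsOpen (X.relInt t)) {S O : Set α}
    (hS : S ⊆ t) (hO : IsOpen O) (hne : O.Nonempty) (hOS : O ⊆ S) : X.HasDim S (X.dim t) := by
  obtain ⟨x, hx⟩ := hne
  obtain ⟨y, hy, hy'⟩ := mem_closure_iff.mp (subset_closure_relInt ht (hS (hOS hx))) O hO hx
  refine ⟨⟨x, hOS hx⟩, t, ht, hS, ?_⟩
  have h1 : IsOpen (X.chart t '' (O ∩ X.relInt t)) :=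
    isOpen_chart_image ht (hO.inter hopen) inter_subset_right
  have h2 := h1.affineSpan_eq_top ⟨_, mem_image_of_mem _ ⟨hy, hy'⟩⟩
  have h3 : affineSpan ℝ (X.chart t '' S) = ⊤ := top_le_iff.mp (h2 ▸
    affineSpan_mono ℝ (image_mono (inter_subset_left.trans hOS)))
  rw [h3, AffineSubspace.direction_top, finrank_top, Module.finrank_fin_fun]

end PolyComplex

namespace IsCellMap

variable {α β : Type*} [TopologicalSpace α] [TopologicalSpace β] {X : PolyComplex α}
  {Y : PolyComplex β} {F : α → β} {s : Set α} {t : Set β}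

lemma injOn_of_inverse (hs : s ∈ X.cells) {A : Matrix (Fin (Y.dim t)) (Fin (X.dim s)) ℤ}
    {b : Fin (Y.dim t) → ℝ} (hA : ∀ x ∈ s, Y.chart t (F x) = (rmat A).mulVec (X.chart s x) + b)
    {B : Matrix (Fin (X.dim s)) (Fin (Y.dim t)) ℝ} (hB : B * rmat A = 1) : InjOn F s := by
  intro x hx y hy hxy
  apply PolyComplex.chart_injOn hs hx hy
  have h : (rmat A).mulVec (X.chart s x) = (rmat A).mulVec (X.chart s y) := by
    have h1 := hA x hx
    rw [hxy, hA y hy] at h1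
    exact (add_right_cancel h1).symm
  have h2 := congrArg B.mulVec h
  rwa [Matrix.mulVec_mulVec, Matrix.mulVec_mulVec, hB, Matrix.one_mulVec, Matrix.one_mulVec] at h2

/-- In the charts the image is the preimage of an open set under the inverse affine map. Openness in
the ambient space needs the relative interior of the target cell to be open there. -/
lemma isOpen_image_of_inverse (hF : IsCellMap X Y F) (hs : s ∈ X.cells) (ht : t ∈ Y.cells)
    (htgt : tgt X Y F s = t)
    {A : Matrix (Fin (Y.dim t)) (Fin (X.dim s)) ℤ}
    {b : Fin (Y.dim t) → ℝ} (hA : ∀ x ∈ s, Y.chart t (F x) = (rmat A).mulVec (X.chart s x) + b)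
    {B : Matrix (Fin (X.dim s)) (Fin (Y.dim t)) ℝ} (hB : B * rmat A = 1) (hB' : rmat A * B = 1)
    (hopen : IsOpen (Y.relInt t)) {O : Set α} (hO : IsOpen O) (hOs : O ⊆ X.relInt s) :
    IsOpen (F '' O) := by
  have h1 : F '' O = Y.relInt t ∩ (fun y => B.mulVec (Y.chart t y - b)) ⁻¹' (X.chart s '' O) := by
    ext y
    constructor
    · rintro ⟨x, hx, rfl⟩
      refine ⟨htgt ▸ hF.mapsTo_relInt hs (hOs hx), x, hx, ?_⟩
      change X.chart s x = B.mulVec (Y.chart t (F x) - b)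
      rw [hA x (hOs hx).1, add_sub_cancel_right, Matrix.mulVec_mulVec, hB, Matrix.one_mulVec]
    · rintro ⟨hy, x, hx, hxy⟩
      refine ⟨x, hx, ?_⟩
      apply PolyComplex.chart_injOn ht (htgt ▸ hF.mapsTo hs (hOs hx).1) hy.1
      have hxy' : X.chart s x = B.mulVec (Y.chart t y - b) := hxy
      rw [hA x (hOs hx).1, hxy', Matrix.mulVec_mulVec, hB', Matrix.one_mulVec, sub_add_cancel]
  rw [h1]
  refine ContinuousOn.isOpen_inter_preimage ?_ hopen (PolyComplex.isOpen_chart_image hs hO hOs)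
  exact (continuous_mulVec B).comp_continuousOn
    (((PolyComplex.chart_continuousOn ht).mono (Y.relInt_subset t)).sub continuousOn_const)

/-- A row vector killed by the linear part is constant along the image. -/
lemma exists_wall {A : Matrix (Fin (Y.dim t)) (Fin (X.dim s)) ℤ}
    {b : Fin (Y.dim t) → ℝ} (hA : ∀ x ∈ s, Y.chart t (F x) = (rmat A).mulVec (X.chart s x) + b)
    (h : X.dim s < Y.dim t ∨ X.dim s = Y.dim t ∧ latIdx A = 0) :
    ∃ w : (Fin (Y.dim t) → ℤ) × ℝ, w.1 ≠ 0 ∧ ∀ x ∈ s, intForm w.1 (Y.chart t (F x)) = w.2 := by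
  obtain ⟨a, ha, haA⟩ := exists_vecMul_eq_zero A h
  refine ⟨(a, intForm a b), ha, fun x hx => ?_⟩
  rw [hA x hx, intForm_add, intForm_mulVec, haA, intForm_zero_left, zero_add]

end IsCellMap

/-! ### The lattice index of a morphism -/

namespace OrbitMorphism

variable {α β : Type*} [TopologicalSpace α] [TopologicalSpace β]
  {X : PolyComplex α} {Y : PolyComplex β} {G H : Type*} [Group G] [Group H]
  [MulAction G α] [MulAction H β]

/-- The definition picks some matrix that describes `f`; by uniqueness any other one may be used. -/
lemma latticeIndex_eq (f : OrbitMorphism X Y G H) {s : Set α} {t : Set β} (hs : s ∈ X.cells)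
    {A : Matrix (Fin (Y.dim t)) (Fin (X.dim s)) ℤ} {b : Fin (Y.dim t) → ℝ}
    (hA : ∀ x ∈ s, Y.chart t (f.toFun x) = (rmat A).mulVec (X.chart s x) + b) :
    f.latticeIndex s t = latIdx A := by
  have h : ∃ (A : Matrix (Fin (Y.dim t)) (Fin (X.dim s)) ℤ) (b : Fin (Y.dim t) → ℝ),
      ∀ x ∈ s, Y.chart t (f.toFun x)
        = (A.map (fun k : ℤ => (k : ℝ))).mulVec (X.chart s x) + b := ⟨A, b, hA⟩
  rw [latticeIndex, dif_pos h]
  obtain ⟨b', hb'⟩ := h.choose_spec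
  have h1 : h.choose = A := rmat_injective (mulVec_add_ext (X.chart_full s hs) (b := b') (b' := b)
    (by
      rintro _ ⟨x, hx, rfl⟩
      exact (hb' x hx).symm.trans (hA x hx))).1
  rw [h1]
  rfl

/-- The lattice index of `f` on the cell `s`. -/
def idx (f : OrbitMorphism X Y G H) (s : Set α) : ℕ := f.latticeIndex s (tgt X Y f.toFun s)

/-- Translation by `h` is a unimodular change of the target chart, so every translate of `f` has the
same index on `s`. -/
lemma latIdx_smul_eq_idx (f : OrbitMorphism X Y G H) (hY : IsOrbitSpace Y H) (h : H) {s : Set α}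
    (hs : s ∈ X.cells) {t : Set β} (ht : h • tgt X Y f.toFun s = t)
    {A : Matrix (Fin (Y.dim t)) (Fin (X.dim s)) ℤ}
    {b : Fin (Y.dim t) → ℝ}
    (hA : ∀ x ∈ s, Y.chart t (h • f.toFun x) = (rmat A).mulVec (X.chart s x) + b) :
    latIdx A = f.idx s := by
  subst ht
  have ht := f.isCellMap.tgt_mem hs
  obtain ⟨A₀, b₀, hA₀⟩ := intAffineOn_iff.mp (f.isCellMap.chart_affine hs)
  obtain ⟨U, c, hU⟩ := intAffineOn_iff.mp (hY.chart_affine h ht)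
  obtain ⟨U', c', hU'⟩ := intAffineOn_iff.mp (hY.chart_affine_symm h ht)
  have h1 : U' * U = 1 := mul_eq_one_of_inverse (Y.chart_full _ ht) hU hU'
  have h2 : U * U' = 1 := by
    refine mul_eq_one_of_inverse
      (F := fun x => Y.chart (h • tgt X Y f.toFun s) (h • x)) (s := tgt X Y f.toFun s) ?_ hU' hU
    have h3 := Y.chart_full _ (hY.smul_mem h _ ht)
    rwa [← Set.image_smul, image_image] at h3
  have h3 : A = U * A₀ := by
    apply rmat_injective
    refine (mulVec_add_ext (X.chart_full s hs) (b := b) (b' := (rmat U).mulVec b₀ + c) ?_).1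
    rintro _ ⟨x, hx, rfl⟩
    rw [← hA x hx, hU _ (f.isCellMap.mapsTo hs hx), hA₀ x hx, Matrix.mulVec_add,
      Matrix.mulVec_mulVec, rmat_mul, add_assoc]
  rw [h3, latIdx_mul_left h1 h2, idx, f.latticeIndex_eq hs hA₀]

lemma idx_smul (f : OrbitMorphism X Y G H) (hX : IsOrbitSpace X G) (hY : IsOrbitSpace Y H) (g : G)
    {s : Set α} (hs : s ∈ X.cells) : f.idx (g • s) = f.idx s := by
  have hgs := hX.smul_mem g s hs
  have htg := f.tgt_smul_source hX hY g hs
  obtain ⟨A, b, hA⟩ := intAffineOn_iff.mp (f.isCellMap.chart_affine hgs)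
  obtain ⟨V, c, hV⟩ := intAffineOn_iff.mp (hX.chart_affine g hs)
  obtain ⟨V', c', hV'⟩ := intAffineOn_iff.mp (hX.chart_affine_symm g hs)
  have h2 : V * V' = 1 := by
    refine mul_eq_one_of_inverse (F := fun x => X.chart (g • s) (g • x)) (s := s) ?_ hV' hV
    have h3 := X.chart_full _ hgs
    rwa [← Set.image_smul, image_image] at h3
  have h4 : latIdx (A * V) = f.idx s := by
    refine f.latIdx_smul_eq_idx hY (f.groupHom g) hs htg.symm (b := (rmat A).mulVec c + b)
      fun x hx => ?_
    rw [← f.map_smul, hA _ (smul_mem_smul_set hx), hV x hx, Matrix.mulVec_add,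
      Matrix.mulVec_mulVec, rmat_mul, add_assoc]
  rw [← h4, latIdx_mul_right h2, idx, f.latticeIndex_eq hgs hA]

/-- The `n`-dimensional cells on which `f` is injective with `n`-dimensional image. -/
structure IsGood (f : OrbitMorphism X Y G H) (n : ℕ) (s : Set α) : Prop where
  mem : s ∈ X.cells
  dim_eq : X.dim s = n
  dim_tgt : Y.dim (tgt X Y f.toFun s) = n
  idx_ne : f.idx s ≠ 0

variable {f : OrbitMorphism X Y G H} {n : ℕ} {s : Set α}

lemma IsGood.smul (h : f.IsGood n s) (hX : IsOrbitSpace X G) (hY : IsOrbitSpace Y H) (g : G) :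
    f.IsGood n (g • s) where
  mem := hX.smul_mem g s h.mem
  dim_eq := by rw [hX.dim_smul g h.mem, h.dim_eq]
  dim_tgt := by
    rw [f.tgt_smul_source hX hY g h.mem, hY.dim_smul _ (f.isCellMap.tgt_mem h.mem), h.dim_tgt]
  idx_ne := by rw [f.idx_smul hX hY g h.mem]; exact h.idx_ne

lemma IsGood.exists_matrix (hs : f.IsGood n s) (hY : IsOrbitSpace Y H) (h : H) {t : Set β}
    (ht : h • tgt X Y f.toFun s = t) :
    ∃ (A : Matrix (Fin (Y.dim t)) (Fin (X.dim s)) ℤ) (b : Fin (Y.dim t) → ℝ)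
      (B : Matrix (Fin (X.dim s)) (Fin (Y.dim t)) ℝ),
      (∀ x ∈ s, Y.chart t (h • f.toFun x) = (rmat A).mulVec (X.chart s x) + b) ∧
      B * rmat A = 1 ∧ rmat A * B = 1 ∧ latIdx A = f.idx s := by
  subst ht
  have h1 := (f.isCellMap_smul hY h).chart_affine hs.mem
  rw [f.tgt_smul hY h hs.mem] at h1
  obtain ⟨A, b, hA⟩ := intAffineOn_iff.mp h1
  have h2 := f.latIdx_smul_eq_idx hY h hs.mem rfl hA
  obtain ⟨B, hB, hB'⟩ := exists_inverse_of_latIdx_ne_zero (A := A)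
    (by rw [hY.dim_smul h (f.isCellMap.tgt_mem hs.mem), hs.dim_eq, hs.dim_tgt])
    (by rw [h2]; exact hs.idx_ne)
  exact ⟨A, b, B, hA, hB, hB', h2⟩

lemma IsGood.injOn (hs : f.IsGood n s) (hY : IsOrbitSpace Y H) : InjOn f.toFun s := by
  obtain ⟨A, b, B, hA, hB, -, -⟩ := hs.exists_matrix hY 1 (one_smul H _)
  refine IsCellMap.injOn_of_inverse hs.mem (b := b) (t := tgt X Y f.toFun s) (A := A) ?_ hB
  simpa using hA

end OrbitMorphism

/-! ### Finiteness of stabilizers -/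

/-- The elements that carry `a` to a given point form a coset of the stabilizer or the empty set. -/
lemma finite_smul_mem {G A : Type*} [Group G] [MulAction G A] {a : A} {S : Set A}
    (ha : {g : G | g • a = a}.Finite) (hS : S.Finite) : {g : G | g • a ∈ S}.Finite := by
  have h : {g : G | g • a ∈ S} = ⋃ b ∈ S, {g : G | g • a = b} := by
    ext g; simp
  rw [h]
  refine hS.biUnion fun b _ => ?_
  by_cases hb : ∃ g₀ : G, g₀ • a = b
  · obtain ⟨g₀, rfl⟩ := hb
    refine (ha.image fun g => g₀ * g).subset ?_
    intro g hg
    refine ⟨g₀⁻¹ * g, ?_, by simp⟩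
    change (g₀⁻¹ * g) • a = a
    rw [mul_smul, show g • a = g₀ • a from hg, inv_smul_smul]
  · refine Set.finite_empty.subset fun g hg => hb ⟨g, hg⟩

namespace IsOrbitSpace

variable {α : Type u} [TopologicalSpace α] {X : PolyComplex α} {G : Type*} [Group G]
  [MulAction G α] {s t : Set α}

lemma finite_subset_smul (hX : IsOrbitSpace X G) (hs : s ∈ X.cells) (ht : t ∈ X.cells)
    (hstab : {g : G | g • t = t}.Finite) : {g : G | s ⊆ g • t}.Finite :=
  (finite_smul_mem hstab (PolyComplex.finite_above hs)).subset
    fun g hg => ⟨hX.smul_mem g t ht, hg⟩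

/-- The stabilizer of `s` moves `t` among the finitely many cells above `s`. In this way finiteness
passes from top-dimensional cells to their faces. -/
lemma finite_stabilizer_of_subset (hX : IsOrbitSpace X G) (hs : s ∈ X.cells) (ht : t ∈ X.cells)
    (hst : s ⊆ t) (hstab : {g : G | g • t = t}.Finite) : {g : G | g • s = s}.Finite :=
  (hX.finite_subset_smul hs ht hstab).subset fun g hg => by
    have h : g • s = s := hg
    have := smul_set_mono (a := g) hst
    rwa [h] at this

end IsOrbitSpace

namespace IsTropicalOrbitSpace

variable {α : Type u} [TopologicalSpace α] {X : PolyComplex α} {G : Type*} [Group G]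
  [MulAction G α] {n : ℕ} {ω : Set α → ℚ} {s t : Set α}

lemma eq_of_subset (hX : IsTropicalOrbitSpace X G n ω) (hs : s ∈ X.cells) (hd : X.dim s = n)
    (ht : t ∈ X.cells) (hst : s ⊆ t) : s = t :=
  PolyComplex.eq_of_subset_of_dim_le hs ht hst (hd ▸ (hX.pure_dim t ht).1)

lemma star_eq_relInt (hX : IsTropicalOrbitSpace X G n ω) (hs : s ∈ X.cells) (hd : X.dim s = n) :
    X.star s = X.relInt s :=
  PolyComplex.star_eq_relInt hs fun _ ht hst => hX.eq_of_subset hs hd ht hst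

lemma isOpen_relInt (hX : IsTropicalOrbitSpace X G n ω) (hs : s ∈ X.cells) (hd : X.dim s = n) :
    IsOpen (X.relInt s) := hX.star_eq_relInt hs hd ▸ X.star_open s hs

lemma finite_stabilizer_cell (hX : IsTropicalOrbitSpace X G n ω)
    (hstab : ∀ t ∈ X.cells, X.dim t = n → {g : G | g • t = t}.Finite) (hs : s ∈ X.cells) :
    {g : G | g • s = s}.Finite := by
  obtain ⟨-, t, ht, hst, hd⟩ := hX.pure_dim s hs
  exact hX.orbitSpace.finite_stabilizer_of_subset hs ht hst (hstab t ht hd)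

end IsTropicalOrbitSpace

/-! ### Cones of the star fan -/

namespace PolyComplex

variable {α : Type u} [TopologicalSpace α] {X : PolyComplex α} {r s t : Set α} {x : α}

lemma smul_mem_of_isClosedCone {n : ℕ} {P : Set (Fin n → ℝ)} (hP : IsClosedCone P)
    {x : Fin n → ℝ} {c : ℝ} (hc : 0 < c) : c • x ∈ P ↔ x ∈ P := by
  obtain ⟨W, rfl⟩ := hP
  simp only [mem_ofPred_eq, intForm_smul]
  exact forall₂_congr fun a _ => mul_nonneg_iff_of_pos_left hc

/-- A cell of an open fan is invariant under small dilations. -/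
lemma exists_one_add_smul_mem {n : ℕ} {F : Set (Set (Fin n → ℝ))} (hF : IsOpenFan F)
    {S : Set (Fin n → ℝ)} (hS : S ∈ F) {x : Fin n → ℝ} (hx : x ∈ S) :
    ∃ ε : ℝ, 0 < ε ∧ (1 + ε) • x ∈ S := by
  obtain ⟨C, R, U, hC, hR, hU, -, rfl⟩ := hF
  obtain ⟨c, hc, rfl⟩ := hS
  have hcont : Continuous fun ε : ℝ => (1 + ε) • x := by fun_prop
  have h0 : (fun ε : ℝ => (1 + ε) • x) ⁻¹' U ∈ 𝓝 (0 : ℝ) :=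
    (hU.preimage hcont).mem_nhds (by simpa using hx.2)
  obtain ⟨δ, hδ, hball⟩ := Metric.mem_nhds_iff.mp h0
  refine ⟨δ / 2, by positivity, ⟨⟨?_, ?_⟩, hball ?_⟩⟩
  · exact (smul_mem_of_isClosedCone (hC.closedCone c hc) (by positivity)).mpr hx.1.1
  · rintro ⟨r, hr, hxr⟩
    exact hx.1.2 ⟨r, hr,
      (smul_mem_of_isClosedCone (hC.closedCone r (hR hr)) (by positivity)).mp hxr⟩
  · simpa [abs_of_pos hδ] using hδ

/-- The coordinate change between the star chart of a cell and the chart of a larger cell. -/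
lemma exists_star_coords (hr : r ∈ X.cells) (hs : s ∈ X.cells) (hrs : r ⊆ s) :
    ∃ (J : Matrix (Fin (X.starDim r)) (Fin (X.dim s)) ℤ) (b : Fin (X.starDim r) → ℝ)
      (K : Matrix (Fin (X.dim s)) (Fin (X.starDim r)) ℤ) (c : Fin (X.dim s) → ℝ),
      (∀ x ∈ s ∩ X.star r, X.starChart r x = (rmat J).mulVec (X.chart s x) + b) ∧
      (∀ x ∈ s ∩ X.star r, X.chart s x = (rmat K).mulVec (X.starChart r x) + c) ∧
      K * J = 1 ∧ b ∈ LinearMap.range (rmat J).mulVecLin ∧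
      Submodule.span ℝ (starCone X r s) = LinearMap.range (rmat J).mulVecLin := by
  obtain ⟨hfan, h1, h2⟩ := X.star_cell r hr s hs hrs
  obtain ⟨J, b, hJ⟩ := intAffineOn_iff.mp h1
  obtain ⟨K, c, hK⟩ := intAffineOn_iff.mp h2
  have hsub : X.relInt s ⊆ s ∩ X.star r :=
    subset_inter (X.relInt_subset s) (relInt_subset_star_of_subset hs hrs)
  have hspan : affineSpan ℝ (X.chart s '' (s ∩ X.star r)) = ⊤ :=
    top_le_iff.mp (affineSpan_relInt hs ▸ affineSpan_mono ℝ (image_mono hsub))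
  -- The cone is stable under small dilations, so a positive multiple of a vector of the cone is a
  -- difference of two of its points. Hence the affine span of the cone passes through the origin
  -- and is its linear span.
  have hb : b ∈ LinearMap.range (rmat J).mulVecLin := by
    obtain ⟨x, hx⟩ := relInt_nonempty hs
    obtain ⟨ε, hε, y, hy, hyx⟩ := exists_one_add_smul_mem (X.fan_open r hr) hfan
      (mem_image_of_mem _ (hsub hx))
    have e1 := hJ x (hsub hx)
    have e2 := hJ y hy
    have e3 : ε • X.starChart r x = (rmat J).mulVec (X.chart s y - X.chart s x) := by
      rw [Matrix.mulVec_sub]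
      have : (1 + ε) • X.starChart r x = X.starChart r x + ε • X.starChart r x := by module
      rw [← hyx, e2, e1] at this
      rw [e1]
      rw [show (rmat J).mulVec (X.chart s y) - (rmat J).mulVec (X.chart s x) =
        ((rmat J).mulVec (X.chart s y) + b) - ((rmat J).mulVec (X.chart s x) + b) by abel, this]
      abel
    refine ⟨ε⁻¹ • (X.chart s y - X.chart s x) - X.chart s x, ?_⟩
    rw [Matrix.mulVecLin_apply, Matrix.mulVec_sub, Matrix.mulVec_smul, ← e3, smul_smul,
      inv_mul_cancel₀ hε.ne', one_smul, e1]
    abel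
  refine ⟨J, b, K, c, hJ, hK, mul_eq_one_of_inverse hspan hJ hK, hb, ?_⟩
  apply le_antisymm
  · rw [Submodule.span_le]
    rintro _ ⟨x, hx, rfl⟩
    rw [hJ x hx]
    exact add_mem ⟨_, rfl⟩ hb
  · rintro _ ⟨y, rfl⟩
    have h3 : ∀ y, (rmat J).mulVecLin y ∈ Submodule.span ℝ (starCone X r s) := by
      obtain ⟨x₀, hx₀⟩ := relInt_nonempty hs
      have h4 : X.chart s '' (s ∩ X.star r) ⊆ AffineSubspace.mk' (X.chart s x₀)
          ((Submodule.span ℝ (starCone X r s)).comap (rmat J).mulVecLin) := by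
        rintro _ ⟨x, hx, rfl⟩
        rw [SetLike.mem_coe, AffineSubspace.mem_mk', Submodule.mem_comap, vsub_eq_sub, map_sub]
        have : (rmat J).mulVecLin (X.chart s x) - (rmat J).mulVecLin (X.chart s x₀)
            = X.starChart r x - X.starChart r x₀ := by
          rw [hJ x hx, hJ x₀ (hsub hx₀)]
          simp
        rw [this]
        exact sub_mem (Submodule.subset_span (mem_image_of_mem _ hx))
          (Submodule.subset_span (mem_image_of_mem _ (hsub hx₀)))
      have h5 := affineSpan_le.mpr h4
      rw [hspan] at h5
      intro y
      have h6 := h5 (AffineSubspace.mem_top ℝ _ (y + X.chart s x₀))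
      rw [AffineSubspace.mem_mk'] at h6
      simpa using h6
    exact h3 y

/-- The integral left inverse makes the image lattice saturated: integral points of the real span
come from integral points. -/
lemma rvec_mem_range_iff {m n : ℕ} {J : Matrix (Fin m) (Fin n) ℤ} {K : Matrix (Fin n) (Fin m) ℤ}
    (h : K * J = 1) {v : Fin m → ℤ} :
    rvec v ∈ LinearMap.range (rmat J).mulVecLin ↔ v = J.mulVec (K.mulVec v) := by
  constructor
  · rintro ⟨y, hy⟩
    have hy' : (rmat J).mulVec y = rvec v := hy
    have h1 : (rmat K).mulVec (rvec v) = y := by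
      rw [← hy', Matrix.mulVec_mulVec, ← rmat_mul, h, rmat_one, Matrix.one_mulVec]
    apply rvec_injective
    rw [← rmat_mulVec_rvec, ← rmat_mulVec_rvec, h1, hy']
  · intro hv
    refine ⟨rvec (K.mulVec v), ?_⟩
    rw [Matrix.mulVecLin_apply, rmat_mulVec_rvec, ← hv]

/-- If the two cones had the same span, the coordinates of `s` could be recovered integrally from
those of `r`, against the inequality of dimensions. -/
lemma exists_starCone_notMem_span (hr : r ∈ X.cells) (hs : s ∈ X.cells) (hrs : r ⊂ s) :
    ∃ x ∈ starCone X r s, x ∉ Submodule.span ℝ (starCone X r r) := by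
  by_contra hcon
  push Not at hcon
  obtain ⟨J, b, K, c, -, -, h1, -, hV⟩ := exists_star_coords hr hr Subset.rfl
  obtain ⟨J', b', K', c', -, -, h1', -, hV'⟩ := exists_star_coords hr hs hrs.1
  have hle : Submodule.span ℝ (starCone X r s) ≤ Submodule.span ℝ (starCone X r r) :=
    Submodule.span_le.mpr hcon
  rw [hV, hV'] at hle
  have hd := dim_lt_of_ssubset hr hs hrs
  have h2 : (K * J') = (K * J') := rfl
  have h3 : (K' * J) * (K * J') = 1 := by
    rw [Matrix.mul_assoc, ← Matrix.mul_assoc J K J']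
    have : J * K * J' = J' := by
      apply rmat_injective
      rw [rmat_mul, rmat_mul]
      apply Matrix.ext_of_mulVec_single
      intro i
      obtain ⟨y, hy⟩ := hle ⟨Pi.single i 1, rfl⟩
      rw [Matrix.mulVecLin_apply, Matrix.mulVecLin_apply] at hy
      rw [← Matrix.mulVec_mulVec, ← hy, Matrix.mulVec_mulVec, Matrix.mul_assoc, ← rmat_mul K J, h1,
        rmat_one, Matrix.mul_one]
    rw [this, h1']
  exact absurd (le_of_mul_eq_one h3) (not_le.mpr hd)

end PolyComplex

/-! ### Primitive normal vectors -/

section Primitive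

variable {N : ℕ} {ct cs : Set (Fin N → ℝ)} {w w' : Fin N → ℤ}

lemma rvec_sub_mul (v w : Fin N → ℤ) (k : ℤ) :
    (fun i => ((v i - k * w i : ℤ) : ℝ)) = rvec v - (k : ℝ) • rvec w := by
  ext i
  simp [rvec]

lemma IsPrimitiveNormal.exists_sub_mem (h : IsPrimitiveNormal ct cs w) {v : Fin N → ℤ}
    (hv : rvec v ∈ Submodule.span ℝ cs) :
    ∃ k : ℤ, rvec v - (k : ℝ) • rvec w ∈ Submodule.span ℝ ct := by
  obtain ⟨k, hk⟩ := h.2.1 v hv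
  rw [rvec_sub_mul] at hk
  exact ⟨k, hk⟩

lemma IsPrimitiveNormal.exists_smul (h : IsPrimitiveNormal ct cs w) {x : Fin N → ℝ} (hx : x ∈ cs)
    (hx' : x ∉ ct) : ∃ r : ℝ, 0 < r ∧ x - r • rvec w ∈ Submodule.span ℝ ct := h.2.2 x ⟨hx, hx'⟩

lemma IsPrimitiveNormal.rvec_mem (h : IsPrimitiveNormal ct cs w) :
    rvec w ∈ Submodule.span ℝ cs := h.1

/-- Modulo the span each vector is an integral multiple of the other, so the factor is ±1; both
point into the same half space, so it is 1. A point outside the span is needed for `w` to be nonzero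
there. -/
lemma IsPrimitiveNormal.sub_mem (h : IsPrimitiveNormal ct cs w) (h' : IsPrimitiveNormal ct cs w')
    (hne : ∃ x ∈ cs, x ∉ Submodule.span ℝ ct) : rvec w - rvec w' ∈ Submodule.span ℝ ct := by
  obtain ⟨x, hx, hxV⟩ := hne
  have hxct : x ∉ ct := fun h => hxV (Submodule.subset_span h)
  obtain ⟨r, hr, h1⟩ := h.exists_smul hx hxct
  obtain ⟨r', hr', h2⟩ := h'.exists_smul hx hxct
  obtain ⟨k, hk⟩ := h.exists_sub_mem h'.rvec_mem
  obtain ⟨k', hk'⟩ := h'.exists_sub_mem h.rvec_mem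
  set V := Submodule.span ℝ ct
  have hwV : rvec w ∉ V := fun hw => hxV (by
    have := V.add_mem h1 (V.smul_mem r hw)
    rwa [sub_add_cancel] at this)
  have h3 : (1 - (k' : ℝ) * k) • rvec w ∈ V := by
    have := V.add_mem hk' (V.smul_mem (k' : ℝ) hk)
    convert this using 1
    module
  have h4 : (1 - (k' : ℝ) * k) = 0 := by
    by_contra hne
    exact hwV ((V.smul_mem_iff hne).mp h3)
  have h5 : (r - r' * k) • rvec w ∈ V := by
    have := V.sub_mem (V.sub_mem h2 h1) (V.smul_mem (-r') hk)
    convert this using 1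
    module
  have h6 : r - r' * k = 0 := by
    by_contra hne
    exact hwV ((V.smul_mem_iff hne).mp h5)
  have hk0 : (0 : ℝ) < k := by
    by_contra hneg
    have : r' * (k : ℝ) ≤ 0 := mul_nonpos_of_nonneg_of_nonpos hr'.le (not_lt.mp hneg)
    linarith
  have hk1 : k' * k = 1 := by exact_mod_cast (sub_eq_zero.mp h4).symm
  have hk2 : k' = 1 := by
    rcases Int.eq_one_or_neg_one_of_mul_eq_one hk1 with h | h
    · exact h
    · subst h
      have : k = -1 := by linarith
      subst this
      norm_num at hk0
  subst hk2
  simpa using hk'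

/-- Primitive normal vectors are carried along by integral isomorphisms. -/
lemma IsPrimitiveNormal.map (h : IsPrimitiveNormal ct cs w) {cs' : Set (Fin N → ℝ)}
    {A A' : Matrix (Fin N) (Fin N) ℤ} (hA : MapsTo (rmat A).mulVec cs cs')
    (hA' : MapsTo (rmat A').mulVec cs' cs) (hAA' : ∀ x ∈ cs', (rmat A).mulVec
      ((rmat A').mulVec x) = x) (hV : ∀ v ∈ Submodule.span ℝ ct, (rmat A).mulVec v = v) :
    IsPrimitiveNormal ct cs' (A.mulVec w) := by
  have hspan : ∀ {B : Matrix (Fin N) (Fin N) ℤ} {c c' : Set (Fin N → ℝ)},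
      MapsTo (rmat B).mulVec c c' → ∀ v ∈ Submodule.span ℝ c,
        (rmat B).mulVec v ∈ Submodule.span ℝ c' := by
    intro B c c' hB v hv
    have : Submodule.span ℝ c ≤ (Submodule.span ℝ c').comap (rmat B).mulVecLin :=
      Submodule.span_le.mpr fun x hx => Submodule.subset_span (hB hx)
    exact this hv
  have hid : ∀ v ∈ Submodule.span ℝ cs', (rmat A).mulVec ((rmat A').mulVec v) = v := by
    intro v hv
    have : Submodule.span ℝ cs' ≤ LinearMap.eqLocus ((rmat A).mulVecLin ∘ₗ (rmat A').mulVecLin)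
        LinearMap.id := Submodule.span_le.mpr fun x hx => hAA' x hx
    exact this hv
  refine ⟨?_, ?_, ?_⟩
  · have := hspan hA _ h.rvec_mem
    rwa [rmat_mulVec_rvec] at this
  · intro v hv
    have h1 := hspan hA' _ hv
    change (rmat A').mulVec (rvec v) ∈ _ at h1
    rw [rmat_mulVec_rvec] at h1
    obtain ⟨k, hk⟩ := h.exists_sub_mem h1
    refine ⟨k, ?_⟩
    rw [rvec_sub_mul, ← rmat_mulVec_rvec]
    have h2 := hV _ hk
    rw [Matrix.mulVec_sub, Matrix.mulVec_smul, ← rmat_mulVec_rvec, hid (rvec v) hv] at h2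
    rw [h2]
    rw [← rmat_mulVec_rvec] at hk
    exact hk
  · rintro x ⟨hx, hxt⟩
    have h1 : (rmat A').mulVec x ∉ ct := by
      intro hmem
      have := hV _ (Submodule.subset_span hmem)
      rw [hAA' x hx] at this
      exact hxt (this ▸ hmem)
    obtain ⟨r, hr, h2⟩ := h.exists_smul (hA' hx) h1
    refine ⟨r, hr, ?_⟩
    change x - r • rvec (A.mulVec w) ∈ _
    have h3 := hV _ h2
    rw [Matrix.mulVec_sub, Matrix.mulVec_smul, hAA' x hx, rmat_mulVec_rvec] at h3
    rw [h3]
    exact h2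

end Primitive

/-! ### The pointwise stabilizer of a cell acts linearly on its star -/

lemma smul_eq_of_mem_fixing {G α : Type*} [Group G] [MulAction G α] {r : Set α} {g : G} (hg : g ∈ fixingSubgroup G r) : g • r = r := by
  rw [mem_fixingSubgroup_iff] at hg
  ext x
  constructor
  · rintro ⟨y, hy, rfl⟩
    change g • y ∈ r
    rwa [hg y hy]
  · intro hx
    exact ⟨x, hx, hg x hx⟩

namespace IsOrbitSpace

variable {α : Type u} [TopologicalSpace α] {X : PolyComplex α} {G : Type*} [Group G]
  [MulAction G α] {r s t : Set α}

lemma smul_mem_star_of_fixing (hX : IsOrbitSpace X G) {g : G} (hg : g ∈ fixingSubgroup G r) {x : α}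
    (hx : x ∈ X.star r) : g • x ∈ X.star r := by
  have := hX.smul_mem_star g hx
  rwa [smul_eq_of_mem_fixing hg] at this

/-- The action in the star chart is affine and agrees with the identity on the relative interior of
`r`, hence its linear part fixes the span of the cone. The offset of the chart of `r` lies in this
span as well, and this forces the translation part to vanish. -/
lemma exists_linear_of_fixing (hX : IsOrbitSpace X G) (hr : r ∈ X.cells) {g : G}
    (hg : g ∈ fixingSubgroup G r) : ∃ A : Matrix (Fin (X.starDim r)) (Fin (X.starDim r)) ℤ,
      (∀ x ∈ X.star r, X.starChart r (g • x) = (rmat A).mulVec (X.starChart r x)) ∧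
      ∀ v ∈ Submodule.span ℝ (starCone X r r), (rmat A).mulVec v = v := by
  have h0 : IntAffineOn (X.star r) (X.starChart r) (fun x => X.starChart r (g • x)) := by
    have h1 := hX.smul_affine g r hr
    have h2 : ∀ r', r' = r → IntAffineOn (X.star r) (X.starChart r)
        (fun x => X.starChart r' (g • x)) → IntAffineOn (X.star r) (X.starChart r)
        (fun x => X.starChart r (g • x)) := by
      rintro _ rfl h
      exact h
    exact h2 _ (smul_eq_of_mem_fixing hg) h1
  obtain ⟨A, b, hA⟩ := intAffineOn_iff.mp h0
  obtain ⟨J, c, K, d, hJ, hK, hKJ, ⟨c', hc'⟩, hV⟩ :=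
    PolyComplex.exists_star_coords hr hr Subset.rfl
  rw [mem_fixingSubgroup_iff] at hg
  have h3 : ∀ x ∈ X.chart r '' X.relInt r, (rmat J).mulVec x + c
      = (rmat (A * J)).mulVec x + ((rmat A).mulVec c + b) := by
    rintro _ ⟨x, hx, rfl⟩
    have hx' : x ∈ r ∩ X.star r := by rwa [PolyComplex.inter_star_self hr]
    have h4 := hA x hx'.2
    rw [hg x hx'.1, hJ x hx'] at h4
    rw [h4, Matrix.mulVec_add, Matrix.mulVec_mulVec, ← rmat_mul, add_assoc]
  obtain ⟨h5, h6⟩ := mulVec_add_ext (PolyComplex.affineSpan_relInt hr) h3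
  have h7 : ∀ v ∈ Submodule.span ℝ (starCone X r r), (rmat A).mulVec v = v := by
    rw [hV]
    rintro _ ⟨y, rfl⟩
    rw [Matrix.mulVecLin_apply, Matrix.mulVec_mulVec, ← rmat_mul, ← h5]
  have h8 : b = 0 := by
    have h9 : (rmat A).mulVec c = c := h7 c (by rw [hV]; exact ⟨c', hc'⟩)
    rw [h9] at h6
    simpa using h6
  refine ⟨A, fun x hx => ?_, h7⟩
  rw [hA x hx, h8, add_zero]

/-- A representation of the pointwise stabilizer of a cell on its star chart. -/
lemma isPrimitiveNormal_smul (hX : IsOrbitSpace X G) (hr : r ∈ X.cells) {g : G}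
    (hg : g ∈ fixingSubgroup G r)
    {A : Matrix (Fin (X.starDim r)) (Fin (X.starDim r)) ℤ}
    (hA : ∀ x ∈ X.star r, X.starChart r (g • x) = (rmat A).mulVec (X.starChart r x))
    (hV : ∀ v ∈ Submodule.span ℝ (starCone X r r), (rmat A).mulVec v = v)
    {w : Fin (X.starDim r) → ℤ}
    (hw : IsPrimitiveNormal (starCone X r r) (starCone X r s) w) :
    IsPrimitiveNormal (starCone X r r) (starCone X r (g • s)) (A.mulVec w) := by
  have hg' : g⁻¹ ∈ fixingSubgroup G r := inv_mem hg
  obtain ⟨A', hA', -⟩ := hX.exists_linear_of_fixing hr hg'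
  refine hw.map (A' := A') ?_ ?_ ?_ hV
  · rintro _ ⟨x, hx, rfl⟩
    rw [← hA x hx.2]
    exact ⟨g • x, ⟨smul_mem_smul_set hx.1, hX.smul_mem_star_of_fixing hg hx.2⟩, rfl⟩
  · rintro _ ⟨x, hx, rfl⟩
    rw [← hA' x hx.2]
    exact ⟨g⁻¹ • x, ⟨mem_smul_set_iff_inv_smul_mem.mp hx.1,
      hX.smul_mem_star_of_fixing hg' hx.2⟩, rfl⟩
  · rintro _ ⟨x, hx, rfl⟩
    rw [← hA' x hx.2, ← hA _ (hX.smul_mem_star_of_fixing hg' hx.2), smul_inv_smul]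

/-- If the pointwise stabilizer of a facet is finite, then its elements that map a cell to itself
fix this cell pointwise. -/
lemma mem_fixing_of_smul_eq (hX : IsOrbitSpace X G) (hr : r ∈ X.cells) (hs : s ∈ X.above r)
    (hfin : (fixingSubgroup G r : Set G).Finite) {w : Fin (X.starDim r) → ℤ}
    (hw : IsPrimitiveNormal (starCone X r r) (starCone X r s) w) {g : G}
    (hg : g ∈ fixingSubgroup G r) (hgs : g • s = s) : g ∈ fixingSubgroup G s := by
  obtain ⟨A, hA, hV⟩ := hX.exists_linear_of_fixing hr hg
  have h1 := hX.isPrimitiveNormal_smul hr hg hA hV hw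
  rw [hgs] at h1
  have h2 := h1.sub_mem hw (PolyComplex.exists_starCone_notMem_span hr hs.1 hs.2)
  rw [← rmat_mulVec_rvec] at h2
  -- The vector `v` lies in the span fixed by the action, so the m-th power of `g` moves `w` to w +
  -- m v; finite order of `g` gives `v = 0`.
  set v := (rmat A).mulVec (rvec w) - rvec w with hv
  have hpow : ∀ m : ℕ, ∀ x ∈ X.star r, X.starChart r (g ^ m • x)
      = ((rmat A).mulVecLin ^ m) (X.starChart r x) ∧ g ^ m • x ∈ X.star r := by
    intro m
    induction m with
    | zero => intro x hx; simp [hx]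
    | succ m ih =>
      intro x hx
      obtain ⟨h3, h4⟩ := ih x hx
      rw [pow_succ', mul_smul]
      refine ⟨?_, hX.smul_mem_star_of_fixing hg h4⟩
      rw [hA _ h4, h3, pow_succ', Module.End.mul_apply, Matrix.mulVecLin_apply]
  have hpw : ∀ m : ℕ, ((rmat A).mulVecLin ^ m) (rvec w) = rvec w + (m : ℝ) • v := by
    intro m
    induction m with
    | zero => simp
    | succ m ih =>
      rw [pow_succ', Module.End.mul_apply, ih, map_add, map_smul, Matrix.mulVecLin_apply,
        Matrix.mulVecLin_apply, hV v h2]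
      have : (rmat A).mulVec (rvec w) = rvec w + v := by rw [hv]; abel
      rw [this]
      push_cast
      module
  obtain ⟨m, hm, hgm⟩ : ∃ m, 0 < m ∧ g ^ m = 1 := by
    have : Finite (fixingSubgroup G r) := hfin
    obtain ⟨m, hm, h⟩ := (isOfFinOrder_of_finite (⟨g, hg⟩ : fixingSubgroup G r)).exists_pow_eq_one
    exact ⟨m, hm, by simpa using congrArg Subtype.val h⟩
  have hv0 : v = 0 := by
    have h3 : Submodule.span ℝ (starCone X r s) ≤
        LinearMap.eqLocus ((rmat A).mulVecLin ^ m) LinearMap.id := by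
      rw [Submodule.span_le]
      rintro _ ⟨x, hx, rfl⟩
      have := (hpow m x hx.2).1
      rw [hgm, one_smul] at this
      exact this.symm
    have h4 := h3 hw.rvec_mem
    rw [LinearMap.mem_eqLocus, hpw m] at h4
    have h5 : (m : ℝ) • v = 0 := by simpa using h4
    exact (smul_eq_zero.mp h5).resolve_left (by exact_mod_cast hm.ne')
  have hAw : (rmat A).mulVec (rvec w) = rvec w := sub_eq_zero.mp (hv ▸ hv0)
  -- A point of the cone is a multiple of `w` plus a vector of the span of the facet, and both are
  -- fixed.
  have hfix : ∀ x ∈ X.relInt s, g • x = x := by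
    intro x hx
    have hxs : x ∈ X.star r := PolyComplex.relInt_subset_star_of_subset hs.1 hs.2.1 hx
    apply PolyComplex.starChart_injOn hr (hX.smul_mem_star_of_fixing hg hxs) hxs
    rw [hA x hxs]
    by_cases hmem : X.starChart r x ∈ starCone X r r
    · exact hV _ (Submodule.subset_span hmem)
    · obtain ⟨c, -, h6⟩ := hw.exists_smul (mem_image_of_mem _ ⟨hx.1, hxs⟩) hmem
      have h7 := hV _ h6
      rw [Matrix.mulVec_sub, Matrix.mulVec_smul, hAw] at h7
      exact sub_left_injective h7
  rw [mem_fixingSubgroup_iff]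
  have hmaps : MapsTo (fun x => g • x) s s := fun x hx => hgs ▸ smul_mem_smul_set hx
  have hc := PolyComplex.chart_continuousOn hs.1
  have h8 : EqOn (fun x => X.chart s (g • x)) (X.chart s) s :=
    Set.EqOn.of_subset_closure (s := X.relInt s) (fun x hx => congrArg _ (hfix x hx))
      (hc.comp (hX.continuous_smul g).continuousOn hmaps) hc (X.relInt_subset s)
      (PolyComplex.subset_closure_relInt hs.1)
  intro x hx
  exact PolyComplex.chart_injOn hs.1 (hmaps hx) hx (h8 hx)

end IsOrbitSpace

/-! ### The balancing condition without the coefficients `λ` -/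

/-- Orbit and stabilizer: each member of the orbit is hit as often as the order of the stabilizer of
`a`. -/
lemma sum_smul_orbit {G A : Type*} [Group G] [MulAction G A] (Γ : Subgroup G) [Fintype Γ]
    (l : A → ℝ) (a : A) :
    ∑ g : Γ, l ((g : G) • a) = Nat.card {g : Γ // (g : G) • a = a} *
      ∑ᶠ b ∈ {b | ∃ g ∈ Γ, b = g • a}, l b := by
  classical
  have horb : {b | ∃ g ∈ Γ, b = g • a}
      = ((Finset.univ.image fun g : Γ => (g : G) • a : Finset A) : Set A) := by
    ext b
    simp [eq_comm]
  rw [Finset.sum_comp (s := Finset.univ) l (fun g : Γ => (g : G) • a), horb,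
    finsum_mem_coe_finset, Finset.mul_sum]
  refine Finset.sum_congr rfl fun b hb => ?_
  obtain ⟨g₀, -, rfl⟩ := Finset.mem_image.mp hb
  rw [nsmul_eq_mul]
  congr 2
  rw [← Fintype.card_subtype, ← Nat.card_eq_fintype_card]
  refine Nat.card_congr ((Equiv.mulLeft g₀⁻¹).subtypeEquiv fun g => ?_)
  simp only [Equiv.coe_mulLeft, Subgroup.coe_mul, InvMemClass.coe_inv, mul_smul, inv_smul_eq_iff]

section Weights

variable {α : Type u} {G : Type*} [Group G] [MulAction G α]

lemma card_fixingSubgroup_smul (g : G) (s : Set α) :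
    Nat.card (fixingSubgroup G (g • s)) = Nat.card (fixingSubgroup G s) := by
  refine Nat.card_congr ((MulAut.conj g⁻¹).toEquiv.subtypeEquiv fun k => ?_)
  change k ∈ fixingSubgroup G (g • s) ↔ g⁻¹ * k * g⁻¹⁻¹ ∈ fixingSubgroup G s
  rw [mem_fixingSubgroup_iff, mem_fixingSubgroup_iff]
  constructor
  · intro h x hx
    have := h (g • x) (smul_mem_smul_set hx)
    rw [mul_smul, mul_smul, inv_inv, this, inv_smul_smul]
  · rintro h _ ⟨x, hx, rfl⟩
    have := h x hx
    rw [mul_smul, mul_smul, inv_inv, inv_smul_eq_iff] at this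
    exact this

lemma card_fixingSubgroup_ne_zero {r s : Set α} (hs : r ⊆ s) (hfin : (fixingSubgroup G r : Set G).Finite) :
    Nat.card (fixingSubgroup G s) ≠ 0 := by
  have h : (fixingSubgroup G s : Set G).Finite :=
    hfin.subset fun g hg => fixingSubgroup_antitone G α hs hg
  have : Finite (fixingSubgroup G s) := h
  exact Nat.card_pos.ne'

end Weights

section Balance

variable {α : Type u} [TopologicalSpace α] {X : PolyComplex α} {G : Type*} [Group G]
  [MulAction G α] {ω : Set α → ℚ} {r s : Set α}

lemma smul_mem_above (hX : IsOrbitSpace X G) {g : G} (hg : g ∈ fixingSubgroup G r) :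
    g • s ∈ X.above r ↔ s ∈ X.above r := by
  have key : ∀ {g : G} {s : Set α}, g ∈ fixingSubgroup G r → s ∈ X.above r →
      g • s ∈ X.above r := by
    intro g s hg hs
    refine ⟨hX.smul_mem g s hs.1, ?_, fun h => hs.2.2 ?_⟩
    · have := smul_set_mono (a := g) hs.2.1
      rwa [smul_eq_of_mem_fixing hg] at this
    · rwa [← smul_eq_of_mem_fixing hg, smul_set_subset_smul_set_iff] at h
  refine ⟨fun h => ?_, key hg⟩
  have := key (inv_mem hg) h
  rwa [inv_smul_smul] at this

/-- The isotropy of the action on the cells around a facet has the order that appears in the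
denominator of `classWeight`, because an element that preserves such a cell fixes it pointwise. -/
lemma card_stabilizer_eq (hX : IsOrbitSpace X G) (hr : r ∈ X.cells) (hs : s ∈ X.above r)
    (hfin : (fixingSubgroup G r : Set G).Finite) {w : Fin (X.starDim r) → ℤ}
    (hw : IsPrimitiveNormal (starCone X r r) (starCone X r s) w) :
    Nat.card {g : fixingSubgroup G r // (g : G) • s = s} = Nat.card (fixingSubgroup G s) := by
  refine Nat.card_congr
    { toFun := fun g => ⟨g.1.1, hX.mem_fixing_of_smul_eq hr hs hfin hw g.1.2 g.2⟩
      invFun := fun g => ⟨⟨g.1, fixingSubgroup_antitone G α hs.2.1 g.2⟩,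
        smul_eq_of_mem_fixing g.2⟩
      left_inv := fun g => rfl
      right_inv := fun g => rfl }

/-- Averaging over the pointwise stabilizer of the facet eliminates the coefficients from the
balancing condition. -/
theorem IsBalancedAt.exists_sum_mem (h : IsBalancedAt X G ω r) (hX : IsOrbitSpace X G)
    (hr : r ∈ X.cells) (hfin : (fixingSubgroup G r : Set G).Finite)
    (hω : ∀ g : G, ∀ s ∈ X.above r, ω (g • s) = ω s) :
    ∃ w : Set α → Fin (X.starDim r) → ℤ,
      (∀ s ∈ X.above r, IsPrimitiveNormal (starCone X r r) (starCone X r s) (w s)) ∧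
      ∑ᶠ s ∈ X.above r, (ω s : ℝ) • rvec (w s) ∈ Submodule.span ℝ (starCone X r r) := by
  classical
  obtain ⟨hab, l, w, -, hw, hl, hsum⟩ := h
  refine ⟨w, hw, ?_⟩
  set V := Submodule.span ℝ (starCone X r r) with hVdef
  have : Finite (fixingSubgroup G r) := hfin
  have : Fintype (fixingSubgroup G r) := Fintype.ofFinite _
  rw [finsum_mem_eq_finite_toFinset_sum _ hab] at hsum ⊢
  set S := hab.toFinset with hS
  have hmemS : ∀ s, s ∈ S ↔ s ∈ X.above r := fun s => hab.mem_toFinset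
  -- Apply `g⁻¹` to the balancing relation. It fixes `V` and permutes the normal vectors modulo `V`,
  -- so reindexing the cells amounts to replacing `l s` by `l (g • s)`.
  have hg : ∀ g : fixingSubgroup G r,
      ∑ s ∈ S, (l ((g : G) • s) * (classWeight G ω s : ℝ)) • rvec (w s) ∈ V := by
    intro g
    obtain ⟨A, hA, hAV⟩ := hX.exists_linear_of_fixing hr (inv_mem g.2)
    have h1 : (rmat A).mulVecLin (∑ s ∈ S, (l s * (classWeight G ω s : ℝ)) • rvec (w s)) ∈ V := by
      rw [Matrix.mulVecLin_apply]
      have hsum' : ∑ s ∈ S, (l s * (classWeight G ω s : ℝ)) • rvec (w s) ∈ V := hsum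
      rw [hAV _ hsum']
      exact hsum'
    rw [map_sum] at h1
    have h2 : ∀ s ∈ S, (rmat A).mulVecLin ((l s * (classWeight G ω s : ℝ)) • rvec (w s))
        - (l s * (classWeight G ω s : ℝ)) • rvec (w ((g : G)⁻¹ • s)) ∈ V := by
      intro s hs
      have hs' := (hmemS s).mp hs
      have hgs := (smul_mem_above hX (inv_mem g.2)).mpr hs'
      rw [map_smul, ← smul_sub, Matrix.mulVecLin_apply, rmat_mulVec_rvec]
      exact V.smul_mem _ ((hX.isPrimitiveNormal_smul hr (inv_mem g.2) hA hAV (hw s hs')).sub_mem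
        (hw _ hgs) (PolyComplex.exists_starCone_notMem_span hr hgs.1 hgs.2))
    have h3 := V.sub_mem h1 (V.sum_mem h2)
    rw [← Finset.sum_sub_distrib] at h3
    simp only [sub_sub_cancel] at h3
    convert h3 using 1
    refine Finset.sum_nbij' (fun s => (g : G) • s) (fun s => (g : G)⁻¹ • s) ?_ ?_ ?_ ?_ ?_
    · intro s hs
      exact (hmemS _).mpr ((smul_mem_above hX g.2).mpr ((hmemS s).mp hs))
    · intro s hs
      exact (hmemS _).mpr ((smul_mem_above hX (inv_mem g.2)).mpr ((hmemS s).mp hs))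
    · intro s _
      exact inv_smul_smul _ _
    · intro s _
      exact smul_inv_smul _ _
    · intro s hs
      rw [inv_smul_smul, classWeight, classWeight, card_fixingSubgroup_smul,
        hω _ s ((hmemS s).mp hs)]
  -- In the sum over all `g` the coefficients of `s` add up to the order of its pointwise
  -- stabilizer, which cancels the denominator of `classWeight`.
  have h4 := V.sum_mem (t := Finset.univ) fun g _ => hg g
  rw [Finset.sum_comm] at h4
  convert h4 using 1
  refine Finset.sum_congr rfl fun s hs => ?_
  have hs' := (hmemS s).mp hs
  have h5 := sum_smul_orbit (fixingSubgroup G r) l s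
  have h6 : {b | ∃ g ∈ fixingSubgroup G r, b = g • s}
      = {s' | s' ∈ X.above r ∧ ∃ g ∈ fixingSubgroup G r, s' = g • s} := by
    ext b
    constructor
    · rintro ⟨g, hg, rfl⟩
      exact ⟨(smul_mem_above hX hg).mpr hs', g, hg, rfl⟩
    · rintro ⟨-, hb⟩
      exact hb
  rw [h6, hl s hs', mul_one, card_stabilizer_eq hX hr hs' hfin (hw s hs')] at h5
  rw [← Finset.sum_smul, ← Finset.sum_mul, h5, classWeight]
  congr 1
  have h7 := card_fixingSubgroup_ne_zero (G := G) hs'.2.1 hfin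
  push_cast
  field_simp

/-- Take λ = |G_s| / |G_r|: the orbit of `s` under G_r has |G_r| / |G_s| members, so these
coefficients add up to one and turn the class weights into a common multiple of the weights. -/
theorem isBalancedAt_of_sum_mem (hX : IsOrbitSpace X G) (hr : r ∈ X.cells)
    (hfin : (fixingSubgroup G r : Set G).Finite) (hab : (X.above r).Finite)
    {w : Set α → Fin (X.starDim r) → ℤ}
    (hw : ∀ s ∈ X.above r, IsPrimitiveNormal (starCone X r r) (starCone X r s) (w s))
    (hsum : ∑ᶠ s ∈ X.above r, (ω s : ℝ) • rvec (w s) ∈ Submodule.span ℝ (starCone X r r)) :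
    IsBalancedAt X G ω r := by
  classical
  have : Finite (fixingSubgroup G r) := hfin
  have : Fintype (fixingSubgroup G r) := Fintype.ofFinite _
  have hr0 : (Nat.card (fixingSubgroup G r) : ℝ) ≠ 0 := by
    exact_mod_cast card_fixingSubgroup_ne_zero (G := G) (Subset.rfl : r ⊆ r) hfin
  let c : Set α → ℝ := fun s => Nat.card (fixingSubgroup G s)
  refine ⟨hab, fun s => c s / c r, w, fun s _ => by positivity, hw, fun s hs => ?_, ?_⟩
  · have h5 := sum_smul_orbit (fixingSubgroup G r) (fun s => c s / c r) s
    have h6 : {b | ∃ g ∈ fixingSubgroup G r, b = g • s}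
        = {s' | s' ∈ X.above r ∧ ∃ g ∈ fixingSubgroup G r, s' = g • s} := by
      ext b
      constructor
      · rintro ⟨g, hg, rfl⟩
        exact ⟨(smul_mem_above hX hg).mpr hs, g, hg, rfl⟩
      · rintro ⟨-, hb⟩
        exact hb
    rw [h6, card_stabilizer_eq hX hr hs hfin (hw s hs)] at h5
    have h7 : (Nat.card (fixingSubgroup G s) : ℝ) ≠ 0 := by
      exact_mod_cast card_fixingSubgroup_ne_zero (G := G) hs.2.1 hfin
    refine mul_left_cancel₀ h7 (h5.symm.trans ?_)
    simp only [c, card_fixingSubgroup_smul]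
    rw [Finset.sum_const, Finset.card_univ, ← Nat.card_eq_fintype_card, nsmul_eq_mul]
    field_simp
  · have h8 : ∀ s ∈ X.above r, ((c s / c r) * (classWeight G ω s : ℝ)) • rvec (w s)
        = (c r)⁻¹ • ((ω s : ℝ) • rvec (w s)) := by
      intro s hs
      have h7 : (Nat.card (fixingSubgroup G s) : ℝ) ≠ 0 := by
        exact_mod_cast card_fixingSubgroup_ne_zero (G := G) hs.2.1 hfin
      rw [smul_smul, classWeight]
      congr 1
      simp only [c]
      push_cast
      field_simp
    have h9 := Submodule.smul_mem _ (c r)⁻¹ hsum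
    rw [smul_finsum_mem hab] at h9
    convert h9 using 1
    exact finsum_mem_congr rfl h8

end Balance

/-! ### Averaging over orbits -/

section Orbits

variable {K : Type*} [Field K] {G A : Type*} [Group G] [MulAction G A]

/-- A sum over orbits does not depend on how each orbit is weighted. Both sides equal a double sum
over pairs (a, g), and the involution (a, g) ↦ (g a, g⁻¹) exchanges the roles of the two weights. -/
lemma finsum_mul_eq_of_invariant {χ χ' Φ : A → K} (hΦ : ∀ (g : G) a, Φ (g • a) = Φ a)
    (hfin : (Function.support fun a => χ a * Φ a).Finite)
    (hfin' : (Function.support fun a => χ' a * Φ a).Finite)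
    (hχ : ∀ a, Φ a ≠ 0 → ∑ᶠ g : G, χ (g • a) = 1)
    (hχ' : ∀ a, Φ a ≠ 0 → ∑ᶠ g : G, χ' (g • a) = 1) :
    ∑ᶠ a, χ a * Φ a = ∑ᶠ a, χ' a * Φ a := by
  have key : ∀ {χ χ' : A → K}, (Function.support fun a => χ a * Φ a).Finite →
      (∀ a, Φ a ≠ 0 → ∑ᶠ g : G, χ' (g • a) = 1) →
      ∑ᶠ a, χ a * Φ a = ∑ᶠ p : A × G, χ p.1 * Φ p.1 * χ' (p.2 • p.1) := by
    intro χ χ' hfin hχ'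
    rw [finsum_curry]
    · refine finsum_congr fun a => ?_
      simp only [← mul_finsum]
      by_cases ha : Φ a = 0
      · simp [ha]
      · rw [hχ' a ha, mul_one]
    · refine (hfin.biUnion (t := fun a => (fun g : G => (a, g)) ''
        (Function.support fun g : G => χ' (g • a))) fun a ha => Set.Finite.image _ ?_).subset ?_
      -- A `finsum` with infinite support is `0`, so the normalization to `1` already forces finite
      -- support.
      · by_contra hinf
        have h0 := finsum_of_infinite_support hinf
        rw [hχ' a fun h => ha (by simp [h])] at h0
        exact one_ne_zero h0
      · rintro ⟨a, g⟩ h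
        exact mem_biUnion (Function.mem_support.mpr (left_ne_zero_of_mul h))
          ⟨g, right_ne_zero_of_mul h, rfl⟩
  rw [key hfin hχ', key hfin' hχ]
  let e : A × G ≃ A × G :=
    { toFun := fun p => (p.2 • p.1, p.2⁻¹)
      invFun := fun p => (p.2 • p.1, p.2⁻¹)
      left_inv := fun p => by simp
      right_inv := fun p => by simp }
  rw [← finsum_comp_equiv e]
  refine finsum_congr fun p => ?_
  simp only [e, Equiv.coe_fn_mk, hΦ, inv_smul_smul]
  ring

open Classical in
/-- The weight that is concentrated on the chosen representative `rep` of an orbit. -/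
def orbitWeight (K : Type*) [Field K] (G : Type*) {A : Type*} [Group G] [MulAction G A]
    (rep : Quotient (MulAction.orbitRel G A) → A) (a : A) : K :=
  if a = rep (Quotient.mk _ a) then (Nat.card (MulAction.stabilizer G a) : K)⁻¹ else 0

/-- The elements that move `a` to the representative form a coset of the stabilizer of `a`, which
has the same order as the stabilizer of the representative. -/
lemma finsum_orbitWeight [CharZero K] {rep : Quotient (MulAction.orbitRel G A) → A}
    (hrep : ∀ c, Quotient.mk _ (rep c) = c) {a : A}
    (ha : {g : G | g • a = a}.Finite) : ∑ᶠ g : G, orbitWeight K G rep (g • a) = 1 := by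
  classical
  set b := rep (Quotient.mk _ a) with hb
  have hmk : ∀ g : G, (Quotient.mk (MulAction.orbitRel G A) (g • a)) = Quotient.mk _ a :=
    fun g => Quotient.sound ⟨g, rfl⟩
  obtain ⟨g₀, hg₀⟩ : ∃ g₀ : G, g₀ • a = b := by
    have : b ∈ MulAction.orbit G a := Quotient.exact (hrep (Quotient.mk _ a))
    exact this
  have hset : {g : G | g • a = b} = (fun g => g₀ * g) '' {g : G | g • a = a} := by
    ext g
    constructor
    · intro hg
      refine ⟨g₀⁻¹ * g, ?_, by simp⟩
      change (g₀⁻¹ * g) • a = a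
      rw [mul_smul, inv_smul_eq_iff, hg₀]
      exact hg
    · rintro ⟨g, hg, rfl⟩
      change (g₀ * g) • a = b
      rw [mul_smul, show g • a = a from hg, hg₀]
  have hfin : {g : G | g • a = b}.Finite := hset ▸ ha.image _
  have hterm : ∀ g : G, orbitWeight K G rep (g • a)
      = if g ∈ {g : G | g • a = b} then (Nat.card (MulAction.stabilizer G b) : K)⁻¹ else 0 := by
    intro g
    unfold orbitWeight
    rw [hmk, ← hb]
    by_cases hg : g • a = b
    · rw [if_pos hg, if_pos (show g ∈ {g : G | g • a = b} from hg), hg]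
    · rw [if_neg hg, if_neg (show g ∉ {g : G | g • a = b} from hg)]
  simp_rw [hterm]
  have hcard : {g : G | g • a = b}.ncard = Nat.card (MulAction.stabilizer G b) := by
    rw [← Nat.card_coe_set_eq]
    refine Nat.card_congr ((Equiv.mulRight g₀⁻¹).subtypeEquiv fun g => ?_)
    change g • a = b ↔ (g * g₀⁻¹) • b = b
    rw [mul_smul, ← hg₀, inv_smul_smul]
  have hpos : {g : G | g • a = b}.ncard ≠ 0 := by
    exact Set.ncard_ne_zero_of_mem (a := g₀) hg₀ hfin
  rw [finsum_eq_sum_of_support_subset (s := hfin.toFinset)]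
  · rw [Finset.sum_congr rfl fun g hg => if_pos (hfin.mem_toFinset.mp hg), Finset.sum_const,
      ← Set.ncard_eq_toFinset_card _ hfin, nsmul_eq_mul, hcard]
    rw [hcard] at hpos
    exact mul_inv_cancel₀ (Nat.cast_ne_zero.mpr hpos)
  · intro g hg
    by_contra h
    exact hg (if_neg (by simpa using h))

/-- Only the chosen representatives carry weight, and they are determined by the finitely many
classes that meet `T`. -/
lemma finite_orbitWeight_ne_zero (rep : Quotient (MulAction.orbitRel G A) → A) {T S : Set A}
    (hT : T.Finite) (hS : ∀ a ∈ S, ∃ g : G, ∃ t ∈ T, a = g • t) :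
    {a | a ∈ S ∧ orbitWeight K G rep a ≠ 0}.Finite := by
  refine (hT.image fun t => rep (Quotient.mk _ t)).subset ?_
  rintro a ⟨haS, ha⟩
  obtain ⟨g, t, ht, rfl⟩ := hS a haS
  refine ⟨t, ht, ?_⟩
  have h : g • t = rep (Quotient.mk _ (g • t)) := by
    by_contra h
    exact ha (if_neg h)
  have hmk : (Quotient.mk (MulAction.orbitRel G A) (g • t)) = Quotient.mk _ t :=
    Quotient.sound ⟨g, rfl⟩
  rw [hmk] at h
  exact h.symm

end Orbits

/-! ### The weighted number of preimages -/

/-- The action of the source group of a homomorphism on the target group by right translation. -/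
@[reducible] def rightTranslation {G H : Type*} [Group G] [Group H] (φ : G →* H) :
    MulAction G H where
  smul g h := h * (φ g)⁻¹
  one_smul h := by change h * (φ 1)⁻¹ = h; simp
  mul_smul g g' h := by
    change h * (φ (g * g'))⁻¹ = h * (φ g')⁻¹ * (φ g)⁻¹
    simp [mul_assoc]

namespace OrbitMorphism

variable {α β : Type*} [TopologicalSpace α] [TopologicalSpace β]
  {X : PolyComplex α} {Y : PolyComplex β} {G H : Type*} [Group G] [Group H]
  [MulAction G α] [MulAction H β]

/-- A morphism of tropical orbit spaces of the same dimension `n`, such that the top-dimensional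
cells of the target have finite setwise stabilizers. -/
structure IsTropical (f : OrbitMorphism X Y G H) (ωX : Set α → ℚ) (ωY : Set β → ℚ)
    (n : ℕ) : Prop where
  source : IsTropicalOrbitSpace X G n ωX
  target : IsTropicalOrbitSpace Y H n ωY
  finite_stab : ∀ t ∈ Y.cells, Y.dim t = n → {h : H | h • t = t}.Finite

open Classical in
/-- The contribution of a cell to the weighted number of preimages. -/
def coef (f : OrbitMorphism X Y G H) (n : ℕ) (ωX : Set α → ℚ) (s : Set α) : ℚ :=
  if f.IsGood n s then orbitWeight ℚ G Quotient.out s * (ωX s * f.idx s) else 0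

open Classical in
/-- The weighted number of preimages of the translates of `Q`. -/
def count (f : OrbitMorphism X Y G H) (n : ℕ) (ωX : Set α → ℚ) (Q : β) : ℚ :=
  ∑ᶠ p : H × Set α, if Q ∈ p.1 • f.toFun '' p.2 then f.coef n ωX p.2 else 0

variable {f : OrbitMorphism X Y G H} {ωX : Set α → ℚ} {ωY : Set β → ℚ} {n : ℕ} {s : Set α}

lemma isGood_of_coef_ne_zero (h : f.coef n ωX s ≠ 0) : f.IsGood n s := by
  by_contra hs
  exact h (if_neg hs)

lemma coef_of_isGood (h : f.IsGood n s) :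
    f.coef n ωX s = orbitWeight ℚ G Quotient.out s * (ωX s * f.idx s) := if_pos h

lemma mem_smul_image {h : H} {S : Set α} {Q : β} :
    Q ∈ h • f.toFun '' S ↔ ∃ P ∈ S, h • f.toFun P = Q := by
  simp [mem_smul_set]

/-- Pairs (h, s) in the same orbit of the action of G by right translation on H have the same image
in Y; the counts are sums over such pairs. -/
lemma smul_image_smul (h : H) (g : G) (S : Set α) :
    (h * (f.groupHom g)⁻¹) • f.toFun '' (g • S) = h • f.toFun '' S := by
  ext Q
  rw [mem_smul_image, mem_smul_image]
  constructor
  · rintro ⟨_, ⟨P, hP, rfl⟩, rfl⟩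
    exact ⟨P, hP, by rw [f.map_smul, mul_smul, inv_smul_smul]⟩
  · rintro ⟨P, hP, rfl⟩
    exact ⟨g • P, ⟨P, hP, rfl⟩, by rw [f.map_smul, mul_smul, inv_smul_smul]⟩

lemma cellOf_subset_of_mem (hY : IsOrbitSpace Y H) (hs : s ∈ X.cells) {h : H} {Q : β}
    (hQ : Q ∈ h • f.toFun '' s) : Y.cellOf Q ⊆ h • tgt X Y f.toFun s := by
  obtain ⟨P, hP, rfl⟩ := mem_smul_image.mp hQ
  exact PolyComplex.cellOf_subset (hY.smul_mem h _ (f.isCellMap.tgt_mem hs))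
    (smul_mem_smul_set (f.isCellMap.mapsTo hs hP))

lemma smul_tgt_of_mem_relInt (hY : IsOrbitSpace Y H) (hs : s ∈ X.cells) {h : H} {Q : β}
    (hQ : Q ∈ h • f.toFun '' X.relInt s) : h • tgt X Y f.toFun s = Y.cellOf Q := by
  obtain ⟨P, hP, rfl⟩ := mem_smul_image.mp hQ
  rw [hY.cellOf_smul, f.isCellMap.cellOf_map, PolyComplex.cellOf_eq hs hP]

namespace IsTropical

variable (hf : f.IsTropical ωX ωY n)
include hf

lemma finite_subset_smul_tgt (hs : s ∈ X.cells) {u : Set β} (hu : u ∈ Y.cells) :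
    {h : H | u ⊆ h • tgt X Y f.toFun s}.Finite :=
  have ht := f.isCellMap.tgt_mem hs
  hf.target.orbitSpace.finite_subset_smul hu ht
    (hf.target.finite_stabilizer_cell hf.finite_stab ht)

lemma finite_smul_mem_image (hs : s ∈ X.cells) (Q : β) :
    {h : H | Q ∈ h • f.toFun '' s}.Finite :=
  (hf.finite_subset_smul_tgt hs (Y.cellOf_mem Q)).subset fun _ hh =>
    cellOf_subset_of_mem hf.target.orbitSpace hs hh

lemma finite_coef_ne_zero : {s | f.coef n ωX s ≠ 0}.Finite := by
  obtain ⟨T, hT, hcov⟩ := hf.source.finite_classes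
  refine (finite_orbitWeight_ne_zero (K := ℚ) Quotient.out hT hcov).subset fun s hs => ?_
  have hgood := isGood_of_coef_ne_zero hs
  refine ⟨hgood.mem, fun h => hs ?_⟩
  rw [coef_of_isGood hgood, h, zero_mul]

/-- The pairs whose image can meet the star of `u`. -/
lemma finite_pairs {u : Set β} (hu : u ∈ Y.cells) :
    {p : H × Set α | f.coef n ωX p.2 ≠ 0 ∧ u ⊆ p.1 • tgt X Y f.toFun p.2}.Finite := by
  refine (hf.finite_coef_ne_zero.biUnion (t := fun s => (fun h : H => (h, s)) ''
    {h : H | u ⊆ h • tgt X Y f.toFun s}) fun s hs => ?_).subset ?_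
  · exact (hf.finite_subset_smul_tgt (isGood_of_coef_ne_zero hs).mem hu).image _
  · rintro ⟨h, s⟩ ⟨hs, hu⟩
    exact mem_biUnion (show s ∈ {s | f.coef n ωX s ≠ 0} from hs) ⟨h, hu, rfl⟩

/-- Setwise stabilizers in X are not assumed finite. The stabilizer of `s` maps to the finite
stabilizer of the target cell, and two elements with the same image in H differ by one that fixes
`s` pointwise, as `f` is injective on `s`. -/
lemma finite_stabilizer_of_isGood (hs : f.IsGood n s) : {g : G | g • s = s}.Finite := by
  have hX := hf.source
  have hfin := hX.finite_stabilizer s hs.mem hs.dim_eq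
  have htgt := hf.finite_stab _ (f.isCellMap.tgt_mem hs.mem) hs.dim_tgt
  obtain ⟨P, hP⟩ := PolyComplex.relInt_nonempty hs.mem
  have hsub : {g : G | g • s = s} ⊆ ⋃ h ∈ {h : H | h • tgt X Y f.toFun s = tgt X Y f.toFun s},
      {g : G | g • s = s ∧ f.groupHom g = h} := by
    intro g hg
    have hg' : g • s = s := hg
    refine mem_biUnion (x := f.groupHom g) ?_ ⟨hg, rfl⟩
    change _ • _ = _
    rw [← f.tgt_smul_source hX.orbitSpace hf.target.orbitSpace g hs.mem, hg']
  refine (htgt.biUnion fun h _ => ?_).subset hsub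
  by_cases hne : {g : G | g • s = s ∧ f.groupHom g = h}.Nonempty
  · obtain ⟨g₀, hg₀, rfl⟩ := hne
    refine (hfin.image fun g => g₀ * g).subset ?_
    rintro g ⟨hg, hgh⟩
    refine ⟨g₀⁻¹ * g, ?_, by simp⟩
    change g₀⁻¹ * g ∈ fixingSubgroup G s
    rw [mem_fixingSubgroup_iff]
    intro x hx
    have hmem : (g₀⁻¹ * g) • x ∈ s := by
      have h1 : g • x ∈ s := hg ▸ smul_mem_smul_set hx
      rw [mul_smul]
      rwa [← hg₀, mem_smul_set_iff_inv_smul_mem] at h1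
    refine hs.injOn hf.target.orbitSpace hmem hx ?_
    rw [f.map_smul, map_mul, map_inv, hgh, inv_mul_cancel, one_smul]
  · rw [not_nonempty_iff_eq_empty.mp hne]
    exact finite_empty

lemma finite_stabilizer_facet (hs : f.IsGood n s) {r : Set α} (hr : r ∈ X.cells) (hrs : r ⊆ s) :
    {g : G | g • r = r}.Finite :=
  hf.source.orbitSpace.finite_stabilizer_of_subset hr hs.mem hrs
    (hf.finite_stabilizer_of_isGood hs)

open Classical in
/-- A sum over the pairs whose image has `Q₀` on its boundary vanishes if it vanishes
around every facet whose image contains `Q₀`. -/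
theorem finsum_boundary_eq_zero {Q₀ : β}
    (havoid : ∀ r ∈ X.cells, X.dim r + 2 ≤ n → ∀ h : H, Q₀ ∉ h • f.toFun '' r)
    (Ψ : H → Set α → ℝ)
    (hΨ : ∀ g h s, f.IsGood n s → Ψ (h * (f.groupHom g)⁻¹) (g • s) = Ψ h s)
    (hbal : ∀ h, ∀ r ∈ X.cells, X.dim r + 1 = n → Q₀ ∈ h • f.toFun '' X.relInt r →
      (∃ s, f.IsGood n s ∧ r ⊂ s) →
      ∑ᶠ s ∈ {s | s ∈ X.above r ∧ f.IsGood n s}, (ωX s * f.idx s) * Ψ h s = 0) :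
    ∑ᶠ p : H × Set α, (if Q₀ ∈ p.1 • f.toFun '' (p.2 \ X.relInt p.2) then
      (f.coef n ωX p.2 : ℝ) * Ψ p.1 p.2 else 0) = 0 := by
  let _ := rightTranslation f.groupHom
  have hXo := hf.source.orbitSpace
  have hYo := hf.target.orbitSpace
  -- Flags (h, s, r) of a good cell and a facet whose image contains `Q₀`. The sum over the pairs
  -- (h, s) is a sum over flags, to be reorganized as a sum over the facets r.
  let Good : (H × Set α) × Set α → Prop := fun a => f.IsGood n a.1.2 ∧ a.2 ∈ X.cells ∧
    X.dim a.2 + 1 = n ∧ a.2 ⊂ a.1.2 ∧ Q₀ ∈ a.1.1 • f.toFun '' X.relInt a.2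
  let Φ : (H × Set α) × Set α → ℝ := fun a =>
    if Good a then (ωX a.1.2 * f.idx a.1.2) * Ψ a.1.1 a.1.2 else 0
  have hGood : ∀ (g : G) a, Good a → Good (g • a) := by
    rintro g ⟨⟨h, s⟩, r⟩ ⟨h1, h2, h3, h4, h5⟩
    refine ⟨h1.smul hXo hYo g, hXo.smul_mem g _ h2, ?_, ?_, ?_⟩
    · change X.dim (g • r) + 1 = n
      rw [hXo.dim_smul g h2]
      exact h3
    · exact ⟨smul_set_mono h4.1, fun h => h4.2 (smul_set_subset_smul_set_iff.mp h)⟩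
    · change Q₀ ∈ (h * (f.groupHom g)⁻¹) • f.toFun '' X.relInt (g • r)
      obtain ⟨P, hP, hPQ⟩ := mem_smul_image.mp h5
      refine mem_smul_image.mpr ⟨g • P, hXo.smul_mem_relInt h2 g hP, ?_⟩
      rw [f.map_smul, mul_smul, inv_smul_smul]
      exact hPQ
  have hΦ : ∀ (g : G) a, Φ (g • a) = Φ a := by
    intro g a
    by_cases ha : Good a
    · have e1 : Φ (g • a) = _ := if_pos (hGood g a ha)
      have e2 : Φ a = _ := if_pos ha
      rw [e1, e2]
      have h1 : ωX (g • a.1.2) = ωX a.1.2 :=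
        hf.source.weight_smul g _ ha.1.mem ha.1.dim_eq
      have h2 : f.idx (g • a.1.2) = f.idx a.1.2 := f.idx_smul hXo hYo g ha.1.mem
      have h3 := hΨ g a.1.1 a.1.2 ha.1
      change (ωX (g • a.1.2) * f.idx (g • a.1.2)) * Ψ (a.1.1 * (f.groupHom g)⁻¹) (g • a.1.2) = _
      rw [h1, h2, h3]
    · have ha' : ¬ Good (g • a) := fun h => ha (by simpa using hGood g⁻¹ _ h)
      have e1 : Φ (g • a) = 0 := if_neg ha'
      have e2 : Φ a = 0 := if_neg ha
      rw [e1, e2]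
  have hΦg : ∀ a, Φ a ≠ 0 → Good a := fun a h => by
    by_contra h'
    exact h (if_neg h')
  obtain ⟨T, hT, hcov⟩ := hf.source.finite_classes
  have hfin : ∀ (S : Set ((H × Set α) × Set α)), S ⊆ {a | Good a} →
      (∀ a ∈ S, orbitWeight ℝ G Quotient.out a.1.2 ≠ 0) → S.Finite := by
    intro S hS hS'
    have h1 := finite_orbitWeight_ne_zero (K := ℝ) Quotient.out hT hcov
    refine Set.Finite.of_finite_image (f := Prod.fst) ((h1.biUnion (t := fun s =>
      (fun h : H => (h, s)) '' {h : H | Q₀ ∈ h • f.toFun '' s}) fun s hs =>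
        (hf.finite_smul_mem_image hs.1 Q₀).image _).subset ?_) ?_
    · rintro _ ⟨⟨⟨h, s⟩, r⟩, ha, rfl⟩
      have hg := hS ha
      refine mem_biUnion (x := s) ⟨hg.1.mem, hS' _ ha⟩ ⟨h, ?_, rfl⟩
      exact smul_set_mono (image_mono ((X.relInt_subset r).trans hg.2.2.2.1.1)) hg.2.2.2.2
    · rintro ⟨⟨h, s⟩, r⟩ ha ⟨⟨h', s'⟩, r'⟩ ha' he
      obtain ⟨rfl, rfl⟩ := Prod.mk.inj he
      have hg := hS ha
      have hg' := hS ha'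
      obtain ⟨P, hP, hPQ⟩ := mem_smul_image.mp hg.2.2.2.2
      obtain ⟨P', hP', hPQ'⟩ := mem_smul_image.mp hg'.2.2.2.2
      have : P = P' := hg.1.injOn hYo (hg.2.2.2.1.1 hP.1) (hg'.2.2.2.1.1 hP'.1)
        (MulAction.injective h (hPQ.trans hPQ'.symm))
      subst this
      rw [Prod.mk.injEq]
      exact ⟨rfl, (PolyComplex.cellOf_eq hg.2.1 hP).symm.trans
        (PolyComplex.cellOf_eq hg'.2.1 hP')⟩
  have hfin₁ : (Function.support fun a : (H × Set α) × Set α =>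
      orbitWeight ℝ G Quotient.out a.1.2 * Φ a).Finite :=
    hfin _ (fun a ha => hΦg a (right_ne_zero_of_mul ha)) fun a ha => left_ne_zero_of_mul ha
  have hfin₂ : (Function.support fun a : (H × Set α) × Set α =>
      orbitWeight ℝ G Quotient.out a.2 * Φ a).Finite := by
    have h1 := finite_orbitWeight_ne_zero (K := ℝ) Quotient.out hT hcov
    refine (h1.biUnion (t := fun r => (fun q : H × Set α => ((q.1, q.2), r)) ''
      ({h : H | Q₀ ∈ h • f.toFun '' r} ×ˢ {s | s ∈ X.cells ∧ r ⊆ s})) fun r hr =>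
      (((hf.finite_smul_mem_image hr.1 Q₀).prod (PolyComplex.finite_above hr.1)).image _)).subset ?_
    rintro ⟨⟨h, s⟩, r⟩ ha
    have hg := hΦg _ (right_ne_zero_of_mul ha)
    exact mem_biUnion (x := r) ⟨hg.2.1, left_ne_zero_of_mul ha⟩
      ⟨(h, s), ⟨smul_set_mono (image_mono (X.relInt_subset r)) hg.2.2.2.2,
        hg.1.mem, hg.2.2.2.1.1⟩, rfl⟩
  -- The representatives are changed from one per class of cells `s` to one per class of facets `r`;
  -- the balancing relation can only be applied when the whole star of `r` is summed.
  have hswap := finsum_mul_eq_of_invariant (G := G) hΦ hfin₁ hfin₂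
    (fun a ha => finsum_orbitWeight (K := ℝ) Quotient.out_eq
      (hf.finite_stabilizer_of_isGood (hΦg a ha).1))
    (fun a ha => finsum_orbitWeight (K := ℝ) Quotient.out_eq
      (hf.finite_stabilizer_facet (hΦg a ha).1 (hΦg a ha).2.1 (hΦg a ha).2.2.2.1.1))
  rw [finsum_curry _ hfin₁] at hswap
  have hleft : ∀ p : H × Set α, (if Q₀ ∈ p.1 • f.toFun '' (p.2 \ X.relInt p.2) then
      (f.coef n ωX p.2 : ℝ) * Ψ p.1 p.2 else 0)
        = ∑ᶠ r, orbitWeight ℝ G Quotient.out p.2 * Φ (p, r) := by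
    rintro ⟨h, s⟩
    by_cases hgood : f.IsGood n s
    swap
    · have : ∀ r, Φ ((h, s), r) = 0 := fun r => if_neg fun hg => hgood hg.1
      simp [this, coef, if_neg hgood]
    have hcast : (orbitWeight ℚ G Quotient.out s : ℝ) = orbitWeight ℝ G Quotient.out s := by
      unfold orbitWeight
      split_ifs <;> simp
    by_cases hQ : Q₀ ∈ h • f.toFun '' (s \ X.relInt s)
    · obtain ⟨P, ⟨hPs, hPn⟩, hPQ⟩ := mem_smul_image.mp hQ
      -- The preimage `P` in `s` is unique, so the cell of `P` is the only facet that completes the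
      -- pair to a flag; smaller faces are excluded by `havoid`.
      have hr := X.cellOf_mem P
      have hrs : X.cellOf P ⊆ s := PolyComplex.cellOf_subset hgood.mem hPs
      have hne : X.cellOf P ≠ s := fun h => hPn (h ▸ X.mem_relInt_cellOf P)
      have hdim := PolyComplex.dim_lt_of_ssubset hr hgood.mem (hrs.ssubset_of_ne hne)
      have hdim' : ¬ X.dim (X.cellOf P) + 2 ≤ n := fun h' => havoid _ hr h' h
        (mem_smul_image.mpr ⟨P, X.mem_cellOf P, hPQ⟩)
      have hg : Good ((h, s), X.cellOf P) := by
        refine ⟨hgood, hr, ?_, hrs.ssubset_of_ne hne,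
          mem_smul_image.mpr ⟨P, X.mem_relInt_cellOf P, hPQ⟩⟩
        rw [hgood.dim_eq] at hdim
        change X.dim (X.cellOf P) + 1 = n
        omega
      rw [if_pos hQ, finsum_eq_single _ (X.cellOf P)]
      · have : Φ ((h, s), X.cellOf P) = _ := if_pos hg
        rw [this, coef_of_isGood hgood, ← hcast]
        push_cast
        ring
      · intro r hr'
        have : Φ ((h, s), r) = 0 := by
          refine if_neg fun hg' => hr' ?_
          obtain ⟨P', hP', hPQ'⟩ := mem_smul_image.mp hg'.2.2.2.2
          have : P = P' := hgood.injOn hYo hPs (hg'.2.2.2.1.1 hP'.1)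
            (MulAction.injective h (hPQ.trans hPQ'.symm))
          subst this
          exact (PolyComplex.cellOf_eq hg'.2.1 hP').symm
        rw [this, mul_zero]
    · rw [if_neg hQ]
      have : ∀ r, Φ ((h, s), r) = 0 := by
        refine fun r => if_neg fun hg' => hQ ?_
        obtain ⟨P', hP', hPQ'⟩ := mem_smul_image.mp hg'.2.2.2.2
        refine mem_smul_image.mpr ⟨P', ⟨hg'.2.2.2.1.1 hP'.1, fun hP'' => ?_⟩, hPQ'⟩
        exact hg'.2.2.2.1.ne ((PolyComplex.cellOf_eq hg'.2.1 hP').symm.trans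
          (PolyComplex.cellOf_eq hgood.mem hP''))
      simp [this]
  rw [finsum_congr hleft, hswap]
  -- Exchanges `s` and `r`, so that currying sums over the cells above a fixed facet first.
  let e : (H × Set α) × Set α ≃ (H × Set α) × Set α :=
    { toFun := fun a => ((a.1.1, a.2), a.1.2)
      invFun := fun a => ((a.1.1, a.2), a.1.2)
      left_inv := fun a => rfl
      right_inv := fun a => rfl }
  rw [← finsum_comp_equiv e, finsum_curry]
  · rw [← finsum_zero (α := H × Set α)]
    refine finsum_congr ?_
    rintro ⟨h, r⟩
    simp only [e, Equiv.coe_fn_mk]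
    rw [← mul_finsum]
    by_cases hr : r ∈ X.cells ∧ X.dim r + 1 = n ∧ Q₀ ∈ h • f.toFun '' X.relInt r ∧
        ∃ s, f.IsGood n s ∧ r ⊂ s
    · rw [← mul_zero (orbitWeight ℝ G Quotient.out r),
        ← hbal h r hr.1 hr.2.1 hr.2.2.1 hr.2.2.2]
      congr 1
      refine finsum_congr fun s => ?_
      rw [finsum_eq_if]
      refine if_congr ⟨fun hg => ⟨⟨hg.1.mem, hg.2.2.2.1⟩, hg.1⟩, fun hg =>
        ⟨hg.2, hr.1, hr.2.1, hg.1.2, hr.2.2.1⟩⟩ rfl rfl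
    · have : ∀ s, Φ ((h, s), r) = 0 := fun s => if_neg fun hg =>
        hr ⟨hg.2.1, hg.2.2.1, hg.2.2.2.2, s, hg.1, hg.2.2.2.1⟩
      simp [this]
  · refine (hfin₂.preimage e.injective.injOn).subset fun a ha => ?_
    exact ha

end IsTropical

end OrbitMorphism

/-! ### Walls -/

lemma IsOrbitSpace.exists_matrix {α : Type u} [TopologicalSpace α] {X : PolyComplex α}
    {G : Type*} [Group G] [MulAction G α] (hX : IsOrbitSpace X G) {s t : Set α} (hs : s ∈ X.cells)
    {g : G} (hg : g • s = t) :
    ∃ (A : Matrix (Fin (X.dim t)) (Fin (X.dim s)) ℤ) (b : Fin (X.dim t) → ℝ),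
      ∀ x ∈ s, X.chart t (g • x) = (rmat A).mulVec (X.chart s x) + b := by
  subst hg
  exact hX.chart_affine g hs

namespace OrbitMorphism

variable {α β : Type*} [TopologicalSpace α] [TopologicalSpace β]
  {X : PolyComplex α} {Y : PolyComplex β} {G H : Type*} [Group G] [Group H]
  [MulAction G α] [MulAction H β] {f : OrbitMorphism X Y G H} {ωX : Set α → ℚ} {ωY : Set β → ℚ}
  {n : ℕ} {s : Set α} {t : Set β}

lemma exists_matrix (f : OrbitMorphism X Y G H) (hY : IsOrbitSpace Y H) (h : H) (hs : s ∈ X.cells)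
    (ht : h • tgt X Y f.toFun s = t) :
    ∃ (A : Matrix (Fin (Y.dim t)) (Fin (X.dim s)) ℤ) (b : Fin (Y.dim t) → ℝ),
      ∀ x ∈ s, Y.chart t (h • f.toFun x) = (rmat A).mulVec (X.chart s x) + b := by
  have h1 := (f.isCellMap_smul hY h).chart_affine hs
  rw [f.tgt_smul hY h hs] at h1
  subst ht
  exact h1

/-- The dimension of the image of `s` is smaller than that of the target cell. -/
def IsDegenerate (f : OrbitMorphism X Y G H) (s : Set α) : Prop :=
  X.dim s < Y.dim (tgt X Y f.toFun s) ∨ X.dim s = Y.dim (tgt X Y f.toFun s) ∧ f.idx s = 0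

/-- A finite set of walls in the cell `t` of `Y` that contain the images of the degenerate cells
and the fixed points of the elements of the stabilizer of `t` that act nontrivially on `t`. -/
structure IsWallSet (f : OrbitMorphism X Y G H) (t : Set β)
    (W : Set ((Fin (Y.dim t) → ℤ) × ℝ)) : Prop where
  finite : W.Finite
  ne_zero : ∀ w ∈ W, w.1 ≠ 0
  degenerate : ∀ r ∈ X.cells, ∀ h : H, h • tgt X Y f.toFun r = t → f.IsDegenerate r →
    ∀ y ∈ h • f.toFun '' r, ∃ w ∈ W, intForm w.1 (Y.chart t y) = w.2
  fixed : ∀ h : H, h • t = t → h ∉ fixingSubgroup H t → ∀ y ∈ t, h • y = y →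
    ∃ w ∈ W, intForm w.1 (Y.chart t y) = w.2

lemma isGood_of_not_isDegenerate (hX : IsTropicalOrbitSpace X G n ωX) (hs : s ∈ X.cells)
    (hd : Y.dim (tgt X Y f.toFun s) = n) (h : ¬ f.IsDegenerate s) : f.IsGood n s := by
  have h1 := (hX.pure_dim s hs).1
  unfold IsDegenerate at h
  have h2 : X.dim s = n := by omega
  exact ⟨hs, h2, hd, fun h3 => h (Or.inr ⟨h2.trans hd.symm, h3⟩)⟩

namespace IsTropical

variable (hf : f.IsTropical ωX ωY n)
include hf

/-- Writing r = g r₀ with r₀ in a finite list, the translate of r by h has the same image as that of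
r₀ by h φ(g), and only finitely many elements of H carry the target of r₀ to `t`. -/
lemma exists_finite_pairs (ht : t ∈ Y.cells) : ∃ 𝓟 : Set (H × Set α), 𝓟.Finite ∧
    (∀ p ∈ 𝓟, p.2 ∈ X.cells ∧ p.1 • tgt X Y f.toFun p.2 = t) ∧
    ∀ r ∈ X.cells, ∀ h : H, h • tgt X Y f.toFun r = t → ∃ p ∈ 𝓟,
      p.1 • f.toFun '' p.2 = h • f.toFun '' r ∧ X.dim p.2 = X.dim r ∧ f.idx p.2 = f.idx r := by
  have hXo := hf.source.orbitSpace
  have hYo := hf.target.orbitSpace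
  obtain ⟨T, hT, hcov⟩ := hf.source.finite_classes
  refine ⟨⋃ r ∈ T ∩ X.cells, (fun h : H => (h, r)) '' {h : H | h • tgt X Y f.toFun r = t},
    (hT.inter_of_left _).biUnion fun r hr => Set.Finite.image _ ?_, ?_, ?_⟩
  · exact (hf.finite_subset_smul_tgt hr.2 ht).subset fun h hh => (show _ = t from hh).ge
  · intro p hp
    obtain ⟨r, hr, h, hh, rfl⟩ := by simpa only [mem_iUnion₂] using hp
    exact ⟨hr.2, hh⟩
  · intro r hr h hh
    obtain ⟨g, r₀, hr₀, rfl⟩ := hcov r hr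
    have hr₀' : r₀ ∈ X.cells := (hXo.smul_mem_iff g).mp hr
    refine ⟨(h * f.groupHom g, r₀), mem_biUnion (x := r₀) ⟨hr₀, hr₀'⟩ ⟨h * f.groupHom g, ?_, rfl⟩,
      ?_, (hXo.dim_smul g hr₀').symm, (f.idx_smul hXo hYo g hr₀').symm⟩
    · change (h * f.groupHom g) • tgt X Y f.toFun r₀ = t
      rw [mul_smul, ← f.tgt_smul_source hXo hYo g hr₀', hh]
    · have := smul_image_smul (f := f) (h * f.groupHom g) g r₀
      rw [← this, mul_inv_cancel_right]

/-- Up to equality of images there are finitely many degenerate cells over `t`, each inside one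
hyperplane; and `t` has a finite stabilizer, each of whose elements contributes at most one
equation. -/
lemma exists_isWallSet (ht : t ∈ Y.cells) : ∃ W, f.IsWallSet t W := by
  have hYo := hf.target.orbitSpace
  obtain ⟨𝓟, hfin, h𝓟, hcov⟩ := hf.exists_finite_pairs ht
  have h1 : ∀ p ∈ 𝓟, f.IsDegenerate p.2 → ∃ w : (Fin (Y.dim t) → ℤ) × ℝ, w.1 ≠ 0 ∧
      ∀ y ∈ p.1 • f.toFun '' p.2, intForm w.1 (Y.chart t y) = w.2 := by
    intro p hp hdeg
    obtain ⟨hs, hpt⟩ := h𝓟 p hp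
    obtain ⟨A, b, hA⟩ := f.exists_matrix hYo p.1 hs hpt
    have hd : Y.dim t = Y.dim (tgt X Y f.toFun p.2) := by
      rw [← hpt, hYo.dim_smul _ (f.isCellMap.tgt_mem hs)]
    obtain ⟨w, hw, hw'⟩ := IsCellMap.exists_wall hA (by
      rw [f.latIdx_smul_eq_idx hYo p.1 hs hpt hA, hd]
      exact hdeg)
    refine ⟨w, hw, fun y hy => ?_⟩
    obtain ⟨P, hP, rfl⟩ := mem_smul_image.mp hy
    exact hw' P hP
  choose! w hw hw' using h1
  have h2 : ∀ h : H, h • t = t → h ∉ fixingSubgroup H t → ∃ W : Set ((Fin (Y.dim t) → ℤ) × ℝ),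
      W.Finite ∧ (∀ w ∈ W, w.1 ≠ 0) ∧ ∀ y ∈ t, h • y = y →
        ∃ w ∈ W, intForm w.1 (Y.chart t y) = w.2 := by
    intro h hh hfix
    obtain ⟨A, b, hA⟩ := hYo.exists_matrix ht hh
    -- A nonzero row of A - 1 is an equation for the fixed points. If A = 1, the element acts by a
    -- translation, and a fixed point makes it the identity on `t`.
    by_cases hrow : ∃ i, A i - (1 : Matrix _ _ ℤ) i ≠ 0
    · obtain ⟨i, hi⟩ := hrow
      refine ⟨{(A i - (1 : Matrix _ _ ℤ) i, -b i)}, finite_singleton _, ?_, ?_⟩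
      · rintro w rfl
        exact hi
      · intro y hy hyy
        refine ⟨_, rfl, ?_⟩
        have h3 := congrFun (hA y hy) i
        rw [hyy] at h3
        have h4 : intForm (A i - (1 : Matrix _ _ ℤ) i) (Y.chart t y)
            = (rmat A).mulVec (Y.chart t y) i - (rmat (1 : Matrix _ _ ℤ)).mulVec (Y.chart t y) i := by
          simp only [intForm, Matrix.mulVec, dotProduct, rmat, Matrix.map_apply, Pi.sub_apply,
            Int.cast_sub, sub_mul, Finset.sum_sub_distrib]
        rw [h4, rmat_one, Matrix.one_mulVec]
        rw [Pi.add_apply] at h3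
        linarith
    · have hA1 : A = 1 := by
        funext i
        by_contra hi
        exact hrow ⟨i, sub_ne_zero.mpr hi⟩
      subst hA1
      refine ⟨∅, finite_empty, by simp, fun y hy hyy => ?_⟩
      refine absurd ((mem_fixingSubgroup_iff H).mpr fun z hz => ?_) hfix
      have h3 := hA y hy
      rw [hyy, rmat_one, Matrix.one_mulVec, left_eq_add] at h3
      have h4 := hA z hz
      rw [h3, rmat_one, Matrix.one_mulVec, add_zero] at h4
      exact PolyComplex.chart_injOn ht (hh ▸ smul_mem_smul_set hz) hz h4
  choose! W' hW'fin hW'ne hW' using h2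
  have hstab := hf.target.finite_stabilizer_cell hf.finite_stab ht
  refine ⟨w '' {p | p ∈ 𝓟 ∧ f.IsDegenerate p.2} ∪
    ⋃ h ∈ {h : H | h • t = t ∧ h ∉ fixingSubgroup H t}, W' h,
    ((hfin.subset fun p hp => hp.1).image _).union
      ((hstab.subset fun h hh => hh.1).biUnion fun h hh => hW'fin h hh.1 hh.2), ?_, ?_, ?_⟩
  · rintro v (⟨p, hp, rfl⟩ | hv)
    · exact hw p hp.1 hp.2
    · obtain ⟨h, hh, hv⟩ := by simpa only [mem_iUnion₂] using hv
      exact hW'ne h hh.1 hh.2 v hv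
  · intro r hr h hh hdeg y hy
    obtain ⟨p, hp, he, hd, hi⟩ := hcov r hr h hh
    obtain ⟨hs, hpt⟩ := h𝓟 p hp
    have hdeg' : f.IsDegenerate p.2 := by
      have e1 : Y.dim (tgt X Y f.toFun p.2) = Y.dim t := by
        rw [← hpt, hYo.dim_smul _ (f.isCellMap.tgt_mem hs)]
      have e2 : Y.dim (tgt X Y f.toFun r) = Y.dim t := by
        rw [← hh, hYo.dim_smul _ (f.isCellMap.tgt_mem hr)]
      unfold IsDegenerate at hdeg ⊢
      rwa [e1, hd, hi, ← e2]
    exact ⟨w p, Or.inl ⟨p, ⟨hp, hdeg'⟩, rfl⟩, hw' p hp hdeg' y (he ▸ hy)⟩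
  · intro h hh hfix y hy hyy
    obtain ⟨v, hv, hv'⟩ := hW' h hh hfix y hy hyy
    exact ⟨v, Or.inr (mem_biUnion (x := h) ⟨hh, hfix⟩ hv), hv'⟩

lemma isOpen_image_of_isGood (hs : f.IsGood n s) (h : H) {O : Set α} (hO : IsOpen O)
    (hOs : O ⊆ X.relInt s) : IsOpen (h • f.toFun '' O) := by
  have hYo := hf.target.orbitSpace
  have htgt := f.isCellMap.tgt_mem hs.mem
  obtain ⟨A, b, B, hA, hBA, hAB, -⟩ := hs.exists_matrix hYo h rfl
  have := (f.isCellMap_smul hYo h).isOpen_image_of_inverse hs.mem (hYo.smul_mem h _ htgt)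
    (f.tgt_smul hYo h hs.mem) hA hBA hAB (hf.target.isOpen_relInt (hYo.smul_mem h _ htgt)
      ((hYo.dim_smul h htgt).trans hs.dim_tgt)) hO hOs
  rwa [← image_smul, image_image]

/-- The image of a good cell in the chart of its target cell. -/
lemma image_chart_of_isGood (hs : f.IsGood n s) {h : H} (ht : h • tgt X Y f.toFun s = t) :
    Convex ℝ (Y.chart t '' (h • f.toFun '' s)) ∧
    Y.chart t '' (h • f.toFun '' X.relInt s) = interior (Y.chart t '' (h • f.toFun '' s)) ∧
    (interior (Y.chart t '' (h • f.toFun '' s))).Nonempty := by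
  have hYo := hf.target.orbitSpace
  obtain ⟨A, b, B, hA, hBA, hAB, -⟩ := hs.exists_matrix hYo h ht
  let e : (Fin (X.dim s) → ℝ) ≃ₜ (Fin (Y.dim t) → ℝ) :=
    { toFun := fun x => (rmat A).mulVec x + b
      invFun := fun y => B.mulVec (y - b)
      left_inv := fun x => by simp [hBA]
      right_inv := fun y => by simp [hAB]
      continuous_toFun := (continuous_mulVec _).add continuous_const
      continuous_invFun := (continuous_mulVec _).comp (continuous_id.sub continuous_const) }
  have himg : ∀ S ⊆ s, Y.chart t '' (h • f.toFun '' S) = e '' (X.chart s '' S) := by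
    intro S hS
    rw [← image_smul, image_image, image_image, image_image]
    exact image_congr fun x hx => hA x (hS hx)
  rw [himg _ Subset.rfl, himg _ (X.relInt_subset s), X.image_relInt, e.image_interior]
  refine ⟨?_, rfl, ?_⟩
  · have h1 : e '' (X.chart s '' s)
        = (fun y => b + y) '' ((rmat A).mulVecLin '' (X.chart s '' s)) := by
      rw [image_image (g := fun y => b + y)]
      exact image_congr fun x _ => add_comm _ _
    rw [h1, image_add_left]
    exact ((PolyComplex.convex_image hs.mem).linear_image _).translate_preimage_right _
  · rw [← e.image_interior]
    exact (PolyComplex.interior_nonempty hs.mem).image _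

end IsTropical

end OrbitMorphism

/-! ### Images of good cells are closed -/

lemma finite_segment_wall {n : ℕ} {p q : Fin n → ℝ} {w : (Fin n → ℤ) × ℝ}
    (hq : intForm w.1 q ≠ w.2) : {c : ℝ | intForm w.1 (p + c • (q - p)) = w.2}.Finite := by
  refine Set.Subsingleton.finite fun c hc c' hc' => ?_
  simp only [mem_ofPred_eq, intForm_add, intForm_smul, intForm_sub] at hc hc'
  have h1 : (c - c') * (intForm w.1 q - intForm w.1 p) = 0 := by linarith
  rcases mul_eq_zero.mp h1 with h2 | h2
  · exact sub_eq_zero.mp h2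
  · rw [h2, mul_zero, add_zero] at hc
    exact absurd ((sub_eq_zero.mp h2).trans hc) hq

lemma exists_pos_forall_notMem {B : Set ℝ} (hB : B.Finite) :
    ∃ s₀ : ℝ, 0 < s₀ ∧ s₀ ≤ 1 ∧ ∀ s, 0 < s → s ≤ s₀ → s ∉ B := by
  have h1 : (B \ {0})ᶜ ∈ 𝓝 (0 : ℝ) :=
    (hB.subset sdiff_subset).isClosed.isOpen_compl.mem_nhds (by simp)
  obtain ⟨ε, hε, hball⟩ := Metric.mem_nhds_iff.mp h1
  refine ⟨min 1 (ε / 2), by positivity, min_le_left _ _, fun s hs hs' hsB => ?_⟩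
  refine hball (show s ∈ Metric.ball 0 ε from ?_) ⟨hsB, hs.ne'⟩
  rw [Metric.mem_ball, Real.dist_0_eq_abs, abs_of_pos hs]
  linarith [min_le_right 1 (ε / 2)]

namespace OrbitMorphism

variable {α β : Type*} [TopologicalSpace α] [TopologicalSpace β]
  {X : PolyComplex α} {Y : PolyComplex β} {G H : Type*} [Group G] [Group H]
  [MulAction G α] [MulAction H β] {f : OrbitMorphism X Y G H} {ωX : Set α → ℚ} {ωY : Set β → ℚ}
  {n : ℕ} {s : Set α} {t : Set β}

/-- The quotient topology on |Y|/H enters the whole argument only here: closedness of an H-invariant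
set can be tested on |X|. -/
lemma isClosed_of_isClosed_preimage (hq : IsQuotientMap f.orbitMap) {S : Set β}
    (hS : ∀ h : H, ∀ y, h • y ∈ S → y ∈ S) (hc : IsClosed (f.toFun ⁻¹' S)) : IsClosed S := by
  have hmk : ∀ {y : β}, (Quotient.mk (MulAction.orbitRel H β) y) ∈
      Quotient.mk (MulAction.orbitRel H β) '' S → y ∈ S := by
    rintro y ⟨z, hz, hzy⟩
    have h1 : z ∈ MulAction.orbit H y := Quotient.exact hzy
    obtain ⟨h, rfl⟩ := h1
    exact hS h y hz
  have h2 : IsQuotientMap (f.orbitMap ∘ Quotient.mk (MulAction.orbitRel G α)) :=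
    hq.comp isQuotientMap_quotient_mk'
  have h3 : IsClosed (Quotient.mk (MulAction.orbitRel H β) '' S) := by
    rw [← h2.isClosed_preimage]
    convert hc using 1
    ext x
    exact ⟨fun h => hmk h, fun h => ⟨_, h, rfl⟩⟩
  have h4 := h3.preimage (continuous_quotient_mk' (s := MulAction.orbitRel H β))
  convert h4 using 1
  ext y
  exact ⟨fun h => ⟨_, h, rfl⟩, fun h => hmk h⟩

/-- An open overlap inside an n-dimensional cell gives all dimensions that the common image
condition compares. -/
lemma common_images_eq (hf : f.IsTropical ωX ωY n) (ht : t ∈ Y.cells) (hd : Y.dim t = n)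
    {X' : PolyComplex α}
    (hcommon : ∀ s ∈ X'.cells, ∀ s' ∈ X'.cells, ∀ (h : H) (d : ℕ),
      Y.HasDim (f.toFun '' s ∩ h • (f.toFun '' s')) d → Y.HasDim (f.toFun '' s) d →
      Y.HasDim (h • (f.toFun '' s')) d → f.toFun '' s = h • (f.toFun '' s'))
    {s s' : Set α} (hs : s ∈ X'.cells) (hs' : s' ∈ X'.cells) {h : H} (hst : f.toFun '' s ⊆ t)
    (hst' : h • f.toFun '' s' ⊆ t) {V : Set β} (hV : IsOpen V) (hne : V.Nonempty)
    (hVs : V ⊆ f.toFun '' s) (hVs' : V ⊆ h • f.toFun '' s') :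
    f.toFun '' s = h • f.toFun '' s' := by
  have hopen := hf.target.isOpen_relInt ht hd
  exact hcommon s hs s' hs' h (Y.dim t)
    (PolyComplex.hasDim_of_open_subset ht hopen (inter_subset_left.trans hst) hV hne
      (subset_inter hVs hVs'))
    (PolyComplex.hasDim_of_open_subset ht hopen hst hV hne hVs)
    (PolyComplex.hasDim_of_open_subset ht hopen hst' hV hne hVs')

/-- If the translates of a good cell accumulate on the image of a point, then this image is
attained. -/
lemma exists_mem_of_accumulation (hf : f.IsTropical ωX ωY n) (hs : f.IsGood n s) {P P₂ : α}
    {X' : PolyComplex α} (hX' : X'.IsRefinement X)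
    (hcommon : ∀ s ∈ X'.cells, ∀ s' ∈ X'.cells, ∀ (h : H) (d : ℕ),
      Y.HasDim (f.toFun '' s ∩ h • (f.toFun '' s')) d → Y.HasDim (f.toFun '' s) d →
      Y.HasDim (h • (f.toFun '' s')) d → f.toFun '' s = h • (f.toFun '' s'))
    (hP₂ : P₂ ∈ X'.star (X'.cellOf P)) {r : Set α} (hr : f.IsGood n r) (hP₂r : P₂ ∈ X.relInt r)
    {h : H} (hP₂s : f.toFun P₂ ∈ h • f.toFun '' X.relInt s) :
    f.toFun P ∈ h • f.toFun '' s := by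
  have hYo := hf.target.orbitSpace
  have hs_open := hf.source.isOpen_relInt hs.mem hs.dim_eq
  have hr_open := hf.source.isOpen_relInt hr.mem hr.dim_eq
  have hst : h • tgt X Y f.toFun s = tgt X Y f.toFun r := by
    rw [smul_tgt_of_mem_relInt hYo hs.mem hP₂s, f.isCellMap.cellOf_map,
      PolyComplex.cellOf_eq hr.mem hP₂r]
  have hsub : ∀ {r : Set α} (hr : f.IsGood n r) {s₁ O : Set α} (hs₁ : s₁ ∈ X'.cells)
      (hO : O.Nonempty) (hOs₁ : O ⊆ s₁) (hOr : O ⊆ X.relInt r), s₁ ⊆ r := by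
    intro r hr s₁ O hs₁ hO hOs₁ hOr
    obtain ⟨t₁, ht₁, hst₁⟩ := (hX' s₁ hs₁).1
    obtain ⟨z, hz⟩ := hO
    have := hf.source.eq_of_subset hr.mem hr.dim_eq ht₁
      (PolyComplex.subset_of_mem_relInt hr.mem ht₁ (hOr hz) (hst₁ (hOs₁ hz)))
    rwa [this]
  set O₂ := (X'.star (X'.cellOf P) ∩ X.relInt r) ∩ f.toFun ⁻¹' (h • f.toFun '' X.relInt s)
    with hO₂
  have hO₂open : IsOpen O₂ := ((X'.star_open _ (X'.cellOf_mem P)).inter hr_open).inter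
    ((hf.isOpen_image_of_isGood hs h hs_open Subset.rfl).preimage f.continuous)
  -- A cell of the refinement that contains `P` and an open piece near `P₂` whose image lies in the
  -- translated image of `s`.
  obtain ⟨s₂, hs₂, hPs₂, O₃, hO₃, hO₃open, hO₃ne, hO₃s₂⟩ :=
    PolyComplex.exists_cell_open_subset (X'.cellOf_mem P) hO₂open ⟨P₂, ⟨hP₂, hP₂r⟩, hP₂s⟩
      (inter_subset_left.trans inter_subset_left)
  have hO₃r : O₃ ⊆ X.relInt r := fun x hx => (hO₃ hx).1.2
  have hU : IsOpen (h⁻¹ • f.toFun '' O₃) := hf.isOpen_image_of_isGood hr h⁻¹ hO₃open hO₃r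
  set O₄ := X.relInt s ∩ f.toFun ⁻¹' (h⁻¹ • f.toFun '' O₃) with hO₄
  have hO₄open : IsOpen O₄ := hs_open.inter (hU.preimage f.continuous)
  obtain ⟨x, hx⟩ : O₄.Nonempty := by
    obtain ⟨z, hz⟩ := hO₃ne
    obtain ⟨x, hx, hxz⟩ := mem_smul_image.mp (hO₃ hz).2
    exact ⟨x, hx, mem_smul_image.mpr ⟨z, hz, by rw [← hxz, inv_smul_smul]⟩⟩
  obtain ⟨s₁, hs₁, -, O₅, hO₅, hO₅open, hO₅ne, hO₅s₁⟩ :=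
    PolyComplex.exists_cell_open_subset (X := X') (X'.cellOf_mem x)
      (hO₄open.inter (X'.star_open _ (X'.cellOf_mem x)))
      ⟨x, hx, PolyComplex.relInt_subset_star (X'.cellOf_mem x) (X'.mem_relInt_cellOf x)⟩
      inter_subset_right
  have hO₅s : O₅ ⊆ X.relInt s := fun z hz => (hO₅ hz).1.1
  have hs₁s := hsub hs hs₁ hO₅ne hO₅s₁ hO₅s
  have hs₂r := hsub hr hs₂ hO₃ne hO₃s₂ hO₃r
  -- The cell `s₂` around `P` and the cell `s₁` inside `s` have openly overlapping images, hence
  -- equal ones; so the image of `P` already lies in the translate of `f(s)`.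
  have heq := common_images_eq hf (f.isCellMap.tgt_mem hr.mem) hr.dim_tgt hcommon hs₂ hs₁ (h := h)
    (image_subset_iff.mpr fun z hz => f.isCellMap.mapsTo hr.mem (hs₂r hz))
    (hst ▸ smul_set_mono (image_subset_iff.mpr fun z hz => f.isCellMap.mapsTo hs.mem (hs₁s hz)))
    (hf.isOpen_image_of_isGood hs h hO₅open hO₅s) (hO₅ne.image _).smul_set
    (by
      intro y hy
      obtain ⟨z, hz, rfl⟩ := mem_smul_image.mp hy
      obtain ⟨z', hz', hzz'⟩ := mem_smul_image.mp (hO₅ hz).1.2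
      exact ⟨z', hO₃s₂ hz', by rw [← hzz', smul_inv_smul]⟩)
    (smul_set_mono (image_mono hO₅s₁))
  have h1 : f.toFun P ∈ f.toFun '' s₂ := ⟨P, hPs₂ (X'.mem_cellOf P), rfl⟩
  rw [heq] at h1
  exact smul_set_mono (image_mono hs₁s) h1

/-- Suppose Q is a limit point of f(s) outside f(s). A generic segment from Q runs inside the image
of the relative interior of s except at Q. The H-orbit S of the segment without Q is not closed, so
neither is its preimage in X: some P is a limit of points mapped into S while f(P) is not in S.
Nearby points are mapped to translates of the segment by one of finitely many elements, and
shrinking the neighbourhood forces f(P) = h Q. As the segment avoids the walls, these nearby points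
lie in good cells, and the common refinement gives h Q in h f(s), a contradiction. -/
theorem IsTropical.isClosed_image (hf : f.IsTropical ωX ωY n) (hq : IsQuotientMap f.orbitMap)
    (hs : f.IsGood n s) : IsClosed (f.toFun '' s) := by
  have hYo := hf.target.orbitSpace
  set t := tgt X Y f.toFun s with ht_def
  have ht : t ∈ Y.cells := f.isCellMap.tgt_mem hs.mem
  have hFt : f.toFun '' s ⊆ t := image_subset_iff.mpr (f.isCellMap.mapsTo hs.mem)
  have hFrel : f.toFun '' X.relInt s ⊆ Y.relInt t :=
    image_subset_iff.mpr (f.isCellMap.mapsTo_relInt hs.mem)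
  obtain ⟨hconv, hint, hne⟩ := hf.image_chart_of_isGood hs (one_smul H t)
  rw [one_smul] at hconv hint hne
  rw [one_smul] at hint
  obtain ⟨W, hW⟩ := hf.exists_isWallSet ht
  refine isClosed_of_closure_subset fun Q hQ => ?_
  by_contra hQs
  have hQt : Q ∈ t := closure_minimal hFt (PolyComplex.isClosed_cell ht) hQ
  set p := Y.chart t Q with hp_def
  have hp : p ∈ closure (Y.chart t '' (f.toFun '' s)) :=
    ((PolyComplex.chart_continuousOn ht Q hQt).mono hFt).mem_closure_image hQ
  obtain ⟨q, hqint, hqW⟩ := exists_mem_notMem_affineSubspaces hW.finite wallSpace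
    (fun w hw => wallSpace_ne_top (hW.ne_zero w hw)) isOpen_interior hne
  have hpq : p ≠ q := by
    rintro h
    obtain ⟨y, hy, hyq⟩ := interior_subset hqint
    rw [← h] at hyq
    exact hQs (PolyComplex.chart_injOn ht (hFt hy) hQt hyq ▸ hy)
  let γ : ℝ → Fin (Y.dim t) → ℝ := fun c => p + c • (q - p)
  have hγ : Continuous γ := by fun_prop
  have hγinj : Function.Injective γ := by
    intro c c' h
    have h1 : c • (q - p) = c' • (q - p) := add_left_cancel h
    exact smul_left_injective ℝ (sub_ne_zero.mpr hpq.symm) h1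
  let R : ℝ → β := fun c => Y.chartInv t Q (γ c)
  have hγint : ∀ c, 0 < c → c ≤ 1 → R c ∈ f.toFun '' X.relInt s ∧ Y.chart t (R c) = γ c := by
    intro c hc hc'
    have h1 := hconv.add_smul_sub_mem_interior' hp hqint ⟨hc, hc'⟩
    rw [← hint] at h1
    obtain ⟨y, hy, hyc⟩ := h1
    have h2 : R c = y := by
      change Y.chartInv t Q (p + c • (q - p)) = y
      rw [← hyc]
      exact PolyComplex.chartInv_chart ht (hFrel hy).1
    rw [h2]
    exact ⟨hy, hyc⟩
  -- The segment is shortened so that it meets no wall and no stabilizing element of `t` carries one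
  -- of its points back to `Q`.
  obtain ⟨s₀, hs₀, hs₁, hbad⟩ := exists_pos_forall_notMem (B :=
    (⋃ w ∈ W, {c : ℝ | intForm w.1 (p + c • (q - p)) = w.2}) ∪
    ⋃ h ∈ {h : H | h • t = t}, {c : ℝ | 0 < c ∧ c ≤ 1 ∧ h • R c = Q})
    ((hW.finite.biUnion fun w hw => finite_segment_wall (hqW w hw)).union
      ((hf.finite_stab t ht hs.dim_tgt).biUnion fun h _ => Set.Subsingleton.finite fun c hc c' hc' =>
        hγinj (by
          rw [← (hγint c hc.1 hc.2.1).2, ← (hγint c' hc'.1 hc'.2.1).2,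
            MulAction.injective h (hc.2.2.trans hc'.2.2.symm)])))
  set K := t ∩ Y.chart t ⁻¹' (γ '' Icc 0 s₀) with hK
  have hKclosed : IsClosed K := (PolyComplex.chart_continuousOn ht).preimage_isClosed_of_isClosed
    (PolyComplex.isClosed_cell ht) (isCompact_Icc.image hγ).isClosed
  have hRK : ∀ c, 0 < c → c ≤ s₀ → R c ∈ K := fun c hc hc' =>
    have h1 := hγint c hc (hc'.trans hs₁)
    ⟨(hFrel h1.1).1, c, ⟨hc.le, hc'⟩, h1.2.symm⟩
  -- The H-orbit of the half-open segment; `K` is the closed segment, so a point of `h • K` outside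
  -- `S` must be `h • Q`.
  set S : Set β := {y | ∃ (h : H) (c : ℝ), 0 < c ∧ c ≤ s₀ ∧ y = h • R c} with hS
  have hKS : ∀ (h : H), ∀ y ∈ K, h • y ∉ S → y = Q := by
    rintro h y ⟨hyt, c, ⟨hc, hc'⟩, hcy⟩ hyS
    rcases hc.eq_or_lt with rfl | hc
    · refine PolyComplex.chart_injOn ht hyt hQt ?_
      rw [← hcy]
      simp [γ, p]
    · refine absurd ⟨h, c, hc, hc', ?_⟩ hyS
      congr 1
      have h1 := hγint c hc (hc'.trans hs₁)
      exact PolyComplex.chart_injOn ht hyt (hFrel h1.1).1 (hcy.symm.trans h1.2.symm)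
  have hcell : ∀ (h : H) (c : ℝ), 0 < c → c ≤ s₀ → Y.cellOf (h • R c) = h • t := by
    intro h c hc hc'
    rw [hYo.cellOf_smul, PolyComplex.cellOf_eq ht (hFrel (hγint c hc (hc'.trans hs₁)).1)]
  have hQS : Q ∉ S := by
    rintro ⟨h, c, hc, hc', hQc⟩
    have h1 : h • t ⊆ t := by
      rw [← hcell h c hc hc', ← hQc]
      exact PolyComplex.cellOf_subset ht hQt
    have h2 := hf.target.eq_of_subset (hYo.smul_mem h t ht)
      ((hYo.dim_smul h ht).trans hs.dim_tgt) ht h1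
    exact hbad c hc hc' (Or.inr (mem_biUnion (x := h) h2 ⟨hc, hc'.trans hs₁, hQc.symm⟩))
  have hQcl : Q ∈ closure S := by
    have hsub : R '' Ioc 0 s₀ ⊆ S := by
      rintro _ ⟨c, hc, rfl⟩
      exact ⟨1, c, hc.1, hc.2, (one_smul H _).symm⟩
    refine closure_mono hsub (mem_closure_of_embedding (Y.chart_embedding t ht) ?_ hQt ?_)
    · rintro _ ⟨c, hc, rfl⟩
      exact (hRK c hc.1 hc.2).1
    · have h1 : Y.chart t '' (R '' Ioc 0 s₀) = γ '' Ioc 0 s₀ := by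
        rw [image_image]
        exact image_congr fun c hc => (hγint c hc.1 (hc.2.trans hs₁)).2
      rw [h1]
      refine image_closure_subset_closure_image hγ ⟨0, ?_, by simp [γ, p]⟩
      rw [closure_Ioc hs₀.ne]
      exact ⟨le_rfl, hs₀.le⟩
  have hSinv : ∀ h : H, ∀ y, h • y ∈ S → y ∈ S := by
    rintro h y ⟨h', c, hc, hc', hy⟩
    exact ⟨h⁻¹ * h', c, hc, hc', by rw [mul_smul, ← hy, inv_smul_smul]⟩
  obtain ⟨P, hP, hPS⟩ : ∃ P ∈ closure (f.toFun ⁻¹' S), f.toFun P ∉ S := by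
    by_contra! hcon
    exact hQS ((isClosed_of_isClosed_preimage hq hSinv
      (isClosed_of_closure_subset hcon)).closure_subset hQcl)
  obtain ⟨X', hX', hcommon⟩ := f.common_images
  set u := Y.cellOf (f.toFun P) with hu
  have hHf : {h : H | u ⊆ h • t}.Finite :=
    hYo.finite_subset_smul (Y.cellOf_mem _) ht (hf.finite_stab t ht hs.dim_tgt)
  -- The closed union of the finitely many translates of `K` that come near the image of `P` but
  -- whose endpoint is a different point. Removing it leaves a neighbourhood of the image of `P`.
  set D := ⋃ h ∈ {h : H | u ⊆ h • t ∧ h • Q ≠ f.toFun P}, (fun y => h⁻¹ • y) ⁻¹' K with hD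
  have hDclosed : IsClosed D := (hHf.subset fun h hh => hh.1).isClosed_biUnion fun h _ =>
    hKclosed.preimage (hYo.continuous_smul h⁻¹)
  have hPD : f.toFun P ∉ D := by
    intro hPD
    obtain ⟨h, hh, hPK⟩ := by simpa only [hD, mem_iUnion₂] using hPD
    have := hKS h _ hPK (by rwa [smul_inv_smul])
    exact hh.2 (by rw [← this, smul_inv_smul])
  set O := X'.star (X'.cellOf P) ∩ f.toFun ⁻¹' (Y.star u ∩ Dᶜ) with hO
  have hOopen : IsOpen O := (X'.star_open _ (X'.cellOf_mem P)).inter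
    (((Y.star_open _ (Y.cellOf_mem _)).inter hDclosed.isOpen_compl).preimage f.continuous)
  have hPO : P ∈ O := ⟨PolyComplex.relInt_subset_star (X'.cellOf_mem P) (X'.mem_relInt_cellOf P),
    PolyComplex.relInt_subset_star (Y.cellOf_mem _) (Y.mem_relInt_cellOf _), hPD⟩
  obtain ⟨P₂, hP₂O, h, c, hc, hc', hP₂⟩ := mem_closure_iff.mp hP O hOopen hPO
  have hcellP₂ : Y.cellOf (f.toFun P₂) = h • t := by rw [hP₂, hcell h c hc hc']
  have huh : u ⊆ h • t := by
    rw [← hcellP₂]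
    exact PolyComplex.mem_star_iff.mp hP₂O.2.1
  have hhQ : h • Q = f.toFun P := by
    by_contra hne
    refine hP₂O.2.2 (mem_biUnion (x := h) ⟨huh, hne⟩ ?_)
    change h⁻¹ • f.toFun P₂ ∈ K
    rw [hP₂, inv_smul_smul]
    exact hRK c hc hc'
  have hr := X.cellOf_mem P₂
  have htgt : tgt X Y f.toFun (X.cellOf P₂) = h • t := by rw [← f.isCellMap.cellOf_map, hcellP₂]
  -- A degenerate cell through `P₂` would put the segment point `R c` on a wall.
  have hgood : f.IsGood n (X.cellOf P₂) := by
    refine isGood_of_not_isDegenerate hf.source hr ?_ fun hdeg => ?_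
    · rw [htgt, hYo.dim_smul h ht, hs.dim_tgt]
    · obtain ⟨w, hw, hw'⟩ := hW.degenerate _ hr h⁻¹ (by rw [htgt, inv_smul_smul]) hdeg (R c)
        (mem_smul_image.mpr ⟨P₂, X.mem_cellOf P₂, by rw [hP₂, inv_smul_smul]⟩)
      rw [(hγint c hc (hc'.trans hs₁)).2] at hw'
      exact hbad c hc hc' (Or.inl (mem_biUnion (x := w) hw hw'))
  have hfinal := exists_mem_of_accumulation hf hs hX' hcommon hP₂O.1 hgood
    (X.mem_relInt_cellOf P₂) (h := h) (by
      rw [hP₂]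
      exact smul_mem_smul_set (hγint c hc (hc'.trans hs₁)).1)
  rw [← hhQ, smul_mem_smul_set_iff] at hfinal
  exact hQs hfinal

end OrbitMorphism

/-! ### Crossing a wall inside a top-dimensional cell -/

lemma Generates.exists_real {q r : ℕ} {u : Fin q → ℤ} {J : Matrix (Fin q) (Fin r) ℤ}
    (h : Generates u J) (d : Fin q → ℝ) :
    ∃ (k : ℝ) (y : Fin r → ℝ), d = k • rvec u + (rmat J).mulVec y := by
  choose k y hky using fun i : Fin q => h (Pi.single i 1)
  refine ⟨∑ i, d i * k i, ∑ i, d i • rvec (y i), ?_⟩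
  have h1 : d = ∑ i, d i • rvec (Pi.single i 1 : Fin q → ℤ) := by
    funext j
    simp [rvec, Finset.sum_apply, Pi.single_apply]
  have h2 : ∀ i, d i • rvec (Pi.single i 1 : Fin q → ℤ)
      = (d i * k i) • rvec u + (rmat J).mulVec (d i • rvec (y i)) := by
    intro i
    rw [hky i, Matrix.mulVec_smul, rmat_mulVec_rvec, mul_smul, ← smul_add]
    congr 1
    funext j
    simp [rvec]
  calc d = ∑ i, d i • rvec (Pi.single i 1 : Fin q → ℤ) := h1
    _ = ∑ i, ((d i * k i) • rvec u + (rmat J).mulVec (d i • rvec (y i))) :=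
      Finset.sum_congr rfl fun i _ => h2 i
    _ = _ := by
      rw [Finset.sum_add_distrib, ← Finset.sum_smul]
      congr 1
      exact (map_sum (rmat J).mulVecLin _ _).symm

namespace PolyComplex

variable {α : Type u} [TopologicalSpace α] {X : PolyComplex α} {r s t : Set α} {x : α}

/-- Coordinates of a cell `s` around one of its facets `r`: the chart of `r` and the primitive
normal vector generate the lattice of `s`. -/
lemma exists_facet_coords (hr : r ∈ X.cells) (hs : s ∈ X.cells) (hrs : r ⊆ s)
    {w : Fin (X.starDim r) → ℤ} (hw : IsPrimitiveNormal (starCone X r r) (starCone X r s) w)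
    {Jr : Matrix (Fin (X.starDim r)) (Fin (X.dim r)) ℤ} {br : Fin (X.starDim r) → ℝ}
    {Kr : Matrix (Fin (X.dim r)) (Fin (X.starDim r)) ℤ}
    (hJr : ∀ x ∈ r ∩ X.star r, X.starChart r x = (rmat Jr).mulVec (X.chart r x) + br)
    (hKJr : Kr * Jr = 1)
    (hspanr : Submodule.span ℝ (starCone X r r) = LinearMap.range (rmat Jr).mulVecLin) :
    ∃ (J : Matrix (Fin (X.starDim r)) (Fin (X.dim s)) ℤ) (b : Fin (X.starDim r) → ℝ)
      (K : Matrix (Fin (X.dim s)) (Fin (X.starDim r)) ℤ) (c₀ : Fin (X.dim s) → ℝ),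
      (∀ x ∈ s ∩ X.star r, X.starChart r x = (rmat J).mulVec (X.chart s x) + b) ∧
      (∃ c, ∀ x ∈ s ∩ X.star r, X.chart s x = (rmat K).mulVec (X.starChart r x) + c) ∧
      J * (K * Jr) = Jr ∧ J.mulVec (K.mulVec w) = w ∧
      Generates (K.mulVec w) (K * Jr) ∧
      (∀ z ∈ X.relInt r, X.chart s z = (rmat (K * Jr)).mulVec (X.chart r z) + c₀) ∧
      ∀ x ∈ s ∩ X.star r, x ∉ r → ∀ P ∈ X.relInt r, ∃ (k : ℝ) (y : Fin (X.dim r) → ℝ), 0 < k ∧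
        X.chart s x - X.chart s P = k • rvec (K.mulVec w) + (rmat (K * Jr)).mulVec y := by
  obtain ⟨J, b, K, c, hJ, hK, hKJ, -, hspan⟩ := exists_star_coords hr hs hrs
  have hrange : ∀ v, rvec v ∈ Submodule.span ℝ (starCone X r s) → v = J.mulVec (K.mulVec v) :=
    fun v hv => (rvec_mem_range_iff hKJ).mp (hspan ▸ hv)
  have hcone : starCone X r r ⊆ starCone X r s := image_mono (inter_subset_inter_left _ hrs)
  have hrel : X.relInt r = r ∩ X.star r := (inter_star_self hr).symm
  have hJJr : J * (K * Jr) = Jr := by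
    refine Matrix.ext_of_mulVec_single fun i => ?_
    rw [← Matrix.mulVec_mulVec, ← Matrix.mulVec_mulVec]
    refine (hrange _ (Submodule.span_mono hcone ?_)).symm
    rw [hspanr]
    exact ⟨rvec (Pi.single i 1), rmat_mulVec_rvec _ _⟩
  refine ⟨J, b, K, (rmat K).mulVec br + c, hJ, ⟨c, hK⟩, hJJr, (hrange w hw.rvec_mem).symm,
    ?_, ?_, ?_⟩
  · intro z
    obtain ⟨k, hk⟩ := hw.exists_sub_mem (v := J.mulVec z) (by
      rw [hspan]
      exact ⟨rvec z, rmat_mulVec_rvec _ _⟩)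
    rw [hspanr] at hk
    have h1 : rvec (J.mulVec z) - (k : ℝ) • rvec w = rvec (J.mulVec z - k • w) := by
      funext i
      simp [rvec]
    rw [h1, rvec_mem_range_iff hKJr] at hk
    refine ⟨k, Kr.mulVec (J.mulVec z - k • w), ?_⟩
    have h2 := congrArg K.mulVec hk
    rw [Matrix.mulVec_sub, Matrix.mulVec_mulVec, hKJ, Matrix.one_mulVec, Matrix.mulVec_smul,
      Matrix.mulVec_mulVec] at h2
    rw [← h2]
    abel
  · intro z hz
    have hz' : z ∈ r ∩ X.star r := hrel ▸ hz
    rw [hK z ⟨hrs hz'.1, hz'.2⟩, hJr z hz', Matrix.mulVec_add, Matrix.mulVec_mulVec, rmat_mul,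
      add_assoc]
  · intro x hx hxr P hP
    have hP' : P ∈ r ∩ X.star r := hrel ▸ hP
    obtain ⟨k, hk, hmem⟩ := hw.exists_smul (x := X.starChart r x) ⟨x, hx, rfl⟩ (by
      rintro ⟨z, hz, hzx⟩
      exact hxr (starChart_injOn hr hz.2 hx.2 hzx ▸ hz.1))
    have hmem' := Submodule.sub_mem _ hmem
      (Submodule.subset_span (show X.starChart r P ∈ starCone X r r from ⟨P, hP', rfl⟩))
    rw [hspanr] at hmem'
    obtain ⟨y, hy⟩ := hmem'
    refine ⟨k, y, hk, ?_⟩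
    rw [hK x hx, hK P ⟨hrs hP'.1, hP'.2⟩, add_sub_add_right_eq_sub, ← Matrix.mulVec_sub, rmat_mul,
      ← Matrix.mulVec_mulVec]
    have hy' : (rmat Jr).mulVec y = X.starChart r x - k • rvec w - X.starChart r P := hy
    rw [hy', ← rmat_mulVec_rvec, ← Matrix.mulVec_smul, ← Matrix.mulVec_add]
    congr 1
    abel

/-- An integral linear form that exhibits `r` as a face of `s`. -/
lemma exists_face_form (hr : r ∈ X.cells) (hs : s ∈ X.cells) (hrs : r ⊆ s) :
    ∃ (a : Fin (X.dim s) → ℤ) (p : ℝ), (∀ z ∈ s, p ≤ intForm a (X.chart s z)) ∧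
      ∀ z ∈ s, intForm a (X.chart s z) = p ↔ z ∈ r := by
  have hinter : s ∩ r = r := inter_eq_right.mpr hrs
  obtain ⟨-, ⟨a, p, hle, heq⟩, -⟩ := X.inter_mem s hs r hr (by
    rw [hinter]
    exact cell_nonempty hr)
  rw [hinter] at heq
  refine ⟨a, p, fun z hz => hle _ ⟨z, hz, rfl⟩, fun z hz => ?_⟩
  constructor
  · intro h
    have h1 : X.chart s z ∈ X.chart s '' r := heq ▸ ⟨⟨z, hz, rfl⟩, h⟩
    obtain ⟨z', hz', hzz'⟩ := h1
    exact chart_injOn hs (hrs hz') hz hzz' ▸ hz'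
  · intro h
    have h1 : X.chart s z ∈ X.chart s '' r := ⟨z, h, rfl⟩
    rw [heq] at h1
    exact h1.2

/-- Near a point of the relative interior of the facet `r`, the cell `s` is a half space. -/
lemma eventually_mem_halfspace (hr : r ∈ X.cells) (hs : s ∈ X.cells) (hrs : r ⊂ s) {P : α}
    (hP : P ∈ X.relInt r) {J : Matrix (Fin (X.dim s)) (Fin (X.dim r)) ℝ}
    {c₀ u : Fin (X.dim s) → ℝ} (hJ : ∀ z ∈ X.relInt r, X.chart s z = J.mulVec (X.chart r z) + c₀)
    (hx : x ∈ s) (hxr : x ∉ r) {k₀ : ℝ} {y₀ : Fin (X.dim r) → ℝ} (hk₀ : 0 < k₀)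
    (hxP : X.chart s x - X.chart s P = k₀ • u + J.mulVec y₀) (k : ℝ) (y : Fin (X.dim r) → ℝ) :
    (0 ≤ k → ∀ᶠ c : ℝ in 𝓝[>] 0,
      X.chart s P + c • (k • u + J.mulVec y) ∈ X.chart s '' s) ∧
    (k < 0 → ∀ c : ℝ, 0 < c → X.chart s P + c • (k • u + J.mulVec y) ∉ X.chart s '' s) := by
  have hopen : ∀ d : Fin (X.dim r) → ℝ, ∀ᶠ c : ℝ in 𝓝[>] 0,
      X.chart r P + c • d ∈ interior (X.chart r '' r) := by
    intro d
    have h1 : Filter.Tendsto (fun c : ℝ => X.chart r P + c • d) (𝓝 0) (𝓝 (X.chart r P)) := by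
      have : Continuous fun c : ℝ => X.chart r P + c • d := by fun_prop
      simpa using this.tendsto 0
    exact nhdsWithin_le_nhds (h1.eventually (isOpen_interior.mem_nhds hP.2))
  have hmem : ∀ d : Fin (X.dim r) → ℝ, X.chart r P + d ∈ interior (X.chart r '' r) →
      ∃ z ∈ X.relInt r, X.chart s z = X.chart s P + J.mulVec d := by
    intro d hd
    rw [← X.image_relInt] at hd
    obtain ⟨z, hz, hzd⟩ := hd
    refine ⟨z, hz, ?_⟩
    rw [hJ z hz, hJ P hP, hzd, Matrix.mulVec_add]
    abel
  constructor
  · intro hk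
    set a := k / k₀ with ha_def
    have ha : 0 ≤ a := div_nonneg hk hk₀.le
    have hak : a * k₀ = k := div_mul_cancel₀ k hk₀.ne'
    -- the point is a convex combination of `x` and of a point of the relative interior of `r`
    have h2 : ∀ᶠ c : ℝ in 𝓝 0, (1 - c * a : ℝ) ∈ Ioi 0 := by
      have : Continuous fun c : ℝ => 1 - c * a := by fun_prop
      have := this.tendsto 0
      simp only [zero_mul, sub_zero] at this
      exact this.eventually (isOpen_Ioi.mem_nhds (show (0 : ℝ) < 1 from one_pos))
    have h1 : ∀ᶠ c : ℝ in 𝓝 0, X.chart r P + (c * (1 - c * a)⁻¹) • (y - a • y₀)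
        ∈ interior (X.chart r '' r) := by
      have h3 : Filter.Tendsto (fun c : ℝ => X.chart r P + (c * (1 - c * a)⁻¹) • (y - a • y₀))
          (𝓝 0) (𝓝 (X.chart r P)) := by
        have : ContinuousAt (fun c : ℝ => X.chart r P + (c * (1 - c * a)⁻¹) • (y - a • y₀)) 0 := by
          refine continuousAt_const.add (ContinuousAt.smul (continuousAt_id.mul
            (ContinuousAt.inv₀ (by fun_prop) (by simp))) continuousAt_const)
        simpa [ContinuousAt] using this
      exact h3.eventually (isOpen_interior.mem_nhds hP.2)
    filter_upwards [nhdsWithin_le_nhds h1, nhdsWithin_le_nhds h2, self_mem_nhdsWithin]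
      with c hc1 hc2 hc
    have hc2' : (0 : ℝ) < 1 - c * a := hc2
    have hc' : (0 : ℝ) < c := hc
    obtain ⟨z, hz, hzc⟩ := hmem _ hc1
    have hconv := convex_image hs (mem_image_of_mem _ (hrs.1 hz.1)) (mem_image_of_mem _ hx)
      hc2'.le (mul_nonneg hc'.le ha) (by ring)
    convert hconv using 1
    have hx' : X.chart s x = X.chart s P + (k₀ • u + J.mulVec y₀) := by
      rw [← hxP]
      abel
    rw [hzc, hx', Matrix.mulVec_smul, Matrix.mulVec_sub, Matrix.mulVec_smul, ← hak]
    generalize J.mulVec y = Y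
    generalize J.mulVec y₀ = Y₀
    funext i
    simp only [Pi.add_apply, Pi.smul_apply, Pi.sub_apply, smul_eq_mul]
    field_simp
    ring
  · rintro hk c hc ⟨x', hx', hx'c⟩
    -- The form that defines the face is constant along `r` and larger at `x`, so it is positive on
    -- `u`; a point with `k < 0` would violate the inequality valid on `s`.
    obtain ⟨a, p, hle, hface⟩ := exists_face_form hr hs hrs.1
    have hJa : ∀ d, intForm a (J.mulVec d) = 0 := by
      intro d
      obtain ⟨c, hc1, hc2⟩ := ((hopen d).and self_mem_nhdsWithin).exists
      obtain ⟨z, hz, hzc⟩ := hmem _ hc1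
      have h1 := (hface z (hrs.1 hz.1)).mpr hz.1
      have h2 := (hface P (hrs.1 hP.1)).mpr hP.1
      rw [hzc, intForm_add, h2, Matrix.mulVec_smul, intForm_smul] at h1
      have h3 : c * intForm a (J.mulVec d) = 0 := by linarith
      exact (mul_eq_zero.mp h3).resolve_left (ne_of_gt hc2)
    have hP0 := (hface P (hrs.1 hP.1)).mpr hP.1
    have hxa : p < intForm a (X.chart s x) :=
      lt_of_le_of_ne (hle x hx) fun h => hxr ((hface x hx).mp h.symm)
    have hua : 0 < intForm a u := by
      have h1 := congrArg (intForm a) hxP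
      rw [intForm_sub, intForm_add, intForm_smul, hJa, hP0] at h1
      have h2 : 0 < k₀ * intForm a u := by linarith
      exact (mul_pos_iff_of_pos_left hk₀).mp h2
    have h1 := hle x' hx'
    rw [hx'c, intForm_add, intForm_smul, intForm_add, intForm_smul, hJa, hP0] at h1
    nlinarith [mul_neg_of_neg_of_pos hk hua, mul_neg_of_pos_of_neg hc
      (mul_neg_of_neg_of_pos hk hua)]

end PolyComplex

open Classical in
/-- Whether the ray from `q` in direction `v` starts inside `D`. -/
def raySide {m : ℕ} (D : Set (Fin m → ℝ)) (q v : Fin m → ℝ) : ℝ :=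
  if ∀ᶠ c : ℝ in 𝓝[>] 0, q + c • v ∈ D then 1 else 0

/-- How the line through `q` in direction `v` enters or leaves `D` at `q`. -/
def crossing {m : ℕ} (D : Set (Fin m → ℝ)) (q v : Fin m → ℝ) : ℝ :=
  raySide D q v - raySide D q (-v)

lemma raySide_of_eventually {m : ℕ} {D : Set (Fin m → ℝ)} {q v : Fin m → ℝ}
    (h : ∀ᶠ c : ℝ in 𝓝[>] 0, q + c • v ∈ D) : raySide D q v = 1 := if_pos h

lemma raySide_of_eventually_notMem {m : ℕ} {D : Set (Fin m → ℝ)} {q v : Fin m → ℝ}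
    (h : ∀ᶠ c : ℝ in 𝓝[>] 0, q + c • v ∉ D) : raySide D q v = 0 := by
  refine if_neg fun h' => ?_
  obtain ⟨c, hc, hc'⟩ := (h.and h').exists
  exact hc hc'

/-! ### Balancing at facets mapped into the interior of a top-dimensional cell. -/

namespace OrbitMorphism

variable {α β : Type*} [TopologicalSpace α] [TopologicalSpace β]
  {X : PolyComplex α} {Y : PolyComplex β} {G H : Type*} [Group G] [Group H]
  [MulAction G α] [MulAction H β] {f : OrbitMorphism X Y G H} {ωX : Set α → ℚ} {ωY : Set β → ℚ}
  {n : ℕ} {r s : Set α} {t : Set β}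

lemma exists_star_matrix (f : OrbitMorphism X Y G H) (hY : IsOrbitSpace Y H) (h : H)
    (hr : r ∈ X.cells) (ht : h • tgt X Y f.toFun r = t) :
    MapsTo (fun x => h • f.toFun x) (X.star r) (Y.star t) ∧
    ∃ (D : Matrix (Fin (Y.starDim t)) (Fin (X.starDim r)) ℤ) (e : Fin (Y.starDim t) → ℝ),
      ∀ x ∈ X.star r, Y.starChart t (h • f.toFun x) = (rmat D).mulVec (X.starChart r x) + e := by
  have h1 := (f.isCellMap_smul hY h).star_affine hr
  have h2 := (f.isCellMap_smul hY h).mapsTo_star hr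
  rw [f.tgt_smul hY h hr] at h1 h2
  subst ht
  exact ⟨h2, h1⟩

lemma matrix_eqOn_of_relInt (f : OrbitMorphism X Y G H) (hY : IsOrbitSpace Y H) (hs : s ∈ X.cells)
    {h : H} (hst : h • tgt X Y f.toFun s = t)
    {A : Matrix (Fin (Y.dim t)) (Fin (X.dim s)) ℤ} {b : Fin (Y.dim t) → ℝ}
    (hA : ∀ x ∈ X.relInt s, Y.chart t (h • f.toFun x) = (rmat A).mulVec (X.chart s x) + b) :
    ∀ x ∈ s, Y.chart t (h • f.toFun x) = (rmat A).mulVec (X.chart s x) + b := by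
  have ht : t ∈ Y.cells := hst ▸ hY.smul_mem h _ (f.isCellMap.tgt_mem hs)
  refine mulVec_eqOn_of_dense (X.relInt_subset s) (PolyComplex.subset_closure_relInt hs)
    (PolyComplex.chart_continuousOn hs) ?_ hA
  refine (PolyComplex.chart_continuousOn ht).comp
    ((hY.continuous_smul h).comp f.continuous).continuousOn fun x hx => ?_
  rw [← hst]
  exact smul_mem_smul_set (f.isCellMap.mapsTo hs hx)

lemma smul_tgt_eq_of_subset (hY : IsTropicalOrbitSpace Y H n ωY) (f : OrbitMorphism X Y G H)
    (hr : r ∈ X.cells) (hs : s ∈ X.cells) (hrs : r ⊆ s) {h : H}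
    (htgt : h • tgt X Y f.toFun r = t) (htd : Y.dim t = n) : h • tgt X Y f.toFun s = t := by
  have hmem := hY.orbitSpace.smul_mem h _ (f.isCellMap.tgt_mem hr)
  have hmem' := hY.orbitSpace.smul_mem h _ (f.isCellMap.tgt_mem hs)
  refine (hY.eq_of_subset (htgt ▸ hmem) htd hmem' ?_).symm
  rw [← htgt]
  exact smul_set_mono (f.isCellMap.tgt_mono hr hs hrs)

/-- A top-dimensional cell has its relative interior as star, so its own chart replaces the star
chart. One matrix then describes the translate of `f` on all cells around `r` simultaneously, and
this is what links them. -/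
lemma exists_star_matrix_of_top (hY : IsTropicalOrbitSpace Y H n ωY) (f : OrbitMorphism X Y G H)
    (h : H) (hr : r ∈ X.cells) (ht : h • tgt X Y f.toFun r = t) (htd : Y.dim t = n) :
    ∃ (D : Matrix (Fin (Y.dim t)) (Fin (X.starDim r)) ℤ) (e : Fin (Y.dim t) → ℝ),
      ∀ x ∈ X.star r, Y.chart t (h • f.toFun x) = (rmat D).mulVec (X.starChart r x) + e := by
  have htm : t ∈ Y.cells := ht ▸ hY.orbitSpace.smul_mem h _ (f.isCellMap.tgt_mem hr)
  obtain ⟨h1, h2⟩ := f.exists_star_matrix hY.orbitSpace h hr ht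
  rw [hY.star_eq_relInt htm htd] at h1
  have h3 := ((PolyComplex.relInt_starChart_affine htm htm Subset.rfl).2.comp h1)
  exact IntAffineOn.trans (F' := fun x => Y.starChart t (h • f.toFun x)) h2 h3

lemma ray_mem_image_iff {h : H} {P : α}
    {A : Matrix (Fin (Y.dim t)) (Fin (X.dim s)) ℤ} {b : Fin (Y.dim t) → ℝ}
    (hA : ∀ x ∈ s, Y.chart t (h • f.toFun x) = (rmat A).mulVec (X.chart s x) + b)
    {B : Matrix (Fin (X.dim s)) (Fin (Y.dim t)) ℝ} (hBA : B * rmat A = 1) (hP : P ∈ s)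
    (d : Fin (X.dim s) → ℝ) (c : ℝ) :
    Y.chart t (h • f.toFun P) + c • (rmat A).mulVec d ∈ Y.chart t '' (h • f.toFun '' s) ↔
      X.chart s P + c • d ∈ X.chart s '' s := by
  rw [hA P hP, add_right_comm, ← Matrix.mulVec_smul, ← Matrix.mulVec_add]
  constructor
  · rintro ⟨_, hy, hyc⟩
    obtain ⟨z, hz, rfl⟩ := mem_smul_image.mp hy
    rw [hA z hz, add_left_inj] at hyc
    have := congrArg B.mulVec hyc
    rw [Matrix.mulVec_mulVec, Matrix.mulVec_mulVec, hBA, Matrix.one_mulVec,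
      Matrix.one_mulVec] at this
    exact ⟨z, hz, this⟩
  · rintro ⟨z, hz, hzc⟩
    exact ⟨_, mem_smul_image.mpr ⟨z, hz, rfl⟩, by rw [hA z hz, hzc]⟩

/-- Near `P` the cell is the half space in which the coefficient of the normal `u` is nonnegative.
For `k = 0` both rays stay in the cell and cancel, so the sign is correct in all three cases. -/
lemma crossing_eq (hr : r ∈ X.cells) (hs : f.IsGood n s) (hrs : r ⊂ s)
    {h : H} {P : α} (hP : P ∈ X.relInt r)
    {A : Matrix (Fin (Y.dim t)) (Fin (X.dim s)) ℤ} {b : Fin (Y.dim t) → ℝ}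
    (hA : ∀ x ∈ s, Y.chart t (h • f.toFun x) = (rmat A).mulVec (X.chart s x) + b)
    {B : Matrix (Fin (X.dim s)) (Fin (Y.dim t)) ℝ} (hBA : B * rmat A = 1)
    {J : Matrix (Fin (X.dim s)) (Fin (X.dim r)) ℝ}
    {c₀ u : Fin (X.dim s) → ℝ} (hJ : ∀ z ∈ X.relInt r, X.chart s z = J.mulVec (X.chart r z) + c₀)
    {x : α} (hx : x ∈ s) (hxr : x ∉ r) {k₀ : ℝ} {y₀ : Fin (X.dim r) → ℝ} (hk₀ : 0 < k₀)
    (hxP : X.chart s x - X.chart s P = k₀ • u + J.mulVec y₀) (k : ℝ) (y : Fin (X.dim r) → ℝ) :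
    crossing (Y.chart t '' (h • f.toFun '' s)) (Y.chart t (h • f.toFun P))
      ((rmat A).mulVec (k • u + J.mulVec y)) = SignType.sign k := by
  have hmem := fun (d : Fin (X.dim s) → ℝ) c => ray_mem_image_iff hA hBA (hrs.1 hP.1) d c
  have hplus : ∀ (k : ℝ) (y : Fin (X.dim r) → ℝ), 0 ≤ k →
      raySide (Y.chart t '' (h • f.toFun '' s)) (Y.chart t (h • f.toFun P))
        ((rmat A).mulVec (k • u + J.mulVec y)) = 1 := by
    intro k y hk
    refine raySide_of_eventually ?_
    filter_upwards [(PolyComplex.eventually_mem_halfspace hr hs.mem hrs hP hJ hx hxr hk₀ hxP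
      k y).1 hk] with c hc
    exact (hmem _ c).mpr hc
  have hminus : ∀ (k : ℝ) (y : Fin (X.dim r) → ℝ), k < 0 →
      raySide (Y.chart t '' (h • f.toFun '' s)) (Y.chart t (h • f.toFun P))
        ((rmat A).mulVec (k • u + J.mulVec y)) = 0 := by
    intro k y hk
    refine raySide_of_eventually_notMem ?_
    filter_upwards [self_mem_nhdsWithin] with c hc
    exact fun hc' => (PolyComplex.eventually_mem_halfspace hr hs.mem hrs hP hJ hx hxr hk₀ hxP
      k y).2 hk c hc ((hmem _ c).mp hc')
  have hneg : -(rmat A).mulVec (k • u + J.mulVec y)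
      = (rmat A).mulVec ((-k) • u + J.mulVec (-y)) := by
    rw [← Matrix.mulVec_neg, Matrix.mulVec_neg y, neg_add, neg_smul]
  rw [crossing, hneg]
  rcases lt_trichotomy k 0 with hk | rfl | hk
  · rw [hminus k y hk, hplus (-k) _ (by linarith), sign_neg hk]
    simp
  · rw [hplus 0 y le_rfl, hplus (-0) _ (by simp)]
    simp
  · rw [hplus k y hk.le, hminus (-k) _ (by linarith), sign_pos hk]
    simp

open Classical in
/-- The balancing condition of `X` at a facet whose image lies in the interior of a
top-dimensional cell of `Y`: the number of sheets does not change along a line that crosses it. -/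
lemma IsTropical.finsum_crossing_eq_zero (hf : f.IsTropical ωX ωY n) (htd : Y.dim t = n)
    (hr : r ∈ X.cells) (hrd : X.dim r + 1 = n) {h : H} (htgt : h • tgt X Y f.toFun r = t)
    (hex : ∃ s, f.IsGood n s ∧ r ⊂ s) {P : α} (hP : P ∈ X.relInt r) (v : Fin (Y.dim t) → ℝ) :
    ∑ᶠ s ∈ {s | s ∈ X.above r ∧ f.IsGood n s}, (ωX s * f.idx s) *
      crossing (Y.chart t '' (h • f.toFun '' s)) (Y.chart t (h • f.toFun P)) v = 0 := by
  have hX := hf.source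
  have hXo := hX.orbitSpace
  have hYo := hf.target.orbitSpace
  have ht : t ∈ Y.cells := htgt ▸ hYo.smul_mem h _ (f.isCellMap.tgt_mem hr)
  have hdim : ∀ s ∈ X.above r, X.dim s = n := fun s hs => by
    have := PolyComplex.dim_lt_of_ssubset hr hs.1 hs.2
    have := (hX.pure_dim s hs.1).1
    omega
  have hfix : (fixingSubgroup G r : Set G).Finite := by
    obtain ⟨s₀, hs₀, hrs₀⟩ := hex
    exact (hf.finite_stabilizer_facet hs₀ hr hrs₀.1).subset fun g hg => smul_eq_of_mem_fixing hg
  have hbal := hX.balanced r hr hrd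
  obtain ⟨w, hw, hsum⟩ := hbal.exists_sum_mem hXo hr hfix
    fun g s hs => hX.weight_smul g s hs.1 (hdim s hs)
  obtain ⟨Jr, br, Kr, cr, hJr, -, hKJr, -, hspanr⟩ :=
    PolyComplex.exists_star_coords hr hr Subset.rfl
  obtain ⟨D, e, hD⟩ := exists_star_matrix_of_top hf.target f h hr htgt htd
  -- The form x ↦ det(x, image of the facet) on the chart of `t`: it vanishes along the image of
  -- `r`, and its values on the images of the normal vectors are, up to sign, the lattice indices.
  obtain ⟨ℓ, hℓ, hidx⟩ := exists_side_form (htd.trans hrd.symm) (D * Jr)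
  -- the contribution of one cell
  have hone : ∀ s ∈ X.above r, (f.idx s : ℝ) = |ℓ ((rmat D).mulVec (rvec (w s)))| ∧
      (f.IsGood n s → (f.idx s : ℝ) *
        crossing (Y.chart t '' (h • f.toFun '' s)) (Y.chart t (h • f.toFun P)) v
          = SignType.sign (ℓ v) * ℓ ((rmat D).mulVec (rvec (w s)))) := by
    intro s hs
    obtain ⟨J, b, K, c₀, hJ, -, hJJr, hJw, hgen, hc₀, hout⟩ :=
      PolyComplex.exists_facet_coords hr hs.1 hs.2.1 (hw s hs) hJr hKJr hspanr
    have hst := smul_tgt_eq_of_subset hf.target f hr hs.1 hs.2.1 htgt htd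
    have hA : ∀ x ∈ s, Y.chart t (h • f.toFun x)
        = (rmat (D * J)).mulVec (X.chart s x) + ((rmat D).mulVec b + e) := by
      refine f.matrix_eqOn_of_relInt hYo hs.1 hst fun x hx => ?_
      have hx' : x ∈ s ∩ X.star r :=
        ⟨hx.1, PolyComplex.relInt_subset_star_of_subset hs.1 hs.2.1 hx⟩
      rw [hD x hx'.2, hJ x hx', Matrix.mulVec_add, Matrix.mulVec_mulVec, rmat_mul, add_assoc]
    have hlat := f.latIdx_smul_eq_idx hYo h hs.1 hst hA
    have hAu : (D * J).mulVec (K.mulVec (w s)) = D.mulVec (w s) := by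
      rw [← Matrix.mulVec_mulVec, hJw]
    have hI := hidx (X.dim s) ((hdim s hs).trans hrd.symm) (D * J) _ _ hgen
      (by rw [Matrix.mul_assoc, hJJr])
    rw [hlat, hAu, ← rmat_mulVec_rvec] at hI
    refine ⟨hI, fun hgood => ?_⟩
    obtain ⟨B, hBA, hAB⟩ := exists_inverse_of_latIdx_ne_zero (A := D * J)
      ((hdim s hs).trans htd.symm) (by rw [hlat]; exact hgood.idx_ne)
    obtain ⟨k, y, hky⟩ := hgen.exists_real (B.mulVec v)
    have hv : v = (rmat (D * J)).mulVec
        (k • rvec (K.mulVec (w s)) + (rmat (K * Jr)).mulVec y) := by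
      rw [← hky, Matrix.mulVec_mulVec, hAB, Matrix.one_mulVec]
    obtain ⟨x, hx⟩ := PolyComplex.relInt_nonempty hs.1
    have hxr : x ∉ r := fun hxr => hs.2.2 (PolyComplex.subset_of_mem_relInt hs.1 hr hx hxr)
    obtain ⟨k₀, y₀, hk₀, hxP⟩ := hout x
      ⟨hx.1, PolyComplex.relInt_subset_star_of_subset hs.1 hs.2.1 hx⟩ hxr P hP
    have hcr := crossing_eq hr hgood hs.2 hP hA hBA hc₀ hx.1 hxr hk₀ hxP k y
    rw [← hv] at hcr
    have hℓv : ℓ v = k * ℓ ((rmat D).mulVec (rvec (w s))) := by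
      rw [hv, Matrix.mulVec_add, map_add, Matrix.mulVec_smul, _root_.map_smul, rmat_mulVec_rvec, hAu,
        Matrix.mulVec_mulVec, ← rmat_mul, Matrix.mul_assoc, hJJr, hℓ, add_zero, smul_eq_mul,
        rmat_mulVec_rvec]
    -- The index is |ℓ(D w)|, and sign(k ℓ) · ℓ = sign(k) · |ℓ|.
    rw [hcr, hℓv, sign_mul, SignType.coe_mul, mul_assoc, sign_mul_self, hI, mul_comm]
  -- sum over all cells
  have hterm : ∀ s, (∑ᶠ (_ : s ∈ {s | s ∈ X.above r ∧ f.IsGood n s}), (ωX s * f.idx s) *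
      crossing (Y.chart t '' (h • f.toFun '' s)) (Y.chart t (h • f.toFun P)) v)
      = SignType.sign (ℓ v) *
        ∑ᶠ (_ : s ∈ X.above r), (ωX s : ℝ) * ℓ ((rmat D).mulVec (rvec (w s))) := by
    intro s
    by_cases hs : s ∈ X.above r
    · rw [finsum_eq_if, finsum_eq_if, if_pos hs]
      by_cases hgood : f.IsGood n s
      · rw [if_pos ⟨hs, hgood⟩, mul_assoc, (hone s hs).2 hgood]
        ring
      -- A cell around `r` that is not good has index zero, so ℓ vanishes on the image of its normal
      -- vector. The sum may thus be extended to all cells above `r`, as the balancing condition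
      -- requires.
      · have hst := smul_tgt_eq_of_subset hf.target f hr hs.1 hs.2.1 htgt htd
        have hidx0 : f.idx s = 0 := by
          by_contra hne
          refine hgood ⟨hs.1, hdim s hs, ?_, hne⟩
          rw [← htd, ← hst, hYo.dim_smul h (f.isCellMap.tgt_mem hs.1)]
        have h0 := (hone s hs).1
        rw [hidx0, Nat.cast_zero, eq_comm, abs_eq_zero] at h0
        rw [if_neg fun hg => hgood hg.2, h0]
        simp
    · simp [hs]
  rw [finsum_congr hterm, ← mul_finsum]
  have hVzero : ∀ z ∈ Submodule.span ℝ (starCone X r r), ℓ ((rmat D).mulVec z) = 0 := by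
    intro z hz
    rw [hspanr] at hz
    obtain ⟨y, rfl⟩ := hz
    rw [Matrix.mulVecLin_apply, Matrix.mulVec_mulVec, ← rmat_mul, hℓ]
  have hz := hVzero _ hsum
  rw [finsum_mem_eq_finite_toFinset_sum _ hbal.1, ← Matrix.mulVecLin_apply, map_sum, map_sum] at hz
  rw [finsum_mem_eq_finite_toFinset_sum _ hbal.1]
  refine mul_eq_zero_of_right _ (Eq.trans ?_ hz)
  refine Finset.sum_congr rfl fun s _ => ?_
  rw [_root_.map_smul, _root_.map_smul, smul_eq_mul, Matrix.mulVecLin_apply]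

end OrbitMorphism

/-! ### The number of preimages is constant on the generic part of a cell -/

section Lines

variable {m : ℕ} {D : Set (Fin m → ℝ)} {q v : Fin m → ℝ}

/-- The parameters at which a line meets a convex set form an interval; if they accumulate at 0 from
the right, they contain a whole interval next to 0. -/
lemma eventually_ray_of_convex (hD : Convex ℝ D) (q v : Fin m → ℝ) :
    (∀ᶠ c : ℝ in 𝓝[>] 0, q + c • v ∈ D) ∨ ∀ᶠ c : ℝ in 𝓝[>] 0, q + c • v ∉ D := by
  by_cases h : ∀ᶠ c : ℝ in 𝓝[>] 0, q + c • v ∉ D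
  · exact Or.inr h
  have hfreq : ∃ᶠ c : ℝ in 𝓝[>] 0, q + c • v ∈ D := fun h' => h h'
  left
  obtain ⟨c₁, hc₁, hpos⟩ := (hfreq.and_eventually self_mem_nhdsWithin).exists
  filter_upwards [Ioo_mem_nhdsGT (show (0 : ℝ) < c₁ from hpos)] with c hc
  obtain ⟨c₂, hc₂, hc₂'⟩ := (hfreq.and_eventually (Ioo_mem_nhdsGT hc.1)).exists
  have hord : Set.OrdConnected {c : ℝ | q + c • v ∈ D} := by
    have h1 : Convex ℝ {c : ℝ | q + c • v ∈ D} := by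
      intro x hx y hy a b ha hb hab
      have := hD hx hy ha hb hab
      change q + (a • x + b • y) • v ∈ D
      convert this using 1
      rw [smul_add, smul_add, add_add_add_comm, ← add_smul, hab, one_smul, add_smul, smul_smul,
        smul_smul]
      rfl
    exact h1.ordConnected
  exact hord.out hc₂ hc₁ ⟨hc₂'.2.le, hc.2.le⟩

open Classical in
lemma eventually_ite_eq_raySide (hD : Convex ℝ D) (q v : Fin m → ℝ) :
    ∀ᶠ c : ℝ in 𝓝[>] 0, (if q + c • v ∈ D then (1 : ℝ) else 0) = raySide D q v := by
  rcases eventually_ray_of_convex hD q v with h | h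
  · rw [raySide_of_eventually h]
    filter_upwards [h] with c hc using if_pos hc
  · rw [raySide_of_eventually_notMem h]
    filter_upwards [h] with c hc using if_neg hc

lemma eventually_ray_of_nhds {p : (Fin m → ℝ) → Prop} (h : ∀ᶠ x in 𝓝 q, p x) (v : Fin m → ℝ) :
    ∀ᶠ c : ℝ in 𝓝[>] 0, p (q + c • v) := by
  have : Continuous fun c : ℝ => q + c • v := by fun_prop
  have h1 := this.tendsto 0
  rw [zero_smul, add_zero] at h1
  exact nhdsWithin_le_nhds (h1.eventually h)

lemma crossing_eq_zero_of_nhds (h : (∀ᶠ x in 𝓝 q, x ∈ D) ∨ ∀ᶠ x in 𝓝 q, x ∉ D) :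
    crossing D q v = 0 := by
  rcases h with h | h
  · rw [crossing, raySide_of_eventually (eventually_ray_of_nhds h v),
      raySide_of_eventually (eventually_ray_of_nhds h (-v)), sub_self]
  · rw [crossing, raySide_of_eventually_notMem (eventually_ray_of_nhds h v),
      raySide_of_eventually_notMem (eventually_ray_of_nhds h (-v)), sub_self]

/-- A function on a convex set of reals that is punctured-locally constant has the same generic
value everywhere. -/
lemma eq_of_punctured_locally_constant {U : Set ℝ} (hU : IsOpen U) (hconv : Convex ℝ U) {g : ℝ → ℝ}
    {a : ℝ → ℝ} (ha : ∀ c ∈ U, ∀ᶠ x in 𝓝[≠] c, g x = a c) {c c' : ℝ} (hc : c ∈ U) (hc' : c' ∈ U) :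
    a c = a c' := by
  refine hconv.isPreconnected.induction₂ (fun x y => a x = a y) (fun x hx => ?_)
    (fun _ _ _ _ _ _ h h' => h.trans h') (fun _ _ _ _ h => h.symm) hc hc'
  have h1 : ∀ᶠ y in 𝓝[≠] x, a x = a y := by
    filter_upwards [eventually_eventually_nhdsWithin.mpr (ha x hx),
      nhdsWithin_le_nhds (hU.mem_nhds hx), self_mem_nhdsWithin] with y hy hyU hyx
    rw [isOpen_compl_singleton.nhdsWithin_eq hyx] at hy
    have hy' : ∀ᶠ z in 𝓝[≠] y, g z = a x := nhdsWithin_le_nhds hy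
    obtain ⟨z, hz, hz'⟩ := (hy'.and (ha y hyU)).exists
    exact hz.symm.trans hz'
  refine nhdsWithin_le_nhds ?_
  rw [eventually_nhdsWithin_iff] at h1
  filter_upwards [h1] with y hy
  by_cases hyx : y = x
  · rw [hyx]
  · exact hy hyx

lemma eventually_punctured {p : ℝ → Prop} {c₀ : ℝ} (h : ∀ᶠ c in 𝓝[>] 0, p (c₀ + c))
    (h' : ∀ᶠ c in 𝓝[>] 0, p (c₀ - c)) : ∀ᶠ c in 𝓝[≠] c₀, p c := by
  rw [← nhdsLT_sup_nhdsGT, Filter.eventually_sup]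
  constructor
  · have h1 : Filter.Tendsto (fun c => c₀ - c) (𝓝[<] c₀) (𝓝[>] 0) := by
      refine tendsto_nhdsWithin_iff.mpr ⟨?_, ?_⟩
      · have : Continuous fun c : ℝ => c₀ - c := by fun_prop
        exact (this.tendsto' c₀ 0 (sub_self _)).mono_left nhdsWithin_le_nhds
      · filter_upwards [self_mem_nhdsWithin] with c hc using sub_pos.mpr (mem_Iio.mp hc)
    filter_upwards [h1.eventually h'] with c hc
    rwa [sub_sub_cancel] at hc
  · have h1 : Filter.Tendsto (fun c => c - c₀) (𝓝[>] c₀) (𝓝[>] 0) := by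
      refine tendsto_nhdsWithin_iff.mpr ⟨?_, ?_⟩
      · have : Continuous fun c : ℝ => c - c₀ := by fun_prop
        exact (this.tendsto' c₀ 0 (sub_self _)).mono_left nhdsWithin_le_nhds
      · filter_upwards [self_mem_nhdsWithin] with c hc using sub_pos.mpr (mem_Ioi.mp hc)
    filter_upwards [h1.eventually h] with c hc
    rwa [add_sub_cancel] at hc

/-- The points `q'` such that the line from `q` to `q'` meets a given affine subspace of
codimension two only in `q` are generic. -/
lemma exists_affineSubspace_of_codim_two {k : ℕ} (hk : k + 2 ≤ m) (A : Matrix (Fin m) (Fin k) ℤ)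
    (b q : Fin m → ℝ) : ∃ L : AffineSubspace ℝ (Fin m → ℝ), L ≠ ⊤ ∧
      ∀ q' ∉ L, ∀ (c : ℝ) (x : Fin k → ℝ), q + c • (q' - q) = (rmat A).mulVec x + b → c = 0 := by
  -- The affine space spanned by `q` and the given subspace; its dimension is at most k + 1, which
  -- is less than m.
  refine ⟨AffineSubspace.mk' q
    (LinearMap.range (rmat A).mulVecLin ⊔ Submodule.span ℝ {b - q}), fun h => ?_, ?_⟩
  · have h1 := congrArg AffineSubspace.direction h
    rw [AffineSubspace.direction_mk', AffineSubspace.direction_top] at h1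
    have h2 := Submodule.finrank_add_le_finrank_add_finrank
      (LinearMap.range (rmat A).mulVecLin) (Submodule.span ℝ {b - q})
    rw [h1, finrank_top, Module.finrank_fin_fun] at h2
    have h3 := LinearMap.finrank_range_le (rmat A).mulVecLin
    rw [Module.finrank_fin_fun] at h3
    have h4 := finrank_span_le_card (R := ℝ) ({b - q} : Set (Fin m → ℝ))
    simp only [toFinset_singleton, Finset.card_singleton] at h4
    omega
  · intro q' hq' c x hx
    by_contra hc
    refine hq' ?_
    rw [AffineSubspace.mem_mk', vsub_eq_sub]
    have h1 : q' - q = c⁻¹ • ((rmat A).mulVec x + (b - q)) := by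
      rw [eq_inv_smul_iff₀ hc, add_sub_assoc', ← hx, add_sub_cancel_left]
    rw [h1]
    exact Submodule.smul_mem _ _ (Submodule.add_mem_sup ⟨x, rfl⟩
      (Submodule.mem_span_singleton_self _))

end Lines

namespace OrbitMorphism

variable {α β : Type*} [TopologicalSpace α] [TopologicalSpace β]
  {X : PolyComplex α} {Y : PolyComplex β} {G H : Type*} [Group G] [Group H]
  [MulAction G α] [MulAction H β] {f : OrbitMorphism X Y G H} {ωX : Set α → ℚ} {ωY : Set β → ℚ}
  {n : ℕ} {s : Set α} {t : Set β}

lemma mem_image_chart (ht : t ∈ Y.cells) {S : Set β} (hS : S ⊆ t) {y : β} (hy : y ∈ t) :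
    Y.chart t y ∈ Y.chart t '' S ↔ y ∈ S :=
  (PolyComplex.chart_injOn ht).mem_image_iff hS hy

namespace IsTropical

variable (hf : f.IsTropical ωX ωY n)
include hf

open Classical in
lemma count_eq_sum {u : Set β} (hu : u ∈ Y.cells) {y : β} (hy : u ⊆ Y.cellOf y) :
    f.count n ωX y = ∑ p ∈ (hf.finite_pairs hu).toFinset,
      if y ∈ p.1 • f.toFun '' p.2 then f.coef n ωX p.2 else 0 := by
  refine finsum_eq_sum_of_support_subset _ fun p hp => ?_
  rw [Finset.mem_coe, Finite.mem_toFinset]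
  by_cases hyp : y ∈ p.1 • f.toFun '' p.2
  · have hne : f.coef n ωX p.2 ≠ 0 := by
      rw [Function.mem_support, if_pos hyp] at hp
      exact hp
    exact ⟨hne, hy.trans (cellOf_subset_of_mem hf.target.orbitSpace
      (isGood_of_coef_ne_zero hne).mem hyp)⟩
  · exact absurd (if_neg hyp) hp

/-- The pairs contributing on the interior of a top-dimensional cell. -/
lemma of_mem_pairs (ht : t ∈ Y.cells) (htd : Y.dim t = n) {p : H × Set α}
    (hp : p ∈ (hf.finite_pairs ht).toFinset) :
    f.IsGood n p.2 ∧ p.1 • tgt X Y f.toFun p.2 = t ∧ p.1 • f.toFun '' p.2 ⊆ t := by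
  obtain ⟨hp1, hp2⟩ := (Finite.mem_toFinset _).mp hp
  have hgood := isGood_of_coef_ne_zero hp1
  have h1 := hf.target.eq_of_subset ht htd
    (hf.target.orbitSpace.smul_mem p.1 _ (f.isCellMap.tgt_mem hgood.mem)) hp2
  refine ⟨hgood, h1.symm, ?_⟩
  rw [h1]
  exact smul_set_mono (image_subset_iff.mpr (f.isCellMap.mapsTo hgood.mem))

lemma isClosed_smul_image (hq : IsQuotientMap f.orbitMap) (hs : f.IsGood n s) (h : H) :
    IsClosed (h • f.toFun '' s) := by
  have h1 : h • f.toFun '' s = (fun y => h⁻¹ • y) ⁻¹' (f.toFun '' s) := by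
    rw [preimage_smul, inv_inv]
  rw [h1]
  exact (hf.isClosed_image hq hs).preimage (hf.target.orbitSpace.continuous_smul h⁻¹)

/-- Off the boundary of the image of a good cell, membership in this image is locally constant. -/
lemma eventually_mem_or_notMem (hq : IsQuotientMap f.orbitMap) (ht : t ∈ Y.cells)
    (hs : f.IsGood n s) {h : H} (htgt : h • tgt X Y f.toFun s = t) {y : β} (hy : y ∈ Y.relInt t)
    (hyb : y ∉ h • f.toFun '' (s \ X.relInt s)) :
    (y ∈ h • f.toFun '' s ∧
      ∀ᶠ x in 𝓝 (Y.chart t y), x ∈ Y.chart t '' (h • f.toFun '' s)) ∨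
    (y ∉ h • f.toFun '' s ∧
      ∀ᶠ x in 𝓝 (Y.chart t y), x ∉ Y.chart t '' (h • f.toFun '' s)) := by
  have hsub : h • f.toFun '' s ⊆ t := by
    rw [← htgt]
    exact smul_set_mono (image_subset_iff.mpr (f.isCellMap.mapsTo hs.mem))
  by_cases hys : y ∈ h • f.toFun '' s
  · left
    refine ⟨hys, ?_⟩
    obtain ⟨P, hP, hPy⟩ := mem_smul_image.mp hys
    have hPr : P ∈ X.relInt s := by
      by_contra hPr
      exact hyb (mem_smul_image.mpr ⟨P, ⟨hP, hPr⟩, hPy⟩)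
    obtain ⟨-, hint, -⟩ := hf.image_chart_of_isGood hs htgt
    have h1 : Y.chart t y ∈ interior (Y.chart t '' (h • f.toFun '' s)) := by
      rw [← hint]
      exact ⟨y, mem_smul_image.mpr ⟨P, hPr, hPy⟩, rfl⟩
    exact mem_interior_iff_mem_nhds.mp h1
  · right
    refine ⟨hys, ?_⟩
    -- Closedness of images of good cells is what keeps points outside the image outside nearby.
    obtain ⟨V, hV, hVm⟩ := PolyComplex.exists_open_chart_image ht
      (hf.isClosed_smul_image hq hs h).isOpen_compl
    filter_upwards [hV.mem_nhds ((hVm y hy.1).mp hys)] with x hx hxm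
    obtain ⟨z, hz, rfl⟩ := hxm
    exact (hVm z (hsub hz)).mpr hx hz

/-- The generic numbers of preimages on both sides of a point of a line agree. -/
lemma exists_eventually_count_eq (hq : IsQuotientMap f.orbitMap) (ht : t ∈ Y.cells)
    (htd : Y.dim t = n) {y : β} (hy : y ∈ Y.relInt t)
    (havoid : ∀ r ∈ X.cells, X.dim r + 2 ≤ n → ∀ h : H, y ∉ h • f.toFun '' r)
    (v : Fin (Y.dim t) → ℝ) : ∃ a : ℝ,
      (∀ᶠ c : ℝ in 𝓝[>] 0, ∀ z ∈ t, Y.chart t z = Y.chart t y + c • v →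
        (f.count n ωX z : ℝ) = a) ∧
      ∀ᶠ c : ℝ in 𝓝[>] 0, ∀ z ∈ t, Y.chart t z = Y.chart t y + c • (-v) →
        (f.count n ωX z : ℝ) = a := by
  classical
  have hycell := PolyComplex.cellOf_eq ht hy
  set I := (hf.finite_pairs ht).toFinset with hI
  let D : H × Set α → Set (Fin (Y.dim t) → ℝ) := fun p => Y.chart t '' (p.1 • f.toFun '' p.2)
  -- The weighted number of images that contain the start of the ray from `y` in the given
  -- direction.
  let N : (Fin (Y.dim t) → ℝ) → ℝ := fun v =>
    ∑ p ∈ I, (f.coef n ωX p.2 : ℝ) * raySide (D p) (Y.chart t y) v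
  have hN : ∀ v, ∀ᶠ c : ℝ in 𝓝[>] 0, ∀ z ∈ t, Y.chart t z = Y.chart t y + c • v →
      (f.count n ωX z : ℝ) = N v := by
    intro v
    have h1 : ∀ᶠ c : ℝ in 𝓝[>] 0, ∀ p ∈ I, (if Y.chart t y + c • v ∈ D p then (1 : ℝ) else 0)
        = raySide (D p) (Y.chart t y) v := by
      rw [Filter.eventually_all_finset]
      intro p hp
      obtain ⟨hgood, htgt, -⟩ := hf.of_mem_pairs ht htd hp
      exact eventually_ite_eq_raySide (hf.image_chart_of_isGood hgood htgt).1 _ _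
    have h2 := eventually_ray_of_nhds (isOpen_interior.mem_nhds hy.2) v
    filter_upwards [h1, h2] with c hc hc' z hz hzc
    have hzr : z ∈ Y.relInt t := by
      refine ⟨hz, ?_⟩
      rw [hzc]
      exact hc'
    rw [hf.count_eq_sum ht (PolyComplex.cellOf_eq ht hzr).ge, Rat.cast_sum]
    refine Finset.sum_congr rfl fun p hp => ?_
    rw [← hc p hp, ← hzc]
    have hiff := mem_image_chart ht (hf.of_mem_pairs ht htd hp).2.2 hz
    by_cases hzp : z ∈ p.1 • f.toFun '' p.2
    · rw [if_pos hzp, if_pos (hiff.mpr hzp), mul_one]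
    · rw [if_neg hzp, if_neg fun h => hzp (hiff.mp h), mul_zero, Rat.cast_zero]
  -- The difference of `N` in opposite directions is a sum of crossings. Images with `y` in the
  -- interior or in the complement have crossing zero, and those with `y` on the boundary cancel by
  -- balancing at the facets through `y`.
  have hbd := hf.finsum_boundary_eq_zero havoid
    (fun h s => crossing (Y.chart t '' (h • f.toFun '' s)) (Y.chart t y) v)
    (fun g h s _ => by simp only [smul_image_smul]) (by
      intro h r hr hrd hyr hex
      have htgt := smul_tgt_of_mem_relInt hf.target.orbitSpace hr hyr
      rw [hycell] at htgt
      obtain ⟨P, hP, rfl⟩ := mem_smul_image.mp hyr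
      exact hf.finsum_crossing_eq_zero htd hr hrd htgt hex hP v)
  rw [finsum_eq_sum_of_support_subset (s := I)] at hbd
  · have h3 : N v = N (-v) := by
      rw [← sub_eq_zero, ← hbd, ← Finset.sum_sub_distrib]
      refine Finset.sum_congr rfl fun p hp => ?_
      rw [← mul_sub]
      split_ifs with hyp
      · rfl
      · obtain ⟨hgood, htgt, -⟩ := hf.of_mem_pairs ht htd hp
        have h4 : crossing (D p) (Y.chart t y) v = 0 := by
          refine crossing_eq_zero_of_nhds ?_
          rcases hf.eventually_mem_or_notMem hq ht hgood htgt hy hyp with h | h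
          · exact Or.inl h.2
          · exact Or.inr h.2
        exact mul_eq_zero_of_right _ h4
    exact ⟨N v, hN v, h3 ▸ hN (-v)⟩
  · intro p hp
    rw [Function.mem_support] at hp
    split_ifs at hp with hyp
    swap
    · exact absurd rfl hp
    have hne : f.coef n ωX p.2 ≠ 0 := fun h => left_ne_zero_of_mul hp (by rw [h, Rat.cast_zero])
    rw [hI, Finset.mem_coe, Finite.mem_toFinset]
    refine ⟨hne, ?_⟩
    rw [← hycell]
    exact cellOf_subset_of_mem hf.target.orbitSpace (isGood_of_coef_ne_zero hne).mem
      (smul_set_mono (image_mono sdiff_subset) hyp)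

/-- A point off the walls lies in the image of no cell of smaller dimension. -/
lemma notMem_of_off_walls (htd : Y.dim t = n) (ht : t ∈ Y.cells) {W : Set _}
    (hW : f.IsWallSet t W) {y : β} (hy : y ∈ Y.relInt t)
    (hoff : ∀ w ∈ W, intForm w.1 (Y.chart t y) ≠ w.2) {h : H} {P : α} (hPy : h • f.toFun P = y) :
    f.IsGood n (X.cellOf P) ∧ h • tgt X Y f.toFun (X.cellOf P) = t := by
  have hYo := hf.target.orbitSpace
  have hP : y ∈ h • f.toFun '' X.relInt (X.cellOf P) :=
    mem_smul_image.mpr ⟨P, X.mem_relInt_cellOf P, hPy⟩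
  have htgt := smul_tgt_of_mem_relInt hYo (X.cellOf_mem P) hP
  rw [PolyComplex.cellOf_eq ht hy] at htgt
  refine ⟨isGood_of_not_isDegenerate hf.source (X.cellOf_mem P) ?_ fun hdeg => ?_, htgt⟩
  · rw [← htd, ← htgt, hYo.dim_smul h (f.isCellMap.tgt_mem (X.cellOf_mem P))]
  · obtain ⟨w, hw, hw'⟩ := hW.degenerate _ (X.cellOf_mem P) h htgt hdeg y
      (smul_set_mono (image_mono (X.relInt_subset _)) hP)
    exact hoff w hw hw'

lemma notMem_boundary_of_off_walls (htd : Y.dim t = n) (ht : t ∈ Y.cells) {W : Set _}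
    (hW : f.IsWallSet t W) {y : β} (hy : y ∈ Y.relInt t)
    (hoff : ∀ w ∈ W, intForm w.1 (Y.chart t y) ≠ w.2) (hs : s ∈ X.cells)
    (h : H) : y ∉ h • f.toFun '' (s \ X.relInt s) := by
  intro hys
  obtain ⟨P, ⟨hP, hPr⟩, hPy⟩ := mem_smul_image.mp hys
  have hgood := (hf.notMem_of_off_walls htd ht hW hy hoff hPy).1
  have := hf.source.eq_of_subset hgood.mem hgood.dim_eq hs (PolyComplex.cellOf_subset hs hP)
  exact hPr (this ▸ X.mem_relInt_cellOf P)

/-- A boundary point of a good cell lies in a smaller, hence not good, cell, so off the walls no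
image of a good cell has `y` on its boundary and membership in each image is locally constant. -/
lemma eventually_count_eq_of_off_walls (hq : IsQuotientMap f.orbitMap) (ht : t ∈ Y.cells)
    (htd : Y.dim t = n) {W : Set _} (hW : f.IsWallSet t W) {y : β} (hy : y ∈ Y.relInt t)
    (hoff : ∀ w ∈ W, intForm w.1 (Y.chart t y) ≠ w.2) :
    ∀ᶠ x in 𝓝 (Y.chart t y), ∀ z ∈ t, Y.chart t z = x → f.count n ωX z = f.count n ωX y := by
  classical
  have h1 : ∀ᶠ x in 𝓝 (Y.chart t y), ∀ p ∈ (hf.finite_pairs ht).toFinset,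
      (x ∈ Y.chart t '' (p.1 • f.toFun '' p.2) ↔ y ∈ p.1 • f.toFun '' p.2) := by
    rw [Filter.eventually_all_finset]
    intro p hp
    obtain ⟨hgood, htgt, -⟩ := hf.of_mem_pairs ht htd hp
    rcases hf.eventually_mem_or_notMem hq ht hgood htgt hy
      (hf.notMem_boundary_of_off_walls htd ht hW hy hoff hgood.mem p.1) with h | h
    · filter_upwards [h.2] with x hx using iff_of_true hx h.1
    · filter_upwards [h.2] with x hx using iff_of_false hx h.1
  filter_upwards [h1, isOpen_interior.mem_nhds hy.2] with x hx hx' z hz hzx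
  have hzr : z ∈ Y.relInt t := ⟨hz, hzx ▸ hx'⟩
  rw [hf.count_eq_sum ht (PolyComplex.cellOf_eq ht hzr).ge,
    hf.count_eq_sum ht (PolyComplex.cellOf_eq ht hy).ge]
  refine Finset.sum_congr rfl fun p hp => ?_
  have h2 := hx p hp
  rw [← hzx, mem_image_chart ht (hf.of_mem_pairs ht htd hp).2.2 hz] at h2
  exact if_congr h2 rfl rfl

/-- Along the line the count is locally constant away from isolated parameters, with equal values on
both sides of each of them; at the two ends the generic value is the actual one, since these points
are off the walls. -/
lemma count_eq_of_line (hq : IsQuotientMap f.orbitMap) (ht : t ∈ Y.cells)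
    (htd : Y.dim t = n) {W : Set _} (hW : f.IsWallSet t W) {y y' : β} (hy : y ∈ Y.relInt t)
    (hy' : y' ∈ Y.relInt t) (hoff : ∀ w ∈ W, intForm w.1 (Y.chart t y) ≠ w.2)
    (hoff' : ∀ w ∈ W, intForm w.1 (Y.chart t y') ≠ w.2)
    (havoid : ∀ z ∈ Y.relInt t, ∀ c : ℝ, c ≠ 0 →
      Y.chart t z = Y.chart t y + c • (Y.chart t y' - Y.chart t y) →
      ∀ r ∈ X.cells, X.dim r + 2 ≤ n → ∀ h : H, z ∉ h • f.toFun '' X.relInt r) :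
    f.count n ωX y = f.count n ωX y' := by
  set γ : ℝ → Fin (Y.dim t) → ℝ := fun c => Y.chart t y + c • (Y.chart t y' - Y.chart t y) with hγ
  have hγc : Continuous γ := by fun_prop
  have hγ0 : γ 0 = Y.chart t y := by simp [γ]
  have hγ1 : γ 1 = Y.chart t y' := by simp [γ]
  set U := γ ⁻¹' interior (Y.chart t '' t) with hU
  have hUopen : IsOpen U := isOpen_interior.preimage hγc
  have hUconv : Convex ℝ U := by
    intro a ha b hb k l hk hl hkl
    have := (PolyComplex.convex_image ht).interior ha hb hk hl hkl
    change γ (k • a + l • b) ∈ interior _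
    convert this using 1
    simp only [γ, smul_add, smul_smul, smul_eq_mul]
    rw [add_add_add_comm, ← add_smul, ← add_smul, hkl, one_smul]
  let R : ℝ → β := fun c => Y.chartInv t y (γ c)
  have hR : ∀ c ∈ U, R c ∈ Y.relInt t ∧ Y.chart t (R c) = γ c := fun c hc =>
    ⟨PolyComplex.chartInv_mem_relInt hc, PolyComplex.chart_chartInv (interior_subset hc)⟩
  have hUev : ∀ c₀ ∈ U, ∀ e : ℝ, ∀ᶠ c : ℝ in 𝓝[>] 0, c₀ + c * e ∈ U := by
    intro c₀ hc₀ e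
    have : Continuous fun c : ℝ => c₀ + c * e := by fun_prop
    have h1 := this.tendsto 0
    rw [zero_mul, add_zero] at h1
    exact nhdsWithin_le_nhds (h1.eventually (hUopen.mem_nhds hc₀))
  have hlocal : ∀ c₀ ∈ U, ∃ a : ℝ, ∀ᶠ c in 𝓝[≠] c₀, (f.count n ωX (R c) : ℝ) = a := by
    intro c₀ hc₀
    have hav : ∀ r ∈ X.cells, X.dim r + 2 ≤ n → ∀ h : H, R c₀ ∉ h • f.toFun '' r := by
      intro r hr hrd h hmem
      obtain ⟨P, hP, hPR⟩ := mem_smul_image.mp hmem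
      have hle := PolyComplex.dim_le_of_subset (X.cellOf_mem P) hr (PolyComplex.cellOf_subset hr hP)
      -- The parameter 0 is the point `y` itself, which is off the walls and so meets good cells
      -- only; hence `havoid` need not cover it.
      by_cases hc0 : c₀ = 0
      · have hRy : R c₀ = y := by
          change Y.chartInv t y (γ c₀) = y
          rw [hc0, hγ0]
          exact PolyComplex.chartInv_chart ht hy.1
        have := (hf.notMem_of_off_walls htd ht hW hy hoff (hPR.trans hRy)).1.dim_eq
        omega
      · exact havoid (R c₀) (hR c₀ hc₀).1 c₀ hc0 (hR c₀ hc₀).2 _ (X.cellOf_mem P) (by omega) h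
          (mem_smul_image.mpr ⟨P, X.mem_relInt_cellOf P, hPR⟩)
    obtain ⟨a, ha, ha'⟩ := hf.exists_eventually_count_eq hq ht htd (hR c₀ hc₀).1 hav
      (Y.chart t y' - Y.chart t y)
    refine ⟨a, eventually_punctured ?_ ?_⟩
    · filter_upwards [ha, hUev c₀ hc₀ 1] with c hc hcU
      rw [mul_one] at hcU
      refine hc _ (hR _ hcU).1.1 ?_
      rw [(hR _ hcU).2, (hR c₀ hc₀).2, hγ]
      simp only [add_smul, add_assoc]
    · filter_upwards [ha', hUev c₀ hc₀ (-1)] with c hc hcU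
      rw [mul_neg_one, ← sub_eq_add_neg] at hcU
      refine hc _ (hR _ hcU).1.1 ?_
      rw [(hR _ hcU).2, (hR c₀ hc₀).2, hγ]
      simp only [sub_smul, smul_neg]
      abel
  choose! a ha using hlocal
  have hend : ∀ c ∈ U, ∀ z ∈ Y.relInt t, Y.chart t z = γ c →
      (∀ w ∈ W, intForm w.1 (Y.chart t z) ≠ w.2) → a c = f.count n ωX z := by
    intro c hc z hz hzc hzoff
    have h1 := hf.eventually_count_eq_of_off_walls hq ht htd hW hz hzoff
    rw [hzc] at h1
    have h2 := ((hγc.tendsto c).eventually h1).and (hUopen.mem_nhds hc)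
    have h3 : ∀ᶠ x in 𝓝[≠] c, _ := nhdsWithin_le_nhds h2
    obtain ⟨x, ⟨hx1, hx3⟩, hx2⟩ := (h3.and (ha c hc)).exists
    rw [← hx2, hx1 (R x) (hR x hx3).1.1 (hR x hx3).2]
  have h0U : (0 : ℝ) ∈ U := by
    change γ 0 ∈ interior (Y.chart t '' t)
    rw [hγ0]
    exact hy.2
  have h1U : (1 : ℝ) ∈ U := by
    change γ 1 ∈ interior (Y.chart t '' t)
    rw [hγ1]
    exact hy'.2
  have h3 := eq_of_punctured_locally_constant hUopen hUconv ha h0U h1U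
  rw [hend 0 h0U y hy hγ0.symm hoff, hend 1 h1U y' hy' hγ1.symm hoff'] at h3
  exact_mod_cast h3

/-- The weighted number of preimages is constant on the complement of the walls of a cell. -/
theorem count_eq_of_off_walls (hq : IsQuotientMap f.orbitMap) (ht : t ∈ Y.cells)
    (htd : Y.dim t = n) {W : Set _} (hW : f.IsWallSet t W) {y y' : β} (hy : y ∈ Y.relInt t)
    (hy' : y' ∈ Y.relInt t) (hoff : ∀ w ∈ W, intForm w.1 (Y.chart t y) ≠ w.2)
    (hoff' : ∀ w ∈ W, intForm w.1 (Y.chart t y') ≠ w.2) :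
    f.count n ωX y = f.count n ωX y' := by
  have hYo := hf.target.orbitSpace
  obtain ⟨𝓟, hfin, h𝓟, hcov⟩ := hf.exists_finite_pairs ht
  have hL : ∀ (q : Fin (Y.dim t) → ℝ) (p : H × Set α), ∃ L : AffineSubspace ℝ (Fin (Y.dim t) → ℝ),
      p ∈ 𝓟 → X.dim p.2 + 2 ≤ n → L ≠ ⊤ ∧ ∀ q' ∉ L, ∀ c : ℝ,
        q + c • (q' - q) ∈ Y.chart t '' (p.1 • f.toFun '' p.2) → c = 0 := by
    intro q p
    by_cases hp : p ∈ 𝓟 ∧ X.dim p.2 + 2 ≤ n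
    · obtain ⟨A, b, hA⟩ := f.exists_matrix hYo p.1 (h𝓟 p hp.1).1 (h𝓟 p hp.1).2
      obtain ⟨L, hL, hL'⟩ := exists_affineSubspace_of_codim_two (hp.2.trans htd.ge) A b q
      refine ⟨L, fun _ _ => ⟨hL, fun q' hq' c hc => ?_⟩⟩
      obtain ⟨z, hz, hzc⟩ := hc
      obtain ⟨P, hP, rfl⟩ := mem_smul_image.mp hz
      rw [hA P hP] at hzc
      exact hL' q' hq' c _ hzc.symm
    · exact ⟨⊤, fun h1 h2 => absurd ⟨h1, h2⟩ hp⟩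
  choose L hL using hL
  let q : Bool → Fin (Y.dim t) → ℝ := fun i => Y.chart t (bif i then y else y')
  let 𝓛 : (((Fin (Y.dim t) → ℤ) × ℝ) ⊕ (Bool × (H × Set α))) →
      AffineSubspace ℝ (Fin (Y.dim t) → ℝ) := Sum.elim wallSpace fun j => L (q j.1) j.2
  -- A third point off the walls whose lines to `y` and to `y'` miss all images of codimension two,
  -- except possibly at `y` and `y'`. Only finitely many images have to be avoided.
  obtain ⟨x, hx, hxL⟩ := exists_mem_notMem_affineSubspaces
    (I := Sum.inl '' W ∪ Sum.inr '' (univ ×ˢ {p | p ∈ 𝓟 ∧ X.dim p.2 + 2 ≤ n}))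
    ((hW.finite.image _).union ((finite_univ.prod (hfin.subset fun p hp => hp.1)).image _)) 𝓛
    (by
      rintro _ (⟨w, hw, rfl⟩ | ⟨⟨i, p⟩, ⟨-, hp⟩, rfl⟩)
      · exact wallSpace_ne_top (hW.ne_zero w hw)
      · exact (hL (q i) p hp.1 hp.2).1) isOpen_interior (PolyComplex.interior_nonempty ht)
  rw [← Y.image_relInt] at hx
  obtain ⟨z, hz, rfl⟩ := hx
  have hzoff : ∀ w ∈ W, intForm w.1 (Y.chart t z) ≠ w.2 := fun w hw h =>
    hxL (Sum.inl w) (Or.inl ⟨w, hw, rfl⟩) h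
  have key : ∀ (i : Bool) (y₁ : β), (bif i then y else y') = y₁ → ∀ z' ∈ Y.relInt t, ∀ c : ℝ,
      c ≠ 0 → Y.chart t z' = Y.chart t y₁ + c • (Y.chart t z - Y.chart t y₁) →
      ∀ r ∈ X.cells, X.dim r + 2 ≤ n → ∀ h : H, z' ∉ h • f.toFun '' X.relInt r := by
    rintro i _ rfl z' hz' c hc hz'c r hr hrd h hmem
    have htgt := smul_tgt_of_mem_relInt hYo hr hmem
    rw [PolyComplex.cellOf_eq ht hz'] at htgt
    obtain ⟨p, hp, himg, hpd, -⟩ := hcov r hr h htgt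
    have hpd' : X.dim p.2 + 2 ≤ n := by rwa [hpd]
    refine hc ((hL (q i) p hp hpd').2 _
      (hxL (Sum.inr (i, p)) (Or.inr ⟨(i, p), ⟨mem_univ _, hp, hpd'⟩, rfl⟩)) c ?_)
    rw [← hz'c, himg]
    exact mem_image_of_mem _ (smul_set_mono (image_mono (X.relInt_subset r)) hmem)
  exact (hf.count_eq_of_line hq ht htd hW hy hz hoff hzoff (key true y rfl)).trans
    (hf.count_eq_of_line hq ht htd hW hy' hz hoff' hzoff (key false y' rfl)).symm

end IsTropical

end OrbitMorphism

/-! ### The generic number of preimages of a cell -/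

namespace OrbitMorphism

variable {α β : Type*} [TopologicalSpace α] [TopologicalSpace β]
  {X : PolyComplex α} {Y : PolyComplex β} {G H : Type*} [Group G] [Group H]
  [MulAction G α] [MulAction H β] {f : OrbitMorphism X Y G H} {ωX : Set α → ℚ} {ωY : Set β → ℚ}
  {n : ℕ} {s : Set α} {t u : Set β}

/-- A chosen wall set of the cell `t`. -/
def walls (f : OrbitMorphism X Y G H) (t : Set β) : Set ((Fin (Y.dim t) → ℤ) × ℝ) :=
  Classical.epsilon (f.IsWallSet t)

/-- The points of the relative interior of `t` off its walls. -/
def IsOff (f : OrbitMorphism X Y G H) (t : Set β) (y : β) : Prop :=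
  y ∈ Y.relInt t ∧ ∀ w ∈ f.walls t, intForm w.1 (Y.chart t y) ≠ w.2

open Classical in
/-- The weighted number of preimages of the generic points of the cell `t`. -/
def genCount (f : OrbitMorphism X Y G H) (n : ℕ) (ωX : Set α → ℚ) (t : Set β) : ℚ :=
  if h : ∃ y, f.IsOff t y then f.count n ωX h.choose else 0

lemma count_smul (f : OrbitMorphism X Y G H) (h : H) (y : β) :
    f.count n ωX (h • y) = f.count n ωX y := by
  unfold count
  rw [← finsum_comp_equiv ((Equiv.mulLeft h).prodCongr (Equiv.refl (Set α)))]
  refine finsum_congr fun p => ?_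
  have hiff : h • y ∈ (h * p.1) • f.toFun '' p.2 ↔ y ∈ p.1 • f.toFun '' p.2 := by
    rw [mul_smul, smul_mem_smul_set_iff]
  by_cases hy : y ∈ p.1 • f.toFun '' p.2
  · exact (if_pos (hiff.mpr hy)).trans (if_pos hy).symm
  · exact (if_neg fun h => hy (hiff.mp h)).trans (if_neg hy).symm

namespace IsTropical

variable (hf : f.IsTropical ωX ωY n)
include hf

lemma isWallSet_walls (ht : t ∈ Y.cells) : f.IsWallSet t (f.walls t) :=
  Classical.epsilon_spec (hf.exists_isWallSet ht)

lemma exists_isOff_mem (ht : t ∈ Y.cells) {O : Set β} (hO : IsOpen O)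
    (hne : (O ∩ Y.relInt t).Nonempty) : ∃ y ∈ O, f.IsOff t y := by
  obtain ⟨V, hV, hVm⟩ := PolyComplex.exists_open_chart_image ht hO
  obtain ⟨x, hxO, hx⟩ := hne
  have hW := hf.isWallSet_walls ht
  obtain ⟨p, hp, hpW⟩ := exists_mem_notMem_affineSubspaces hW.finite wallSpace
    (fun w hw => wallSpace_ne_top (hW.ne_zero w hw)) (hV.inter isOpen_interior)
    ⟨Y.chart t x, (hVm x hx.1).mp hxO, hx.2⟩
  obtain ⟨y, hy, rfl⟩ := Y.image_relInt t ▸ hp.2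
  exact ⟨y, (hVm y hy.1).mpr hp.1, hy, hpW⟩

lemma exists_isOff (ht : t ∈ Y.cells) : ∃ y, f.IsOff t y := by
  obtain ⟨y, -, hy⟩ := hf.exists_isOff_mem ht isOpen_univ (by
    rw [univ_inter]
    exact PolyComplex.relInt_nonempty ht)
  exact ⟨y, hy⟩

lemma count_eq_genCount (hq : IsQuotientMap f.orbitMap) (ht : t ∈ Y.cells) (htd : Y.dim t = n)
    {y : β} (hy : f.IsOff t y) : f.count n ωX y = f.genCount n ωX t := by
  have h : ∃ y, f.IsOff t y := ⟨y, hy⟩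
  rw [genCount, dif_pos h]
  exact hf.count_eq_of_off_walls hq ht htd (hf.isWallSet_walls ht) hy.1 h.choose_spec.1 hy.2
    h.choose_spec.2

lemma isOpen_isOff (ht : t ∈ Y.cells) (htd : Y.dim t = n) : IsOpen {y | f.IsOff t y} := by
  have hW := hf.isWallSet_walls ht
  have h1 : {y | f.IsOff t y}
      = Y.relInt t ∩ Y.chart t ⁻¹' ⋂ w ∈ f.walls t, {x | intForm w.1 x ≠ w.2} := by
    ext y
    simp [IsOff]
  rw [h1]
  refine ((PolyComplex.chart_continuousOn ht).mono (Y.relInt_subset t)).isOpen_inter_preimage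
    (hf.target.isOpen_relInt ht htd) (hW.finite.isOpen_biInter fun w _ => ?_)
  exact isOpen_ne_fun (continuous_intForm w.1) continuous_const

/-- The walls of `t` and of `h • t` are chosen independently, so a point is taken that is generic
for both choices; at such a point invariance of `count` decides. -/
lemma genCount_smul (hq : IsQuotientMap f.orbitMap) (ht : t ∈ Y.cells) (htd : Y.dim t = n)
    (h : H) : f.genCount n ωX (h • t) = f.genCount n ωX t := by
  have hYo := hf.target.orbitSpace
  obtain ⟨y, hy⟩ := hf.exists_isOff ht
  obtain ⟨z, hz, hz'⟩ := hf.exists_isOff_mem (hYo.smul_mem h t ht)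
    (O := (fun z => h⁻¹ • z) ⁻¹' {y | f.IsOff t y})
    ((hf.isOpen_isOff ht htd).preimage (hYo.continuous_smul h⁻¹))
    ⟨h • y, by simpa using hy, hYo.smul_mem_relInt ht h hy.1⟩
  rw [← hf.count_eq_genCount hq (hYo.smul_mem h t ht) ((hYo.dim_smul h ht).trans htd) hz',
    ← hf.count_eq_genCount hq ht htd hz, f.count_smul]

/-- Let `u` be a facet of the top-dimensional cell `t`. If the image of a good cell contains a
generic point of `u`, it contains the rays from this point into the interior of `t`. -/
lemma eventually_ray_mem (hu : u ∈ Y.cells) (hud : Y.dim u + 1 = n) (ht : t ∈ Y.cells)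
    (hut : u ⊂ t) (hs : f.IsGood n s) {h : H} (htgt : h • tgt X Y f.toFun s = t) {Q : β}
    (hQ : f.IsOff u Q) (hQs : Q ∈ h • f.toFun '' s) {z : β} (hz : z ∈ Y.relInt t) :
    ∀ᶠ c : ℝ in 𝓝[>] 0, Y.chart t Q + c • (Y.chart t z - Y.chart t Q)
      ∈ Y.chart t '' (h • f.toFun '' s) := by
  have hX := hf.source
  have hYo := hf.target.orbitSpace
  obtain ⟨P, hP, rfl⟩ := mem_smul_image.mp hQs
  set r := X.cellOf P with hr_def
  have hr : r ∈ X.cells := X.cellOf_mem P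
  have hPr : P ∈ X.relInt r := X.mem_relInt_cellOf P
  have hPQ : h • f.toFun P ∈ h • f.toFun '' X.relInt r := mem_smul_image.mpr ⟨P, hPr, rfl⟩
  have hru : h • tgt X Y f.toFun r = u := by
    rw [smul_tgt_of_mem_relInt hYo hr hPQ, PolyComplex.cellOf_eq hu hQ.1]
  have hrs : r ⊂ s := by
    refine (PolyComplex.cellOf_subset hs.mem hP).ssubset_of_ne fun hrs => hut.ne ?_
    rw [← hru, hr_def, hrs, htgt]
  -- A face of smaller dimension than the facet `u` would be degenerate, and `Q` is off the walls of
  -- `u`.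
  have hrd : X.dim r + 1 = n := by
    have h1 := PolyComplex.dim_lt_of_ssubset hr hs.mem hrs
    have h2 : ¬ X.dim r < Y.dim u := by
      intro hlt
      obtain ⟨w, hw, hw'⟩ := (hf.isWallSet_walls hu).degenerate r hr h hru
        (Or.inl (by rwa [← hYo.dim_smul h (f.isCellMap.tgt_mem hr), hru])) _
        (smul_set_mono (image_mono (X.relInt_subset r)) hPQ)
      exact hQ.2 w hw hw'
    rw [hs.dim_eq] at h1
    omega
  obtain ⟨-, l, w, -, hw, -⟩ := hX.balanced r hr hrd
  obtain ⟨Jr, br, Kr, cr, hJr, -, hKJr, -, hspanr⟩ :=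
    PolyComplex.exists_star_coords hr hr Subset.rfl
  obtain ⟨J, b, K, c₀, -, -, -, -, hgen, hc₀, hout⟩ :=
    PolyComplex.exists_facet_coords hr hs.mem hrs.1 (hw s ⟨hs.mem, hrs⟩) hJr hKJr hspanr
  obtain ⟨A, e, B, hA, hBA, hAB, -⟩ := hs.exists_matrix hYo h htgt
  obtain ⟨a, p, hle, hface⟩ := PolyComplex.exists_face_form hu ht hut.1
  have hinterior : ∀ z ∈ Y.relInt t, p < intForm a (Y.chart t z) := fun z hz =>
    lt_of_le_of_ne (hle z hz.1) fun heq =>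
      hut.2 (PolyComplex.subset_of_mem_relInt ht hu hz ((hface z hz.1).mp heq.symm))
  obtain ⟨x, hx⟩ := PolyComplex.relInt_nonempty hs.mem
  have hxr : x ∉ r := fun hxr => hrs.2 (PolyComplex.subset_of_mem_relInt hs.mem hr hx hxr)
  obtain ⟨k₀, y₀, hk₀, hxP⟩ := hout x
    ⟨hx.1, PolyComplex.relInt_subset_star_of_subset hs.mem hrs.1 hx⟩ hxr P hPr
  -- The form that cuts `u` out of `t` is constant on the image of `r`, which lies in `u`.
  have haJ : ∀ y, intForm a ((rmat A).mulVec ((rmat (K * Jr)).mulVec y)) = 0 := by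
    have h1 : ∀ x ∈ X.chart r '' X.relInt r, intForm (Matrix.vecMul a (A * (K * Jr))) x
        = p - intForm a ((rmat A).mulVec c₀ + e) := by
      rintro _ ⟨z, hz, rfl⟩
      have hzu : h • f.toFun z ∈ u := by
        rw [← hru]
        exact smul_mem_smul_set (f.isCellMap.mapsTo hr hz.1)
      have h2 := (hface _ (hut.1 hzu)).mpr hzu
      rw [hA z (hrs.1 hz.1), hc₀ z hz, Matrix.mulVec_add, Matrix.mulVec_mulVec, ← rmat_mul,
        add_assoc, intForm_add, intForm_mulVec] at h2
      linarith
    have h3 := (eq_zero_of_intForm_eq (PolyComplex.affineSpan_relInt hr) h1).1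
    intro y
    rw [Matrix.mulVec_mulVec, ← rmat_mul, intForm_mulVec, h3, intForm_zero_left]
  have hPp := (hface _ (hut.1 hQ.1.1)).mpr hQ.1.1
  have hau : 0 < intForm a ((rmat A).mulVec (rvec (K.mulVec (w s)))) := by
    have hxt : h • f.toFun x ∈ Y.relInt t := by
      rw [← htgt]
      exact hYo.smul_mem_relInt (f.isCellMap.tgt_mem hs.mem) h (f.isCellMap.mapsTo_relInt hs.mem hx)
    have h1 := hinterior _ hxt
    have h2 : X.chart s x = X.chart s P + (k₀ • rvec (K.mulVec (w s)) + (rmat (K * Jr)).mulVec y₀) :=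
      by
        rw [← hxP]
        abel
    rw [hA x hx.1, h2, Matrix.mulVec_add, add_right_comm, ← hA P hP, intForm_add, hPp,
      Matrix.mulVec_add, intForm_add, haJ, Matrix.mulVec_smul, intForm_smul] at h1
    have h3 : 0 < k₀ * intForm a ((rmat A).mulVec (rvec (K.mulVec (w s)))) := by linarith
    exact (mul_pos_iff_of_pos_left hk₀).mp h3
  obtain ⟨k, y, hky⟩ := hgen.exists_real (B.mulVec (Y.chart t z - Y.chart t (h • f.toFun P)))
  have hv : Y.chart t z - Y.chart t (h • f.toFun P)
      = (rmat A).mulVec (k • rvec (K.mulVec (w s)) + (rmat (K * Jr)).mulVec y) := by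
    rw [← hky, Matrix.mulVec_mulVec, hAB, Matrix.one_mulVec]
  -- The same form increases from `Q` to the interior point `z` and increases along the image of the
  -- normal of `s`, so the direction to `z` points into the half space of `s`.
  have hk : 0 < k := by
    have h1 := hinterior z hz
    have h2 := congrArg (intForm a) hv
    rw [intForm_sub, hPp, Matrix.mulVec_add, intForm_add, haJ, Matrix.mulVec_smul,
      intForm_smul] at h2
    have h3 : 0 < k * intForm a ((rmat A).mulVec (rvec (K.mulVec (w s)))) := by linarith
    exact (mul_pos_iff_of_pos_right hau).mp h3
  filter_upwards [(PolyComplex.eventually_mem_halfspace hr hs.mem hrs hPr hc₀ hx.1 hxr hk₀ hxP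
    k y).1 hk.le] with c hc
  rw [hv]
  exact (ray_mem_image_iff hA hBA hP _ c).mpr hc

open Classical in
/-- The generic number of preimages of a top-dimensional cell can be computed at a generic point
of a facet. -/
lemma genCount_eq_sum (hq : IsQuotientMap f.orbitMap) (hu : u ∈ Y.cells) (hud : Y.dim u + 1 = n)
    (ht : t ∈ Y.cells) (htd : Y.dim t = n) (hut : u ⊂ t) {Q : β} (hQ : f.IsOff u Q) :
    f.genCount n ωX t = ∑ p ∈ (hf.finite_pairs ht).toFinset,
      if Q ∈ p.1 • f.toFun '' p.2 then f.coef n ωX p.2 else 0 := by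
  have hW := hf.isWallSet_walls ht
  obtain ⟨z, hz⟩ := hf.exists_isOff ht
  have hQt : Q ∈ t := hut.1 hQ.1.1
  set γ : ℝ → Fin (Y.dim t) → ℝ := fun c => Y.chart t Q + c • (Y.chart t z - Y.chart t Q) with hγ
  have h1 : ∀ᶠ c : ℝ in 𝓝[>] 0, ∀ p ∈ (hf.finite_pairs ht).toFinset,
      (γ c ∈ Y.chart t '' (p.1 • f.toFun '' p.2) ↔ Q ∈ p.1 • f.toFun '' p.2) := by
    rw [Filter.eventually_all_finset]
    intro p hp
    obtain ⟨hgood, htgt, hsub⟩ := hf.of_mem_pairs ht htd hp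
    by_cases hQp : Q ∈ p.1 • f.toFun '' p.2
    -- Move from `Q` into `t`: images through `Q` contain the beginning of the ray, and closed
    -- images that miss `Q` miss it.
    · filter_upwards [hf.eventually_ray_mem hu hud ht hut hgood htgt hQ hQp hz.1] with c hc
      exact iff_of_true hc hQp
    · obtain ⟨V, hV, hVm⟩ := PolyComplex.exists_open_chart_image ht
        (hf.isClosed_smul_image hq hgood p.1).isOpen_compl
      filter_upwards [eventually_ray_of_nhds (hV.mem_nhds ((hVm Q hQt).mp hQp)) _] with c hc
      refine iff_of_false ?_ hQp
      rintro ⟨y, hy, hyc⟩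
      exact (hVm y (hsub hy)).mpr (hyc ▸ hc) hy
  -- The endpoint `z` lies on no wall, so the segment meets each wall at most once and its points
  -- close to `Q` are generic.
  obtain ⟨s₀, hs₀, hs₁, hbad⟩ := exists_pos_forall_notMem
    (hW.finite.biUnion fun w hw => finite_segment_wall (p := Y.chart t Q) (hz.2 w hw))
  obtain ⟨c, hc, hcI⟩ := (h1.and (Ioo_mem_nhdsGT hs₀)).exists
  have hint : γ c ∈ interior (Y.chart t '' t) := by
    exact (PolyComplex.convex_image ht).add_smul_sub_mem_interior (mem_image_of_mem _ hQt) hz.1.2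
      ⟨hcI.1, hcI.2.le.trans hs₁⟩
  obtain ⟨y, hy, hyc⟩ := Y.image_relInt t ▸ hint
  have hyoff : f.IsOff t y := by
    refine ⟨hy, fun w hw hw' => hbad c hcI.1 hcI.2.le (mem_biUnion hw ?_)⟩
    rw [hyc] at hw'
    exact hw'
  rw [← hf.count_eq_genCount hq ht htd hyoff,
    hf.count_eq_sum ht (PolyComplex.cellOf_eq ht hy).ge]
  refine Finset.sum_congr rfl fun p hp => ?_
  have h2 := hc p hp
  rw [← hyc, mem_image_chart ht (hf.of_mem_pairs ht htd hp).2.2 hy.1] at h2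
  exact if_congr h2 rfl rfl

end IsTropical

end OrbitMorphism

/-! ### The generic numbers of preimages are balanced -/

namespace OrbitMorphism

variable {α β : Type*} [TopologicalSpace α] [TopologicalSpace β]
  {X : PolyComplex α} {Y : PolyComplex β} {G H : Type*} [Group G] [Group H]
  [MulAction G α] [MulAction H β] {f : OrbitMorphism X Y G H} {ωX : Set α → ℚ} {ωY : Set β → ℚ}
  {n : ℕ} {r s : Set α} {t u : Set β}

/-- Comparison of the primitive normal vectors and of the lattice indices along `f`. -/
lemma idx_mul_eq (hf : f.IsTropical ωX ωY n) (hu : u ∈ Y.cells) (hud : Y.dim u + 1 = n)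
    {w : Set β → Fin (Y.starDim u) → ℤ}
    (hw : ∀ t ∈ Y.above u, IsPrimitiveNormal (starCone Y u u) (starCone Y u t) (w t))
    {L : (Fin (Y.starDim u) → ℝ) →ₗ[ℝ] ℝ}
    (hL : ∀ v ∈ Submodule.span ℝ (starCone Y u u), L v = 0)
    {h : H} (hr : r ∈ X.cells) (hrd : X.dim r + 1 = n) (htgt : h • tgt X Y f.toFun r = u)
    {D : Matrix (Fin (Y.starDim u)) (Fin (X.starDim r)) ℤ} {e : Fin (Y.starDim u) → ℝ}
    (hD : ∀ x ∈ X.star r, Y.starChart u (h • f.toFun x) = (rmat D).mulVec (X.starChart r x) + e)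
    {Jr : Matrix (Fin (X.starDim r)) (Fin (X.dim r)) ℤ} {br : Fin (X.starDim r) → ℝ}
    {Kr : Matrix (Fin (X.dim r)) (Fin (X.starDim r)) ℤ}
    (hJr : ∀ x ∈ r ∩ X.star r, X.starChart r x = (rmat Jr).mulVec (X.chart r x) + br)
    (hKJr : Kr * Jr = 1)
    (hspanr : Submodule.span ℝ (starCone X r r) = LinearMap.range (rmat Jr).mulVecLin)
    {Ju : Matrix (Fin (Y.starDim u)) (Fin (Y.dim u)) ℤ} {bu : Fin (Y.starDim u) → ℝ}
    {Ku : Matrix (Fin (Y.dim u)) (Fin (Y.starDim u)) ℤ}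
    (hJu : ∀ x ∈ u ∩ Y.star u, Y.starChart u x = (rmat Ju).mulVec (Y.chart u x) + bu)
    (hKJu : Ku * Ju = 1)
    (hspanu : Submodule.span ℝ (starCone Y u u) = LinearMap.range (rmat Ju).mulVecLin)
    {T : Matrix (Fin (Y.dim u)) (Fin (X.dim r)) ℤ} (hT : D * Jr = Ju * T)
    (hlatT : latIdx T = f.idx r)
    (hs : s ∈ X.above r) {ws : Fin (X.starDim r) → ℤ}
    (hws : IsPrimitiveNormal (starCone X r r) (starCone X r s) ws) :
    (f.IsGood n s → (f.idx s : ℝ) * L (rvec (w (h • tgt X Y f.toFun s)))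
      = f.idx r * L ((rmat D).mulVec (rvec ws))) ∧
    (¬ f.IsGood n s → (f.idx r : ℝ) * L ((rmat D).mulVec (rvec ws)) = 0) := by
  have hX := hf.source
  have hYo := hf.target.orbitSpace
  set t := h • tgt X Y f.toFun s with ht_def
  have ht : t ∈ Y.cells := hYo.smul_mem h _ (f.isCellMap.tgt_mem hs.1)
  have hsd : X.dim s = n := by
    have := PolyComplex.dim_lt_of_ssubset hr hs.1 hs.2
    have := (hX.pure_dim s hs.1).1
    omega
  have hut : u ⊆ t := by
    rw [← htgt]
    exact smul_set_mono (f.isCellMap.tgt_mono hr hs.1 hs.2.1)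
  obtain ⟨J, b, K, c₀, hJ, -, hJJr, hJw, hgen, -, -⟩ :=
    PolyComplex.exists_facet_coords hr hs.1 hs.2.1 hws hJr hKJr hspanr
  obtain ⟨P, hP⟩ := PolyComplex.relInt_nonempty hr
  have hPstar : P ∈ X.star r := PolyComplex.relInt_subset_star hr hP
  obtain ⟨x, hx⟩ := PolyComplex.relInt_nonempty hs.1
  have hxstar : x ∈ X.star r := PolyComplex.relInt_subset_star_of_subset hs.1 hs.2.1 hx
  have hxr : x ∉ r := fun hxr => hs.2.2 (PolyComplex.subset_of_mem_relInt hs.1 hr hx hxr)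
  obtain ⟨k, hk, hkmem⟩ := hws.exists_smul (x := X.starChart r x) ⟨x, ⟨hx.1, hxstar⟩, rfl⟩ (by
    rintro ⟨z, hz, hzx⟩
    exact hxr (PolyComplex.starChart_injOn hr hz.2 hxstar hzx ▸ hz.1))
  have hPu : h • f.toFun P ∈ Y.relInt u := by
    rw [← htgt]
    exact hYo.smul_mem_relInt (f.isCellMap.tgt_mem hr) h (f.isCellMap.mapsTo_relInt hr hP)
  have hxt : h • f.toFun x ∈ Y.relInt t :=
    hYo.smul_mem_relInt (f.isCellMap.tgt_mem hs.1) h (f.isCellMap.mapsTo_relInt hs.1 hx)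
  have hDV : ∀ v ∈ Submodule.span ℝ (starCone X r r),
      (rmat D).mulVec v ∈ Submodule.span ℝ (starCone Y u u) := by
    intro v hv
    rw [hspanr] at hv
    obtain ⟨y, rfl⟩ := hv
    rw [hspanu, Matrix.mulVecLin_apply, Matrix.mulVec_mulVec, ← rmat_mul, hT, rmat_mul,
      ← Matrix.mulVec_mulVec]
    exact ⟨_, rfl⟩
  have hPV : X.starChart r P ∈ Submodule.span ℝ (starCone X r r) :=
    Submodule.subset_span ⟨P, ⟨hP.1, hPstar⟩, rfl⟩
  have hPV' : Y.starChart u (h • f.toFun P) ∈ Submodule.span ℝ (starCone Y u u) :=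
    Submodule.subset_span ⟨_, ⟨hPu.1, PolyComplex.relInt_subset_star hu hPu⟩, rfl⟩
  -- the image of `k • ws` modulo the span of the facet
  have hkD : Y.starChart u (h • f.toFun x) - k • (rmat D).mulVec (rvec ws)
      ∈ Submodule.span ℝ (starCone Y u u) := by
    have h1 := Submodule.add_mem _ (hDV _ (Submodule.sub_mem _ hkmem hPV)) hPV'
    convert h1 using 1
    rw [hD x hxstar, hD P hPstar, Matrix.mulVec_sub, Matrix.mulVec_sub, Matrix.mulVec_smul]
    abel
  by_cases hut' : u = t
  -- Here `s` is flattened onto the facet `u`. It is not good, and the image of its normal vector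
  -- lies in the span of `u`, where `L` vanishes.
  · have hbad : ¬ f.IsGood n s := by
      intro hgood
      have h1 : Y.dim t = n := by rw [ht_def, hYo.dim_smul h (f.isCellMap.tgt_mem hs.1),
        hgood.dim_tgt]
      rw [← hut'] at h1
      omega
    refine ⟨fun h => absurd h hbad, fun _ => ?_⟩
    have hxu : Y.starChart u (h • f.toFun x) ∈ Submodule.span ℝ (starCone Y u u) := by
      have hx' : h • f.toFun x ∈ Y.relInt u := by
        have := hxt
        rwa [← hut'] at this
      exact Submodule.subset_span ⟨_, ⟨hx'.1, PolyComplex.relInt_subset_star hu hx'⟩, rfl⟩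
    have h1 := hL _ (Submodule.sub_mem _ hxu hkD)
    rw [sub_sub_cancel, _root_.map_smul, smul_eq_mul] at h1
    rw [(mul_eq_zero.mp h1).resolve_left hk.ne', mul_zero]
  · have htab : t ∈ Y.above u := ⟨ht, hut.ssubset_of_ne hut'⟩
    have htd : Y.dim t = n := by
      have := PolyComplex.dim_lt_of_ssubset hu ht htab.2
      have := (hf.target.pure_dim t ht).1
      omega
    have hxstar' : h • f.toFun x ∈ Y.star u :=
      PolyComplex.relInt_subset_star_of_subset ht hut hxt
    obtain ⟨k', hk', hkmem'⟩ := (hw t htab).exists_smul (x := Y.starChart u (h • f.toFun x))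
      ⟨_, ⟨hxt.1, hxstar'⟩, rfl⟩ (by
        rintro ⟨z, hz, hzx⟩
        have := PolyComplex.starChart_injOn hu hz.2 hxstar' hzx ▸ hz.1
        exact htab.2.2 (PolyComplex.subset_of_mem_relInt ht hu hxt this))
    -- `D ws` is `k' / k` times the normal vector modulo the span of the facet
    have hDw : (rmat D).mulVec (rvec ws) - (k' / k) • rvec (w t)
        ∈ Submodule.span ℝ (starCone Y u u) := by
      have h1 := Submodule.smul_mem _ k⁻¹ (Submodule.sub_mem _ hkmem' hkD)
      convert h1 using 1
      rw [sub_sub_sub_cancel_left, smul_sub, smul_smul, smul_smul, inv_mul_cancel₀ hk.ne',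
        one_smul, div_eq_inv_mul]
    have hLw : L ((rmat D).mulVec (rvec ws)) = k' / k * L (rvec (w t)) := by
      have h1 := hL _ hDw
      rw [map_sub, _root_.map_smul, smul_eq_mul] at h1
      linarith
    obtain ⟨Jt, bt, Kt, ct, -, ⟨c, hKt⟩, -, -, hgent, -, -⟩ :=
      PolyComplex.exists_facet_coords hu ht hut (hw t htab) hJu hKJu hspanu
    have hA : ∀ x ∈ s, Y.chart t (h • f.toFun x)
        = (rmat (Kt * D * J)).mulVec (X.chart s x) + ((rmat Kt).mulVec ((rmat D).mulVec b + e) + c)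
        := by
      refine f.matrix_eqOn_of_relInt hYo hs.1 rfl fun z hz => ?_
      have hz' : z ∈ s ∩ X.star r :=
        ⟨hz.1, PolyComplex.relInt_subset_star_of_subset hs.1 hs.2.1 hz⟩
      have hzt : h • f.toFun z ∈ Y.relInt t :=
        hYo.smul_mem_relInt (f.isCellMap.tgt_mem hs.1) h (f.isCellMap.mapsTo_relInt hs.1 hz)
      rw [hKt _ ⟨hzt.1, PolyComplex.relInt_subset_star_of_subset ht hut hzt⟩, hD z hz'.2, hJ z hz',
        Matrix.mulVec_add, Matrix.mulVec_add, Matrix.mulVec_add, Matrix.mulVec_add,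
        Matrix.mulVec_mulVec, Matrix.mulVec_mulVec, ← rmat_mul, ← rmat_mul, Matrix.mul_assoc]
      simp only [add_assoc]
    have hlat := f.latIdx_smul_eq_idx hYo h hs.1 rfl hA
    rw [hspanu] at hDw
    obtain ⟨y, hy⟩ := hDw
    -- Modulo the span of `u`, `f` stretches the normal vector by k' / k; the index on `s` is
    -- therefore idx r · k' / k, and the factor cancels against the value of `L`.
    have hfacet := latIdx_facet (A := Kt * D * J) (u := K.mulVec ws) (J := K * Jr) (K := Kt)
      (J' := Ju) (T := T) (u' := w t) (k := k' / k) (y := y)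
      (by omega) (htd.trans hrd.symm) (hsd.trans hrd.symm) hgen
      (by rw [Matrix.mul_assoc, hJJr, Matrix.mul_assoc, hT, Matrix.mul_assoc]) hgent (by
        rw [← Matrix.mulVec_mulVec, hJw, ← Matrix.mulVec_mulVec, ← rmat_mulVec_rvec,
          ← rmat_mulVec_rvec]
        congr 1
        have hy' : (rmat Ju).mulVec y = (rmat D).mulVec (rvec ws) - (k' / k) • rvec (w t) := hy
        rw [hy']
        abel)
    rw [hlat, hlatT, abs_of_pos (div_pos hk' hk)] at hfacet
    have hmain : (f.idx s : ℝ) * L (rvec (w t)) = f.idx r * L ((rmat D).mulVec (rvec ws)) := by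
      rw [hfacet, hLw]
      ring
    refine ⟨fun _ => hmain, fun hbad => ?_⟩
    -- In this case the target has full dimension, so only a zero index can keep `s` from being
    -- good.
    have h0 : f.idx s = 0 := by
      by_contra hne
      refine hbad ⟨hs.1, hsd, ?_, hne⟩
      rw [← htd, ht_def, hYo.dim_smul h (f.isCellMap.tgt_mem hs.1)]
    rw [← hmain, h0, Nat.cast_zero, zero_mul]

/-- The balancing condition of `X` at a facet that is mapped onto a facet of `Y`. -/
lemma finsum_facet_eq_zero (hf : f.IsTropical ωX ωY n) (hu : u ∈ Y.cells) (hud : Y.dim u + 1 = n)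
    {w : Set β → Fin (Y.starDim u) → ℤ}
    (hw : ∀ t ∈ Y.above u, IsPrimitiveNormal (starCone Y u u) (starCone Y u t) (w t))
    {L : (Fin (Y.starDim u) → ℝ) →ₗ[ℝ] ℝ}
    (hL : ∀ v ∈ Submodule.span ℝ (starCone Y u u), L v = 0)
    {h : H} (hr : r ∈ X.cells) (hrd : X.dim r + 1 = n) (htgt : h • tgt X Y f.toFun r = u)
    (hex : ∃ s, f.IsGood n s ∧ r ⊂ s) :
    ∑ᶠ s ∈ {s | s ∈ X.above r ∧ f.IsGood n s}, (ωX s * f.idx s) *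
      L (rvec (w (h • tgt X Y f.toFun s))) = 0 := by
  classical
  have hX := hf.source
  have hYo := hf.target.orbitSpace
  have hfix : (fixingSubgroup G r : Set G).Finite := by
    obtain ⟨s₀, hs₀, hrs₀⟩ := hex
    exact (hf.finite_stabilizer_facet hs₀ hr hrs₀.1).subset fun g hg => smul_eq_of_mem_fixing hg
  have hdim : ∀ s ∈ X.above r, X.dim s = n := fun s hs => by
    have := PolyComplex.dim_lt_of_ssubset hr hs.1 hs.2
    have := (hX.pure_dim s hs.1).1
    omega
  have hbal := hX.balanced r hr hrd
  obtain ⟨ws, hws, hsum⟩ := hbal.exists_sum_mem hX.orbitSpace hr hfix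
    fun g s hs => hX.weight_smul g s hs.1 (hdim s hs)
  obtain ⟨Jr, br, Kr, cr, hJr, -, hKJr, -, hspanr⟩ :=
    PolyComplex.exists_star_coords hr hr Subset.rfl
  obtain ⟨Ju, bu, Ku, cu, hJu, -, hKJu, -, hspanu⟩ :=
    PolyComplex.exists_star_coords hu hu Subset.rfl
  obtain ⟨-, D, e, hD⟩ := f.exists_star_matrix hYo h hr htgt
  obtain ⟨T, c, hTc⟩ := f.exists_matrix hYo h hr htgt
  have hlatT := f.latIdx_smul_eq_idx hYo h hr htgt hTc
  -- The star matrix `D` restricts on the facet to the matrix `T` of `f` in the charts of `r` and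
  -- `u`.
  have hT : D * Jr = Ju * T := by
    refine rmat_injective (mulVec_add_ext (PolyComplex.affineSpan_relInt hr)
      (b := (rmat D).mulVec br + e) (b' := (rmat Ju).mulVec c + bu) ?_).1
    rintro _ ⟨z, hz, rfl⟩
    have hz' : z ∈ r ∩ X.star r := ⟨hz.1, PolyComplex.relInt_subset_star hr hz⟩
    have hzu : h • f.toFun z ∈ Y.relInt u := by
      rw [← htgt]
      exact hYo.smul_mem_relInt (f.isCellMap.tgt_mem hr) h (f.isCellMap.mapsTo_relInt hr hz)
    have h1 := hJu _ ⟨hzu.1, PolyComplex.relInt_subset_star hu hzu⟩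
    rw [hD z hz'.2, hJr z hz', hTc z hz.1, Matrix.mulVec_add, Matrix.mulVec_add,
      Matrix.mulVec_mulVec, Matrix.mulVec_mulVec, ← rmat_mul, ← rmat_mul] at h1
    simpa only [add_assoc] using h1
  have hone := fun s hs => idx_mul_eq hf hu hud hw hL hr hrd htgt hD hJr hKJr hspanr hJu hKJu
    hspanu hT hlatT hs (hws s hs)
  have hterm : ∀ s, (∑ᶠ (_ : s ∈ {s | s ∈ X.above r ∧ f.IsGood n s}), (ωX s * f.idx s) *
      L (rvec (w (h • tgt X Y f.toFun s))))
      = f.idx r * ∑ᶠ (_ : s ∈ X.above r), (ωX s : ℝ) * L ((rmat D).mulVec (rvec (ws s))) := by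
    intro s
    by_cases hs : s ∈ X.above r
    · rw [finsum_eq_if, finsum_eq_if, if_pos hs]
      by_cases hgood : f.IsGood n s
      · rw [if_pos ⟨hs, hgood⟩, mul_assoc, (hone s hs).1 hgood]
        ring
      · rw [if_neg fun hg => hgood hg.2, mul_left_comm, (hone s hs).2 hgood, mul_zero]
    · simp [hs]
  rw [finsum_congr hterm, ← mul_finsum]
  have hz : L ((rmat D).mulVecLin (∑ᶠ s ∈ X.above r, (ωX s : ℝ) • rvec (ws s))) = 0 := by
    rw [hspanr] at hsum
    obtain ⟨y, hy⟩ := hsum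
    rw [← hy, Matrix.mulVecLin_apply, Matrix.mulVecLin_apply, Matrix.mulVec_mulVec, ← rmat_mul, hT,
      rmat_mul, ← Matrix.mulVec_mulVec]
    exact hL _ (hspanu ▸ ⟨_, rfl⟩)
  rw [finsum_mem_eq_finite_toFinset_sum _ hbal.1, map_sum, map_sum] at hz
  rw [finsum_mem_eq_finite_toFinset_sum _ hbal.1]
  refine mul_eq_zero_of_right _ (Eq.trans ?_ hz)
  refine Finset.sum_congr rfl fun s _ => ?_
  rw [_root_.map_smul, _root_.map_smul, smul_eq_mul, Matrix.mulVecLin_apply]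

/-- The generic numbers of preimages satisfy the balancing condition on `Y`. -/
theorem IsTropical.finsum_genCount_mem (hf : f.IsTropical ωX ωY n)
    (hq : IsQuotientMap f.orbitMap) (hu : u ∈ Y.cells) (hud : Y.dim u + 1 = n)
    {w : Set β → Fin (Y.starDim u) → ℤ}
    (hw : ∀ t ∈ Y.above u, IsPrimitiveNormal (starCone Y u u) (starCone Y u t) (w t)) :
    ∑ᶠ t ∈ Y.above u, (f.genCount n ωX t : ℝ) • rvec (w t)
      ∈ Submodule.span ℝ (starCone Y u u) := by
  classical
  have hYo := hf.target.orbitSpace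
  by_contra hnot
  -- Otherwise some linear form vanishes on the span of the facet but not on the sum. It suffices
  -- that every such form kills the sum, which turns balancing into a numerical identity.
  obtain ⟨L, hL0, hLbot⟩ := Submodule.exists_dual_map_eq_bot_of_notMem hnot inferInstance
  have hL : ∀ v ∈ Submodule.span ℝ (starCone Y u u), L v = 0 := fun v hv => by
    have h1 : L v ∈ Submodule.map L (Submodule.span ℝ (starCone Y u u)) := ⟨v, hv, rfl⟩
    rw [hLbot] at h1
    exact h1
  refine hL0 ?_
  have hfin : (Y.above u).Finite := (hf.target.balanced u hu hud).1
  have hdim : ∀ t ∈ Y.above u, Y.dim t = n := fun t ht => by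
    have := PolyComplex.dim_lt_of_ssubset hu ht.1 ht.2
    have := (hf.target.pure_dim t ht.1).1
    omega
  obtain ⟨Q, hQ⟩ := hf.exists_isOff hu
  have hQcell := PolyComplex.cellOf_eq hu hQ.1
  -- The boundary identity at a generic point of `u`, with the value of `L` on the normal vector of
  -- the target cell as weight. Cells of dimension at most n - 2 are degenerate over `u`, hence
  -- avoid `Q`.
  have hbd := hf.finsum_boundary_eq_zero (Q₀ := Q) (by
      intro r hr hrd h hmem
      obtain ⟨P, hP, hPQ⟩ := mem_smul_image.mp hmem
      have hle := PolyComplex.dim_le_of_subset (X.cellOf_mem P) hr (PolyComplex.cellOf_subset hr hP)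
      have hPQ' : Q ∈ h • f.toFun '' X.relInt (X.cellOf P) :=
        mem_smul_image.mpr ⟨P, X.mem_relInt_cellOf P, hPQ⟩
      have htgt := smul_tgt_of_mem_relInt hYo (X.cellOf_mem P) hPQ'
      rw [hQcell] at htgt
      obtain ⟨w, hw, hw'⟩ := (hf.isWallSet_walls hu).degenerate _ (X.cellOf_mem P) h htgt
        (Or.inl (by
          rw [← hYo.dim_smul h (f.isCellMap.tgt_mem (X.cellOf_mem P)), htgt]
          omega)) _ (smul_set_mono (image_mono (X.relInt_subset _)) hPQ')
      exact hQ.2 w hw hw')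
    (fun h s => L (rvec (w (h • tgt X Y f.toFun s)))) (by
      intro g h s hs
      rw [f.tgt_smul_source hf.source.orbitSpace hYo g hs.mem, mul_smul, inv_smul_smul]) (by
      intro h r hr hrd hmem hex
      have htgt := smul_tgt_of_mem_relInt hYo hr hmem
      rw [hQcell] at htgt
      exact finsum_facet_eq_zero hf hu hud hw hL hr hrd htgt hex)
  set I := (hf.finite_pairs hu).toFinset with hI
  rw [finsum_eq_sum_of_support_subset (s := I)] at hbd
  -- The pairs are grouped by their target cell `t` above `u`; each group adds up to `genCount` of
  -- `t`, computed at `Q`.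
  · rw [← hbd, finsum_mem_eq_finite_toFinset_sum _ hfin, map_sum,
      ← Finset.sum_fiberwise_of_maps_to (s := I) (t := hfin.toFinset)
        (g := fun p => p.1 • tgt X Y f.toFun p.2)]
    · refine Finset.sum_congr rfl fun t ht => ?_
      have ht' := hfin.mem_toFinset.mp ht
      rw [_root_.map_smul, hf.genCount_eq_sum hq hu hud ht'.1 (hdim t ht') ht'.2 hQ, smul_eq_mul,
        Rat.cast_sum, Finset.sum_mul]
      have hset : (hf.finite_pairs ht'.1).toFinset
          = I.filter fun p => p.1 • tgt X Y f.toFun p.2 = t := by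
        ext p
        rw [Finset.mem_filter]
        constructor
        · intro hp
          have hp' := (Finite.mem_toFinset _).mp hp
          exact ⟨(Finite.mem_toFinset _).mpr ⟨hp'.1, ht'.2.1.trans hp'.2⟩,
            (hf.of_mem_pairs ht'.1 (hdim t ht') hp).2.1⟩
        · rintro ⟨hp, hpt⟩
          exact (Finite.mem_toFinset _).mpr ⟨((Finite.mem_toFinset _).mp hp).1, hpt.ge⟩
      rw [hset]
      refine Finset.sum_congr rfl fun p hp => ?_
      obtain ⟨hpI, hpt⟩ := Finset.mem_filter.mp hp
      have hgood := isGood_of_coef_ne_zero ((Finite.mem_toFinset _).mp hpI).1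
      rw [hpt]
      -- The point `Q` lies in the relative interior of `u`, not of `t`, so its preimages in a cell
      -- over `t` lie on the boundary of this cell.
      have hiff : Q ∈ p.1 • f.toFun '' p.2 ↔ Q ∈ p.1 • f.toFun '' (p.2 \ X.relInt p.2) := by
        refine ⟨fun hQp => ?_, fun h => smul_set_mono (image_mono sdiff_subset) h⟩
        obtain ⟨P, hP, hPQ⟩ := mem_smul_image.mp hQp
        refine mem_smul_image.mpr ⟨P, ⟨hP, fun hPr => ?_⟩, hPQ⟩
        have h1 := smul_tgt_of_mem_relInt hYo hgood.mem (mem_smul_image.mpr ⟨P, hPr, hPQ⟩)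
        rw [hQcell] at h1
        exact ht'.2.ne (h1.symm.trans hpt)
      by_cases hQp : Q ∈ p.1 • f.toFun '' p.2
      · rw [if_pos hQp, if_pos (hiff.mp hQp)]
      · rw [if_neg hQp, if_neg (fun h => hQp (hiff.mpr h)), Rat.cast_zero, zero_mul]
    · intro p hp
      have hp' := (Finite.mem_toFinset _).mp hp
      have hgood := isGood_of_coef_ne_zero hp'.1
      have htm := hYo.smul_mem p.1 _ (f.isCellMap.tgt_mem hgood.mem)
      refine hfin.mem_toFinset.mpr ⟨htm, hp'.2.ssubset_of_ne fun he => ?_⟩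
      have h1 := hYo.dim_smul p.1 (f.isCellMap.tgt_mem hgood.mem)
      rw [← he, hgood.dim_tgt] at h1
      omega
  · intro p hp
    rw [Function.mem_support] at hp
    split_ifs at hp with hQp
    swap
    · exact absurd rfl hp
    have hne : f.coef n ωX p.2 ≠ 0 := fun h => left_ne_zero_of_mul hp (by rw [h, Rat.cast_zero])
    rw [hI, Finset.mem_coe, Finite.mem_toFinset]
    refine ⟨hne, ?_⟩
    rw [← hQcell]
    exact cellOf_subset_of_mem hYo (isGood_of_coef_ne_zero hne).mem
      (smul_set_mono (image_mono sdiff_subset) hQp)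

end OrbitMorphism

/-! ### Subcomplexes -/

/-- Faces and intersections only make cones smaller, so a downward closed selection of cones is
again a fan. It provides the star fans of subcomplexes. -/
lemma IsOpenFan.sep {n : ℕ} {F : Set (Set (Fin n → ℝ))} (hF : IsOpenFan F)
    {p : Set (Fin n → ℝ) → Prop} (hp : ∀ S S', S ⊆ S' → p S' → p S) :
    IsOpenFan {S | S ∈ F ∧ p S} := by
  obtain ⟨C, R, U, hC, hR, hU, h0, rfl⟩ := hF
  have hzero : ∀ c ∈ C, (0 : Fin n → ℝ) ∈ c := by
    intro c hc
    obtain ⟨W, rfl⟩ := hC.closedCone c hc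
    intro a _
    simp [intForm]
  set C' := {c | c ∈ C ∧ p ((c \ ⋃₀ R) ∩ U)} with hC'
  have hmono : ∀ c ∈ C', ∀ c' ∈ C, c' ⊆ c → c' ∈ C' := fun c hc c' hc' hsub =>
    ⟨hc', hp _ _ (inter_subset_inter_left _ (sdiff_subset_sdiff_left hsub)) hc.2⟩
  have hinter : ∀ c ∈ C', ∀ r ∈ C, c ∩ r ∈ C' := fun c hc r hr =>
    hmono c hc _ (hC.face_mem c hc.1 _ ⟨0, hzero c hc.1, hzero r hr⟩
      (hC.inter_face c hc.1 r hr).1) inter_subset_left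
  -- The removed cones must belong to the smaller fan, so each of them is replaced by its
  -- intersections with the selected cones; the differences do not change.
  have hdiff : ∀ c ∈ C', (c \ ⋃₀ {d | ∃ c ∈ C', ∃ r ∈ R, d = c ∩ r}) ∩ U = (c \ ⋃₀ R) ∩ U := by
    intro c hc
    ext x
    constructor
    · rintro ⟨⟨hx, hx'⟩, hxU⟩
      exact ⟨⟨hx, fun ⟨r, hr, hxr⟩ => hx' ⟨c ∩ r, ⟨c, hc, r, hr, rfl⟩, hx, hxr⟩⟩, hxU⟩
    · rintro ⟨⟨hx, hx'⟩, hxU⟩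
      refine ⟨⟨hx, ?_⟩, hxU⟩
      rintro ⟨_, ⟨c', -, r, hr, rfl⟩, hxr⟩
      exact hx' ⟨r, hr, hxr.2⟩
  refine ⟨C', {d | ∃ c ∈ C', ∃ r ∈ R, d = c ∩ r}, U, ⟨hC.finite.subset fun c hc => hc.1,
    fun s hs => hC.closedCone s hs.1, fun s hs t hne ht => ?_,
    fun s hs t ht => hC.inter_face s hs.1 t ht.1⟩, ?_, hU, h0, ?_⟩
  · refine hmono s hs t (hC.face_mem s hs.1 t hne ht) ?_
    obtain ⟨a, q, -, rfl⟩ := ht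
    exact fun x hx => hx.1
  · rintro _ ⟨c, hc, r, hr, rfl⟩
    exact hinter c hc r (hR hr)
  · ext S
    constructor
    · rintro ⟨⟨c, hc, rfl⟩, hpS⟩
      exact ⟨c, ⟨hc, hpS⟩, hdiff c ⟨hc, hpS⟩⟩
    · rintro ⟨c, hc, rfl⟩
      refine ⟨⟨c, hc.1, (hdiff c hc).symm⟩, ?_⟩
      change p ((c \ ⋃₀ _) ∩ U)
      rw [hdiff c hc]
      exact hc.2

lemma IsEmbedding.domRestrict_comp {α β γ : Type*} [TopologicalSpace α] [TopologicalSpace β]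
    [TopologicalSpace γ] {i : α → β} (hi : IsEmbedding i) {s : Set α} {c : Set β} {φ : β → γ}
    (hφ : IsEmbedding (c.domRestrict φ)) (hs : MapsTo i s c) :
    IsEmbedding (s.domRestrict fun x => φ (i x)) :=
  hφ.comp ((hi.comp IsEmbedding.subtypeVal).codRestrict c fun x => hs x.2)

lemma val_image_preimage {α : Type*} {𝓒 : Set (Set α)} {A : Set α} (hA : A = ⋃₀ 𝓒) {c : Set α}
    (hc : c ∈ 𝓒) : (Subtype.val '' (Subtype.val ⁻¹' c : Set A) : Set α) = c := by
  rw [Subtype.image_preimage_coe, inter_eq_right, hA]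
  exact subset_sUnion_of_mem hc

namespace PolyComplex

variable {α : Type u} [TopologicalSpace α] (X : PolyComplex α) {𝓒 : Set (Set α)} (A : Set α)

/-- The data of the subcomplex with support `A`. -/
def subData (𝓒 : Set (Set α)) : ComplexData A where
  cells := {s | Subtype.val '' s ∈ 𝓒}
  dim s := X.dim (Subtype.val '' s)
  chart s x := X.chart (Subtype.val '' s) x
  starDim s := X.starDim (Subtype.val '' s)
  starChart s x := X.starChart (Subtype.val '' s) x
  fan s := {S | S ∈ X.fan (Subtype.val '' s) ∧
    ∃ t ∈ 𝓒, Subtype.val '' s ⊆ t ∧ S ⊆ starCone X (Subtype.val '' s) t}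

variable {X A}

lemma subData_chart_image (s S : Set A) : (X.subData A 𝓒).chart s '' S
    = X.chart (Subtype.val '' s) '' (Subtype.val '' S) := by
  rw [image_image]
  rfl

lemma mem_subData_relInt {s : Set A} {x : A} :
    x ∈ (X.subData A 𝓒).relInt s ↔ (x : α) ∈ X.relInt (Subtype.val '' s) := by
  change _ ∧ _ ∈ interior ((X.subData A 𝓒).chart s '' s) ↔ _ ∧ _
  rw [subData_chart_image, Subtype.val_injective.mem_set_image]
  rfl

variable (h𝓒 : 𝓒 ⊆ X.cells) (hdown : ∀ s ∈ 𝓒, ∀ t ∈ X.cells, t ⊆ s → t ∈ 𝓒) (hA : A = ⋃₀ 𝓒)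
include h𝓒 hdown hA

lemma cellOf_mem_of_mem (x : A) : X.cellOf x ∈ 𝓒 := by
  obtain ⟨c, hc, hxc⟩ := hA.subset x.2
  exact hdown c hc _ (X.cellOf_mem _) (cellOf_subset (h𝓒 hc) hxc)

/-- The selection of cells is downward closed, so the cell of a point of the support is selected and
stars in the subcomplex are traces of stars. -/
lemma mem_subData_star {s : Set A} {x : A} :
    x ∈ (X.subData A 𝓒).star s ↔ (x : α) ∈ X.star (Subtype.val '' s) := by
  rw [mem_star_iff]
  constructor
  · rintro ⟨t, ht, hst, hx⟩
    rw [cellOf_eq (h𝓒 ht) (mem_subData_relInt.mp hx)]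
    exact image_mono hst
  · intro h
    have hx := cellOf_mem_of_mem h𝓒 hdown hA x
    have hval := val_image_preimage hA hx
    refine ⟨Subtype.val ⁻¹' X.cellOf x, ?_, image_subset_iff.mp h, ?_⟩
    · change _ ∈ 𝓒
      rwa [hval]
    · rw [mem_subData_relInt, hval]
      exact X.mem_relInt_cellOf _

lemma subData_star_image (s t : Set A) :
    (X.subData A 𝓒).starChart s '' (t ∩ (X.subData A 𝓒).star s)
      = starCone X (Subtype.val '' s) (Subtype.val '' t) := by
  ext p
  constructor
  · rintro ⟨x, ⟨hxt, hxs⟩, rfl⟩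
    exact ⟨x, ⟨mem_image_of_mem _ hxt, (mem_subData_star h𝓒 hdown hA).mp hxs⟩, rfl⟩
  · rintro ⟨_, ⟨⟨x, hxt, rfl⟩, hxs⟩, rfl⟩
    exact ⟨x, ⟨hxt, (mem_subData_star h𝓒 hdown hA).mpr hxs⟩, rfl⟩

/-- The subcomplex of `X` that consists of a downward closed set of cells. -/
def sub : PolyComplex A where
  toComplexData := X.subData A 𝓒
  inter_mem s hs t ht hne := by
    rw [subData_chart_image, subData_chart_image, subData_chart_image, subData_chart_image,
      image_inter Subtype.val_injective]
    obtain ⟨x, hxs, hxt⟩ := hne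
    have h := X.inter_mem _ (h𝓒 hs) _ (h𝓒 ht)
      ⟨x, mem_image_of_mem _ hxs, mem_image_of_mem _ hxt⟩
    refine ⟨?_, h.2⟩
    change Subtype.val '' (s ∩ t) ∈ 𝓒
    rw [image_inter Subtype.val_injective]
    exact hdown _ hs _ h.1 inter_subset_left
  chart_embedding s hs := IsEmbedding.domRestrict_comp IsEmbedding.subtypeVal
    (X.chart_embedding _ (h𝓒 hs)) (mapsTo_image _ _)
  chart_polyhedron s hs := by
    rw [subData_chart_image]
    exact X.chart_polyhedron _ (h𝓒 hs)
  chart_full s hs := by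
    rw [subData_chart_image]
    exact X.chart_full _ (h𝓒 hs)
  chart_affine s hs t ht := (X.chart_affine _ (h𝓒 hs) _ (h𝓒 ht)).comp (g := Subtype.val)
    fun _ hx => ⟨mem_image_of_mem _ hx.1, mem_image_of_mem _ hx.2⟩
  exists_unique_cell x := by
    have hx := cellOf_mem_of_mem h𝓒 hdown hA x
    have hval := val_image_preimage hA hx
    refine ⟨Subtype.val ⁻¹' X.cellOf x, ⟨?_, ?_⟩, ?_⟩
    · change _ ∈ 𝓒
      rwa [hval]
    · rw [mem_subData_relInt, hval]
      exact X.mem_relInt_cellOf _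
    · rintro s ⟨hs, hxs⟩
      rw [cellOf_eq (h𝓒 hs) (mem_subData_relInt.mp hxs),
        preimage_image_eq _ Subtype.val_injective]
  star_open s hs := by
    have h : (X.subData A 𝓒).star s = Subtype.val ⁻¹' X.star (Subtype.val '' s) :=
      ext fun x => mem_subData_star h𝓒 hdown hA
    rw [h]
    exact (X.star_open _ (h𝓒 hs)).preimage continuous_subtype_val
  fan_open s hs := (X.fan_open _ (h𝓒 hs)).sep fun _ _ hS ⟨t, ht, hst, hSt⟩ =>
    ⟨t, ht, hst, hS.trans hSt⟩
  star_embedding s hs := IsEmbedding.domRestrict_comp IsEmbedding.subtypeVal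
    (X.star_embedding _ (h𝓒 hs)) fun _ hx => (mem_subData_star h𝓒 hdown hA).mp hx
  star_image s hs := by
    ext p
    constructor
    · rintro ⟨x, hx, rfl⟩
      have hx' := (mem_subData_star h𝓒 hdown hA).mp hx
      have hxc := cellOf_mem_of_mem h𝓒 hdown hA x
      have hsub := mem_star_iff.mp hx'
      exact ⟨starCone X (Subtype.val '' s) (X.cellOf x),
        ⟨(X.star_cell _ (h𝓒 hs) _ (h𝓒 hxc) hsub).1, _, hxc, hsub, Subset.rfl⟩,
        x, ⟨X.mem_cellOf _, hx'⟩, rfl⟩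
    · rintro ⟨S, ⟨-, t, ht, -, hSt⟩, hp⟩
      obtain ⟨x, ⟨hxt, hxs⟩, rfl⟩ := hSt hp
      exact ⟨⟨x, hA.symm.subset ⟨t, ht, hxt⟩⟩, (mem_subData_star h𝓒 hdown hA).mpr hxs, rfl⟩
  star_cell s hs t ht hst := by
    have h := X.star_cell _ (h𝓒 hs) _ (h𝓒 ht) (image_mono (f := Subtype.val) hst)
    have hmaps : MapsTo Subtype.val (t ∩ (X.subData A 𝓒).star s)
        (Subtype.val '' t ∩ X.star (Subtype.val '' s)) := fun x hx =>
      ⟨mem_image_of_mem _ hx.1, (mem_subData_star h𝓒 hdown hA).mp hx.2⟩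
    refine ⟨?_, h.2.1.comp hmaps, h.2.2.comp hmaps⟩
    rw [subData_star_image h𝓒 hdown hA]
    exact ⟨h.1, _, ht, image_mono hst, Subset.rfl⟩
  star_affine s hs t ht := (X.star_affine _ (h𝓒 hs) _ (h𝓒 ht)).comp (g := Subtype.val)
    fun _ hx => ⟨(mem_subData_star h𝓒 hdown hA).mp hx.1, (mem_subData_star h𝓒 hdown hA).mp hx.2⟩

end PolyComplex

/-! ### Irreducible tropical orbit spaces -/

/-- The action on an invariant subset. -/
@[reducible] def subAction {H β : Type*} [Group H] [MulAction H β] {A : Set β}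
    (hA : ∀ h : H, ∀ x ∈ A, h • x ∈ A) : MulAction H A where
  smul h x := ⟨h • (x : β), hA h x x.2⟩
  one_smul x := Subtype.ext (one_smul H (x : β))
  mul_smul g h x := Subtype.ext (mul_smul g h (x : β))

section

variable {β : Type*} {H : Type*} [Group H] [MulAction H β] {A : Set β}
  (hH : ∀ h : H, ∀ x ∈ A, h • x ∈ A)

lemma val_image_smul (h : H) (s : Set A) :
    letI := subAction hH
    Subtype.val '' (h • s) = h • (Subtype.val '' s) := by
  let _ := subAction hH
  ext x
  constructor
  · rintro ⟨_, ⟨y, hy, rfl⟩, rfl⟩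
    exact smul_mem_smul_set (mem_image_of_mem _ hy)
  · rintro ⟨_, ⟨y, hy, rfl⟩, rfl⟩
    exact ⟨h • y, smul_mem_smul_set hy, rfl⟩

lemma fixingSubgroup_val_image (s : Set A) :
    letI := subAction hH
    fixingSubgroup H s = fixingSubgroup H (Subtype.val '' s) := by
  let _ := subAction hH
  ext h
  rw [mem_fixingSubgroup_iff, mem_fixingSubgroup_iff, forall_mem_image]
  exact forall₂_congr fun y _ => Subtype.ext_iff

end

/-! ### Tropical orbit structures on subcomplexes. -/

section Sub

variable {β : Type u} [TopologicalSpace β] {Y : PolyComplex β} {H : Type*} [Group H]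
  [MulAction H β] {n : ℕ} {ωY : Set β → ℚ} {𝓒 : Set (Set β)} {A : Set β}

lemma IsOrbitSpace.starChart_smul_affine (hY : IsOrbitSpace Y H) (h : H) {c c' : Set β}
    (hc : c ∈ Y.cells) (hc' : c' = h • c) :
    IntAffineOn (Y.star c) (Y.starChart c) (fun x => Y.starChart c' (h • x)) := by
  subst hc'
  exact hY.smul_affine h c hc

variable (h𝓒 : 𝓒 ⊆ Y.cells) (hdown : ∀ s ∈ 𝓒, ∀ t ∈ Y.cells, t ⊆ s → t ∈ 𝓒) (hA : A = ⋃₀ 𝓒)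
  (hH : ∀ h : H, ∀ x ∈ A, h • x ∈ A)

lemma isOrbitSpace_sub (hY : IsOrbitSpace Y H) (h𝓒H : ∀ h : H, ∀ s ∈ 𝓒, h • s ∈ 𝓒) :
    letI := subAction hH
    IsOrbitSpace (Y.sub h𝓒 hdown hA) H := by
  let _ := subAction hH
  refine ⟨fun h => ?_, fun h s hs => ?_, fun h s hs => ?_⟩
  · exact ((hY.continuous_smul h).comp continuous_subtype_val).subtype_mk _
  · change Subtype.val '' (h • s) ∈ 𝓒
    rw [val_image_smul]
    exact h𝓒H h _ hs
  · exact (hY.starChart_smul_affine h (h𝓒 hs) (val_image_smul hH h s)).comp (g := Subtype.val)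
      fun _ hx => (PolyComplex.mem_subData_star h𝓒 hdown hA).mp hx

lemma isSubOrbitSpace_sub :
    letI := subAction hH
    IsSubOrbitSpace (Y.sub h𝓒 hdown hA) Y H Subtype.val := by
  let _ := subAction hH
  refine ⟨Subtype.val_injective, continuous_subtype_val, fun _ _ => rfl,
    fun s hs => ⟨_, h𝓒 hs, Subset.rfl⟩, fun s hs t ht => ?_⟩
  obtain rfl : t = Subtype.val '' s := (ht.2.2 _ (h𝓒 hs) Subset.rfl).antisymm ht.2.1
  exact ⟨fun _ hx => (PolyComplex.mem_subData_star h𝓒 hdown hA).mp hx,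
    IntAffineOn.refl _ _, IntAffineOn.refl _ _⟩

lemma starCone_sub (s t : Set A) : starCone (Y.sub h𝓒 hdown hA) s t
    = starCone Y (Subtype.val '' s) (Subtype.val '' t) :=
  PolyComplex.subData_star_image h𝓒 hdown hA s t

/-- Cells that are left out have weight zero, so the balancing sum is unchanged; the coefficients λ
are then rebuilt from the stabilizers in the subcomplex. -/
lemma isBalancedAt_sub (hY : IsOrbitSpace Y H) (h𝓒H : ∀ h : H, ∀ s ∈ 𝓒, h • s ∈ 𝓒)
    {wt : Set β → ℚ} {s : Set A} (hs : Subtype.val '' s ∈ 𝓒)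
    (hfin : (fixingSubgroup H (Subtype.val '' s) : Set H).Finite)
    (hwt : ∀ t ∈ Y.above (Subtype.val '' s), t ∉ 𝓒 → wt t = 0)
    {w : Set β → Fin (Y.starDim (Subtype.val '' s)) → ℤ}
    (hw : ∀ t ∈ Y.above (Subtype.val '' s),
      IsPrimitiveNormal (starCone Y (Subtype.val '' s) (Subtype.val '' s))
        (starCone Y (Subtype.val '' s) t) (w t))
    (hsum : ∑ᶠ t ∈ Y.above (Subtype.val '' s), (wt t : ℝ) • rvec (w t)
      ∈ Submodule.span ℝ (starCone Y (Subtype.val '' s) (Subtype.val '' s))) :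
    letI := subAction hH
    IsBalancedAt (Y.sub h𝓒 hdown hA) H (fun t => wt (Subtype.val '' t)) s := by
  let _ := subAction hH
  set Z := Y.sub h𝓒 hdown hA
  have hmem : ∀ t ∈ Z.above s, Subtype.val '' t ∈ Y.above (Subtype.val '' s) := fun t ht =>
    ⟨h𝓒 ht.1, Subtype.val_injective.image_strictMono ht.2⟩
  refine isBalancedAt_of_sum_mem (isOrbitSpace_sub h𝓒 hdown hA hH hY h𝓒H) hs ?_
    ((Z.finite_above hs).subset fun t ht => ⟨ht.1, ht.2.1⟩) (w := fun t => w (Subtype.val '' t))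
    (fun t ht => ?_) ?_
  · rwa [fixingSubgroup_val_image]
  · rw [starCone_sub, starCone_sub]
    exact hw _ (hmem t ht)
  · rw [starCone_sub]
    have key : ∑ᶠ t ∈ Z.above s, (wt (Subtype.val '' t) : ℝ) • rvec (w (Subtype.val '' t))
        = ∑ᶠ t ∈ Y.above (Subtype.val '' s), (wt t : ℝ) • rvec (w t) := ?_
    · rw [← key] at hsum
      exact hsum
    rw [finsum_mem_inter_support_eq' _ (Y.above (Subtype.val '' s))
      {t | t ∈ Y.above (Subtype.val '' s) ∧ t ∈ 𝓒}]
    · refine finsum_mem_eq_of_bijOn (fun t => Subtype.val '' t) ⟨fun t ht => ⟨hmem t ht, ht.1⟩,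
        fun t _ t' _ h => Subtype.val_injective.image_injective h, fun t ht => ?_⟩ fun t _ => rfl
      have hval := val_image_preimage hA ht.2
      refine ⟨Subtype.val ⁻¹' t, ⟨?_, ?_⟩, hval⟩
      · change _ ∈ 𝓒
        rw [hval]
        exact ht.2
      · exact ⟨image_subset_iff.mp ht.1.2.1, fun hle => ht.1.2.2 (hval ▸ image_mono hle)⟩
    · intro t ht
      refine ⟨fun h => ⟨h, ?_⟩, fun h => h.1⟩
      by_contra hc
      exact ht (by simp [hwt t h hc])

/-- On an irreducible tropical orbit space, a balanced weight that does not vanish identically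
vanishes nowhere. -/
theorem IsIrreducible.weight_ne_zero {H : Type v} [Group H] [MulAction H β]
    (hirr : IsIrreducible Y H n) (hY : IsTropicalOrbitSpace Y H n ωY)
    (hstab : ∀ t ∈ Y.cells, Y.dim t = n → {h : H | h • t = t}.Finite) {wt : Set β → ℚ}
    (hwt : ∀ h : H, ∀ t ∈ Y.cells, Y.dim t = n → wt (h • t) = wt t)
    (hbal : ∀ u ∈ Y.cells, Y.dim u + 1 = n → ∃ w : Set β → Fin (Y.starDim u) → ℤ,
      (∀ t ∈ Y.above u, IsPrimitiveNormal (starCone Y u u) (starCone Y u t) (w t)) ∧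
      ∑ᶠ t ∈ Y.above u, (wt t : ℝ) • rvec (w t) ∈ Submodule.span ℝ (starCone Y u u))
    {t₀ : Set β} (ht₀ : t₀ ∈ Y.cells) (htd₀ : Y.dim t₀ = n) (hne : wt t₀ ≠ 0) {t : Set β}
    (ht : t ∈ Y.cells) (htd : Y.dim t = n) : wt t ≠ 0 := by
  have hYo := hY.orbitSpace
  -- The support of the weight: all faces of top-dimensional cells of nonzero weight.
  set 𝓒 := {s | s ∈ Y.cells ∧ ∃ t ∈ Y.cells, Y.dim t = n ∧ wt t ≠ 0 ∧ s ⊆ t}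
  have h𝓒 : 𝓒 ⊆ Y.cells := fun s hs => hs.1
  have hdown : ∀ s ∈ 𝓒, ∀ t ∈ Y.cells, t ⊆ s → t ∈ 𝓒 :=
    fun s ⟨_, c, hc, hcd, hcw, hsc⟩ t ht hts => ⟨ht, c, hc, hcd, hcw, hts.trans hsc⟩
  have h𝓒H : ∀ h : H, ∀ s ∈ 𝓒, h • s ∈ 𝓒 := fun h s ⟨hs, c, hc, hcd, hcw, hsc⟩ =>
    ⟨hYo.smul_mem h s hs, h • c, hYo.smul_mem h c hc, (hYo.dim_smul h hc).trans hcd,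
      by rwa [hwt h c hc hcd], smul_set_mono hsc⟩
  have htop : ∀ s ∈ Y.cells, Y.dim s = n → (s ∈ 𝓒 ↔ wt s ≠ 0) := by
    refine fun s hs hsd => ⟨?_, fun h => ⟨hs, s, hs, hsd, h, Subset.rfl⟩⟩
    rintro ⟨-, c, hc, -, hcw, hsc⟩
    rwa [hY.eq_of_subset hs hsd hc hsc]
  set A := ⋃₀ 𝓒 with hA
  have hH : ∀ h : H, ∀ x ∈ A, h • x ∈ A := fun h x ⟨s, hs, hx⟩ =>
    ⟨h • s, h𝓒H h s hs, smul_mem_smul_set hx⟩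
  let _ := subAction hH
  set Z := Y.sub h𝓒 hdown hA
  have hZ : IsTropicalOrbitSpace Z H n (fun s => wt (Subtype.val '' s)) := by
    refine ⟨isOrbitSpace_sub h𝓒 hdown hA hH hYo h𝓒H, fun s hs => ?_, fun h s hs hd => ?_, ?_,
      fun s hs hd => ?_, fun s hs hd => ?_⟩
    · obtain ⟨hs', c, hc, hcd, hcw, hsc⟩ : Subtype.val '' s ∈ 𝓒 := hs
      have hval := val_image_preimage hA ((htop c hc hcd).mpr hcw)
      refine ⟨(hY.pure_dim _ hs').1, Subtype.val ⁻¹' c, ?_, image_subset_iff.mp hsc, ?_⟩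
      · change _ ∈ 𝓒
        rw [hval]
        exact (htop c hc hcd).mpr hcw
      · change Y.dim _ = n
        rw [hval, hcd]
    · rw [val_image_smul]
      exact hwt h _ (h𝓒 hs) hd
    · obtain ⟨T, hT, hTc⟩ := hY.finite_classes
      refine ⟨(fun c => Subtype.val ⁻¹' c) '' T, hT.image _, fun s hs => ?_⟩
      obtain ⟨h, c, hc, hsc⟩ := hTc _ (h𝓒 hs)
      have hc𝓒 : c ∈ 𝓒 := by
        rw [eq_inv_smul_iff.mpr hsc.symm]
        exact h𝓒H _ _ hs
      refine ⟨h, _, mem_image_of_mem _ hc, Subtype.val_injective.image_injective ?_⟩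
      rw [val_image_smul, val_image_preimage hA hc𝓒, hsc]
    · rw [fixingSubgroup_val_image]
      exact hY.finite_stabilizer _ (h𝓒 hs) hd
    · obtain ⟨w, hw, hsum⟩ := hbal _ (h𝓒 hs) hd
      refine isBalancedAt_sub h𝓒 hdown hA hH hYo h𝓒H hs
        ((hY.finite_stabilizer_cell hstab (h𝓒 hs)).subset fun h hh => smul_eq_of_mem_fixing hh)
        (fun c hc hc𝓒 => ?_) hw hsum
      have hlt := PolyComplex.dim_lt_of_ssubset (h𝓒 hs) hc.1 hc.2
      have hle := (hY.pure_dim c hc.1).1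
      have hd' : Y.dim (Subtype.val '' s) + 1 = n := hd
      by_contra hne
      exact hc𝓒 ((htop c hc.1 (by omega)).mpr hne)
  have ht₀𝓒 := (htop t₀ ht₀ htd₀).mpr hne
  obtain ⟨x₀, hx₀⟩ := PolyComplex.cell_nonempty ht₀
  -- Irreducibility makes the support all of Y. A relative interior point of `t` then lies in a cell
  -- of the support, so `t` belongs to it and has nonzero weight.
  have hsurj := hirr A Z _ Subtype.val ⟨⟨x₀, t₀, ht₀𝓒, hx₀⟩⟩ hZ
    (fun s hs hd => (htop _ (h𝓒 hs) hd).mp hs) (isSubOrbitSpace_sub h𝓒 hdown hA hH)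
    (PolyComplex.isClosed_of_lower h𝓒).isClosedEmbedding_subtypeVal
  obtain ⟨x, hx⟩ := PolyComplex.relInt_nonempty ht
  obtain ⟨⟨_, c, hc, hxc⟩, rfl⟩ := hsurj x
  exact (htop t ht htd).mp (hdown c hc t ht (PolyComplex.subset_of_mem_relInt ht (h𝓒 hc) hx hxc))

end Sub

namespace OrbitMorphism

variable {α : Type u} {β : Type v} [TopologicalSpace α] [TopologicalSpace β]
  {X : PolyComplex α} {Y : PolyComplex β} {G H : Type*} [Group G] [Group H]
  [MulAction G α] [MulAction H β] {f : OrbitMorphism X Y G H} {ωX : Set α → ℚ} {ωY : Set β → ℚ}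
  {n : ℕ}

/-- The generic number of preimages is proportional to the weight of the target. -/
theorem IsTropical.exists_genCount_eq (hf : f.IsTropical ωX ωY n) (hq : IsQuotientMap f.orbitMap)
    (hirr : IsIrreducible Y H n) (hωY : ∀ t ∈ Y.cells, Y.dim t = n → ωY t ≠ 0) :
    ∃ d : ℚ, ∀ t ∈ Y.cells, Y.dim t = n → f.genCount n ωX t = d * ωY t := by
  by_cases hex : ∃ t₀ ∈ Y.cells, Y.dim t₀ = n
  swap
  · exact ⟨0, fun t ht htd => (hex ⟨t, ht, htd⟩).elim⟩
  obtain ⟨t₀, ht₀, htd₀⟩ := hex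
  -- Chosen so that `genCount` - d · ωY vanishes on `t₀`.
  set d := f.genCount n ωX t₀ / ωY t₀ with hd
  refine ⟨d, fun t ht htd => ?_⟩
  have hY := hf.target
  have hYo := hY.orbitSpace
  by_contra hne
  -- If the balanced difference were nonzero on `t`, irreducibility would make it nonzero on `t₀`
  -- too.
  refine hirr.weight_ne_zero hY hf.finite_stab (wt := fun t => f.genCount n ωX t - d * ωY t)
    (fun h t ht htd => ?_) (fun u hu hud => ?_) ht htd (sub_ne_zero.mpr hne) ht₀ htd₀ ?_
  · rw [hf.genCount_smul hq ht htd, hY.weight_smul h t ht htd]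
  · have hdim : ∀ t ∈ Y.above u, Y.dim t = n := fun t ht => by
      have := PolyComplex.dim_lt_of_ssubset hu ht.1 ht.2
      have := (hY.pure_dim t ht.1).1
      omega
    obtain ⟨w, hw, hsum⟩ := (hY.balanced u hu hud).exists_sum_mem hYo hu
      ((hY.finite_stabilizer_cell hf.finite_stab hu).subset fun h hh => smul_eq_of_mem_fixing hh)
      fun h t ht => hY.weight_smul h t ht.1 (hdim t ht)
    refine ⟨w, hw, ?_⟩
    have hfin : (Y.above u).Finite := (Y.finite_above hu).subset fun t ht => ⟨ht.1, ht.2.1⟩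
    have := Submodule.sub_mem _ (hf.finsum_genCount_mem hq hu hud hw)
      (Submodule.smul_mem _ (d : ℝ) hsum)
    rw [smul_finsum_mem hfin, ← finsum_mem_sub_distrib _ _ hfin] at this
    rw [finsum_mem_congr rfl fun t _ => show _ = ((f.genCount n ωX t - d * ωY t : ℚ) : ℝ) • rvec (w t)
      by rw [smul_smul, ← sub_smul]; push_cast; rfl] at this
    exact this
  · rw [hd, div_mul_cancel₀ _ (hωY t₀ ht₀ htd₀), sub_self]

end OrbitMorphism

/-! ### Relatively open polyhedra -/

lemma IsGenPolyhedron.inter {n : ℕ} {P Q : Set (Fin n → ℝ)} (hP : IsGenPolyhedron P)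
    (hQ : IsGenPolyhedron Q) : IsGenPolyhedron (P ∩ Q) := by
  classical
  obtain ⟨W, S, rfl⟩ := hP
  obtain ⟨W', S', rfl⟩ := hQ
  refine ⟨W ∪ W', S ∪ S', ?_⟩
  ext x
  simp only [mem_inter_iff, mem_ofPred_eq, Finset.mem_union, or_imp, forall_and]
  tauto

lemma IsGenPolyhedron.preimage {m n : ℕ} {P : Set (Fin m → ℝ)} (hP : IsGenPolyhedron P)
    (A : Matrix (Fin m) (Fin n) ℤ) (b : Fin m → ℝ) :
    IsGenPolyhedron {x | (rmat A).mulVec x + b ∈ P} := by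
  classical
  obtain ⟨W, S, rfl⟩ := hP
  refine ⟨W.image fun w => (Matrix.vecMul w.1 A, w.2 - intForm w.1 b),
    S.image fun w => (Matrix.vecMul w.1 A, w.2 - intForm w.1 b), ?_⟩
  ext x
  simp only [mem_ofPred_eq, Finset.forall_mem_image, intForm_add, intForm_mulVec,
    sub_le_iff_le_add, sub_lt_iff_lt_add]

lemma isGenPolyhedron_univ {n : ℕ} : IsGenPolyhedron (univ : Set (Fin n → ℝ)) :=
  ⟨∅, ∅, by simp⟩

lemma isGenPolyhedron_biInter {n : ℕ} {ι : Type*} {I : Set ι} (hI : I.Finite)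
    {P : ι → Set (Fin n → ℝ)} (hP : ∀ i ∈ I, IsGenPolyhedron (P i)) :
    IsGenPolyhedron {x | ∀ i ∈ I, x ∈ P i} := by
  induction I, hI using Set.Finite.induction_on with
  | empty => simpa using isGenPolyhedron_univ
  | @insert a s _ _ ih =>
    have h := (hP a (mem_insert a s)).inter (ih fun i hi => hP i (mem_insert_of_mem a hi))
    convert h using 1
    ext x
    simp

lemma intForm_neg_left {n : ℕ} (a : Fin n → ℤ) (x : Fin n → ℝ) :
    intForm (-a) x = -intForm a x := by
  simp [intForm]

lemma isGenPolyhedron_sign {n : ℕ} (a : Fin n → ℤ) (p : ℝ) (ε : SignType) :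
    IsGenPolyhedron {x | SignType.sign (intForm a x - p) = ε} := by
  cases ε
  · refine ⟨{(a, p), (-a, -p)}, ∅, ?_⟩
    ext x
    change SignType.sign _ = 0 ↔ _
    rw [sign_eq_zero_iff, sub_eq_zero, le_antisymm_iff]
    simp only [Finset.mem_insert, Finset.mem_singleton, forall_eq_or_imp, forall_eq,
      intForm_neg_left, neg_le_neg_iff, Finset.notMem_empty, IsEmpty.forall_iff, implies_true,
      and_true, mem_ofPred_eq]
    exact and_comm
  · refine ⟨∅, {(-a, -p)}, ?_⟩
    ext x
    change SignType.sign _ = -1 ↔ _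
    rw [sign_eq_neg_one_iff]
    simp [intForm_neg_left]
  · refine ⟨∅, {(a, p)}, ?_⟩
    ext x
    change SignType.sign _ = 1 ↔ _
    rw [sign_eq_one_iff]
    simp

/-- Weak inequalities become strict: from an interior point one can move a little against the form.
Inequalities with zero form hold automatically once the polyhedron is nonempty and are dropped. -/
lemma isGenPolyhedron_interior {n : ℕ} {P : Set (Fin n → ℝ)} (hP : IsGenPolyhedron P) :
    IsGenPolyhedron (interior P) := by
  classical
  rcases P.eq_empty_or_nonempty with rfl | ⟨x₀, hx₀⟩
  · rwa [interior_empty]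
  obtain ⟨W, S, rfl⟩ := hP
  refine ⟨∅, W.filter (fun w => w.1 ≠ 0) ∪ S, Subset.antisymm (fun x hx => ?_) ?_⟩
  · refine ⟨by simp, fun w hw => ?_⟩
    rcases Finset.mem_union.mp hw with hw | hw
    · obtain ⟨hw, hw0⟩ := Finset.mem_filter.mp hw
      have hc : ContinuousAt (fun c : ℝ => x - c • rvec w.1) 0 := by fun_prop
      have hx' : interior {x | (∀ w ∈ W, w.2 ≤ intForm w.1 x) ∧ ∀ s ∈ S, s.2 < intForm s.1 x}
          ∈ 𝓝 (x - (0 : ℝ) • rvec w.1) := by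
        rw [zero_smul, sub_zero]
        exact isOpen_interior.mem_nhds hx
      have hev : ∀ᶠ c : ℝ in 𝓝[>] 0, _ := (hc.eventually_mem hx').filter_mono nhdsWithin_le_nhds
      obtain ⟨c, hc, hc0⟩ := (hev.and self_mem_nhdsWithin).exists
      have h1 := (interior_subset hc).1 w hw
      rw [intForm_sub, intForm_smul] at h1
      have := mul_pos (mem_Ioi.mp hc0) (intForm_rvec_self hw0)
      linarith
    · exact (interior_subset hx).2 w hw
  · refine interior_maximal (fun x hx => ⟨fun w hw => ?_, fun w hw =>
      hx.2 w (Finset.mem_union_right _ hw)⟩) ?_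
    · by_cases h0 : w.1 = 0
      · have := hx₀.1 w hw
        rw [h0, intForm_zero_left] at this ⊢
        exact this
      · exact (hx.2 w (Finset.mem_union_left _ (Finset.mem_filter.mpr ⟨hw, h0⟩))).le
    · simp only [Finset.notMem_empty, IsEmpty.forall_iff, implies_true, true_and]
      simp only [ofPred_forall]
      exact isOpen_biInter_finset fun w _ => isOpen_lt continuous_const (continuous_intForm _)

/-! ### Lattice bases of rational subspaces -/

/-- The image of an integral form is a free ℤ-module, so the kernel splits off. `J` is a basis of
the kernel, and `K` gives the coordinates of the projection v ↦ v - σ(a v) for a section σ. -/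
lemma exists_kernel_basis {N : ℕ} (a : Fin N → ℤ) :
    ∃ (d : ℕ) (J : Matrix (Fin N) (Fin d) ℤ) (K : Matrix (Fin d) (Fin N) ℤ), K * J = 1 ∧
      Matrix.vecMul a J = 0 ∧ ∀ x, intForm a x = 0 → (rmat (J * K)).mulVec x = x := by
  let ℓ : (Fin N → ℤ) →ₗ[ℤ] ℤ := Fintype.linearCombination ℤ a
  have hℓ : ∀ v, ℓ v = ∑ i, v i * a i := fun v => by simp [ℓ, Fintype.linearCombination_apply]
  have hℓs : ∀ j, ℓ (Pi.single j 1) = a j := fun j => by simp [ℓ]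
  obtain ⟨σ, hσ⟩ := ℓ.rangeRestrict.exists_rightInverse_of_surjective
    (LinearMap.range_rangeRestrict ℓ)
  have hσ' : ∀ v, ℓ (σ v) = v := fun v => congrArg Subtype.val (LinearMap.congr_fun hσ v)
  let g : Fin N → LinearMap.range ℓ := fun j => ⟨a j, Pi.single j 1, hℓs j⟩
  let P : Fin N → LinearMap.ker ℓ := fun j => ⟨Pi.single j 1 - σ (g j), by
    rw [LinearMap.mem_ker, map_sub, hℓs, hσ', sub_self]⟩
  let b := Module.finBasis ℤ (LinearMap.ker ℓ)
  let J : Matrix (Fin N) (Fin (Module.finrank ℤ (LinearMap.ker ℓ))) ℤ :=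
    Matrix.of fun i k => (b k : Fin N → ℤ) i
  let K : Matrix (Fin (Module.finrank ℤ (LinearMap.ker ℓ))) (Fin N) ℤ :=
    Matrix.of fun k j => b.repr (P j) k
  have hJK : J * K = 1 - Matrix.of fun i j => σ (g j) i := by
    ext i j
    have h := congrFun (congrArg Subtype.val (b.sum_repr (P j))) i
    rw [Matrix.mul_apply, Matrix.sub_apply, Matrix.one_apply, Matrix.of_apply]
    simp only [Submodule.coe_sum, Submodule.coe_smul, Finset.sum_apply, Pi.smul_apply,
      smul_eq_mul, P, Pi.sub_apply, Pi.single_apply] at h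
    rw [← h]
    exact Finset.sum_congr rfl fun k _ => mul_comm _ _
  refine ⟨_, J, K, ?_, ?_, fun x hx => ?_⟩
  · ext k l
    have h : ∑ j, (b l : Fin N → ℤ) j • P j = b l := by
      have h0 : ∑ j, (b l : Fin N → ℤ) j • g j = 0 := by
        refine Subtype.ext ?_
        have := (b l).2
        rw [LinearMap.mem_ker, hℓ] at this
        simpa [g] using this
      refine Subtype.ext ?_
      have h1 : ∑ j, (b l : Fin N → ℤ) j • σ (g j) = 0 := by
        simp_rw [← map_smul, ← map_sum, h0, map_zero]
      simp only [Submodule.coe_sum, Submodule.coe_smul, P, smul_sub, Finset.sum_sub_distrib, h1,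
        sub_zero]
      ext i
      simp [Finset.sum_apply, Pi.single_apply]
    rw [Matrix.mul_apply, Matrix.one_apply]
    have h2 := congrArg (fun v => b.repr v k) h
    simp only [map_sum, _root_.map_smul, Finsupp.coe_finsetSum, Finset.sum_apply,
      Finsupp.smul_apply, smul_eq_mul, b.repr_self] at h2
    rw [Finsupp.single_apply] at h2
    simp only [eq_comm (a := k), ← h2]
    exact Finset.sum_congr rfl fun j _ => mul_comm _ _
  · ext k
    have := (b k).2
    rw [LinearMap.mem_ker, hℓ] at this
    rw [Matrix.vecMul, dotProduct, Pi.zero_apply, ← this]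
    exact Finset.sum_congr rfl fun j _ => mul_comm _ _
  · have hS : (rmat (Matrix.of fun i j => σ (g j) i)).mulVec x = 0 := by
      ext i
      by_cases ha : a = 0
      · have : ∀ j, g j = 0 := fun j => Subtype.ext (congrFun ha j)
        simp [Matrix.mulVec, dotProduct, rmat, this]
      obtain ⟨k, hk⟩ := Function.ne_iff.mp ha
      have hcomm : ∀ j, a k * σ (g j) i = a j * σ (g k) i := fun j => by
        have : a k • g j = a j • g k := Subtype.ext (mul_comm _ _)
        have := congrFun (congrArg σ this) i
        rwa [map_smul, map_smul] at this
      have hk' : (a k : ℝ) ≠ 0 := Int.cast_ne_zero.mpr hk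
      refine (mul_eq_zero.mp ?_).resolve_left hk'
      rw [Matrix.mulVec, dotProduct, Finset.mul_sum]
      calc ∑ j, (a k : ℝ) * (((σ (g j) i : ℤ) : ℝ) * x j)
          = ∑ j, (σ (g k) i : ℝ) * (a j * x j) := Finset.sum_congr rfl fun j _ => by
            have : (a k : ℝ) * σ (g j) i = a j * σ (g k) i := by exact_mod_cast hcomm j
            rw [← mul_assoc, this]
            ring
        _ = 0 := by
            rw [← Finset.mul_sum]
            exact mul_eq_zero_of_right _ hx
    have hsub : rmat (J * K) = 1 - rmat (Matrix.of fun i j => σ (g j) i) := by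
      rw [hJK]
      ext i j
      simp [rmat, Matrix.one_apply]
    rw [hsub, Matrix.sub_mulVec, Matrix.one_mulVec, hS, sub_zero]

/-- Induction on the number of equations: restrict the next form to the lattice already found and
take its kernel there. -/
lemma exists_lattice_basis {ι : Type*} {I : Set ι} (hI : I.Finite) {N : ℕ} (a : ι → Fin N → ℤ) :
    ∃ (d : ℕ) (J : Matrix (Fin N) (Fin d) ℤ) (K : Matrix (Fin d) (Fin N) ℤ), K * J = 1 ∧
      (∀ i ∈ I, Matrix.vecMul (a i) J = 0) ∧
      ∀ x, (∀ i ∈ I, intForm (a i) x = 0) → (rmat (J * K)).mulVec x = x := by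
  induction I, hI using Set.Finite.induction_on with
  | empty => exact ⟨N, 1, 1, by simp, by simp, fun x _ => by simp [rmat_one]⟩
  | @insert i s _ _ ih =>
    obtain ⟨d, J, K, hKJ, hJ, hx⟩ := ih
    obtain ⟨d', J', K', hKJ', hJ', hx'⟩ := exists_kernel_basis (Matrix.vecMul (a i) J)
    refine ⟨d', J * J', K' * K, ?_, ?_, fun x hxs => ?_⟩
    · rw [Matrix.mul_assoc, ← Matrix.mul_assoc K, hKJ, Matrix.one_mul, hKJ']
    · rintro j (rfl | hj)
      · rw [← Matrix.vecMul_vecMul, hJ']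
      · rw [← Matrix.vecMul_vecMul, hJ j hj, Matrix.zero_vecMul]
    · have h1 := hx x fun j hj => hxs j (mem_insert_of_mem i hj)
      rw [rmat_mul, ← Matrix.mulVec_mulVec] at h1
      have h2 := hx' ((rmat K).mulVec x) (by
        rw [← intForm_mulVec, h1]
        exact hxs i (mem_insert i s))
      rw [rmat_mul, ← Matrix.mulVec_mulVec] at h2
      rw [rmat_mul, rmat_mul, rmat_mul, ← Matrix.mulVec_mulVec, ← Matrix.mulVec_mulVec,
        ← Matrix.mulVec_mulVec, h2, h1]

/-! ### Disjoint unions of relatively open cells -/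

/-- A chart of a relatively open cell: its image is an open polyhedron around the origin. -/
structure IsOpenChart {γ : Type*} [TopologicalSpace γ] (s : Set γ) {d : ℕ}
    (φ : γ → Fin d → ℝ) : Prop where
  embedding : IsEmbedding (s.domRestrict φ)
  polyhedron : IsGenPolyhedron (φ '' s)
  isOpen : IsOpen (φ '' s)
  zero_mem : 0 ∈ φ '' s

lemma isFace_self {n : ℕ} (P : Set (Fin n → ℝ)) : IsFace P P :=
  ⟨0, 0, fun x _ => (intForm_zero_left x).ge, by simp [intForm_zero_left]⟩

/-- The fan whose only cone is the whole space: a nonzero form is unbounded below on it, so it has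
no other nonempty face. The origin must lie in the set, so charts are centred. -/
lemma isOpenFan_singleton {n : ℕ} {U : Set (Fin n → ℝ)} (hU : IsOpen U) (h0 : 0 ∈ U) :
    IsOpenFan {U} := by
  refine ⟨{univ}, ∅, U, ⟨finite_singleton _, ?_, ?_, ?_⟩, empty_subset _, hU, h0, by simp⟩
  · rintro _ rfl
    exact ⟨∅, by simp⟩
  · rintro _ rfl _ ⟨y, hy⟩ ⟨a, p, ha, rfl⟩
    have ha0 : a = 0 := by
      by_contra hne
      have hpos := intForm_rvec_self hne
      have := ha (((p - 1) / intForm a (rvec a)) • rvec a) (mem_univ _)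
      rw [intForm_smul, div_mul_cancel₀ _ hpos.ne'] at this
      linarith
    subst ha0
    rw [mem_singleton_iff, eq_univ_iff_forall]
    intro x
    have := hy.2
    rw [intForm_zero_left] at this
    exact ⟨mem_univ _, by rw [intForm_zero_left, this]⟩
  · rintro _ rfl _ rfl
    rw [inter_self]
    exact ⟨isFace_self _, isFace_self _⟩

section Disjoint

variable {γ : Type u} {𝓢 : Set (Set γ)} {d : Set γ → ℕ} {φ : ∀ s, γ → Fin (d s) → ℝ}

/-- The data of the complex with pairwise disjoint cells `𝓢`. -/
def disjointData (𝓢 : Set (Set γ)) (d : Set γ → ℕ) (φ : ∀ s, γ → Fin (d s) → ℝ) :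
    ComplexData γ where
  cells := 𝓢
  dim := d
  chart := φ
  starDim := d
  starChart := φ
  fan s := {φ s '' s}

lemma eq_of_partition (hpart : ∀ x : γ, ∃! s : Set γ, s ∈ 𝓢 ∧ x ∈ s) {s t : Set γ} (hs : s ∈ 𝓢)
    (ht : t ∈ 𝓢) (hst : (s ∩ t).Nonempty) : s = t :=
  let ⟨x, hxs, hxt⟩ := hst
  (hpart x).unique ⟨hs, hxs⟩ ⟨ht, hxt⟩

variable [TopologicalSpace γ] (hpart : ∀ x : γ, ∃! s : Set γ, s ∈ 𝓢 ∧ x ∈ s)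
  (hφ : ∀ s ∈ 𝓢, IsOpenChart s (φ s))

lemma IsOpenChart.nonempty {s : Set γ} {d : ℕ} {φ : γ → Fin d → ℝ} (h : IsOpenChart s φ) :
    s.Nonempty := let ⟨x, hx, _⟩ := h.zero_mem; ⟨x, hx⟩

include hφ

lemma disjointData_relInt {s : Set γ} (hs : s ∈ 𝓢) : (disjointData 𝓢 d φ).relInt s = s := by
  ext x
  refine ⟨fun h => h.1, fun h => ⟨h, ?_⟩⟩
  change φ s x ∈ interior (φ s '' s)
  rw [(hφ s hs).isOpen.interior_eq]
  exact mem_image_of_mem _ h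

include hpart

lemma eq_of_subset_of_partition {s t : Set γ} (hs : s ∈ 𝓢) (ht : t ∈ 𝓢) (hst : s ⊆ t) : s = t :=
  eq_of_partition hpart hs ht (by rw [inter_eq_left.mpr hst]; exact (hφ s hs).nonempty)

lemma disjointData_star {s : Set γ} (hs : s ∈ 𝓢) : (disjointData 𝓢 d φ).star s = s := by
  ext x
  constructor
  · rintro ⟨t, ht, hst, hx⟩
    rw [eq_of_subset_of_partition hpart hφ hs ht hst]
    exact hx.1
  · exact fun hx => ⟨s, hs, Subset.rfl, (disjointData_relInt hφ hs).symm.subset hx⟩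

/-- The polyhedral complex with open pairwise disjoint cells. -/
def disjointComplex (hopen : ∀ s ∈ 𝓢, IsOpen s) : PolyComplex γ where
  toComplexData := disjointData 𝓢 d φ
  inter_mem s hs t ht hne := by
    obtain rfl := eq_of_partition hpart hs ht hne
    rw [inter_self]
    exact ⟨hs, isFace_self _, isFace_self _⟩
  chart_embedding s hs := (hφ s hs).embedding
  chart_polyhedron s hs := (hφ s hs).polyhedron
  chart_full s hs := (hφ s hs).isOpen.affineSpan_eq_top ⟨0, (hφ s hs).zero_mem⟩
  chart_affine s hs t ht := by
    rcases (s ∩ t).eq_empty_or_nonempty with h | h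
    · rw [h]
      exact intAffineOn_empty
    · obtain rfl := eq_of_partition hpart hs ht h
      exact IntAffineOn.refl _ _
  exists_unique_cell x := by
    obtain ⟨s, ⟨hs, hxs⟩, huniq⟩ := hpart x
    exact ⟨s, ⟨hs, (disjointData_relInt hφ hs).symm.subset hxs⟩, fun t ht => huniq t ⟨ht.1, ht.2.1⟩⟩
  star_open s hs := by
    rw [disjointData_star hpart hφ hs]
    exact hopen s hs
  fan_open s hs := isOpenFan_singleton (hφ s hs).isOpen (hφ s hs).zero_mem
  star_embedding s hs := by
    rw [disjointData_star hpart hφ hs]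
    exact (hφ s hs).embedding
  star_image s hs := by
    rw [disjointData_star hpart hφ hs]
    exact (sUnion_singleton _).symm
  star_cell s hs t ht hst := by
    obtain rfl := eq_of_subset_of_partition hpart hφ hs ht hst
    rw [disjointData_star hpart hφ hs, inter_self]
    exact ⟨rfl, IntAffineOn.refl _ _, IntAffineOn.refl _ _⟩
  star_affine s hs t ht := by
    rw [disjointData_star hpart hφ hs, disjointData_star hpart hφ ht]
    rcases (s ∩ t).eq_empty_or_nonempty with h | h
    · rw [h]
      exact intAffineOn_empty
    · obtain rfl := eq_of_partition hpart hs ht h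
      exact IntAffineOn.refl _ _

end Disjoint

/-! ### Strata of a system of walls -/

section Strata

variable {β : Type u} [TopologicalSpace β] {Y : PolyComplex β} {𝓦 : Set β → Set (β → ℝ)}

/-- The points in the cell of `x` at which the functions of this cell have the same sign as
at `x`. -/
def stratum (Y : PolyComplex β) (𝓦 : Set β → Set (β → ℝ)) (x : β) : Set β :=
  {y | Y.cellOf y = Y.cellOf x ∧
    ∀ φ ∈ 𝓦 (Y.cellOf x), SignType.sign (φ y) = SignType.sign (φ x)}

lemma mem_stratum_self (x : β) : x ∈ stratum Y 𝓦 x := ⟨rfl, fun _ _ => rfl⟩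

lemma stratum_eq_iff {x y : β} : stratum Y 𝓦 y = stratum Y 𝓦 x ↔ y ∈ stratum Y 𝓦 x := by
  refine ⟨fun h => h ▸ mem_stratum_self y, fun ⟨h1, h2⟩ => ?_⟩
  ext z
  refine and_congr (by rw [h1]) ?_
  rw [h1]
  exact forall₂_congr fun φ hφ => by rw [h2 φ hφ]

/-- The wall functions that vanish at `x` cut out a rational subspace; a lattice basis of it,
centred at `x`, provides the chart. The other sign conditions are open. A vanishing wall function
lowers the dimension, its form being nonzero. -/
lemma exists_stratum_chart (hfin : ∀ c ∈ Y.cells, (𝓦 c).Finite)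
    (hform : ∀ c ∈ Y.cells, ∀ φ ∈ 𝓦 c, ∃ (a : Fin (Y.dim c) → ℤ) (p : ℝ), a ≠ 0 ∧
      ∀ x ∈ c, φ x = intForm a (Y.chart c x) - p) (x : β) :
    ∃ (d : ℕ) (ψ : β → Fin d → ℝ), IsOpenChart (stratum Y 𝓦 x) ψ ∧
      IntAffineOn (stratum Y 𝓦 x) ψ (Y.chart (Y.cellOf x)) ∧
      IntAffineOn (stratum Y 𝓦 x) (Y.chart (Y.cellOf x)) ψ ∧
      d ≤ Y.dim (Y.cellOf x) ∧ ((∃ φ ∈ 𝓦 (Y.cellOf x), φ x = 0) → d < Y.dim (Y.cellOf x)) := by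
  set c := Y.cellOf x with hc
  have hcm : c ∈ Y.cells := Y.cellOf_mem x
  have hxc : x ∈ c := Y.mem_cellOf x
  choose! a p ha hap using hform c hcm
  have hI : {φ | φ ∈ 𝓦 c ∧ φ x = 0}.Finite := (hfin c hcm).subset fun φ h => h.1
  obtain ⟨d, J, K, hKJ, haJ, hJK⟩ := exists_lattice_basis hI a
  have hs : ∀ y ∈ stratum Y 𝓦 x, y ∈ Y.relInt c := fun y hy =>
    (PolyComplex.mem_relInt_iff hcm).mpr hy.1
  set x₀ := Y.chart c x
  set ψ : β → Fin d → ℝ := fun y => (rmat K).mulVec (Y.chart c y) + -(rmat K).mulVec x₀ with hψ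
  have hψ' : ∀ y ∈ stratum Y 𝓦 x, Y.chart c y = (rmat J).mulVec (ψ y) + x₀ := by
    intro y hy
    have h := hJK (Y.chart c y - x₀) fun φ hφ => by
      have h1 := hy.2 φ hφ.1
      rw [hφ.2, sign_zero, sign_eq_zero_iff, hap φ hφ.1 y (hs y hy).1] at h1
      have h2 := hφ.2
      rw [hap φ hφ.1 x hxc] at h2
      rw [intForm_sub]
      linarith
    rw [rmat_mul, ← Matrix.mulVec_mulVec, Matrix.mulVec_sub, sub_eq_add_neg] at h
    exact (eq_add_of_sub_eq h.symm).trans (by rw [hψ])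
  have himg : ψ '' stratum Y 𝓦 x = {z | (rmat J).mulVec z + x₀ ∈ interior (Y.chart c '' c) ∩
      {q | ∀ φ ∈ 𝓦 c, q ∈ {q | SignType.sign (intForm (a φ) q - p φ)
        = SignType.sign (φ x)}}} := by
    ext z
    constructor
    · rintro ⟨y, hy, rfl⟩
      rw [mem_ofPred_eq, ← hψ' y hy]
      exact ⟨(hs y hy).2, fun φ hφ => by rw [mem_ofPred_eq, ← hap φ hφ y (hs y hy).1, hy.2 φ hφ]⟩
    · rintro ⟨h1, h2⟩
      obtain ⟨y, hy, hyz⟩ := interior_subset h1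
      have hyr : y ∈ Y.relInt c := ⟨hy, hyz ▸ h1⟩
      refine ⟨y, ⟨PolyComplex.cellOf_eq hcm hyr, fun φ hφ => ?_⟩, ?_⟩
      · rw [hap φ hφ y hy, hyz]
        exact h2 φ hφ
      · change (rmat K).mulVec (Y.chart c y) + _ = z
        rw [hyz, Matrix.mulVec_add, Matrix.mulVec_mulVec, ← rmat_mul, hKJ, rmat_one,
          Matrix.one_mulVec, add_neg_cancel_right]
  refine ⟨d, ψ, ⟨?_, ?_, ?_, x, mem_stratum_self x, add_neg_cancel _⟩, ⟨J, x₀, hψ'⟩,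
    ⟨K, _, fun y _ => rfl⟩, le_of_mul_eq_one hKJ, ?_⟩
  · have hemb : IsEmbedding ((stratum Y 𝓦 x).domRestrict (Y.chart c)) :=
      IsEmbedding.domRestrict_comp (i := id) IsEmbedding.id (Y.chart_embedding c hcm)
        fun y hy => (hs y hy).1
    refine IsEmbedding.of_comp (g := fun z => (rmat J).mulVec z + x₀)
      (((continuous_mulVec (rmat K)).comp hemb.continuous).add continuous_const)
      ((continuous_mulVec (rmat J)).add continuous_const) ?_
    convert hemb using 1
    funext y
    exact (hψ' y y.2).symm
  · rw [himg]
    exact ((isGenPolyhedron_interior (Y.chart_polyhedron c hcm)).inter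
      (isGenPolyhedron_biInter (hfin c hcm) fun φ _ => isGenPolyhedron_sign _ _ _)).preimage J x₀
  · have hcont : Continuous fun z => (rmat J).mulVec z + x₀ :=
      (continuous_mulVec (rmat J)).add continuous_const
    -- The walls through `x` are satisfied automatically in the coordinates `J`, so only finitely
    -- many strict sign conditions remain.
    have himg' : ψ '' stratum Y 𝓦 x = (fun z => (rmat J).mulVec z + x₀) ⁻¹'
        (interior (Y.chart c '' c)) ∩ ⋂ φ ∈ {φ | φ ∈ 𝓦 c ∧ φ x ≠ 0},
          {z | SignType.sign (intForm (a φ) ((rmat J).mulVec z + x₀) - p φ)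
            = SignType.sign (φ x)} := by
      rw [himg]
      ext z
      simp only [mem_ofPred_eq, mem_inter_iff, mem_preimage, mem_iInter, and_imp]
      refine and_congr_right fun _ => ⟨fun h φ hφ _ => h φ hφ, fun h φ hφ => ?_⟩
      by_cases h0 : φ x = 0
      · have h2 := hap φ hφ x hxc
        rw [intForm_add, intForm_mulVec, haJ φ ⟨hφ, h0⟩, intForm_zero_left, zero_add, ← h2]
      · exact h φ hφ h0
    rw [himg']
    refine (isOpen_interior.preimage hcont).inter
      (((hfin c hcm).subset fun φ h => h.1).isOpen_biInter fun φ hφ => ?_)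
    have hc' : Continuous fun z => intForm (a φ) ((rmat J).mulVec z + x₀) - p φ :=
      ((continuous_intForm _).comp hcont).sub continuous_const
    rcases lt_or_gt_of_ne hφ.2 with h | h
    · simp only [sign_neg h, sign_eq_neg_one_iff]
      exact isOpen_lt hc' continuous_const
    · simp only [sign_pos h, sign_eq_one_iff]
      exact isOpen_lt continuous_const hc'
  · rintro ⟨φ, hφ, h0⟩
    exact lt_of_vecMul_eq_zero hKJ (ha φ hφ) (haJ φ ⟨hφ, h0⟩)

end Strata

/-! ### The complex of the strata -/

/-- The subset `N` with the topology in which the fibres of `σ` are open: the disjoint union of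
the fibres of `σ` in `N`. -/
def Strata {β : Type u} (N : Set β) (_σ : β → Set β) : Type u := N

namespace Strata

variable {β : Type u} {N : Set β} {σ : β → Set β}

/-- The inclusion into the ambient space. -/
def val (x : Strata N σ) : β := Subtype.val x

lemma val_injective : Function.Injective (val : Strata N σ → β) := Subtype.val_injective

lemma range_val : range (val : Strata N σ → β) = N := Subtype.range_val

variable [TopologicalSpace β]

/-- A suborbit space needs only a continuous injection, so the topology may be refined until the
strata are open. Every stratum is then its own star, and the star axioms reduce to statements about
single cells. -/
instance : TopologicalSpace (Strata N σ) :=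
  .induced val inferInstance ⊓ .induced (fun x => σ x.val) ⊥

lemma continuous_val : Continuous (val : Strata N σ → β) :=
  continuous_iff_le_induced.mpr inf_le_left

lemma isOpen_preimage (S : Set (Set β)) : IsOpen {x : Strata N σ | σ x.val ∈ S} := by
  let _ : TopologicalSpace (Set β) := ⊥
  have : DiscreteTopology (Set β) := ⟨rfl⟩
  have h : Continuous (fun x : Strata N σ => σ x.val) :=
    continuous_iff_le_induced.mpr inf_le_right
  exact (isOpen_discrete S).preimage h

lemma isEmbedding_domRestrict {s : Set (Strata N σ)} {S : Set β} (hs : ∀ x ∈ s, σ x.val = S) :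
    IsEmbedding (s.domRestrict val) := by
  refine ⟨⟨?_⟩, fun x y h => Subtype.ext (val_injective h)⟩
  let _ : TopologicalSpace (Set β) := ⊥
  change TopologicalSpace.induced Subtype.val (_ ⊓ _) = _
  rw [induced_inf, induced_compose, induced_compose]
  have h : (fun x : Strata N σ => σ x.val) ∘ (Subtype.val : s → Strata N σ) = fun _ => S :=
    funext fun x => hs x x.2
  rw [h, induced_const, inf_top_eq]
  rfl

lemma continuous_map {F : Strata N σ → Strata N σ} {F' : β → β} (hF' : Continuous F')
    (hF : ∀ x, (F x).val = F' x.val) {k : Set β → Set β} (hk : ∀ x, σ (F' x) = k (σ x)) :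
    Continuous F := by
  refine continuous_inf_rng.mpr ⟨continuous_induced_rng.mpr ?_, continuous_induced_rng.mpr ?_⟩
  · exact (hF'.comp continuous_val).congr fun x => (hF x).symm
  · let _ : TopologicalSpace (Set β) := ⊥
    have h : Continuous (fun x : Strata N σ => σ x.val) :=
      continuous_iff_le_induced.mpr inf_le_right
    have h' : (fun x : Strata N σ => σ x.val) ∘ F = k ∘ fun x => σ x.val :=
      funext fun x => by rw [Function.comp_apply, hF]; exact hk x.val
    rw [h']
    exact continuous_bot.comp h

end Strata

/-! ### The wall locus as the support of a suborbit space. -/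

section

variable {β : Type u} [TopologicalSpace β] {Y : PolyComplex β} {𝓦 : Set β → Set (β → ℝ)}
  {H : Type*} [Group H] [MulAction H β] {n : ℕ} {ωY : Set β → ℚ}

lemma smul_mem_stratum (hY : IsOrbitSpace Y H)
    (hinv : ∀ (h : H) c, ∀ φ ∈ 𝓦 (h • c), (fun x => φ (h • x)) ∈ 𝓦 c) (h : H) {x y : β}
    (hy : y ∈ stratum Y 𝓦 x) : h • y ∈ stratum Y 𝓦 (h • x) := by
  refine ⟨by rw [hY.cellOf_smul, hY.cellOf_smul, hy.1], fun φ hφ => ?_⟩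
  rw [hY.cellOf_smul] at hφ
  exact hy.2 _ (hinv h _ φ hφ)

lemma stratum_smul (hY : IsOrbitSpace Y H)
    (hinv : ∀ (h : H) c, ∀ φ ∈ 𝓦 (h • c), (fun x => φ (h • x)) ∈ 𝓦 c) (h : H) (x : β) :
    stratum Y 𝓦 (h • x) = h • stratum Y 𝓦 x := by
  ext y
  rw [mem_smul_set_iff_inv_smul_mem]
  refine ⟨fun hy => ?_, fun hy => ?_⟩
  · have := smul_mem_stratum hY hinv h⁻¹ hy
    rwa [inv_smul_smul] at this
  · have := smul_mem_stratum hY hinv h hy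
    rwa [smul_inv_smul] at this

/-- The points on the cells of dimension less than `n` and on the walls. -/
def wallLocus (Y : PolyComplex β) (𝓦 : Set β → Set (β → ℝ)) (n : ℕ) : Set β :=
  {x | Y.dim (Y.cellOf x) < n ∨ ∃ φ ∈ 𝓦 (Y.cellOf x), φ x = 0}

lemma stratum_subset_wallLocus {x : β} (hx : x ∈ wallLocus Y 𝓦 n) :
    stratum Y 𝓦 x ⊆ wallLocus Y 𝓦 n := by
  intro y hy
  refine hx.imp (fun h => by rwa [hy.1]) fun ⟨φ, hφ, h0⟩ => ⟨φ, by rwa [hy.1], ?_⟩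
  rw [← sign_eq_zero_iff, hy.2 φ hφ, h0, sign_zero]

lemma smul_mem_wallLocus (hY : IsOrbitSpace Y H)
    (hinv : ∀ (h : H) c, ∀ φ ∈ 𝓦 (h • c), (fun x => φ (h • x)) ∈ 𝓦 c) (h : H) (x : β)
    (hx : x ∈ wallLocus Y 𝓦 n) : h • x ∈ wallLocus Y 𝓦 n := by
  refine hx.imp (fun hd => ?_) fun ⟨φ, hφ, h0⟩ => ⟨fun y => φ (h⁻¹ • y), ?_, ?_⟩
  · rwa [hY.cellOf_smul, hY.dim_smul h (Y.cellOf_mem x)]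
  · rw [hY.cellOf_smul]
    exact hinv h⁻¹ _ φ (by rwa [inv_smul_smul])
  · change φ (h⁻¹ • h • x) = 0
    rwa [inv_smul_smul]

/-- The complement is a union of open pieces of the relative interiors of n-dimensional cells, each
cut out by finitely many inequations. -/
lemma isClosed_wallLocus (hY : IsTropicalOrbitSpace Y H n ωY)
    (hfin : ∀ c ∈ Y.cells, (𝓦 c).Finite)
    (hform : ∀ c ∈ Y.cells, ∀ φ ∈ 𝓦 c, ∃ (a : Fin (Y.dim c) → ℤ) (p : ℝ), a ≠ 0 ∧
      ∀ x ∈ c, φ x = intForm a (Y.chart c x) - p) : IsClosed (wallLocus Y 𝓦 n) := by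
  rw [← isOpen_compl_iff]
  have h : (wallLocus Y 𝓦 n)ᶜ = ⋃ c ∈ {c | c ∈ Y.cells ∧ Y.dim c = n},
      Y.relInt c ∩ ⋂ φ ∈ 𝓦 c, Y.relInt c ∩ φ ⁻¹' {0}ᶜ := by
    ext x
    simp only [wallLocus, mem_compl_iff, mem_ofPred_eq, not_or, not_lt, not_exists, not_and,
      mem_iUnion, mem_inter_iff, mem_iInter, mem_preimage, mem_singleton_iff, exists_prop]
    constructor
    · rintro ⟨h1, h2⟩
      exact ⟨_, ⟨Y.cellOf_mem x, (hY.pure_dim _ (Y.cellOf_mem x)).1.antisymm h1⟩,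
        Y.mem_relInt_cellOf x, fun φ hφ => ⟨Y.mem_relInt_cellOf x, h2 φ hφ⟩⟩
    · rintro ⟨c, ⟨hc, hcd⟩, hx, hφ⟩
      rw [PolyComplex.cellOf_eq hc hx, hcd]
      exact ⟨le_rfl, fun φ hφ' => (hφ φ hφ').2⟩
  rw [h]
  refine isOpen_biUnion fun c hc => (hY.isOpen_relInt hc.1 hc.2).inter
    ((hfin c hc.1).isOpen_biInter fun φ hφ => ?_)
  obtain ⟨a, p, -, hap⟩ := hform c hc.1 φ hφ
  refine ContinuousOn.isOpen_inter_preimage ?_ (hY.isOpen_relInt hc.1 hc.2) isOpen_compl_singleton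
  exact ((((continuous_intForm a).comp_continuousOn (PolyComplex.chart_continuousOn hc.1)).sub
    continuousOn_const).congr hap).mono (Y.relInt_subset c)

/-- The locus of the lower-dimensional cells and of finitely many classes of walls is the support
of a suborbit space of smaller dimension. -/
theorem IsTropicalOrbitSpace.exists_wall_complex (hY : IsTropicalOrbitSpace Y H n ωY)
    (hfin : ∀ c ∈ Y.cells, (𝓦 c).Finite)
    (hform : ∀ c ∈ Y.cells, ∀ φ ∈ 𝓦 c, ∃ (a : Fin (Y.dim c) → ℤ) (p : ℝ), a ≠ 0 ∧
      ∀ x ∈ c, φ x = intForm a (Y.chart c x) - p)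
    (hinv : ∀ (h : H) c, ∀ φ ∈ 𝓦 (h • c), (fun x => φ (h • x)) ∈ 𝓦 c) :
    ∃ (γ : Type u) (_ : TopologicalSpace γ) (_ : MulAction H γ) (Y₀ : PolyComplex γ) (i : γ → β),
      IsOrbitSpace Y₀ H ∧ FinitelyManyClasses Y₀ H ∧ IsSubOrbitSpace Y₀ Y H i ∧
      IsClosed (range i) ∧ (∀ s ∈ Y₀.cells, Y₀.dim s < n) ∧ range i = wallLocus Y 𝓦 n := by
  classical
  have hYo := hY.orbitSpace
  set σ := stratum Y 𝓦 with hσ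
  let γ := Strata (wallLocus Y 𝓦 n) σ
  let _ : MulAction H γ := subAction (smul_mem_wallLocus hYo hinv)
  have hval : ∀ (h : H) (x : γ), (h • x).val = h • x.val := fun _ _ => rfl
  let 𝓢 : Set (Set γ) := range fun x : γ => Strata.val ⁻¹' σ x.val
  have himg : ∀ x : γ, Strata.val '' (Strata.val ⁻¹' σ x.val : Set γ) = σ x.val := fun x => by
    rw [image_preimage_eq_inter_range, Strata.range_val, inter_eq_left]
    exact stratum_subset_wallLocus x.2
  have hsmul : ∀ (h : H) (x : γ), h • (Strata.val ⁻¹' σ x.val : Set γ)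
      = Strata.val ⁻¹' σ (h • x).val := fun h x => by
    ext y
    rw [mem_smul_set_iff_inv_smul_mem, mem_preimage, mem_preimage, hval, hval, hσ,
      stratum_smul hYo hinv, mem_smul_set_iff_inv_smul_mem]
  have hpart : ∀ x : γ, ∃! s : Set γ, s ∈ 𝓢 ∧ x ∈ s := fun x => by
    refine ⟨_, ⟨⟨x, rfl⟩, mem_stratum_self x.val⟩, ?_⟩
    rintro _ ⟨⟨y, rfl⟩, hx⟩
    change Strata.val ⁻¹' σ y.val = Strata.val ⁻¹' σ x.val
    rw [hσ, stratum_eq_iff.mpr hx]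
  have hopen : ∀ s ∈ 𝓢, IsOpen s := by
    rintro _ ⟨x, rfl⟩
    convert Strata.isOpen_preimage (N := wallLocus Y 𝓦 n) (σ := σ) {σ x.val} using 1
    ext y
    exact stratum_eq_iff.symm
  -- Chart, dimension and surrounding cell `c` of Y, chosen for all strata at once; the trivial
  -- values for other sets play no role.
  have hex : ∀ s : Set γ, ∃ (d : ℕ) (ψ : γ → Fin d → ℝ) (c : Set β), s ∈ 𝓢 → IsOpenChart s ψ ∧
      IntAffineOn s ψ (fun x => Y.chart c x.val) ∧ IntAffineOn s (fun x => Y.chart c x.val) ψ ∧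
      d < n ∧ c ∈ Y.cells ∧ ∀ x ∈ s, x.val ∈ Y.relInt c := by
    intro s
    by_cases hs : s ∈ 𝓢
    · obtain ⟨x, rfl⟩ := hs
      obtain ⟨d, ψ, hψ, h1, h2, hd, hd'⟩ := exists_stratum_chart hfin hform x.val
      have himg' : (fun y : γ => ψ y.val) '' (Strata.val ⁻¹' σ x.val) = ψ '' σ x.val := by
        conv_rhs => rw [← himg x, image_image]
      have hc := Y.cellOf_mem x.val
      have hle := (hY.pure_dim _ hc).1
      refine ⟨d, fun y => ψ y.val, Y.cellOf x.val, fun _ => ⟨⟨?_, ?_, ?_, ?_⟩,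
        h1.comp fun _ hy => hy, h2.comp fun _ hy => hy, ?_, hc, fun y hy => ?_⟩⟩
      · exact hψ.embedding.comp ((Strata.isEmbedding_domRestrict fun y hy =>
          stratum_eq_iff.mpr hy).codRestrict (σ x.val) fun y => y.2)
      · rw [himg']
        exact hψ.polyhedron
      · rw [himg']
        exact hψ.isOpen
      · rw [himg']
        exact hψ.zero_mem
      -- A point of the locus lies in a lower-dimensional cell or on a wall, and each alternative
      -- makes the dimension of its stratum less than n.
      · exact Or.elim x.2 (fun h => hd.trans_lt h) fun h => (hd' h).trans_le hle
      · exact (PolyComplex.mem_relInt_iff hc).mpr hy.1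
    · exact ⟨0, 0, ∅, fun h => (hs h).elim⟩
  choose d ψ c hψ using hex
  have hchart : ∀ s ∈ 𝓢, IsOpenChart s (ψ s) := fun s hs => (hψ s hs).1
  have hstar : ∀ s ∈ 𝓢, (disjointComplex hpart hchart hopen).star s = s := fun s hs =>
    disjointData_star hpart hchart hs
  have hc_smul : ∀ (h : H), ∀ s ∈ 𝓢, h • s ∈ 𝓢 → c (h • s) = h • c s := by
    intro h s hs hhs
    obtain ⟨x, hx⟩ := (hchart s hs).nonempty
    have h1 := (hψ _ hhs).2.2.2.2.2 (h • x) (smul_mem_smul_set hx)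
    have h2 := (hψ s hs).2.2.2.2.2 x hx
    rw [← PolyComplex.cellOf_eq (hψ _ hhs).2.2.2.2.1 h1, hval, hYo.cellOf_smul,
      PolyComplex.cellOf_eq (hψ s hs).2.2.2.2.1 h2]
  have h𝓢 : ∀ (h : H), ∀ s ∈ 𝓢, h • s ∈ 𝓢 := by
    rintro h _ ⟨x, rfl⟩
    exact ⟨h • x, (hsmul h x).symm⟩
  refine ⟨γ, inferInstance, inferInstance, disjointComplex hpart hchart hopen, Strata.val,
    ⟨fun h => ?_, h𝓢, fun h s hs => ?_⟩, ?_, ⟨Strata.val_injective, Strata.continuous_val,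
    hval, fun s hs => ?_, fun s hs t ht => ?_⟩, ?_, fun s hs => (hψ s hs).2.2.2.1,
    Strata.range_val⟩
  · exact Strata.continuous_map (hYo.continuous_smul h) (hval h) (stratum_smul hYo hinv h)
  · rw [hstar s hs]
    obtain ⟨-, h1, h2, -, hcm, hrel⟩ := hψ s hs
    obtain ⟨-, h1', h2', -, -, -⟩ := hψ _ (h𝓢 h s hs)
    have hmid : IntAffineOn s (fun x : γ => Y.chart (c s) x.val)
        (fun x : γ => Y.chart (c (h • s)) (h • x).val) := by
      rw [hc_smul h s hs (h𝓢 h s hs)]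
      exact (hYo.chart_affine h hcm).comp fun x hx => (hrel x hx).1
    exact (h1.trans hmid).trans (h2'.comp (g := fun x => h • x)
      fun x hx => smul_mem_smul_set hx)
  · obtain ⟨T, hT, hTc⟩ := hY.finite_classes
    -- After translation the stratum lies in one of finitely many cells, where it is given by a
    -- vector of signs.
    refine ⟨⋃ c ∈ {c | c ∈ T ∧ c ∈ Y.cells}, range fun ε : 𝓦 c → SignType =>
      {y : γ | Y.cellOf y.val = c ∧ ∀ φ : 𝓦 c, SignType.sign (φ.1 y.val) = ε φ},
      (hT.subset fun c hc => hc.1).biUnion fun c hc => ?_, ?_⟩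
    · have := (hfin c hc.2).to_subtype
      exact finite_range _
    · rintro _ ⟨x, rfl⟩
      obtain ⟨h, t, ht, hxt⟩ := hTc _ (Y.cellOf_mem x.val)
      have hcell : Y.cellOf (h⁻¹ • x.val) = t := by rw [hYo.cellOf_smul, hxt, inv_smul_smul]
      refine ⟨h, Strata.val ⁻¹' σ (h⁻¹ • x).val, ?_, ?_⟩
      · refine mem_biUnion (x := t) ⟨ht, hcell ▸ Y.cellOf_mem _⟩
          ⟨fun φ => SignType.sign (φ.1 (h⁻¹ • x.val)), ?_⟩
        ext y
        change _ ↔ Y.cellOf y.val = Y.cellOf (h⁻¹ • x.val) ∧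
          ∀ φ ∈ 𝓦 (Y.cellOf (h⁻¹ • x.val)), _ = SignType.sign (φ (h⁻¹ • x.val))
        rw [hcell]
        exact and_congr_right fun _ => ⟨fun hφ φ hm => hφ ⟨φ, hm⟩, fun hφ φ => hφ φ.1 φ.2⟩
      · rw [hsmul, smul_inv_smul]
  · exact ⟨c s, (hψ s hs).2.2.2.2.1, image_subset_iff.mpr fun x hx =>
      ((hψ s hs).2.2.2.2.2 x hx).1⟩
  · obtain ⟨-, h1, h2, -, hcm, hrel⟩ := hψ s hs
    obtain ⟨x, hx⟩ := (hchart s hs).nonempty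
    -- A stratum lies in the relative interior of its cell, which is therefore the minimal cell
    -- containing it.
    obtain rfl : t = c s := by
      refine (ht.2.2 _ hcm (image_subset_iff.mpr fun x hx => (hrel x hx).1)).antisymm ?_
      exact PolyComplex.subset_of_mem_relInt hcm ht.1 (hrel x hx)
        (ht.2.1 (mem_image_of_mem _ hx))
    have h3 := PolyComplex.relInt_starChart_affine hcm hcm Subset.rfl
    rw [hstar s hs]
    exact ⟨fun x hx => PolyComplex.relInt_subset_star hcm (hrel x hx),
      h1.trans (h3.1.comp hrel), (h3.2.comp hrel).trans h2⟩
  · rw [Strata.range_val]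
    exact isClosed_wallLocus hY hfin hform

end

/-! ### The fibres over generic points -/

/-- Splitting a finite sum over pairs whose terms are supported on chosen representatives. -/
lemma finsum_prod_eq_finsum_mem {ι A κ K : Type*} [AddCommMonoid K] {F : ι × A → K}
    (hF : (Function.support F).Finite) {rep : κ → A} (hrep : Function.Injective rep) {S : Set κ}
    (hS : ∀ p, F p ≠ 0 → p.2 ∈ rep '' S) :
    ∑ᶠ p, F p = ∑ᶠ c ∈ S, ∑ᶠ i, F (i, rep c) := by
  rw [← finsum_comp_equiv (Equiv.prodComm A ι), finsum_curry _
    (hF.preimage (Equiv.prodComm A ι).injective.injOn),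
    ← finsum_mem_image (f := fun a => ∑ᶠ i, F (i, a)) hrep.injOn, ← finsum_mem_univ]
  refine finsum_mem_inter_support_eq' _ _ _ fun a ha => iff_of_true (mem_univ a) ?_
  by_contra hna
  refine ha (finsum_eq_zero_of_forall_eq_zero fun i => ?_)
  by_contra hne
  exact hna (hS (i, a) hne)

namespace OrbitMorphism

variable {α β : Type*} [TopologicalSpace α] [TopologicalSpace β]
  {X : PolyComplex α} {Y : PolyComplex β} {G H : Type*} [Group G] [Group H]
  [MulAction G α] [MulAction H β] {f : OrbitMorphism X Y G H} {ωX : Set α → ℚ} {ωY : Set β → ℚ}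
  {n : ℕ} {s : Set α} {t : Set β} {y : β} {P : α}

lemma mem_fibre_iff {c : Quotient (MulAction.orbitRel G α)} (hP : Quotient.mk _ P = c) :
    c ∈ f.fibre y ↔ ∃ h : H, h • f.toFun P = y := by
  subst hP
  change Quotient.mk (MulAction.orbitRel H β) (f.toFun P) = Quotient.mk _ y ↔ _
  rw [eq_comm, Quotient.eq]
  rfl

lemma fibre_smul (h : H) (y : β) : f.fibre (h • y) = f.fibre y := by
  have : (Quotient.mk (MulAction.orbitRel H β) (h • y)) = Quotient.mk _ y :=
    Quotient.sound ⟨h, rfl⟩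
  rw [fibre, fibre, this]

open Classical in
/-- The contribution of the point `P` to the number of preimages of `y` under the translate
of `f` by `h`. -/
def pointTerm (f : OrbitMorphism X Y G H) (ωX : Set α → ℚ) (y : β) (a : H × α) : ℚ :=
  if a.1 • f.toFun a.2 = y then ωX (X.cellOf a.2) * f.idx (X.cellOf a.2) else 0

lemma of_pointTerm_ne_zero {a : H × α} (h : f.pointTerm ωX y a ≠ 0) : a.1 • f.toFun a.2 = y := by
  by_contra hne
  exact h (if_neg hne)

namespace IsTropical

variable (hf : f.IsTropical ωX ωY n)
include hf

/-- An element fixing `y` preserves the cell of `y`; if it did not fix the cell pointwise, its fixed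
point `y` would lie on a wall. -/
lemma stabilizer_eq_target (ht : t ∈ Y.cells) (hy : f.IsOff t y) :
    MulAction.stabilizer H y = fixingSubgroup H t := by
  ext h
  rw [MulAction.mem_stabilizer_iff]
  refine ⟨fun hh => ?_, fun hh => (mem_fixingSubgroup_iff H).mp hh y hy.1.1⟩
  by_contra hfix
  have hht : h • t = t := by
    rw [← PolyComplex.cellOf_eq ht hy.1, ← hf.target.orbitSpace.cellOf_smul, hh]
  obtain ⟨w, hw, hw'⟩ := (hf.isWallSet_walls ht).fixed h hht hfix y hy.1.1 hh
  exact hy.2 w hw hw'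

lemma isGood_of_isOff (ht : t ∈ Y.cells) (htd : Y.dim t = n) (hy : f.IsOff t y) {h : H}
    (hP : h • f.toFun P = y) :
    f.IsGood n (X.cellOf P) ∧ h • tgt X Y f.toFun (X.cellOf P) = t :=
  hf.notMem_of_off_walls htd ht (hf.isWallSet_walls ht) hy.1 hy.2 hP

/-- If g fixes P, then h φ(g) h⁻¹ fixes y, hence all of t. Injectivity of f on the cell of P pulls
this back: g fixes the cell pointwise. -/
lemma stabilizer_eq_source (ht : t ∈ Y.cells) (htd : Y.dim t = n) (hy : f.IsOff t y) {h : H}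
    (hP : h • f.toFun P = y) : MulAction.stabilizer G P = fixingSubgroup G (X.cellOf P) := by
  have hXo := hf.source.orbitSpace
  have hYo := hf.target.orbitSpace
  obtain ⟨hgood, htgt⟩ := hf.isGood_of_isOff ht htd hy hP
  ext g
  rw [MulAction.mem_stabilizer_iff]
  refine ⟨fun hg => ?_, fun hg => (mem_fixingSubgroup_iff G).mp hg P (X.mem_cellOf P)⟩
  have hgs : g • X.cellOf P = X.cellOf P := by rw [← hXo.cellOf_smul, hg]
  have hfix : h * f.groupHom g * h⁻¹ ∈ fixingSubgroup H t := by
    rw [← hf.stabilizer_eq_target ht hy, MulAction.mem_stabilizer_iff, ← hP, mul_smul, mul_smul,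
      inv_smul_smul, ← f.map_smul, hg]
  rw [mem_fixingSubgroup_iff] at hfix ⊢
  intro x hx
  have hxt : h • f.toFun x ∈ t := by
    rw [← htgt]
    exact smul_mem_smul_set (f.isCellMap.mapsTo hgood.mem hx)
  have h1 := hfix _ hxt
  rw [mul_smul, mul_smul, inv_smul_smul, ← f.map_smul] at h1
  refine hgood.injOn hYo ?_ hx (smul_left_cancel h h1)
  have := smul_mem_smul_set (a := g) hx
  rwa [hgs] at this

lemma injOn_pairs (ht : t ∈ Y.cells) (htd : Y.dim t = n) (hy : f.IsOff t y) :
    InjOn (fun a : H × α => (a.1, X.cellOf a.2)) {a | a.1 • f.toFun a.2 = y} := by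
  rintro ⟨h, P⟩ hP ⟨h', P'⟩ hP' heq
  obtain ⟨rfl, hcell⟩ := Prod.mk.inj heq
  refine Prod.ext rfl ((hf.isGood_of_isOff ht htd hy hP).1.injOn hf.target.orbitSpace
    (X.mem_cellOf P) (by rw [hcell]; exact X.mem_cellOf P') ?_)
  exact smul_left_cancel h ((show h • f.toFun P = y from hP).trans
    (show h • f.toFun P' = y from hP').symm)

/-- Each class in the fibre has a representative in one of finitely many cells. There it is
determined by the translating element and the cell, and finitely many elements are possible. -/
lemma finite_fibre (ht : t ∈ Y.cells) (htd : Y.dim t = n) (hy : f.IsOff t y) :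
    (f.fibre y).Finite := by
  have hXo := hf.source.orbitSpace
  obtain ⟨T, hT, hcov⟩ := hf.source.finite_classes
  set D := {a : H × α | a.1 • f.toFun a.2 = y ∧ X.cellOf a.2 ∈ T}
  have hD : D.Finite := by
    refine Finite.of_finite_image (f := fun a : H × α => (a.1, X.cellOf a.2)) ?_
      ((hf.injOn_pairs ht htd hy).mono fun a ha => ha.1)
    refine ((hT.inter_of_left X.cells).biUnion fun s hs =>
      (hf.finite_smul_mem_image hs.2 y).image fun h => (h, s)).subset ?_
    rintro _ ⟨⟨h, P⟩, ⟨hP, hPT⟩, rfl⟩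
    exact mem_biUnion (x := X.cellOf P) ⟨hPT, X.cellOf_mem P⟩
      ⟨h, mem_smul_image.mpr ⟨P, X.mem_cellOf P, hP⟩, rfl⟩
  refine (hD.image fun a => Quotient.mk (MulAction.orbitRel G α) a.2).subset fun c hc => ?_
  obtain ⟨P, rfl⟩ := Quotient.exists_rep c
  obtain ⟨h, hP⟩ := (mem_fibre_iff rfl).mp hc
  obtain ⟨g, s, hs, hPs⟩ := hcov _ (X.cellOf_mem P)
  refine ⟨(h * f.groupHom g, g⁻¹ • P), ⟨?_, ?_⟩, Quotient.sound ⟨g⁻¹, rfl⟩⟩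
  · change (h * f.groupHom g) • f.toFun (g⁻¹ • P) = y
    rw [mul_smul, ← f.map_smul, smul_inv_smul, hP]
  · change X.cellOf (g⁻¹ • P) ∈ T
    rwa [hXo.cellOf_smul, hPs, inv_smul_smul]

open Classical in
-- Off the walls a preimage in a good cell lies in the relative interior and is unique there, so
-- pairs (h, s) with `y` in the image correspond to pairs (h, P) with h f(P) = y.
lemma count_eq_finsum_pointTerm (ht : t ∈ Y.cells) (htd : Y.dim t = n) (hy : f.IsOff t y) :
    f.count n ωX y = ∑ᶠ a : H × α,
      orbitWeight ℚ G Quotient.out (X.cellOf a.2) * f.pointTerm ωX y a := by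
  set F : H × Set α → ℚ := fun p => if y ∈ p.1 • f.toFun '' p.2 then f.coef n ωX p.2 else 0
  set Φ : H × α → ℚ := fun a =>
    orbitWeight ℚ G Quotient.out (X.cellOf a.2) * f.pointTerm ωX y a
  set S : Set (H × α) := {a | a.1 • f.toFun a.2 = y}
  have h1 : ∑ᶠ a, Φ a = ∑ᶠ a ∈ S, Φ a := by
    rw [← finsum_mem_univ]
    exact finsum_mem_inter_support_eq' _ _ _ fun a ha => iff_of_true (mem_univ a)
      (of_pointTerm_ne_zero (right_ne_zero_of_mul ha))
  have h2 : ∑ᶠ p, F p = ∑ᶠ p ∈ (fun a : H × α => (a.1, X.cellOf a.2)) '' S, F p := by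
    rw [← finsum_mem_univ]
    refine finsum_mem_inter_support_eq' _ _ _ fun p hp => iff_of_true (mem_univ p) ?_
    have hpy : y ∈ p.1 • f.toFun '' p.2 := by
      by_contra hne
      exact hp (if_neg hne)
    have hgood : f.IsGood n p.2 := by
      refine isGood_of_coef_ne_zero (ωX := ωX) fun h0 => hp ?_
      rw [← h0]
      exact if_pos hpy
    obtain ⟨P, hPs, hP⟩ := mem_smul_image.mp hpy
    have hPr : P ∈ X.relInt p.2 := by
      by_contra hPr
      exact hf.notMem_boundary_of_off_walls htd ht (hf.isWallSet_walls ht) hy.1 hy.2 hgood.mem p.1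
        (mem_smul_image.mpr ⟨P, ⟨hPs, hPr⟩, hP⟩)
    exact ⟨(p.1, P), hP, Prod.ext rfl (PolyComplex.cellOf_eq hgood.mem hPr)⟩
  change ∑ᶠ p, F p = ∑ᶠ a, Φ a
  rw [h1, h2, finsum_mem_image (hf.injOn_pairs ht htd hy)]
  refine finsum_mem_congr rfl fun a ha => ?_
  have hmem : y ∈ a.1 • f.toFun '' X.cellOf a.2 :=
    mem_smul_image.mpr ⟨a.2, X.mem_cellOf _, ha⟩
  change (if y ∈ a.1 • f.toFun '' X.cellOf a.2 then f.coef n ωX (X.cellOf a.2) else 0)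
    = _ * f.pointTerm ωX y a
  rw [if_pos hmem, coef_of_isGood (hf.isGood_of_isOff ht htd hy ha).1, pointTerm,
    if_pos (show a.1 • f.toFun a.2 = y from ha)]

/-- The weighted number of preimages of a generic point is a sum over the classes in its fibre. -/
theorem count_eq_finsum_fibre (ht : t ∈ Y.cells) (htd : Y.dim t = n) (hy : f.IsOff t y)
    {rep : Quotient (MulAction.orbitRel G α) → α} (hrep : ∀ c, Quotient.mk _ (rep c) = c) :
    f.count n ωX y = ∑ᶠ c ∈ f.fibre y, Nat.card (fixingSubgroup H t) *
      (classWeight G ωX (X.cellOf (rep c)) * f.idx (X.cellOf (rep c))) := by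
  classical
  let _ := rightTranslation f.groupHom
  have hXo := hf.source.orbitSpace
  have hYo := hf.target.orbitSpace
  have hYt := hf.finite_stab t ht htd
  have hrepinj : Function.Injective rep := fun c c' h => by rw [← hrep c, h, hrep]
  have hΦ : ∀ (g : G) (a : H × α), f.pointTerm ωX y (g • a) = f.pointTerm ωX y a := by
    rintro g ⟨h, P⟩
    have hiff : (h * (f.groupHom g)⁻¹) • f.toFun (g • P) = h • f.toFun P := by
      rw [f.map_smul, mul_smul, inv_smul_smul]
    change (if (h * (f.groupHom g)⁻¹) • f.toFun (g • P) = y then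
      ωX (X.cellOf (g • P)) * (f.idx (X.cellOf (g • P)) : ℚ) else 0)
      = if h • f.toFun P = y then ωX (X.cellOf P) * (f.idx (X.cellOf P) : ℚ) else 0
    rw [hiff]
    by_cases hP : h • f.toFun P = y
    · have hgood := (hf.isGood_of_isOff ht htd hy hP).1
      rw [if_pos hP, if_pos hP, hXo.cellOf_smul, hf.source.weight_smul g _ hgood.mem hgood.dim_eq,
        f.idx_smul hXo hYo g hgood.mem]
    · rw [if_neg hP, if_neg hP]
  have hfin₁ : (Function.support fun a : H × α =>
      orbitWeight ℚ G Quotient.out (X.cellOf a.2) * f.pointTerm ωX y a).Finite := by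
    refine Finite.of_finite_image (f := fun a : H × α => (a.1, X.cellOf a.2))
      ((hf.finite_pairs ht).subset ?_) ((hf.injOn_pairs ht htd hy).mono fun a ha =>
        of_pointTerm_ne_zero (right_ne_zero_of_mul ha))
    rintro _ ⟨a, ha, rfl⟩
    have hP := of_pointTerm_ne_zero (right_ne_zero_of_mul ha)
    obtain ⟨hgood, htgt⟩ := hf.isGood_of_isOff ht htd hy hP
    refine ⟨?_, htgt.ge⟩
    change f.coef n ωX (X.cellOf a.2) ≠ 0
    rw [coef_of_isGood hgood]
    change _ * f.pointTerm ωX y a ≠ 0 at ha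
    rwa [pointTerm, if_pos hP] at ha
  have hsupp : ∀ a : H × α, orbitWeight ℚ G rep a.2 * f.pointTerm ωX y a ≠ 0 →
      a.2 ∈ rep '' f.fibre y := by
    intro a ha
    have hP := of_pointTerm_ne_zero (right_ne_zero_of_mul ha)
    have hrepa : a.2 = rep (Quotient.mk _ a.2) := by
      by_contra hne
      exact left_ne_zero_of_mul ha (if_neg hne)
    exact ⟨Quotient.mk _ a.2, (mem_fibre_iff rfl).mpr ⟨a.1, hP⟩, hrepa.symm⟩
  have hfin₂ : (Function.support fun a : H × α =>
      orbitWeight ℚ G rep a.2 * f.pointTerm ωX y a).Finite := by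
    refine (((hf.finite_fibre ht htd hy).image rep).biUnion fun P _ =>
      (hf.finite_smul_mem_image (X.cellOf_mem P) y).image fun h => (h, P)).subset fun a ha => ?_
    exact mem_biUnion (x := a.2) (hsupp a ha) ⟨a.1, mem_smul_image.mpr
      ⟨a.2, X.mem_cellOf _, of_pointTerm_ne_zero (right_ne_zero_of_mul ha)⟩, rfl⟩
  -- The weight on representatives of classes of cells is exchanged for the one on representatives
  -- of classes of points; the sum then splits over the fibre.
  rw [hf.count_eq_finsum_pointTerm ht htd hy, finsum_mul_eq_of_invariant (G := G)
    (χ' := fun a : H × α => orbitWeight ℚ G rep a.2) hΦ hfin₁ hfin₂ (fun a ha => ?_)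
    fun a ha => ?_, finsum_prod_eq_finsum_mem hfin₂ hrepinj hsupp]
  · refine finsum_mem_congr rfl fun c hc => ?_
    obtain ⟨h₀, hP⟩ := (mem_fibre_iff (hrep c)).mp hc
    set P := rep c with hPdef
    -- The translations that carry the image of `P` to `y` form a coset of the stabilizer of `y`,
    -- which is the pointwise stabilizer of `t`.
    have hset : {h : H | h • f.toFun P = y} = (fun h => h * h₀) '' (fixingSubgroup H t : Set H) := by
      rw [← hf.stabilizer_eq_target ht hy]
      ext h
      constructor
      · intro hh
        refine ⟨h * h₀⁻¹, ?_, inv_mul_cancel_right _ _⟩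
        rw [SetLike.mem_coe, MulAction.mem_stabilizer_iff, ← hP, mul_smul, inv_smul_smul, hP]
        exact hh
      · rintro ⟨k, hk, rfl⟩
        change (k * h₀) • f.toFun P = y
        rw [mul_smul, hP]
        exact hk
    have hfinS : {h : H | h • f.toFun P = y}.Finite := by
      rw [hset]
      exact (hYt.subset fun h hh => smul_eq_of_mem_fixing hh).image _
    have hcard : {h : H | h • f.toFun P = y}.ncard = Nat.card (fixingSubgroup H t) := by
      rw [hset, ncard_image_of_injective _ (mul_left_injective h₀)]
      rfl
    have hsum : ∑ᶠ h : H, f.pointTerm ωX y (h, P)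
        = {h : H | h • f.toFun P = y}.ncard * (ωX (X.cellOf P) * f.idx (X.cellOf P)) := by
      rw [finsum_eq_sum_of_support_subset (s := hfinS.toFinset) _ fun h hh =>
        hfinS.mem_toFinset.mpr (of_pointTerm_ne_zero (a := (h, P)) hh), ncard_eq_toFinset_card _ hfinS,
        ← nsmul_eq_mul]
      exact Finset.sum_eq_card_nsmul fun h hh => if_pos (hfinS.mem_toFinset.mp hh)
    -- The stabilizer of `P` is the pointwise stabilizer of its cell, so this is the denominator of
    -- `classWeight`.
    have hw : orbitWeight ℚ G rep P = (Nat.card (fixingSubgroup G (X.cellOf P)) : ℚ)⁻¹ := by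
      rw [orbitWeight, if_pos (by rw [hPdef, hrep]), hf.stabilizer_eq_source ht htd hy hP]
    change ∑ᶠ h : H, orbitWeight ℚ G rep P * f.pointTerm ωX y (h, P) = _
    rw [← mul_finsum, hsum, hcard, hw, classWeight]
    ring
  · have hP := of_pointTerm_ne_zero ha
    have h1 := finsum_orbitWeight (K := ℚ) (rep := Quotient.out) Quotient.out_eq
      (hf.finite_stabilizer_of_isGood (hf.isGood_of_isOff ht htd hy hP).1)
    rw [← h1]
    exact finsum_congr fun g => congrArg _ (hXo.cellOf_smul g a.2)
  · have hP := of_pointTerm_ne_zero ha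
    refine finsum_orbitWeight (K := ℚ) hrep (a := a.2)
      ((hf.finite_stabilizer_of_isGood (hf.isGood_of_isOff ht htd hy hP).1).subset fun g hg => ?_)
    change g • X.cellOf a.2 = X.cellOf a.2
    rw [← hXo.cellOf_smul, show g • a.2 = a.2 from hg]

end IsTropical

end OrbitMorphism

/-! ### The degree of a morphism -/

namespace OrbitMorphism

variable {α : Type u} {β : Type v} [TopologicalSpace α] [TopologicalSpace β]
  {X : PolyComplex α} {Y : PolyComplex β} {G H : Type*} [Group G] [Group H]
  [MulAction G α] [MulAction H β] {f : OrbitMorphism X Y G H} {ωX : Set α → ℚ} {ωY : Set β → ℚ}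
  {n : ℕ}

/-- The functions on a cell that define the translates of the walls of the cells in `T`. -/
def wallFunctions (f : OrbitMorphism X Y G H) (T : Set (Set β)) (c : Set β) : Set (β → ℝ) :=
  {φ | ∃ h : H, ∃ t ∈ T, h • c = t ∧ ∃ w ∈ f.walls t,
    φ = fun x => intForm w.1 (Y.chart t (h • x)) - w.2}

lemma wallFunctions_smul {T : Set (Set β)} (h : H) (c : Set β) :
    ∀ φ ∈ f.wallFunctions T (h • c), (fun x => φ (h • x)) ∈ f.wallFunctions T c := by
  rintro _ ⟨k, t, ht, hkt, w, hw, rfl⟩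
  refine ⟨k * h, t, ht, by rw [mul_smul, hkt], w, hw, ?_⟩
  simp only [mul_smul]

lemma latticeIndex_cellOf (f : OrbitMorphism X Y G H) (P : α) :
    f.latticeIndex (X.cellOf P) (Y.cellOf (f.toFun P)) = f.idx (X.cellOf P) := by
  rw [idx, f.isCellMap.cellOf_map]

namespace IsTropical

variable (hf : f.IsTropical ωX ωY n)
include hf

lemma finite_wallFunctions {T : Set (Set β)} (hT : T.Finite) (hTc : T ⊆ Y.cells) {c : Set β}
    (hc : c ∈ Y.cells) : (f.wallFunctions T c).Finite := by
  have hstab := hf.target.finite_stabilizer_cell hf.finite_stab hc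
  refine (hT.biUnion fun t ht => (finite_smul_mem hstab (finite_singleton t)).biUnion
    fun h _ => (hf.isWallSet_walls (hTc ht)).finite.image
      fun w x => intForm w.1 (Y.chart t (h • x)) - w.2).subset ?_
  rintro _ ⟨h, t, ht, hht, w, hw, rfl⟩
  exact mem_biUnion ht (mem_biUnion (x := h) hht ⟨w, hw, rfl⟩)

/-- Pulled back to `c`, a wall is again given by an integral form; were this form zero, the wall
form would be constant on the full-dimensional cell `t` and hence zero. -/
lemma wallFunctions_affine {T : Set (Set β)} (hTc : T ⊆ Y.cells) {c : Set β} (hc : c ∈ Y.cells) :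
    ∀ φ ∈ f.wallFunctions T c, ∃ (a : Fin (Y.dim c) → ℤ) (p : ℝ), a ≠ 0 ∧
      ∀ x ∈ c, φ x = intForm a (Y.chart c x) - p := by
  rintro _ ⟨h, t, ht, rfl, w, hw, rfl⟩
  obtain ⟨A, b, hA⟩ := hf.target.orbitSpace.chart_affine h hc
  have hA' : ∀ x ∈ c, intForm w.1 (Y.chart (h • c) (h • x)) - w.2
      = intForm (Matrix.vecMul w.1 A) (Y.chart c x) - (w.2 - intForm w.1 b) := fun x hx => by
    rw [show Y.chart (h • c) (h • x) = (rmat A).mulVec (Y.chart c x) + b from hA x hx,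
      intForm_add, intForm_mulVec]
    ring
  refine ⟨_, _, fun h0 => (hf.isWallSet_walls (hTc ht)).ne_zero w hw ?_, hA'⟩
  refine (eq_zero_of_intForm_eq (Y.chart_full _ (hTc ht)) (p := intForm w.1 b) ?_).1
  rintro _ ⟨_, ⟨x, hx, rfl⟩, rfl⟩
  have := hA' x hx
  rw [h0, intForm_zero_left] at this
  change intForm w.1 (Y.chart (h • c) (h • x)) = _
  linarith

lemma exists_isOff_of_notMem_wallLocus {T : Set (Set β)}
    (hcov : ∀ c ∈ Y.cells, ∃ h : H, ∃ t ∈ T, c = h • t) {Q : β}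
    (hQ : Q ∉ wallLocus Y (f.wallFunctions T) n) :
    ∃ h : H, ∃ t ∈ Y.cells, Y.dim t = n ∧ f.IsOff t (h • Q) := by
  have hYo := hf.target.orbitSpace
  have hc := Y.cellOf_mem Q
  obtain ⟨h, t, ht, hQt⟩ := hcov _ hc
  have hQt' : h⁻¹ • Y.cellOf Q = t := by rw [hQt, inv_smul_smul]
  have htc : t ∈ Y.cells := hQt' ▸ hYo.smul_mem h⁻¹ _ hc
  simp only [wallLocus, mem_ofPred_eq, not_or, not_lt, not_exists, not_and] at hQ
  refine ⟨h⁻¹, t, htc, ?_, ?_, fun w hw hw' => hQ.2 _ ⟨h⁻¹, t, ht, hQt', w, hw, rfl⟩ ?_⟩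
  · rw [← hQt', hYo.dim_smul _ hc]
    exact (hf.target.pure_dim _ hc).1.antisymm hQ.1
  · rw [PolyComplex.mem_relInt_iff htc, hYo.cellOf_smul, hQt']
  · exact sub_eq_zero.mpr hw'

variable {t : Set β} {Q : β} {h : H}

lemma isGood_of_isOff_smul (ht : t ∈ Y.cells) (htd : Y.dim t = n) {P : α}
    (hQ : f.IsOff t (h • f.toFun P)) : f.IsGood n (X.cellOf P) :=
  (hf.isGood_of_isOff ht htd hQ rfl).1

/-- The sum of the multiplicities over the fibre of a generic point. -/
theorem finsum_mult (hq : IsQuotientMap f.orbitMap) {d : ℚ}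
    (hd : ∀ t ∈ Y.cells, Y.dim t = n → f.genCount n ωX t = d * ωY t)
    (ht : t ∈ Y.cells) (htd : Y.dim t = n) (hω : ωY t ≠ 0) (hQ : f.IsOff t (h • Q))
    {rep : Quotient (MulAction.orbitRel G α) → α} (hrep : ∀ c, Quotient.mk _ (rep c) = c) :
    ∑ᶠ c ∈ f.fibre Q, f.mult ωX ωY (rep c) = d := by
  have hYo := hf.target.orbitSpace
  -- The weight and the stabilizer order of the cell of f(P) are those of its translate `t`, so the
  -- denominator of the multiplicity is the same for the whole fibre.
  have hterm : ∀ c ∈ f.fibre (h • Q), f.mult ωX ωY (rep c) = (ωY t)⁻¹ *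
      (Nat.card (fixingSubgroup H t) *
        (classWeight G ωX (X.cellOf (rep c)) * f.idx (X.cellOf (rep c)))) := by
    intro c hc
    obtain ⟨k, hk⟩ := (mem_fibre_iff (hrep c)).mp hc
    have hcell : k • Y.cellOf (f.toFun (rep c)) = t := by
      rw [← hYo.cellOf_smul, hk, PolyComplex.cellOf_eq ht hQ.1]
    have hcm := Y.cellOf_mem (f.toFun (rep c))
    rw [mult, f.latticeIndex_cellOf, classWeight.eq_def H, ← hcell, card_fixingSubgroup_smul,
      hf.target.weight_smul k _ hcm (by rw [← hYo.dim_smul k hcm, hcell, htd]), div_div_eq_mul_div,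
      div_eq_inv_mul]
    ring
  rw [← fibre_smul h Q, finsum_mem_congr rfl hterm, ← mul_finsum_mem,
    ← hf.count_eq_finsum_fibre ht htd hQ hrep, hf.count_eq_genCount hq ht htd hQ, hd t ht htd,
    mul_comm, mul_assoc, mul_inv_cancel₀ hω, mul_one]

end IsTropical

end OrbitMorphism

end TropOrbit

end

theorem mainTheorem2 {α : Type u} {β : Type v} [TopologicalSpace α] [TopologicalSpace β]
    {G : Type*} {H : Type*} [Group G] [Group H] [MulAction G α] [MulAction H β]
    (X : TropOrbit.PolyComplex α) (Y : TropOrbit.PolyComplex β)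
    (ωX : Set α → ℚ) (ωY : Set β → ℚ) (n : ℕ)
    (hX : TropOrbit.IsTropicalOrbitSpace X G n ωX)
    (hY : TropOrbit.IsTropicalOrbitSpace Y H n ωY)
    (hωY : ∀ t ∈ Y.cells, Y.dim t = n → ωY t ≠ 0)
    (hstab : ∀ t ∈ Y.cells, Y.dim t = n → {h : H | h • t = t}.Finite)
    (hirr : TropOrbit.IsIrreducible Y H n)
    (f : TropOrbit.OrbitMorphism X Y G H)
    (hf : IsQuotientMap f.orbitMap) :
    ∃ (γ : Type v) (_ : TopologicalSpace γ) (_ : MulAction H γ)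
      (Y₀ : TropOrbit.PolyComplex γ) (i : γ → β),
      TropOrbit.IsOrbitSpace Y₀ H ∧ TropOrbit.FinitelyManyClasses Y₀ H ∧
      TropOrbit.IsSubOrbitSpace Y₀ Y H i ∧ IsClosed (range i) ∧
      (∀ s ∈ Y₀.cells, Y₀.dim s < n) ∧
      (∀ Q : β, Q ∉ range i → ∃ t ∈ Y.cells, Y.dim t = n ∧ Q ∈ Y.relInt t) ∧
      (∀ P : α, f.toFun P ∉ range i →
        (∃ s ∈ X.cells, X.dim s = n ∧ P ∈ X.relInt s) ∧
        f.latticeIndex (X.cellOf P) (Y.cellOf (f.toFun P)) ≠ 0) ∧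
      ∃ d : ℚ, ∀ Q : β, Q ∉ range i →
        (f.fibre Q).Finite ∧
        ∀ rep : Quotient (MulAction.orbitRel G α) → α, (∀ c, Quotient.mk _ (rep c) = c) →
          ∑ᶠ c ∈ f.fibre Q, f.mult ωX ωY (rep c) = d := by
  have hT : f.IsTropical ωX ωY n := ⟨hX, hY, hstab⟩
  have hYo := hY.orbitSpace
  obtain ⟨d, hd⟩ := hT.exists_genCount_eq hf hirr hωY
  obtain ⟨T₀, hT₀, hcov₀⟩ := hY.finite_classes
  -- Walls are chosen only for finitely many representative cells and translated to the others; this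
  -- makes the wall functions H-invariant and finite in number on each cell.
  set T := T₀ ∩ Y.cells
  have hTc : T ⊆ Y.cells := inter_subset_right
  have hcov : ∀ c ∈ Y.cells, ∃ h : H, ∃ t ∈ T, c = h • t := fun c hc => by
    obtain ⟨h, t, ht, rfl⟩ := hcov₀ c hc
    exact ⟨h, t, ⟨ht, (hYo.smul_mem_iff h).mp hc⟩, rfl⟩
  obtain ⟨γ, _, _, Y₀, i, h1, h2, h3, h4, h5, hrange⟩ := hY.exists_wall_complex
    (fun c hc => hT.finite_wallFunctions (hT₀.inter_of_left _) hTc hc)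
    (fun c hc => hT.wallFunctions_affine hTc hc) f.wallFunctions_smul
  have hoff : ∀ Q ∉ range i, ∃ h : H, ∃ t ∈ Y.cells, Y.dim t = n ∧ f.IsOff t (h • Q) :=
    fun Q hQ => hT.exists_isOff_of_notMem_wallLocus hcov (hrange ▸ hQ)
  refine ⟨γ, _, _, Y₀, i, h1, h2, h3, h4, h5, fun Q hQ => ?_, fun P hP => ?_, d, fun Q hQ => ?_⟩
  · obtain ⟨h, t, ht, htd, hy⟩ := hoff Q hQ
    refine ⟨Y.cellOf Q, Y.cellOf_mem Q, ?_, Y.mem_relInt_cellOf Q⟩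
    rw [← hYo.dim_smul h (Y.cellOf_mem Q), ← hYo.cellOf_smul,
      TropOrbit.PolyComplex.cellOf_eq ht hy.1, htd]
  · obtain ⟨h, t, ht, htd, hy⟩ := hoff _ hP
    have hgood := hT.isGood_of_isOff_smul ht htd hy
    refine ⟨⟨_, hgood.mem, hgood.dim_eq, X.mem_relInt_cellOf P⟩, ?_⟩
    -- Infinite indices are recorded as `0`, so a nonzero value expresses finiteness.
    rw [f.latticeIndex_cellOf]
    exact hgood.idx_ne
  · obtain ⟨h, t, ht, htd, hy⟩ := hoff Q hQ
    rw [← f.fibre_smul h Q]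
    refine ⟨hT.finite_fibre ht htd hy, fun rep hrep => ?_⟩
    rw [f.fibre_smul h Q]
    exact hT.finsum_mult hf hd ht htd (hωY t ht htd) hy hrep
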